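/- Work over $\mathbb{C}$. For a sheaf $\mathcal{E}$ of modules on a scheme $S$, $\mathbb{P}(\mathcal{E})\to S$ denotes the projective bundle of rank one quotients of $\mathcal{E}$, with tautological quotient of the pullback of $\mathcal{E}$ onto $\mathcal{O}(1)$. Let $V$ be a complex vector space of dimension $3$, so that $\mathbb{P}(V)\cong\mathbb{P}^2$ and $\mathbb{P}(V^\vee)$ is the space of lines in $\mathbb{P}(V)$, and let $K$ be the kernel bundle in the tautological sequence $$0\to K\to V^\vee\otimes\mathcal{O}_{\mathbb{P}(V^\vee)}\to\mathcal{O}_{\mathbb{P}(V^\vee)}(1)\to 0 .$$ Let $H=\mathrm{Hilb}^2(\mathbb{P}(V))$ be the Hilbert scheme of length $2$ subschemes of $\mathbb{P}(V)$, with universal family $\mathcal{Z}\subset\mathbb{P}(V)\times H$ and projections $p_1:\mathcal{Z}\to\mathbb{P}(V)$, $p_2:\mathcal{Z}\to H$, and let $\mathcal{O}_{\mathbb{P}(V)}(k)^{[2]}=p_{2*}p_1^*\mathcal{O}_{\mathbb{P}(V)}(k)$ be the tautological bundles. There is a morphism $\psi:H\to\mathbb{P}(V^\vee)$ over $\mathbb{C}$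 sending a subscheme $\xi$ to the line that it spans (that is, $\mathcal{Z}$ lies in the pullback under $\mathrm{id}\times\psi$ of the incidence variety in $\mathbb{P}(V)\times\mathbb{P}(V^\vee)$), and $\psi$ is a projective bundle, $H\cong\mathbb{P}(\mathrm{Sym}^2K)$ over $\mathbb{P}(V^\vee)$. Let $\mathcal{O}(1)$ be the tautological quotient line bundle of this projective bundle on $H$, and write $(-1)$ for the twist by its dual. Then for every $k\ge 2$ there is a short exact sequence (a two-term relatively linear resolution) $$0\to\psi^*(\mathrm{Sym}^{k-2}K^\vee)(-1)\to\psi^*(\mathrm{Sym}^kK^\vee)\to\mathcal{O}_{\mathbb{P}(V)}(k)^{[2]}\to 0$$ of sheaves of modules on $H$. -/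

import Mathlib

open CategoryTheory AlgebraicGeometry TensorProduct

/-! ### Symmetric powers of modules -/

namespace SymPower

/-- The `k`-th symmetric power of a module, as the degree `k` part of its symmetric algebra. -/
noncomputable abbrev piece (R M : Type*) [CommRing R] [AddCommGroup M] [Module R M] (k : ℕ) :
    Submodule R (SymmetricAlgebra R M) :=
  LinearMap.range (SymmetricAlgebra.ι R M) ^ k

variable {R S M N : Type*} [CommRing R] [CommRing S] [AddCommGroup M] [Module R M]
  [AddCommGroup N] [Module S N] {f : R →+* S} (g : M →ₛₗ[f] N)

/-- The ring homomorphism of symmetric algebras induced by a semilinear map. -/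
noncomputable def map : SymmetricAlgebra R M →+* SymmetricAlgebra S N :=
  letI : Algebra R (SymmetricAlgebra S N) :=
    ((algebraMap S (SymmetricAlgebra S N)).comp f).toAlgebra
  (SymmetricAlgebra.lift (R := R) (A := SymmetricAlgebra S N)
    { toFun := fun m => SymmetricAlgebra.ι S N (g m)
      map_add' := by simp
      map_smul' := fun r m => by
        rw [g.map_smulₛₗ, _root_.map_smul, RingHom.id_apply, Algebra.smul_def, Algebra.smul_def]
        rfl }).toRingHom

lemma map_ι (m : M) : map g (SymmetricAlgebra.ι R M m) = SymmetricAlgebra.ι S N (g m) := by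
  let : Algebra R (SymmetricAlgebra S N) :=
    ((algebraMap S (SymmetricAlgebra S N)).comp f).toAlgebra
  exact SymmetricAlgebra.lift_ι_apply (R := R) (A := SymmetricAlgebra S N) _ m

lemma map_algebraMap (r : R) :
    map g (algebraMap R (SymmetricAlgebra R M) r) = algebraMap S (SymmetricAlgebra S N) (f r) := by
  let : Algebra R (SymmetricAlgebra S N) :=
    ((algebraMap S (SymmetricAlgebra S N)).comp f).toAlgebra
  exact AlgHom.commutes (SymmetricAlgebra.lift (R := R) (A := SymmetricAlgebra S N) _) r

lemma map_smul (r : R) (x : SymmetricAlgebra R M) : map g (r • x) = f r • map g x := by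
  rw [Algebra.smul_def, map_mul, map_algebraMap, Algebra.smul_def]

lemma map_mem {k : ℕ} {x : SymmetricAlgebra R M} (hx : x ∈ piece R M k) :
    map g x ∈ piece S N k := by
  induction k generalizing x with
  | zero =>
    rw [piece, pow_zero] at hx ⊢
    obtain ⟨r, rfl⟩ := Submodule.mem_one.mp hx
    rw [map_algebraMap]
    exact Submodule.mem_one.mpr ⟨_, rfl⟩
  | succ k ih =>
    rw [piece, pow_succ] at hx ⊢
    induction hx using Submodule.mul_induction_on' with
    | mem_mul_mem a ha b hb =>
      obtain ⟨m, rfl⟩ := hb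
      rw [map_mul, map_ι]
      exact Submodule.mul_mem_mul (ih ha) ⟨_, rfl⟩
    | add a _ b _ ha hb => rw [map_add]; exact add_mem ha hb

lemma map_unique {φ : SymmetricAlgebra R M →+* SymmetricAlgebra S N}
    (h₀ : ∀ r, φ (algebraMap R _ r) = algebraMap S _ (f r))
    (h₁ : ∀ m, φ (SymmetricAlgebra.ι R M m) = SymmetricAlgebra.ι S N (g m))
    (x : SymmetricAlgebra R M) : map g x = φ x := by
  induction x using SymmetricAlgebra.induction with
  | algebraMap r => rw [map_algebraMap, h₀]
  | ι m => rw [map_ι, h₁]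
  | mul a b ha hb => rw [map_mul, map_mul, ha, hb]
  | add a b ha hb => rw [map_add, map_add, ha, hb]

end SymPower

namespace AlgebraicGeometry.Scheme.Modules

universe u

variable {X : Scheme.{u}}

/-! ### Sheaves of modules -/

/-- The sheaf of modules associated with a presheaf of `𝒪_X`-modules. -/
noncomputable def assocSheaf (P : X.PresheafOfModules) : X.Modules :=
  (PresheafOfModules.sheafification (𝟙 X.ringCatSheaf.obj)).obj P

/-- The section of the associated sheaf that is defined by a section of the presheaf. -/
noncomputable def toAssocSheaf (P : X.PresheafOfModules) (U : X.Opens) :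
    P.presheaf.obj (.op U) ⟶ Γ(assocSheaf P, U) :=
  (CategoryTheory.toSheafify (Opens.grothendieckTopology X) P.presheaf).app (.op U)

/-- The structure sheaf `𝒪_X` as a module over itself. -/
noncomputable def structureSheaf (X : Scheme.{u}) : X.Modules :=
  SheafOfModules.unit X.ringCatSheaf

/-- Line bundles: sheaves of modules that are locally isomorphic to the structure sheaf. -/
def IsLineBundle (L : X.Modules) : Prop :=
  ∀ x : X, ∃ U : X.Opens, x ∈ U ∧ Nonempty (L.restrict U.ι ≅ structureSheaf U.toScheme)

/-- The presheaf `U ↦ M(U) ⊗ N(U)`. -/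
noncomputable def tensorPresheaf (M N : X.Modules) : X.PresheafOfModules :=
  PresheafOfModules.Monoidal.tensorObj (R := X.presheaf) M.val N.val

/-- The tensor product of sheaves of modules. -/
noncomputable def tensor (M N : X.Modules) : X.Modules :=
  assocSheaf (tensorPresheaf M N)

/-- The section `s ⊗ t` of `M ⊗ N`. -/
noncomputable def tensorSection {M N : X.Modules} {U : X.Opens} (s : Γ(M, U)) (t : Γ(N, U)) :
    Γ(tensor M N, U) :=
  toAssocSheaf (tensorPresheaf M N) U (s ⊗ₜ[Γ(X, U)] t : TensorProduct Γ(X, U) Γ(M, U) Γ(N, U))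

/-- The tensor powers of a sheaf of modules. -/
noncomputable def tensorPow (L : X.Modules) : ℕ → X.Modules
  | 0 => structureSheaf X
  | k + 1 => tensor (tensorPow L k) L

/-- The restriction maps of a sheaf of modules, as semilinear maps. -/
noncomputable def res (M : X.Modules) {U V : X.Opens} (i : V ⟶ U) :
    Γ(M, U) →ₛₗ[(X.presheaf.map i.op).hom] Γ(M, V) where
  toFun := M.presheaf.map i.op
  map_add' := map_add _
  map_smul' r m := Scheme.Modules.map_smul M i r m

lemma res_id (M : X.Modules) (U : X.Opens) (x : SymmetricAlgebra Γ(X, U) Γ(M, U)) :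
    SymPower.map (res M (𝟙 U)) x = x := by
  refine SymPower.map_unique _ (φ := RingHom.id _) (fun r => ?_) (fun m => ?_) x
  · change _ = algebraMap _ _ (X.presheaf.map (𝟙 (Opposite.op U)) r)
    rw [X.presheaf.map_id]; rfl
  · change _ = SymmetricAlgebra.ι _ _ (M.presheaf.map (𝟙 (Opposite.op U)) m)
    rw [M.presheaf.map_id]; rfl

lemma res_comp (M : X.Modules) {U V W : X.Opens} (i : V ⟶ U) (j : W ⟶ V)
    (x : SymmetricAlgebra Γ(X, U) Γ(M, U)) :
    SymPower.map (res M (j ≫ i)) x = SymPower.map (res M j) (SymPower.map (res M i) x) := by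
  refine SymPower.map_unique _
    (φ := (SymPower.map (res M j)).comp (SymPower.map (res M i))) (fun r => ?_) (fun m => ?_) x
  · rw [RingHom.comp_apply, SymPower.map_algebraMap, SymPower.map_algebraMap]
    change _ = algebraMap _ _ (X.presheaf.map (i.op ≫ j.op) r)
    rw [X.presheaf.map_comp]; rfl
  · rw [RingHom.comp_apply, SymPower.map_ι, SymPower.map_ι]
    change _ = SymmetricAlgebra.ι _ _ (M.presheaf.map (i.op ≫ j.op) m)
    rw [M.presheaf.map_comp]; rfl

/-- The restriction map `Sym^k M(U) → Sym^k M(V)`. -/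
noncomputable def symRes (M : X.Modules) (k : ℕ) {U V : X.Opens} (i : V ⟶ U) :
    SymPower.piece Γ(X, U) Γ(M, U) k →+ SymPower.piece Γ(X, V) Γ(M, V) k where
  toFun x := ⟨SymPower.map (res M i) x.1, SymPower.map_mem _ x.2⟩
  map_zero' := Subtype.ext (map_zero _)
  map_add' _ _ := Subtype.ext (map_add _ _ _)

lemma symRes_smul (M : X.Modules) (k : ℕ) {U V : X.Opens} (i : V ⟶ U) (r : Γ(X, U))
    (x : SymPower.piece Γ(X, U) Γ(M, U) k) :
    symRes M k i (r • x) = X.presheaf.map i.op r • symRes M k i x :=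
  Subtype.ext (SymPower.map_smul (res M i) r x.1)

/-- The presheaf `U ↦ Sym^k M(U)`, as a presheaf of abelian groups. -/
noncomputable def symPresheafAb (M : X.Modules) (k : ℕ) : TopCat.Presheaf Ab X where
  obj U := AddCommGrpCat.of (SymPower.piece Γ(X, U.unop) Γ(M, U.unop) k)
  map i := AddCommGrpCat.ofHom (symRes M k i.unop)
  map_id U := AddCommGrpCat.hom_ext
    (AddMonoidHom.ext fun x => Subtype.ext (res_id M U.unop x.1))
  map_comp i j := AddCommGrpCat.hom_ext
    (AddMonoidHom.ext fun x => Subtype.ext (res_comp M i.unop j.unop x.1))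

noncomputable instance (M : X.Modules) (k : ℕ) (U : (TopologicalSpace.Opens X)ᵒᵖ) :
    Module (X.ringCatSheaf.obj.obj U) ((symPresheafAb M k).obj U) :=
  inferInstanceAs (Module Γ(X, U.unop) (SymPower.piece Γ(X, U.unop) Γ(M, U.unop) k))

/-- The presheaf `U ↦ Sym^k M(U)`. -/
noncomputable def symPresheaf (M : X.Modules) (k : ℕ) : X.PresheafOfModules :=
  PresheafOfModules.ofPresheaf (symPresheafAb M k)
    (fun _ _ i r x => symRes_smul M k i.unop r x)

/-- The `k`-th symmetric power of a sheaf of modules. -/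
noncomputable def sym (M : X.Modules) (k : ℕ) : X.Modules :=
  assocSheaf (symPresheaf M k)

/-- The homomorphisms `M|_U ⟶ 𝒪_U` of sheaves of modules, as compatible families of linear maps. -/
noncomputable def dualSections (M : X.Modules) (U : X.Opens) :
    AddSubgroup (∀ V : {V : X.Opens // V ≤ U}, Γ(M, V.1) →ₗ[Γ(X, V.1)] Γ(X, V.1)) where
  carrier := {φ | ∀ (V W : {V : X.Opens // V ≤ U}) (h : W.1 ≤ V.1) (m : Γ(M, V.1)),
    φ W (M.presheaf.map (homOfLE h).op m) = X.presheaf.map (homOfLE h).op (φ V m)}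
  zero_mem' := by intro V W h m; simp
  add_mem' := by intro φ ψ hφ hψ V W h m; simp [hφ V W h m, hψ V W h m]
  neg_mem' := by intro φ hφ V W h m; simp [hφ V W h m]

lemma map_map_op (U V W : X.Opens) (h₁ : V ≤ U) (h₂ : W ≤ V) (r : Γ(X, U)) :
    X.presheaf.map (homOfLE h₂).op (X.presheaf.map (homOfLE h₁).op r) =
      X.presheaf.map (homOfLE (h₂.trans h₁)).op r := by
  rw [← CommRingCat.comp_apply, ← Functor.map_comp]
  rfl

noncomputable instance (M : X.Modules) (U : X.Opens) : Module Γ(X, U) (dualSections M U) where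
  smul r φ := ⟨fun V => X.presheaf.map (homOfLE V.2).op r • φ.1 V, by
    intro V W h m
    have := φ.2 V W h m
    simp only [LinearMap.smul_apply, this, smul_eq_mul, map_mul]
    rw [map_map_op]⟩
  one_smul φ := by
    ext V : 2
    change X.presheaf.map (homOfLE V.2).op 1 • φ.1 V = φ.1 V
    simp
  mul_smul r s φ := by
    ext V : 2
    change X.presheaf.map (homOfLE V.2).op (r * s) • φ.1 V =
      X.presheaf.map (homOfLE V.2).op r • X.presheaf.map (homOfLE V.2).op s • φ.1 V
    rw [map_mul, mul_smul]
  smul_zero r := by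
    ext V : 2
    change X.presheaf.map (homOfLE V.2).op r •
      (0 : Γ(M, V.1) →ₗ[Γ(X, V.1)] Γ(X, V.1)) = 0
    simp
  smul_add r φ ψ := by
    ext V : 2
    change X.presheaf.map (homOfLE V.2).op r • (φ.1 V + ψ.1 V) =
      X.presheaf.map (homOfLE V.2).op r • φ.1 V + X.presheaf.map (homOfLE V.2).op r • ψ.1 V
    simp
  add_smul r s φ := by
    ext V : 2
    change X.presheaf.map (homOfLE V.2).op (r + s) • φ.1 V =
      X.presheaf.map (homOfLE V.2).op r • φ.1 V + X.presheaf.map (homOfLE V.2).op s • φ.1 V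
    rw [map_add, add_smul]
  zero_smul φ := by
    ext V : 2
    change X.presheaf.map (homOfLE V.2).op 0 • φ.1 V = 0
    simp

/-- The presheaf `U ↦ Hom(M|_U, 𝒪_U)`, as a presheaf of abelian groups. -/
noncomputable def dualPresheafAb (M : X.Modules) : TopCat.Presheaf Ab X where
  obj U := AddCommGrpCat.of (dualSections M U.unop)
  map {U U'} i := AddCommGrpCat.ofHom
    { toFun := fun φ => ⟨fun V => φ.1 ⟨V.1, V.2.trans i.unop.le⟩, fun V W h m =>
        φ.2 ⟨V.1, V.2.trans i.unop.le⟩ ⟨W.1, W.2.trans i.unop.le⟩ h m⟩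
      map_zero' := rfl
      map_add' := fun _ _ => rfl }

noncomputable instance (M : X.Modules) (U : (TopologicalSpace.Opens X)ᵒᵖ) :
    Module (X.ringCatSheaf.obj.obj U) ((dualPresheafAb M).obj U) :=
  inferInstanceAs (Module Γ(X, U.unop) (dualSections M U.unop))

/-- The presheaf `U ↦ Hom(M|_U, 𝒪_U)`. -/
noncomputable def dualPresheaf (M : X.Modules) : X.PresheafOfModules :=
  PresheafOfModules.ofPresheaf (dualPresheafAb M) (by
    intro U U' i r φ
    refine Subtype.ext (funext fun V => ?_)
    exact congrArg (fun t : Γ(X, V.1) => t • φ.1 ⟨V.1, V.2.trans i.unop.le⟩)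
      (map_map_op U.unop U'.unop V.1 i.unop.le V.2 r).symm)

/-- The dual of a sheaf of modules. The presheaf `U ↦ Hom(M|_U, 𝒪_U)` is already a sheaf, so that
passing to the associated sheaf does not change it. -/
noncomputable def dual (M : X.Modules) : X.Modules := assocSheaf (dualPresheaf M)

end AlgebraicGeometry.Scheme.Modules

namespace AlgebraicGeometry

universe u

open Scheme.Modules

/-! ### Projective bundles -/

/-- For `q : π^* E ⟶ L` and `g : T ⟶ P`, the homomorphism `(g ≫ π)^* E ⟶ g^* L` given by `g^* q`. -/
noncomputable def pullbackQuotient {S P T : Scheme.{u}} {E : S.Modules} {π : P ⟶ S} {L : P.Modules}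
    (q : (Scheme.Modules.pullback π).obj E ⟶ L) (g : T ⟶ P) :
    (Scheme.Modules.pullback (g ≫ π)).obj E ⟶ (Scheme.Modules.pullback g).obj L :=
  (pullbackComp g π).inv.app E ≫ (Scheme.Modules.pullback g).map q

/-- `π : P ⟶ S` with `q : π^* E ⟶ L` is the projective bundle `ℙ(E)` of rank one quotients of `E`
with its tautological quotient `π^* E ⟶ 𝒪(1)`: for every `f : T ⟶ S`, the `S`-morphisms `T ⟶ P`
correspond, by pulling back `q`, to the quotients of `f^* E` that are line bundles, up to
isomorphism. -/
structure IsProjectiveBundle {S P : Scheme.{u}} (E : S.Modules) (π : P ⟶ S) {L : P.Modules}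
    (q : (Scheme.Modules.pullback π).obj E ⟶ L) : Prop where
  isLineBundle : IsLineBundle L
  epi : Epi q
  existsUnique : ∀ (T : Scheme.{u}) (f : T ⟶ S) (M : T.Modules)
    (r : (Scheme.Modules.pullback f).obj E ⟶ M), IsLineBundle M → Epi r →
    ∃! g : T ⟶ P, ∃ (h : g ≫ π = f) (e : (Scheme.Modules.pullback g).obj L ≅ M),
      pullbackQuotient q g ≫ e.hom = (pullbackCongr h).hom.app E ≫ r

/-- A projective bundle `ℙ(E)` with its tautological quotient `π^* E ⟶ 𝒪(1)`. -/
structure ProjectiveBundle {S : Scheme.{u}} (E : S.Modules) where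
  space : Scheme.{u}
  π : space ⟶ S
  O1 : space.Modules
  quot : (Scheme.Modules.pullback π).obj E ⟶ O1
  isProjectiveBundle : IsProjectiveBundle E π quot

namespace ProjectiveBundle

variable {S : Scheme.{u}} {E : S.Modules} (P : ProjectiveBundle E)

/-- The line bundle `𝒪(k)`, for `k ≥ 0`. -/
noncomputable def O (k : ℕ) : P.space.Modules := tensorPow P.O1 k

/-- The kernel bundle in the tautological sequence `0 ⟶ K ⟶ π^* E ⟶ 𝒪(1) ⟶ 0`. -/
noncomputable def kernelBundle : P.space.Modules := Limits.kernel P.quot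

end ProjectiveBundle

/-- The sheaf on `Spec k` given by a vector space `V`. -/
noncomputable abbrev vectorSheaf (k : Type u) [Field k] (V : Type u) [AddCommGroup V] [Module k V] :
    (Spec (CommRingCat.of k)).Modules :=
  tilde (R := CommRingCat.of k) (ModuleCat.of k V)

/-- The global section of `L` that is the image of `v : V` under `V ⊗ 𝒪_T ⟶ L`. -/
noncomputable def vectorSection {k : Type u} [Field k] {V : Type u} [AddCommGroup V] [Module k V]
    {T : Scheme.{u}} {f : T ⟶ Spec (CommRingCat.of k)} {L : T.Modules}
    (q : (Scheme.Modules.pullback f).obj (vectorSheaf k V) ⟶ L) (v : V) : Γ(L, ⊤) :=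
  (((pullbackPushforwardAdjunction f).homEquiv _ _ q).app ⊤ :
    Γ(vectorSheaf k V, ⊤) ⟶ Γ((Scheme.Modules.pushforward f).obj L, ⊤))
    ((tilde.toOpen (R := CommRingCat.of k) (ModuleCat.of k V) ⊤).hom v)

/-! ### Hilbert schemes of points -/

/-- `W ⟶ X ×_S T` is a closed subscheme that is finite and locally free of degree `n` over `T`,
that is, a flat family over `T` of length `n` subschemes of `X`. -/
structure IsLengthFamily {S X : Scheme.{u}} (x : X ⟶ S) (n : ℕ) {T W : Scheme.{u}} (t : T ⟶ S)
    (a : W ⟶ X) (p : W ⟶ T) : Prop where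
  comm : a ≫ x = p ≫ t
  isClosedImmersion : IsClosedImmersion (Limits.pullback.lift a p comm)
  isFinite : IsFinite p
  flat : Flat p
  locallyOfFinitePresentation : LocallyOfFinitePresentation p
  finrank_eq : ∀ y : T, p.finrank y = n

/-- The Hilbert scheme of `n` points of `X` over `S` with its universal family: the `S`-scheme that
represents the functor of families of length `n` subschemes of `X`. -/
structure HilbertScheme {S X : Scheme.{u}} (x : X ⟶ S) (n : ℕ) where
  space : Scheme.{u}
  π : space ⟶ S
  family : Scheme.{u}
  p₁ : family ⟶ X
  p₂ : family ⟶ space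
  isLengthFamily : IsLengthFamily x n π p₁ p₂
  existsUnique : ∀ (T W : Scheme.{u}) (t : T ⟶ S) (a : W ⟶ X) (p : W ⟶ T),
    IsLengthFamily x n t a p →
    ∃! g : T ⟶ space, g ≫ π = t ∧ ∃ w : W ⟶ family, w ≫ p₁ = a ∧ IsPullback w p p₂ g

namespace HilbertScheme

/-- The tautological sheaf `F^{[n]} = p₂_* p₁^* F`. -/
noncomputable def tautological {S X : Scheme.{u}} {x : X ⟶ S} {n : ℕ} (H : HilbertScheme x n)
    (F : X.Modules) : H.space.Modules :=
  (Scheme.Modules.pushforward H.p₂).obj ((Scheme.Modules.pullback H.p₁).obj F)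

variable {k : Type u} [Field k] {V : Type u} [AddCommGroup V] [Module k V]
  {P : ProjectiveBundle (vectorSheaf k V)}
  {P' : ProjectiveBundle (vectorSheaf k (Module.Dual k V))}

/-- `ψ` sends every subscheme `ξ` of `ℙ(V)` to a point of `ℙ(V^∨)` whose hyperplane contains `ξ`:
the universal family lies in the pullback of the incidence variety, whose equation in
`ℙ(V) × ℙ(V^∨)` is `∑ xᵢ yᵢ = 0` for the coordinates with respect to dual bases. -/
def IsSpanMap {n : ℕ} (H : HilbertScheme P.π n) (ψ : H.space ⟶ P'.space) : Prop :=
  ∀ (ι : Type) [Fintype ι] [DecidableEq ι] (b : Module.Basis ι k V),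
    ∑ i, tensorSection (vectorSection (pullbackQuotient P.quot H.p₁) (b i))
      (vectorSection (pullbackQuotient P'.quot (H.p₂ ≫ ψ)) (b.coord i)) = 0

end HilbertScheme

end AlgebraicGeometry

/-!
Everything is computed in explicit local bases of sections. A tuple of sections is a basis of a
sheaf of modules over an open subset `U` (`IsBasisOn`) if over every smaller open subset its
restrictions form a basis of the module of sections. Such bases are compatible with pullbacks
(`IsBasisOn.pullSec`), tensor products, symmetric powers and duals, and a line bundle is a sheaf
which locally has a basis with one element (`isLineBundle_iff`). A morphism to a projective space is
thus determined by its homogeneous coordinates with respect to a basis of the vector space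
(`HasCoordsOn`, `ProjectiveBundle.hom_ext`, `ProjectiveBundle.exists_of_coords`).

*Charts.* Let `b` be a basis of the vector space. The pairs of points `(1, x, α + β x)` with
`x² = σ x + τ` form a family over the affine space with coordinates `α, β, σ, τ`
(`exists_universal_chart`), and a family of pairs of points that is locally of this form has a chart
in `b` (`IsChartOn`). By Nakayama's lemma, a family has charts in a general basis near any two given
points of the parameter space (`IsLengthFamily.exists_isChartOn`); here it is used that the field is
infinite. Families with a chart in `b` are classified by the four functions
(`HilbertScheme.exists_hasChart`, `HilbertScheme.HasChart.hom_ext`).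

*The line spanned by a pair of points.* The points `(1, x, α + β x)` lie on the line with
coordinates `(-α, -β, 1)`, and since `1` and `x` are linearly independent over the functions on the
base this is the only such line. Hence the local morphisms to the dual plane glue
(`HilbertScheme.exists_isSpanMap`).

*The resolution.* The fibre of `K^∨` at a line is the space of linear forms on the line, which is the
quotient of the vector space by the vector that cuts out the line, so products of vectors are
sections of `Sym^d K^∨`. On a chart this sheaf has a basis of monomials, its sections are the
polynomials of degree at most `d`, and the restriction of forms to the pairs of points
(`HilbertScheme.exists_restriction`) is evaluation at `x`, which amounts to reduction modulo
`X² - σ X - τ` (`HilbertScheme.restriction_polySum`). For `d = 2` the kernel of the restriction is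
the line bundle generated by `X² - σ X - τ` (`HilbertScheme.exists_kernel_generator`). Multiplying
forms of degree `d` with the sections of this line bundle gives all forms of degree `d + 2` that
vanish on the pairs of points, because `X² - σ X - τ` is monic and division with remainder is
possible (`HilbertScheme.exists_shortExact`). The line bundle `𝒪(1)` is the dual of the kernel, so
that the kernel is isomorphic to `𝒪(-1)`.

*The projective bundle.* The transpose of the inclusion of the kernel into `Sym² K^∨`, where a form
of degree two is viewed as a linear form on `Sym² K` by polarization, is the tautological quotient
`Sym² K ⟶ 𝒪(1)` (`HilbertScheme.exists_quotient`). Conversely, a line bundle quotient of the pullback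
of `Sym² K` by a morphism to the dual plane is locally, in a suitable basis, the polarization of a
form `X² - σ X - τ` on the line with coordinates `(-α, -β, 1)` (`IsQuadric`, `exists_isQuadric`), as
`2` is invertible. So it is given by the same four functions as a family of pairs of points with a
chart. This correspondence does not depend on the basis, so the classifying morphisms glue
(`exists_hom_of_local`), and this yields the universal property of the projective bundle
(`HilbertScheme.IsQuadricQuotient.isProjectiveBundle`).
-/


namespace AlgebraicGeometry.Scheme.Modules
universe u
variable {X : Scheme.{u}}

/-! ### Sections of sheaves of modules -/

/-- Restriction of functions to a smaller open subset. -/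
noncomputable def resF {U V : X.Opens} (h : V ≤ U) : Γ(X, U) →+* Γ(X, V) :=
  (X.presheaf.map (homOfLE h).op).hom

/-- Restriction of sections of a sheaf of modules to a smaller open subset. -/
noncomputable def resM (M : X.Modules) {U V : X.Opens} (h : V ≤ U) : Γ(M, U) →+ Γ(M, V) :=
  (M.presheaf.map (homOfLE h).op).hom

@[simp] lemma resF_resF {U V W : X.Opens} (h : V ≤ U) (h' : W ≤ V) (r : Γ(X, U)) :
    resF h' (resF h r) = resF (h'.trans h) r := map_map_op U V W h h' r

@[simp] lemma resF_self {U : X.Opens} (h : U ≤ U) (r : Γ(X, U)) : resF h r = r := by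
  change X.presheaf.map (𝟙 _) r = r
  simp

variable {M N : X.Modules} {U V W : X.Opens}

@[simp] lemma resM_resM (h : V ≤ U) (h' : W ≤ V) (r : Γ(M, U)) :
    resM M h' (resM M h r) = resM M (h'.trans h) r := by
  change (M.presheaf.map (homOfLE h).op ≫ M.presheaf.map (homOfLE h').op) r = _
  rw [← Functor.map_comp]; rfl

@[simp] lemma resM_self (h : U ≤ U) (r : Γ(M, U)) : resM M h r = r := by
  change M.presheaf.map (𝟙 _) r = r
  simp

@[simp] lemma resM_smul (h : V ≤ U) (r : Γ(X, U)) (s : Γ(M, U)) :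
    resM M h (r • s) = resF h r • resM M h s := Scheme.Modules.map_smul M (homOfLE h) r s

lemma resM_app (φ : M ⟶ N) (h : V ≤ U) (s : Γ(M, U)) :
    φ.app V (resM M h s) = resM N h (φ.app U s) :=
  congr($(φ.mapPresheaf.naturality (homOfLE h).op) s)

/-- Sections agreeing locally are equal. -/
lemma section_ext {s t : Γ(M, U)}
    (H : ∀ x ∈ U, ∃ V : X.Opens, x ∈ V ∧ ∃ h : V ≤ U, resM M h s = resM M h t) : s = t := by
  refine TopCat.Presheaf.IsSheaf.section_ext M.isSheaf (fun x hx => ?_)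
  obtain ⟨V, hxV, h, e⟩ := H x hx
  exact ⟨V, h, hxV, e⟩

lemma section_glue {ι : Type*} (B : ι → X.Opens) (hB : ∀ i, B i ≤ U) (hU : U ≤ ⨆ i, B i)
    (s : ∀ i, Γ(M, B i))
    (H : ∀ i j (W : X.Opens) (hi : W ≤ B i) (hj : W ≤ B j), resM M hi (s i) = resM M hj (s j)) :
    ∃ t : Γ(M, U), ∀ i, resM M (hB i) t = s i := by
  obtain ⟨t, ht, -⟩ := TopCat.Sheaf.existsUnique_gluing' ⟨M.presheaf, M.isSheaf⟩ B U
    (fun i => homOfLE (hB i)) hU s (fun i j => H i j _ _ _)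
  exact ⟨t, ht⟩

lemma fun_ext {s t : Γ(X, U)}
    (H : ∀ x ∈ U, ∃ V : X.Opens, x ∈ V ∧ ∃ h : V ≤ U, resF h s = resF h t) : s = t := by
  refine TopCat.Presheaf.IsSheaf.section_ext X.sheaf.2 (fun x hx => ?_)
  obtain ⟨V, hxV, h, e⟩ := H x hx
  exact ⟨V, h, hxV, e⟩

lemma fun_glue {ι : Type*} (B : ι → X.Opens) (hB : ∀ i, B i ≤ U) (hU : U ≤ ⨆ i, B i)
    (s : ∀ i, Γ(X, B i))
    (H : ∀ i j (W : X.Opens) (hi : W ≤ B i) (hj : W ≤ B j), resF hi (s i) = resF hj (s j)) :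
    ∃ t : Γ(X, U), ∀ i, resF (hB i) t = s i := by
  obtain ⟨t, ht, -⟩ := TopCat.Sheaf.existsUnique_gluing' X.sheaf B U
    (fun i => homOfLE (hB i)) hU s (fun i j => H i j _ _ _)
  exact ⟨t, ht⟩

noncomputable instance (P : X.PresheafOfModules) (U : X.Opens) :
    Module Γ(X, U) (P.presheaf.obj (.op U)) := (P.obj (.op U)).isModule

/-- Restriction of sections of a presheaf of modules to a smaller open subset. -/
noncomputable def resP (P : X.PresheafOfModules) {U V : X.Opens} (h : V ≤ U) :
    P.presheaf.obj (.op U) →+ P.presheaf.obj (.op V) :=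
  (P.presheaf.map (homOfLE h).op).hom

lemma resP_smul (P : X.PresheafOfModules) (h : V ≤ U) (r : Γ(X, U))
    (s : P.presheaf.obj (.op U)) : resP P h (r • s) = resF h r • resP P h s :=
  P.map_smul (homOfLE h).op r s

lemma resP_resP (P : X.PresheafOfModules) (h : V ≤ U) (h' : W ≤ V) (s : P.presheaf.obj (.op U)) :
   resP P h' (resP P h s) = resP P (h'.trans h) s := by
  change (P.presheaf.map (homOfLE h).op ≫ P.presheaf.map (homOfLE h').op) s = _
  rw [← Functor.map_comp]; rfl

lemma toAssocSheaf_res (P : X.PresheafOfModules) (h : V ≤ U) (s : P.presheaf.obj (.op U)) :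
    toAssocSheaf P V (resP P h s) = resM _ h (toAssocSheaf P U s) :=
  congr($((CategoryTheory.toSheafify (Opens.grothendieckTopology X) P.presheaf).naturality
    (homOfLE h).op) s)

lemma toAssocSheaf_smul (P : X.PresheafOfModules) (r : Γ(X, U)) (s : P.presheaf.obj (.op U)) :
    toAssocSheaf P U (r • s) = r • toAssocSheaf P U s :=
  (((PresheafOfModules.sheafificationAdjunction (𝟙 X.ringCatSheaf.obj)).unit.app P).app
    (.op U)).hom.map_smul r s

lemma toAssocSheaf_locally_injective (P : X.PresheafOfModules) (s t : P.presheaf.obj (.op U))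
    (h : toAssocSheaf P U s = toAssocSheaf P U t) (x : X) (hx : x ∈ U) :
    ∃ V : X.Opens, x ∈ V ∧ ∃ h : V ≤ U, resP P h s = resP P h t := by
  obtain ⟨V, f, hf, hV⟩ := Presheaf.equalizerSieve_mem (Opens.grothendieckTopology X)
     (CategoryTheory.toSheafify (Opens.grothendieckTopology X) P.presheaf) s t h x hx
  exact ⟨V, hV, f.le, hf⟩

lemma toAssocSheaf_locally_surjective (P : X.PresheafOfModules) (s : Γ(assocSheaf P, U))
    (x : X) (hx : x ∈ U) :
    ∃ V : X.Opens, x ∈ V ∧ ∃ (h : V ≤ U) (t : _), toAssocSheaf P V t = resM _ h s := by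
  obtain ⟨V, f, hf, hV⟩ := Presheaf.imageSieve_mem (Opens.grothendieckTopology X)
     (CategoryTheory.toSheafify (Opens.grothendieckTopology X) P.presheaf) s x hx
  obtain ⟨t, ht⟩ := hf
  exact ⟨V, hV, f.le, t, ht⟩

end AlgebraicGeometry.Scheme.Modules

namespace AlgebraicGeometry.Scheme.Modules
universe u
variable {X : Scheme.{u}} {M N : X.Modules} {U V W : X.Opens} {ι : Type*} [Fintype ι]

/-! ### Bases of sections -/

/-- The sections `s i` form a basis of `M|_U`: over every open subset of `U`, each section of `M`
is a unique linear combination of their restrictions. -/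
def IsBasisOn (M : X.Modules) (U : X.Opens) (s : ι → Γ(M, U)) : Prop :=
  ∀ (V : X.Opens) (h : V ≤ U),
    Function.Bijective (fun c : ι → Γ(X, V) => ∑ i, c i • resM M h (s i))

namespace IsBasisOn

variable {s : ι → Γ(M, U)}

lemma mono (hs : IsBasisOn M U s) (h : V ≤ U) : IsBasisOn M V (fun i => resM M h (s i)) := by
  intro W h'
  simpa using hs W (h'.trans h)

lemma exists_eq (hs : IsBasisOn M U s) (h : V ≤ U) (m : Γ(M, V)) :
    ∃ c : ι → Γ(X, V), m = ∑ i, c i • resM M h (s i) := by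
  obtain ⟨c, hc⟩ := (hs V h).2 m
  exact ⟨c, hc.symm⟩

lemma exists_eq_self (hs : IsBasisOn M U s) (m : Γ(M, U)) :
    ∃ c : ι → Γ(X, U), m = ∑ i, c i • s i := by
  obtain ⟨c, hc⟩ := hs.exists_eq le_rfl m
  exact ⟨c, by simpa using hc⟩

lemma coeff_eq (hs : IsBasisOn M U s) (h : V ≤ U) {c d : ι → Γ(X, V)}
    (e : ∑ i, c i • resM M h (s i) = ∑ i, d i • resM M h (s i)) : c = d := (hs V h).1 e

lemma coeff_eq_self (hs : IsBasisOn M U s) {c d : ι → Γ(X, U)}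
    (e : ∑ i, c i • s i = ∑ i, d i • s i) : c = d :=
  hs.coeff_eq le_rfl (by simpa using e)

/-- The basis of the module of sections over a smaller open subset. -/
noncomputable def basis (hs : IsBasisOn M U s) (h : V ≤ U) : Module.Basis ι Γ(X, V) Γ(M, V) :=
  Module.Basis.mk (v := fun i => resM M h (s i))
    (by
      rw [Fintype.linearIndependent_iff]
      intro g hg
      have := hs.coeff_eq h (c := g) (d := 0) (by simpa using hg)
      intro i; rw [this]; rfl)
    (by
      intro m _
      obtain ⟨c, rfl⟩ := hs.exists_eq h m
      exact Submodule.sum_mem _ fun i _ => Submodule.smul_mem _ _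
        (Submodule.subset_span ⟨i, rfl⟩))

@[simp] lemma basis_apply (hs : IsBasisOn M U s) (h : V ≤ U) (i : ι) :
    hs.basis h i = resM M h (s i) := by simp [basis]

lemma of_basis {s : ι → Γ(M, U)}
    (H : ∀ (V : X.Opens) (h : V ≤ U), ∃ b : Module.Basis ι Γ(X, V) Γ(M, V),
      ∀ i, b i = resM M h (s i)) : IsBasisOn M U s := by
  intro V h
  obtain ⟨b, hb⟩ := H V h
  convert b.equivFun.symm.bijective using 1
  ext c
  simp [hb, Module.Basis.equivFun_symm_apply]

/-- Being a basis can be checked on arbitrarily small open subsets. -/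
lemma of_locally {s : ι → Γ(M, U)}
    (H : ∀ V : X.Opens, V ≤ U → ∀ x ∈ V, ∃ (W : X.Opens) (_ : x ∈ W) (_ : W ≤ V) (h : W ≤ U),
      Function.Bijective (fun c : ι → Γ(X, W) => ∑ i, c i • resM M h (s i))) :
    IsBasisOn M U s := by
  have hinj : ∀ (V : X.Opens) (h : V ≤ U),
      Function.Injective (fun c : ι → Γ(X, V) => ∑ i, c i • resM M h (s i)) := by
    intro V h c d e
    ext i
    refine fun_ext fun x hx => ?_
    obtain ⟨W, hxW, hWV, hW, hb⟩ := H V h x hx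
    refine ⟨W, hxW, hWV, ?_⟩
    have := congrArg (resM M hWV) e
    simp only [map_sum, resM_smul, resM_resM] at this
    exact congrFun (hb.1 this) i
  intro V h
  refine ⟨hinj V h, fun m => ?_⟩
  choose! B hxB hBV hBU hb using H V h
  choose c hc using fun x : V => (hb x x.2).2 (resM M (hBV x x.2) m)
  have : ∀ i, ∃ t : Γ(X, V), ∀ x : V, resF (hBV x x.2) t = c x i := by
    intro i
    refine fun_glue (fun x : V => B x) (fun x => hBV x x.2)
      (fun x hx => TopologicalSpace.Opens.mem_iSup.mpr ⟨⟨x, hx⟩, hxB x hx⟩) (fun x => c x i) ?_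
    intro x y W hi hj
    refine congrFun (hinj W (hi.trans (hBU x x.2)) (a₁ := fun i => resF hi (c x i))
      (a₂ := fun i => resF hj (c y i)) ?_) i
    have h1 := congrArg (resM M hi) (hc x)
    have h2 := congrArg (resM M hj) (hc y)
    simp only [map_sum, resM_smul, resM_resM] at h1 h2
    exact h1.trans h2.symm
  choose t ht using this
  refine ⟨t, section_ext fun x hx => ⟨B x, hxB x hx, hBV x hx, ?_⟩⟩
  simp only [map_sum, resM_smul, resM_resM, ← hc ⟨x, hx⟩]
  exact Finset.sum_congr rfl fun i _ => by rw [ht i ⟨x, hx⟩]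

lemma of_cover {s : ι → Γ(M, U)}
    (H : ∀ x ∈ U, ∃ (V : X.Opens) (_ : x ∈ V) (h : V ≤ U),
      IsBasisOn M V (fun i => resM M h (s i))) : IsBasisOn M U s := by
  refine of_locally fun V hV x hx => ?_
  obtain ⟨V', hxV', hV', hb⟩ := H x (hV hx)
  refine ⟨V' ⊓ V, ⟨hxV', hx⟩, inf_le_right, inf_le_left.trans hV', ?_⟩
  simpa using hb (V' ⊓ V) inf_le_left

lemma of_iso (hs : IsBasisOn M U s) (e : M ⟶ N) [IsIso e] :
    IsBasisOn N U (fun i => e.app U (s i)) := by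
  intro V h
  have := (ConcreteCategory.bijective_of_isIso (e.app V)).comp (hs V h)
  convert this using 1
  ext c
  simp [resM_app]

lemma congr {κ : Type*} [Fintype κ] (hs : IsBasisOn M U s) (e : κ ≃ ι) {t : κ → Γ(M, U)}
    (ht : ∀ i, t i = s (e i)) : IsBasisOn M U t := by
  refine of_basis fun V h => ⟨(hs.basis h).reindex e.symm, fun i => ?_⟩
  simp [ht]

lemma unitsSMul (hs : IsBasisOn M U s) {t : ι → Γ(M, U)} (w : ι → Γ(X, U)) (hw : ∀ i, IsUnit (w i))
    (ht : ∀ i, t i = w i • s i) : IsBasisOn M U t := by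
  refine of_basis fun V h => ⟨(hs.basis h).isUnitSMul (w := fun i => resF h (w i))
    (fun i => (hw i).map (resF h)), fun i => ?_⟩
  rw [Module.Basis.isUnitSMul_apply, basis_apply, ht, resM_smul]

end IsBasisOn

/-- Functions as sections of the structure sheaf. -/
noncomputable def unitSec (U : X.Opens) : Γ(X, U) ≃ₗ[Γ(X, U)] Γ(structureSheaf X, U) where
  toFun r := r
  invFun r := r
  map_add' _ _ := rfl
  map_smul' _ _ := rfl
  left_inv _ := rfl
  right_inv _ := rfl

lemma resM_unitSec (h : V ≤ U) (r : Γ(X, U)) :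
    resM (structureSheaf X) h (unitSec U r) = unitSec V (resF h r) := rfl

lemma comp_app_apply {K : X.Modules} (φ : M ⟶ N) (ψ : N ⟶ K) (s : Γ(M, U)) :
    (φ ≫ ψ).app U s = ψ.app U (φ.app U s) := rfl

lemma id_app_apply (s : Γ(M, U)) : (𝟙 M : M ⟶ M).app U s = s := rfl

lemma hom_inv_app_apply (e : M ≅ N) (s : Γ(M, U)) : e.inv.app U (e.hom.app U s) = s := by
  rw [← comp_app_apply, e.hom_inv_id, id_app_apply]

lemma inv_hom_app_apply (e : M ≅ N) (s : Γ(N, U)) : e.hom.app U (e.inv.app U s) = s := by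
  rw [← comp_app_apply, e.inv_hom_id, id_app_apply]

lemma isBasisOn_structureSheaf (U : X.Opens) :
    IsBasisOn (structureSheaf X) U (fun _ : Unit => unitSec U 1) := by
  intro V h
  have : ∀ c : Unit → Γ(X, V), ∑ i, c i • resM (structureSheaf X) h (unitSec U 1) =
      unitSec V (c ()) := by
    intro c
    simp only [Finset.univ_unique, Finset.sum_singleton, resM_unitSec]
    rw [← _root_.map_smul]
    simp
  simp only [this]
  exact (unitSec V).bijective.comp (Equiv.funUnique Unit Γ(X, V)).bijective

/-- `toAssocSheaf` as a linear map. -/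
noncomputable def toAssocLinear (P : X.PresheafOfModules) (U : X.Opens) :
    P.presheaf.obj (.op U) →ₗ[Γ(X, U)] Γ(assocSheaf P, U) where
  toFun := toAssocSheaf P U
  map_add' := map_add (toAssocSheaf P U).hom
  map_smul' := toAssocSheaf_smul P

lemma toAssocLinear_res (P : X.PresheafOfModules) (h : V ≤ U) (s : P.presheaf.obj (.op U)) :
    toAssocLinear P V (resP P h s) = resM _ h (toAssocLinear P U s) := toAssocSheaf_res P h s

lemma resM_comb (h : V ≤ U) (h' : W ≤ V) (c : ι → Γ(X, V)) (s : ι → Γ(M, U)) :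
    resM M h' (∑ i, c i • resM M h (s i)) = ∑ i, resF h' (c i) • resM M (h'.trans h) (s i) := by
  simp

lemma resP_comb (P : X.PresheafOfModules) (h : V ≤ U) (h' : W ≤ V) (c : ι → Γ(X, V))
    (s : ι → P.presheaf.obj (.op U)) :
    resP P h' (∑ i, c i • resP P h (s i)) = ∑ i, resF h' (c i) • resP P (h'.trans h) (s i) := by
  rw [map_sum]
  exact Finset.sum_congr rfl fun i _ => by rw [resP_smul, resP_resP]

lemma toAssocLinear_comb (P : X.PresheafOfModules) (h : V ≤ U) (c : ι → Γ(X, V))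
    (s : ι → P.presheaf.obj (.op U)) :
    toAssocLinear P V (∑ i, c i • resP P h (s i)) =
      ∑ i, c i • resM _ h (toAssocLinear P U (s i)) := by
  rw [map_sum]
  exact Finset.sum_congr rfl fun i _ => by rw [_root_.map_smul, toAssocLinear_res]

/-- A presheaf of modules with sections that form a basis over every open subset of `U` has an
associated sheaf with the same basis. -/
lemma isBasisOn_assocSheaf (P : X.PresheafOfModules) (s : ι → P.presheaf.obj (.op U))
    (hs : ∀ (V : X.Opens) (h : V ≤ U),
      Function.Bijective (fun c : ι → Γ(X, V) => ∑ i, c i • resP P h (s i))) :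
    IsBasisOn (assocSheaf P) U (fun i => toAssocSheaf P U (s i)) := by
  change IsBasisOn (assocSheaf P) U (fun i => toAssocLinear P U (s i))
  have hinj : ∀ (V : X.Opens) (h : V ≤ U), Function.Injective
      (fun c : ι → Γ(X, V) => ∑ i, c i • resM _ h (toAssocLinear P U (s i))) := by
    intro V h c d e
    ext i
    simp only [← toAssocLinear_comb] at e
    refine fun_ext fun x hx => ?_
    obtain ⟨W, hxW, hW, e'⟩ := toAssocSheaf_locally_injective P _ _ e x hx
    refine ⟨W, hxW, hW, ?_⟩
    rw [resP_comb, resP_comb] at e'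
    exact congrFun ((hs W (hW.trans h)).1 e') i
  intro V h
  refine ⟨hinj V h, fun m => ?_⟩
  choose! B hxB hBV t ht using toAssocSheaf_locally_surjective P m
  replace ht : ∀ (x) (hx : x ∈ V), toAssocLinear P (B x) (t x) = resM _ (hBV x hx) m := ht
  choose c hc using fun x : V => (hs (B x) ((hBV x x.2).trans h)).2 (t x)
  replace hc : ∀ x : V, ∑ i, c x i • resM _ ((hBV x x.2).trans h) (toAssocLinear P U (s i)) =
      resM _ (hBV x x.2) m := fun x => by
    rw [← ht x x.2, ← hc x, toAssocLinear_comb]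
  have : ∀ i, ∃ t : Γ(X, V), ∀ x : V, resF (hBV x x.2) t = c x i := by
    intro i
    refine fun_glue (fun x : V => B x) (fun x => hBV x x.2)
      (fun x hx => TopologicalSpace.Opens.mem_iSup.mpr ⟨⟨x, hx⟩, hxB x hx⟩) (fun x => c x i) ?_
    intro x y W hi hj
    refine congrFun (hinj W (hi.trans ((hBV x x.2).trans h)) (a₁ := fun i => resF hi (c x i))
      (a₂ := fun i => resF hj (c y i)) ?_) i
    have h1 := congrArg (resM _ hi) (hc x)
    have h2 := congrArg (resM _ hj) (hc y)
    rw [resM_comb, resM_resM] at h1 h2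
    exact h1.trans h2.symm
  choose d hd using this
  refine ⟨d, section_ext fun x hx => ⟨B x, hxB x hx, hBV x hx, ?_⟩⟩
  rw [← hc ⟨x, hx⟩, resM_comb]
  exact Finset.sum_congr rfl fun i _ => by rw [hd i ⟨x, hx⟩]

end AlgebraicGeometry.Scheme.Modules

namespace AlgebraicGeometry.Scheme.Modules
universe u
variable {X Y Z : Scheme.{u}} {M N : X.Modules} {U V W : X.Opens} {ι : Type*} [Fintype ι]

/-! ### Pullback of sections -/

/-- The pullback of a section of a sheaf of modules. -/
noncomputable def pullSec (g : Y ⟶ X) (s : Γ(M, U)) : Γ((pullback g).obj M, g ⁻¹ᵁ U) :=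
  ((pullbackPushforwardAdjunction g).unit.app M).app U s

lemma pullSec_add (g : Y ⟶ X) (s t : Γ(M, U)) : pullSec g (s + t) = pullSec g s + pullSec g t :=
  map_add (((pullbackPushforwardAdjunction g).unit.app M).app U).hom s t

lemma pullSec_sum (g : Y ⟶ X) {κ : Type*} (S : Finset κ) (s : κ → Γ(M, U)) :
    pullSec g (∑ i ∈ S, s i) = ∑ i ∈ S, pullSec g (s i) :=
  map_sum (((pullbackPushforwardAdjunction g).unit.app M).app U).hom s S

lemma pullSec_smul (g : Y ⟶ X) (r : Γ(X, U)) (s : Γ(M, U)) :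
    pullSec g (r • s) = g.app U r • pullSec g s :=
  Hom.app_smul ((pullbackPushforwardAdjunction g).unit.app M) r s

lemma pullSec_resM (g : Y ⟶ X) (h : V ≤ U) (s : Γ(M, U)) :
    pullSec g (resM M h s) = resM _ (g.preimage_mono h) (pullSec g s) :=
  resM_app ((pullbackPushforwardAdjunction g).unit.app M) h s

lemma pullback_map_pullSec (g : Y ⟶ X) (φ : M ⟶ N) (s : Γ(M, U)) :
    ((pullback g).map φ).app (g ⁻¹ᵁ U) (pullSec g s) = pullSec g (φ.app U s) :=
  congr(($((pullbackPushforwardAdjunction g).unit.naturality φ)).app U s).symm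

lemma pullSec_comp (h : Z ⟶ Y) (g : Y ⟶ X) (s : Γ(M, U)) :
    ((pullbackComp h g).inv.app M).app (h ⁻¹ᵁ g ⁻¹ᵁ U)
      (resM _ (show h ⁻¹ᵁ g ⁻¹ᵁ U ≤ (h ≫ g) ⁻¹ᵁ U from le_rfl) (pullSec (h ≫ g) s)) =
        pullSec h (pullSec g s) := by
  have := congr(($(unit_conjugateEquiv ((pullbackPushforwardAdjunction g).comp
    (pullbackPushforwardAdjunction h)) (pullbackPushforwardAdjunction (h ≫ g))
      (pullbackComp h g).inv M)).app U s)
  rw [conjugateEquiv_pullbackComp_inv] at this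
  exact (congrArg _ (resM_self le_rfl _)).trans this.symm

lemma pullSec_comp' (h : Z ⟶ Y) (g : Y ⟶ X) (s : Γ(M, U)) :
    ((pullbackComp h g).hom.app M).app (h ⁻¹ᵁ g ⁻¹ᵁ U) (pullSec h (pullSec g s)) =
      resM _ (show h ⁻¹ᵁ g ⁻¹ᵁ U ≤ (h ≫ g) ⁻¹ᵁ U from le_rfl) (pullSec (h ≫ g) s) := by
  rw [← pullSec_comp]
  exact inv_hom_app_apply ((pullbackComp h g).app M) _

lemma pullSec_congr {g g' : Y ⟶ X} (e : g = g') (s : Γ(M, U)) :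
    ((pullbackCongr e).hom.app M).app (g ⁻¹ᵁ U) (pullSec g s) =
      resM _ (by subst e; exact le_rfl) (pullSec g' s) := by
  subst e
  simp [pullbackCongr]

/-- The restriction of a section of `M` along an open immersion. -/
noncomputable def restrSec (g : Y ⟶ X) [IsOpenImmersion g] (s : Γ(M, U)) :
    Γ(M.restrict g, g ⁻¹ᵁ U) :=
  ((restrictAdjunction g).unit.app M).app U s

lemma restrict_pullSec (g : Y ⟶ X) [IsOpenImmersion g] (s : Γ(M, U)) :
    ((restrictFunctorIsoPullback g).hom.app M).app (g ⁻¹ᵁ U) (restrSec g s) = pullSec g s :=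
  congr(($((restrictAdjunction g).unit_leftAdjointUniq_hom_app
    (pullbackPushforwardAdjunction g) M)).app U s)

lemma final_opensMap (g : Y ⟶ X) : (TopologicalSpace.Opens.map g.base).Final := by
  refine ⟨fun V => ?_⟩
  let T : StructuredArrow V (TopologicalSpace.Opens.map g.base) :=
    StructuredArrow.mk (Y := (⊤ : X.Opens)) (homOfLE le_top)
  have : Nonempty (StructuredArrow V (TopologicalSpace.Opens.map g.base)) := ⟨T⟩
  refine zigzag_isConnected fun A B => ?_
  have hT : ∀ A, Nonempty (A ⟶ T) := fun A =>
    ⟨StructuredArrow.homMk (homOfLE le_top) (Subsingleton.elim _ _)⟩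
  exact (Zigzag.of_hom (hT A).some).trans (Zigzag.of_inv (hT B).some)

lemma exists_pullback_structureSheaf_iso (g : Y ⟶ X) :
    ∃ e : (pullback g).obj (structureSheaf X) ⟶ structureSheaf Y, IsIso e ∧
      ∀ (U : X.Opens) (r : Γ(X, U)),
        e.app (g ⁻¹ᵁ U) (pullSec g (unitSec U r)) = unitSec _ (g.app U r) := by
  have := final_opensMap g
  have : (SheafOfModules.pushforward.{u} (Hom.toRingCatSheafHom g)).IsRightAdjoint :=
    inferInstanceAs ((pushforward g).IsRightAdjoint)
  have hI : IsIso (SheafOfModules.pullbackObjUnitToUnit.{u} (Hom.toRingCatSheafHom g)) := by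
    exact SheafOfModules.instIsIsoPullbackObjUnitToUnitOfFinal (Hom.toRingCatSheafHom g)
  refine ⟨SheafOfModules.pullbackObjUnitToUnit g.toRingCatSheafHom, hI, ?_⟩
  intro U r
  have h1 := SheafOfModules.pullbackPushforwardAdjunction_homEquiv_pullbackObjUnitToUnit
    g.toRingCatSheafHom
  rw [Adjunction.homEquiv_unit] at h1
  exact congr(($h1).val.app (.op U) r)

/-- Homomorphisms from the structure sheaf to `M` that send `1` to a given section. -/
lemma exists_hom_of_section (s : Γ(M, ⊤)) :
    ∃ φ : structureSheaf X ⟶ M, ∀ (U : X.Opens) (r : Γ(X, U)),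
      φ.app U (unitSec U r) = r • resM M le_top s := by
  refine ⟨(SheafOfModules.unitHomEquiv M).symm
    ⟨fun U => resM M le_top s, fun {U V} i => resM_resM le_top i.unop.le s⟩, fun U r => ?_⟩
  rfl

end AlgebraicGeometry.Scheme.Modules

namespace AlgebraicGeometry.Scheme.Modules
universe u
variable {X Y Z : Scheme.{u}} {M N : X.Modules} {U V W : X.Opens} {ι : Type*} [Fintype ι]

/-! ### Pullback of bases -/

/-- A compatible family of linear maps is a homomorphism of sheaves of modules. -/
lemma exists_hom_of_linearMaps (φ : ∀ U : X.Opens, Γ(M, U) →ₗ[Γ(X, U)] Γ(N, U))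
    (H : ∀ (U V : X.Opens) (h : V ≤ U) (m : Γ(M, U)), φ V (resM M h m) = resM N h (φ U m)) :
    ∃ f : M ⟶ N, ∀ (U : X.Opens) (m : Γ(M, U)), f.app U m = φ U m := by
  refine ⟨⟨PresheafOfModules.homMk
    { app := fun U => AddCommGrpCat.ofHom (φ U.unop).toAddMonoidHom
      naturality := fun U V i => ?_ } ?_⟩, fun U m => rfl⟩
  · ext m
    exact H U.unop V.unop i.unop.le m
  · intro U r m
    exact (φ U.unop).map_smul r m

lemma smul_restrict (M : X.Modules) (U : X.Opens) (V : U.toScheme.Opens) (r : Γ(U.toScheme, V))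
    (s : Γ(M.restrict U.ι, V)) :
    r • s = ((show Γ(X, U.ι ''ᵁ V) from r) • (show Γ(M, U.ι ''ᵁ V) from s) :) := by
  change (show Γ(X, U.ι ''ᵁ V) from ((U.ι.appIso V).inv r)) • (show Γ(M, U.ι ''ᵁ V) from s) = _
  rw [Opens.ι_appIso]
  rfl

lemma isBasisOn_restrict_iff {s : ι → Γ(M, U)} :
    IsBasisOn (M.restrict U.ι) (U.ι ⁻¹ᵁ U) (fun i => restrSec U.ι (s i)) ↔ IsBasisOn M U s := by
  have hV : U.ι ''ᵁ (U.ι ⁻¹ᵁ U) = U := by simp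
  -- The open subsets of `U`, considered as a scheme, are the open subsets of `X` contained in `U`.
  have key : ∀ (W : U.toScheme.Opens) (h : W ≤ U.ι ⁻¹ᵁ U) (h' : U.ι ''ᵁ W ≤ U)
      (c : ι → Γ(U.toScheme, W)),
      ∑ i, c i • resM (M.restrict U.ι) h (restrSec U.ι (s i)) =
        (show Γ(M, U.ι ''ᵁ W) from
          ∑ i, (show Γ(X, U.ι ''ᵁ W) from c i) • resM M h' (s i)) := by
    intro W h h' c
    refine Finset.sum_congr rfl fun i _ => ?_
    rw [smul_restrict]
    congr 1
    exact resM_resM hV.le (U.ι.image_mono h) (s i)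
  constructor
  · intro H W hW
    obtain ⟨W', rfl⟩ : ∃ W' : U.toScheme.Opens, W = U.ι ''ᵁ W' := ⟨U.ι ⁻¹ᵁ W, by
      rw [Scheme.Hom.image_preimage_eq_opensRange_inf]; simpa using hW⟩
    have := H W' (by
      rw [← U.ι.preimage_image_eq W']
      exact U.ι.preimage_mono hW)
    simp only [key W' _ hW] at this
    exact this
  · intro H W hW
    have h := (U.ι.image_mono hW).trans hV.le
    have := H (U.ι ''ᵁ W) h
    simp only [key W hW h]
    exact this

lemma IsBasisOn.basis_coord_comb {s : ι → Γ(M, U)} (hs : IsBasisOn M U s) (h : V ≤ U)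
    (c : ι → Γ(X, V)) (j : ι) : (hs.basis h).coord j (∑ i, c i • resM M h (s i)) = c j := by
  have : ∑ i, c i • resM M h (s i) = (hs.basis h).equivFun.symm c := by
    simp [Module.Basis.equivFun_symm_apply]
  rw [this, Module.Basis.coord_apply, ← Module.Basis.equivFun_apply, LinearEquiv.apply_symm_apply]

lemma IsBasisOn.exists_coordinates {s : ι → Γ(M, ⊤)} (hs : IsBasisOn M ⊤ s) (j : ι) :
    ∃ φ : M ⟶ structureSheaf X, ∀ (U : X.Opens) (c : ι → Γ(X, U)),
      φ.app U (∑ i, c i • resM M le_top (s i)) = unitSec U (c j) := by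
  obtain ⟨φ, hφ⟩ := exists_hom_of_linearMaps (M := M) (N := structureSheaf X)
    (fun U => (unitSec U).toLinearMap ∘ₗ (hs.basis (le_top : U ≤ ⊤)).coord j) (by
      intro U V h m
      obtain ⟨c, rfl⟩ := hs.exists_eq (le_top : U ≤ ⊤) m
      rw [resM_comb]
      simp only [LinearMap.comp_apply]
      rw [hs.basis_coord_comb, hs.basis_coord_comb]
      rfl)
  refine ⟨φ, fun U c => ?_⟩
  rw [hφ, LinearMap.comp_apply, hs.basis_coord_comb]
  rfl

lemma app_sum {κ : Type*} (S : Finset κ) (f : κ → (M ⟶ N)) (m : Γ(M, U)) :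
    (∑ i ∈ S, f i).app U m = ∑ i ∈ S, (f i).app U m := by
  classical
  induction S using Finset.induction_on with
  | empty => simp
  | insert a S ha ih => rw [Finset.sum_insert ha, Finset.sum_insert ha, ← ih]; rfl

/-- A finite system of homomorphisms from and to the structure sheaf that exhibits `M` as a direct
sum of copies of it defines a basis. -/
lemma isBasisOn_of_biproduct [DecidableEq ι] {s : ι → Γ(M, ⊤)} (a : ι → (M ⟶ structureSheaf X))
    (b : ι → (structureSheaf X ⟶ M)) (h1 : ∑ i, a i ≫ b i = 𝟙 M)
    (h2 : ∀ i j, b i ≫ a j = if i = j then 𝟙 _ else 0)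
    (hb : ∀ i, (b i).app ⊤ (unitSec ⊤ 1) = s i) : IsBasisOn M ⊤ s := by
  have hb' : ∀ i (V : X.Opens) (r : Γ(X, V)),
      (b i).app V (unitSec V r) = r • resM _ le_top (s i) := by
    intro i V r
    rw [← hb, ← resM_app, ← Hom.app_smul, resM_unitSec, ← _root_.map_smul]
    simp
  intro V h
  constructor
  · intro c d hcd
    ext j
    have key : ∀ c : ι → Γ(X, V), (a j).app V (∑ i, c i • resM _ h (s i)) =
        unitSec V (c j) := by
      intro c
      simp only [← hb']
      rw [map_sum]
      have : ∀ i, (a j).app V ((b i).app V (unitSec V (c i))) =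
          unitSec V (if i = j then c i else 0) := by
        intro i
        refine (congr($(congrArg (fun f => Hom.app f V) (h2 i j)) (unitSec V (c i)))).trans ?_
        split_ifs
        · rfl
        · rw [map_zero]; rfl
      simp only [this]
      rw [← map_sum]
      simp
    exact (unitSec V).injective ((key c).symm.trans ((congrArg _ hcd).trans (key d)))
  · intro m
    refine ⟨fun i => (unitSec V).symm ((a i).app V m), ?_⟩
    have := congr(($(h1)).app V m)
    rw [app_sum] at this
    refine (Finset.sum_congr rfl fun i _ => ?_).trans this
    rw [← hb', LinearEquiv.apply_symm_apply]
    rfl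

/-- A sheaf of modules with a basis of global sections is a direct sum of copies of the structure
sheaf, and pullback functors are additive and preserve the structure sheaf. -/
lemma IsBasisOn.pullSec_top {s : ι → Γ(M, ⊤)} (hs : IsBasisOn M ⊤ s) (g : Y ⟶ X) :
    IsBasisOn ((pullback g).obj M) ⊤ (fun i => pullSec g (s i)) := by
  classical
  choose a ha using hs.exists_coordinates
  choose b hb using fun i => exists_hom_of_section (s i)
  obtain ⟨e, he, hes⟩ := exists_pullback_structureSheaf_iso g
  have h1 : ∑ i, a i ≫ b i = 𝟙 M := by
    ext U m
    obtain ⟨c, rfl⟩ := hs.exists_eq (le_top : U ≤ ⊤) m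
    rw [app_sum]
    refine Finset.sum_congr rfl fun i _ => ?_
    rw [Hom.comp_app, ConcreteCategory.comp_apply, ha, hb]
  have h2 : ∀ i j, b i ≫ a j = if i = j then 𝟙 _ else 0 := by
    intro i j
    ext U r
    obtain ⟨r, rfl⟩ := (unitSec U).surjective r
    rw [Hom.comp_app, ConcreteCategory.comp_apply, hb]
    have := ha j U (Pi.single i r)
    rw [Finset.sum_eq_single i (by intro k _ hk; simp [hk]) (by simp), Pi.single_eq_same] at this
    rw [this]
    split_ifs with h
    · subst h; rw [Pi.single_eq_same]; rfl
    · rw [Pi.single_eq_of_ne (Ne.symm h), map_zero]; rfl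
  refine isBasisOn_of_biproduct (fun i => (pullback g).map (a i) ≫ e)
    (fun i => inv e ≫ (pullback g).map (b i)) ?_ ?_ ?_
  · simp only [Category.assoc, IsIso.hom_inv_id_assoc, ← Functor.map_comp]
    rw [← Functor.map_sum, h1, CategoryTheory.Functor.map_id]
  · intro i j
    simp only [Category.assoc, ← Functor.map_comp_assoc, h2]
    split_ifs <;> simp
  · intro i
    have h : e.app ⊤ (Modules.pullSec (U := ⊤) g (unitSec ⊤ 1)) = unitSec ⊤ 1 :=
      (hes ⊤ 1).trans (congrArg (unitSec ⊤) (map_one (g.app ⊤).hom))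
    have h' : (inv e).app ⊤ (unitSec ⊤ 1) = Modules.pullSec (U := ⊤) g (unitSec ⊤ 1) :=
      (congrArg ((inv e).app ⊤) h).symm.trans
        congr($(congrArg (fun f => Hom.app f ⊤) (IsIso.hom_inv_id e)) _)
    rw [Hom.comp_app, ConcreteCategory.comp_apply, h']
    refine (pullback_map_pullSec (U := ⊤) g (b i) _).trans ?_
    rw [hb, one_smul, resM_self]

/-- The pullback of a basis is a basis. -/
lemma IsBasisOn.pullSec {s : ι → Γ(M, U)} (hs : IsBasisOn M U s) (g : Y ⟶ X) :
    IsBasisOn ((pullback g).obj M) (g ⁻¹ᵁ U) (fun i => Modules.pullSec g (s i)) := by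
  let W := g ⁻¹ᵁ U
  have top_case : ∀ {X Y : Scheme.{u}} {M : X.Modules} {U : X.Opens} {s : ι → Γ(M, U)}
      (_ : IsBasisOn M U s) (_ : U = ⊤) (g : Y ⟶ X), IsBasisOn ((pullback g).obj M) (g ⁻¹ᵁ U)
        (fun i => Modules.pullSec g (s i)) := by
    intro X Y M U s hs hU g
    subst hU
    exact hs.pullSec_top g
  have H := top_case (isBasisOn_restrict_iff.mpr hs) (by simp) (g ∣_ U)
  -- The pullback along `g` restricted to `g ⁻¹ᵁ U` is the pullback of the restriction to `U` along
  -- the restriction of `g`, where the basis is global.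
  let Ψ := (pullback (g ∣_ U)).mapIso ((restrictFunctorIsoPullback U.ι).app M) ≪≫
    (pullbackComp (g ∣_ U) U.ι).app M ≪≫ (pullbackCongr (morphismRestrict_ι g U)).app M ≪≫
    ((pullbackComp W.ι g).app M).symm
  have H2 := H.of_iso Ψ.hom
  have key : ∀ i, Ψ.hom.app _ (Modules.pullSec (g ∣_ U) (restrSec U.ι (s i))) =
      resM _ (by rw [← Scheme.Hom.comp_preimage, morphismRestrict_ι]; rfl)
        (Modules.pullSec W.ι (Modules.pullSec g (s i))) := by
    intro i
    simp only [Ψ, Iso.trans_hom, comp_app_apply, Functor.mapIso_hom, Iso.app_hom, Iso.symm_hom,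
      Iso.app_inv]
    rw [pullback_map_pullSec, restrict_pullSec, pullSec_comp', resM_app, pullSec_congr, resM_resM,
      ← pullSec_comp, ← resM_app, resM_resM]
  have hle : W.ι ⁻¹ᵁ W ≤ (g ∣_ U) ⁻¹ᵁ U.ι ⁻¹ᵁ U := by
    change W.ι ⁻¹ᵁ g ⁻¹ᵁ U ≤ _
    rw [← Scheme.Hom.comp_preimage, ← Scheme.Hom.comp_preimage, morphismRestrict_ι]
  rw [← isBasisOn_restrict_iff]
  have H3 : IsBasisOn ((pullback W.ι).obj ((pullback g).obj M)) (W.ι ⁻¹ᵁ W)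
      (fun i => Modules.pullSec W.ι (Modules.pullSec g (s i))) := by
    have := H2.mono hle
    have e : ∀ i, resM _ hle (Ψ.hom.app _ (Modules.pullSec (g ∣_ U) (restrSec U.ι (s i)))) =
        Modules.pullSec W.ι (Modules.pullSec g (s i)) := fun i => by
      rw [key i]
      exact (resM_resM _ hle _).trans (resM_self le_rfl _)
    exact (funext e) ▸ this
  have H4 := H3.of_iso ((restrictFunctorIsoPullback W.ι).inv.app ((pullback g).obj M))
  simp only [← restrict_pullSec] at H4
  have key2 : ∀ i, ((restrictFunctorIsoPullback W.ι).inv.app ((pullback g).obj M)).app (W.ι ⁻¹ᵁ W)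
      (((restrictFunctorIsoPullback W.ι).hom.app ((pullback g).obj M)).app (W.ι ⁻¹ᵁ W)
        (restrSec W.ι (Modules.pullSec g (s i)))) = restrSec W.ι (Modules.pullSec g (s i)) :=
    fun i => hom_inv_app_apply ((restrictFunctorIsoPullback W.ι).app ((pullback g).obj M)) _
  simp only [key2] at H4
  exact H4

end AlgebraicGeometry.Scheme.Modules

namespace SymPower
open Polynomial
variable {R M : Type*} [CommRing R] [AddCommGroup M] [Module R M] (b : Module.Basis (Fin 2) R M)

/-! ### Monomial bases of symmetric powers of free modules of rank two -/

/-- The homomorphism from the symmetric algebra of a free module of rank two to the polynomial ring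
that sets the first basis vector to one. -/
noncomputable def dehomogenize : SymmetricAlgebra R M →ₐ[R] R[X] :=
  SymmetricAlgebra.lift (b.constr R ![1, X])

lemma dehomogenize_ι (m : M) :
    dehomogenize b (SymmetricAlgebra.ι R M m) = C (b.repr m 0) + C (b.repr m 1) * X := by
  rw [dehomogenize, SymmetricAlgebra.lift_ι_apply, Module.Basis.constr_apply_fintype]
  simp [Module.Basis.equivFun_apply, smul_eq_C_mul]

lemma prod_ι_mem {k : ℕ} (v : Fin k → M) : ∏ i, SymmetricAlgebra.ι R M (v i) ∈ piece R M k := by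
  induction k with
  | zero => simp [piece]
  | succ k ih =>
    rw [Fin.prod_univ_castSucc, piece, pow_succ]
    exact Submodule.mul_mem_mul (ih _) ⟨_, rfl⟩

variable (R) in
/-- The product of `k` elements in the `k`-th symmetric power. -/
noncomputable def prod {k : ℕ} (v : Fin k → M) : piece R M k :=
  ⟨∏ i, SymmetricAlgebra.ι R M (v i), prod_ι_mem v⟩

variable (R) in
/-- The monomial of degree `j` in `m 1` and of degree `k - j` in `m 0`. -/
noncomputable def mon {k : ℕ} (m : Fin 2 → M) (j : Fin (k + 1)) : piece R M k :=
  prod R fun i : Fin k => if (i : ℕ) < j then m 1 else m 0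

lemma prod_ite_lt {A : Type*} [CommMonoid A] (k : ℕ) (j : Fin (k + 1)) (x y : A) :
    (∏ i : Fin k, if (i : ℕ) < j then x else y) = x ^ (j : ℕ) * y ^ (k - j) := by
  rw [Fin.prod_univ_eq_prod_range (fun i => if i < (j : ℕ) then x else y) k,
    Finset.prod_ite, Finset.prod_const, Finset.prod_const]
  have h1 : (Finset.range k).filter (fun i => i < (j : ℕ)) = Finset.range j := by
    ext i; simp; omega
  have h2 : (Finset.range k).filter (fun i => ¬ i < (j : ℕ)) = Finset.Ico (j : ℕ) k := by
    ext i; simp; omega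
  rw [h1, h2]
  simp

lemma coe_mon {k : ℕ} (m : Fin 2 → M) (j : Fin (k + 1)) :
    (mon R m j : piece R M k).1 =
      SymmetricAlgebra.ι R M (m 1) ^ (j : ℕ) * SymmetricAlgebra.ι R M (m 0) ^ (k - j) := by
  rw [← prod_ite_lt]
  simp only [mon, prod]
  exact Finset.prod_congr rfl fun i _ => by split_ifs <;> rfl

lemma dehomogenize_mon {k : ℕ} (j : Fin (k + 1)) :
    dehomogenize b (mon R b j : piece R M k).1 = X ^ (j : ℕ) := by
  rw [coe_mon, map_mul, map_pow, map_pow, dehomogenize_ι, dehomogenize_ι]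
  simp

open scoped Pointwise in
/-- The coefficients of a form with respect to the monomials are those of its dehomogenization. By
linearity it suffices to consider monomials, which span the symmetric power because products of
basis vectors are monomials. -/
lemma eq_sum_mon {k : ℕ} (x : piece R M k) :
    x = ∑ j : Fin (k + 1), (dehomogenize b x.1).coeff j • mon R b j := by
  have hspan : piece R M k = Submodule.span R (Set.range fun j : Fin (k + 1) =>
      (mon R b j : piece R M k).1) := by
    apply le_antisymm
    · have h1 : LinearMap.range (SymmetricAlgebra.ι R M) =
          Submodule.span R (Set.range fun i => SymmetricAlgebra.ι R M (b i)) := by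
        rw [LinearMap.range_eq_map, ← b.span_eq, Submodule.map_span, ← Set.range_comp]
        rfl
      change LinearMap.range (SymmetricAlgebra.ι R M) ^ k ≤ _
      rw [h1, Submodule.span_pow]
      refine Submodule.span_mono ?_
      clear x
      induction k with
      | zero =>
        rintro x hx
        rw [pow_zero, Set.mem_one] at hx
        exact ⟨0, by simp [coe_mon, hx]⟩
      | succ k ih =>
        rintro x hx
        rw [pow_succ] at hx
        obtain ⟨y, hy, z, ⟨i, rfl⟩, rfl⟩ := hx
        obtain ⟨j, rfl⟩ := ih hy
        have hj := j.2
        fin_cases i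
        · refine ⟨j.castSucc, ?_⟩
          simp only [coe_mon, Fin.val_castSucc, Fin.zero_eta]
          rw [show k + 1 - (j : ℕ) = (k - j) + 1 by omega, pow_succ, mul_assoc]
        · refine ⟨j.succ, ?_⟩
          simp only [coe_mon, Fin.val_succ, Fin.mk_one]
          rw [show k + 1 - ((j : ℕ) + 1) = k - j by omega, pow_succ]
          ring
    · rw [Submodule.span_le]
      rintro _ ⟨j, rfl⟩
      exact (mon R b j).2
  apply Subtype.ext
  rw [Submodule.coe_sum]
  simp only [Submodule.coe_smul]
  have hx := hspan.le x.2
  generalize x.1 = x at hx ⊢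
  induction hx using Submodule.span_induction with
  | mem y hy =>
    obtain ⟨i, rfl⟩ := hy
    simp only [dehomogenize_mon, coeff_X_pow]
    simp [Fin.val_inj]
  | zero => simp
  | add y z _ _ hy hz =>
    simp only [map_add, coeff_add, add_smul, Finset.sum_add_distrib]
    rw [← hy, ← hz]
  | smul r y _ hy =>
    simp only [_root_.map_smul, coeff_smul, smul_assoc, ← Finset.smul_sum]
    rw [← hy]

lemma bijective_mon (k : ℕ) : Function.Bijective
    (fun c : Fin (k + 1) → R => ∑ j, c j • (mon R b j : piece R M k)) := by
  constructor
  · intro c d h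
    have h := congrArg (fun x : piece R M k => dehomogenize b x.1) h
    simp only [Submodule.coe_sum, Submodule.coe_smul, map_sum, _root_.map_smul,
      dehomogenize_mon] at h
    ext j
    have := congrArg (fun p => p.coeff j) h
    simpa [coeff_X_pow, Fin.val_inj] using this
  · intro x
    exact ⟨_, (eq_sum_mon b x).symm⟩

end SymPower

namespace AlgebraicGeometry.Scheme.Modules
open _root_.Polynomial hiding X
universe u
variable {X Y Z : Scheme.{u}} {M N : X.Modules} {U V W : X.Opens} {ι κ : Type*} [Fintype ι] [Fintype κ]

/-! ### Bases of tensor products, symmetric powers and duals -/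

lemma bijective_congr {A B : Type*} {f g : A → B} (hg : Function.Bijective g) (h : ∀ a, f a = g a) :
    Function.Bijective f := (funext h) ▸ hg

lemma tensorSection_res (h : V ≤ U) (s : Γ(M, U)) (t : Γ(N, U)) :
    resM _ h (tensorSection s t) = tensorSection (resM M h s) (resM N h t) := by
  refine (toAssocSheaf_res (tensorPresheaf M N) h _).symm.trans ?_
  rfl

lemma isBasisOn_tensor {s : ι → Γ(M, U)} {t : κ → Γ(N, U)} (hs : IsBasisOn M U s)
    (ht : IsBasisOn N U t) :
    IsBasisOn (tensor M N) U (fun i : ι × κ => tensorSection (s i.1) (t i.2)) := by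
  refine isBasisOn_assocSheaf (tensorPresheaf M N)
    (fun i : ι × κ => (s i.1 ⊗ₜ[Γ(X, U)] t i.2 : TensorProduct Γ(X, U) Γ(M, U) Γ(N, U))) ?_
  intro V h
  let b := (hs.basis h).tensorProduct (ht.basis h)
  refine bijective_congr b.equivFun.symm.bijective fun c => ?_
  rw [Module.Basis.equivFun_symm_apply]
  refine Finset.sum_congr rfl fun i _ => ?_
  rw [Module.Basis.tensorProduct_apply, hs.basis_apply, ht.basis_apply]
  rfl

/-- `tensorSection` as a bilinear map. -/
noncomputable def tensorBilin (M N : X.Modules) (U : X.Opens) :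
    Γ(M, U) →ₗ[Γ(X, U)] Γ(N, U) →ₗ[Γ(X, U)] Γ(tensor M N, U) :=
  (TensorProduct.mk Γ(X, U) Γ(M, U) Γ(N, U)).compr₂ (toAssocLinear (tensorPresheaf M N) U :
    TensorProduct Γ(X, U) Γ(M, U) Γ(N, U) →ₗ[Γ(X, U)] Γ(assocSheaf (tensorPresheaf M N), U))

lemma tensorSection_smul_left (r : Γ(X, U)) (s : Γ(M, U)) (t : Γ(N, U)) :
    tensorSection (r • s) t = r • tensorSection s t := by
  exact LinearMap.map_smul₂ (tensorBilin M N U) r s t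

lemma tensorSection_smul_right (r : Γ(X, U)) (s : Γ(M, U)) (t : Γ(N, U)) :
    tensorSection s (r • t) = r • tensorSection s t :=
  (tensorBilin M N U s).map_smul r t

/-- The product of `k` sections in the `k`-th symmetric power. -/
noncomputable def symSec {k : ℕ} (v : Fin k → Γ(M, U)) : Γ(sym M k, U) :=
  toAssocSheaf (symPresheaf M k) U (SymPower.prod Γ(X, U) v)

/-- The monomial sections of the symmetric power defined by two sections. -/
noncomputable def symMon {k : ℕ} (s : Fin 2 → Γ(M, U)) (j : Fin (k + 1)) : Γ(sym M k, U) :=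
  symSec fun i : Fin k => if (i : ℕ) < j then s 1 else s 0

lemma resP_symPresheaf_prod {k : ℕ} (h : V ≤ U) (v : Fin k → Γ(M, U)) :
    resP (symPresheaf M k) h (SymPower.prod Γ(X, U) v) =
      SymPower.prod Γ(X, V) (fun i => resM M h (v i)) := by
  apply Subtype.ext
  change SymPower.map (res M (homOfLE h)) (∏ i, SymmetricAlgebra.ι _ _ (v i)) = _
  rw [map_prod]
  exact Finset.prod_congr rfl fun i _ => SymPower.map_ι _ _

lemma resM_symSec {k : ℕ} (h : V ≤ U) (v : Fin k → Γ(M, U)) :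
    resM _ h (symSec v) = symSec (fun i => resM M h (v i)) := by
  refine (toAssocSheaf_res (symPresheaf M k) h _).symm.trans ?_
  rw [resP_symPresheaf_prod]
  rfl

lemma resM_symMon {k : ℕ} (h : V ≤ U) (s : Fin 2 → Γ(M, U)) (j : Fin (k + 1)) :
    resM _ h (symMon s j) = symMon (fun i => resM M h (s i)) j := by
  rw [symMon, resM_symSec]
  congr 1
  ext i
  split_ifs <;> rfl

lemma isBasisOn_sym {s : Fin 2 → Γ(M, U)} (hs : IsBasisOn M U s) (k : ℕ) :
    IsBasisOn (sym M k) U (symMon s : Fin (k + 1) → _) := by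
  refine isBasisOn_assocSheaf (symPresheaf M k)
    (fun j : Fin (k + 1) => SymPower.mon Γ(X, U) s j) ?_
  intro V h
  refine bijective_congr (SymPower.bijective_mon (hs.basis h) k) fun c => ?_
  refine Finset.sum_congr rfl fun j _ => ?_
  congr 1
  refine (resP_symPresheaf_prod h _).trans ?_
  simp only [SymPower.mon, hs.basis_apply]
  congr 1
  ext i
  split_ifs <;> rfl

/-- The expansion of a product of linear forms into monomials, in terms of the product of the
dehomogenized linear forms. -/
lemma symSec_eq_sum {s : Fin 2 → Γ(M, U)} (hs : IsBasisOn M U s) {k : ℕ} (a d : Fin k → Γ(X, U))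
    (v : Fin k → Γ(M, U)) (hv : ∀ i, v i = a i • s 0 + d i • s 1) :
    symSec v = ∑ j : Fin (k + 1), (∏ i, (C (a i) + C (d i) * _root_.Polynomial.X)).coeff j • symMon s j := by
  have key : SymPower.prod Γ(X, U) v =
      ∑ j : Fin (k + 1), (∏ i, (C (a i) + C (d i) * _root_.Polynomial.X)).coeff j • SymPower.mon Γ(X, U) s j := by
    have h := SymPower.eq_sum_mon (hs.basis le_rfl) (SymPower.prod Γ(X, U) v)
    have hb : (hs.basis le_rfl : Fin 2 → Γ(M, U)) = s := by ext i; simp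
    rw [hb] at h
    rw [h]
    refine Finset.sum_congr rfl fun j _ => ?_
    congr 2
    simp only [SymPower.prod, map_prod]
    refine Finset.prod_congr rfl fun i _ => ?_
    rw [SymPower.dehomogenize_ι, hv, ← congrFun hb 0, ← congrFun hb 1]
    simp [-IsBasisOn.basis_apply]
  rw [symSec, key]
  refine (map_sum (toAssocLinear (symPresheaf M k) U) _ _).trans ?_
  exact Finset.sum_congr rfl fun j _ => toAssocSheaf_smul (symPresheaf M k) _ _


/-- The section of the dual sheaf defined by a compatible family of linear forms. -/
noncomputable def dualSec (y : dualSections M U) : Γ(dual M, U) :=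
  toAssocSheaf (dualPresheaf M) U y

/-- The restriction of a compatible family of linear forms to a smaller open subset. -/
noncomputable def dualRes (h : V ≤ U) (y : dualSections M U) : dualSections M V :=
  resP (dualPresheaf M) h y

lemma dualRes_apply (h : V ≤ U) (y : dualSections M U) (W : {W : X.Opens // W ≤ V}) :
    (dualRes h y).1 W = y.1 ⟨W.1, W.2.trans h⟩ := rfl

lemma resM_dualSec (h : V ≤ U) (y : dualSections M U) :
    resM _ h (dualSec y) = dualSec (dualRes h y) :=
  (toAssocSheaf_res (dualPresheaf M) h y).symm

lemma dualSections_res (y : dualSections M U) {V W : X.Opens} (hV : V ≤ U) (h : W ≤ V)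
    (m : Γ(M, V)) : y.1 ⟨W, h.trans hV⟩ (resM M h m) = resF h (y.1 ⟨V, hV⟩ m) :=
  y.2 ⟨V, hV⟩ ⟨W, h.trans hV⟩ h m

lemma dualSections_smul_apply (r : Γ(X, U)) (y : dualSections M U) {V : X.Opens} (hV : V ≤ U)
    (m : Γ(M, V)) : (r • y).1 ⟨V, hV⟩ m = resF hV r * y.1 ⟨V, hV⟩ m := rfl

lemma dualSections_sum_apply {κ : Type*} (S : Finset κ) (y : κ → dualSections M U) {V : X.Opens}
    (hV : V ≤ U) (m : Γ(M, V)) :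
    (∑ i ∈ S, y i).1 ⟨V, hV⟩ m = ∑ i ∈ S, (y i).1 ⟨V, hV⟩ m := by
  classical
  induction S using Finset.induction_on with
  | empty => simp
  | insert a S ha ih => rw [Finset.sum_insert ha, Finset.sum_insert ha, ← ih]; rfl

lemma dualSec_smul (r : Γ(X, U)) (y : dualSections M U) : dualSec (r • y) = r • dualSec y :=
  toAssocSheaf_smul (dualPresheaf M) r y

lemma dualSec_sum {κ : Type*} (S : Finset κ) (y : κ → dualSections M U) :
    dualSec (∑ i ∈ S, y i) = ∑ i ∈ S, dualSec (y i) :=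
  map_sum (toAssocLinear (dualPresheaf M) U) y S

lemma IsBasisOn.dualSections_ext {s : ι → Γ(M, U)} (hs : IsBasisOn M U s) (h : V ≤ U)
    {y z : dualSections M V}
    (H : ∀ i, y.1 ⟨V, le_rfl⟩ (resM M h (s i)) = z.1 ⟨V, le_rfl⟩ (resM M h (s i))) : y = z := by
  refine Subtype.ext (funext fun W => LinearMap.ext fun m => ?_)
  obtain ⟨c, rfl⟩ := hs.exists_eq (W.2.trans h) m
  simp only [map_sum, _root_.map_smul]
  refine Finset.sum_congr rfl fun i _ => ?_
  have h1 := dualSections_res y le_rfl W.2 (resM M h (s i))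
  have h2 := dualSections_res z le_rfl W.2 (resM M h (s i))
  rw [resM_resM] at h1 h2
  congr 1
  exact h1.trans ((congrArg _ (H i)).trans h2.symm)

open Classical in
/-- A family of linear forms that is dual to a basis is a basis of the dual sheaf. -/
lemma isBasisOn_dual {s : ι → Γ(M, U)} (hs : IsBasisOn M U s) (y : ι → dualSections M U)
    (hy : ∀ i j, (y i).1 ⟨U, le_rfl⟩ (s j) = if i = j then 1 else 0) :
    IsBasisOn (dual M) U (fun i => dualSec (y i)) := by
  refine isBasisOn_assocSheaf (dualPresheaf M) y ?_
  intro V h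
  have hy' : ∀ i j, (y i).1 ⟨V, h⟩ (resM M h (s j)) = if i = j then 1 else 0 := by
    intro i j
    rw [dualSections_res (y i) le_rfl h, hy]
    split_ifs <;> simp
  have key : ∀ (c : ι → Γ(X, V)) (j : ι),
      (∑ i, c i • dualRes h (y i)).1 ⟨V, le_rfl⟩ (resM M h (s j)) = c j := by
    intro c j
    rw [dualSections_sum_apply]
    have h1 : ∀ i, (c i • dualRes h (y i)).1 ⟨V, le_rfl⟩ (resM M h (s j)) =
        if i = j then c i else 0 := fun i => by
      rw [dualSections_smul_apply, resF_self]
      refine (congrArg (c i * ·) (hy' i j)).trans ?_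
      split_ifs <;> simp
    rw [Finset.sum_congr rfl fun i _ => h1 i]
    simp
  constructor
  · intro c d hcd
    ext j
    rw [← key c j, ← key d j]
    exact congrArg (fun z : dualSections M V => z.1 ⟨V, le_rfl⟩ (resM M h (s j))) hcd
  · intro z
    refine ⟨fun j => (show dualSections M V from z).1 ⟨V, le_rfl⟩ (resM M h (s j)), ?_⟩
    exact hs.dualSections_ext h (fun j => key _ j)

open Classical in
lemma IsBasisOn.exists_dualSections {s : ι → Γ(M, U)} (hs : IsBasisOn M U s) (i : ι) :
    ∃ y : dualSections M U, ∀ (V : X.Opens) (h : V ≤ U) (c : ι → Γ(X, V)),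
      y.1 ⟨V, h⟩ (∑ j, c j • resM M h (s j)) = c i := by
  refine ⟨⟨fun V => (hs.basis V.2).coord i, ?_⟩, fun V h c => hs.basis_coord_comb _ _ _⟩
  intro V W h m
  obtain ⟨c, rfl⟩ := hs.exists_eq V.2 m
  change (hs.basis W.2).coord i (resM M h _) = resF h ((hs.basis V.2).coord i _)
  rw [resM_comb, hs.basis_coord_comb, hs.basis_coord_comb]

end AlgebraicGeometry.Scheme.Modules

namespace AlgebraicGeometry.Scheme.Modules
universe u
variable {X Y Z : Scheme.{u}} {M N K : X.Modules} {U V W : X.Opens} {ι κ : Type*}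

/-! ### Local criteria -/

lemma epi_of_locally_surjective (q : M ⟶ N)
    (H : ∀ x : X, ∃ U : X.Opens, x ∈ U ∧ ∀ V ≤ U, Function.Surjective (q.app V)) : Epi q := by
  constructor
  intro K a b e
  ext V n
  refine section_ext fun x hx => ?_
  obtain ⟨U, hxU, hU⟩ := H x
  refine ⟨U ⊓ V, ⟨hxU, hx⟩, inf_le_right, ?_⟩
  obtain ⟨m, hm⟩ := hU (U ⊓ V) inf_le_left (resM _ inf_le_right n)
  rw [← resM_app, ← resM_app, ← hm]
  exact congr($(e).app _ m)

lemma mono_of_locally_injective (q : M ⟶ N)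
    (H : ∀ x : X, ∃ U : X.Opens, x ∈ U ∧ ∀ V ≤ U, Function.Injective (q.app V)) : Mono q := by
  constructor
  intro K a b e
  ext V n
  refine section_ext fun x hx => ?_
  obtain ⟨U, hxU, hU⟩ := H x
  refine ⟨U ⊓ V, ⟨hxU, hx⟩, inf_le_right, ?_⟩
  apply hU (U ⊓ V) inf_le_left
  rw [resM_app, resM_app]
  exact congrArg _ congr($(e).app _ n)

/-- Sections over an open subset, as a functor to abelian groups. -/
noncomputable def sectionsFunctor (U : X.Opens) : X.Modules ⥤ Ab.{u} :=
  toPresheaf X ⋙ (CategoryTheory.evaluation (TopologicalSpace.Opens X)ᵒᵖ Ab.{u}).obj (.op U)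

noncomputable instance (U : X.Opens) : Limits.PreservesLimits (sectionsFunctor (X := X) U) := by
  have h : Limits.PreservesLimitsOfSize.{u, u}
      ((CategoryTheory.evaluation (TopologicalSpace.Opens X)ᵒᵖ Ab.{u}).obj (.op U)) := inferInstance
  exact @Limits.comp_preservesLimits _ _ _ _ _ _ (toPresheaf X) _ _ h

instance (U : X.Opens) : (sectionsFunctor (X := X) U).PreservesZeroMorphisms where
  map_zero _ _ := rfl

lemma kernel_ι_injective (q : M ⟶ N) (U : X.Opens) :
    Function.Injective ((Limits.kernel.ι q).app U) := by
  have : Mono ((sectionsFunctor U).map (Limits.kernel.ι q)) := inferInstance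
  exact (AddCommGrpCat.mono_iff_injective _).mp this

lemma kernel_ι_app (q : M ⟶ N) (k : Γ(Limits.kernel q, U)) :
    q.app U ((Limits.kernel.ι q).app U k) = 0 := by
  rw [← comp_app_apply, Limits.kernel.condition]
  rfl

lemma exists_kernel_section (q : M ⟶ N) (s : Γ(M, U)) (hs : q.app U s = 0) :
    ∃ k : Γ(Limits.kernel q, U), (Limits.kernel.ι q).app U k = s := by
  let S := ShortComplex.mk (Limits.kernel.ι q) q (Limits.kernel.condition q)
  have hS : S.Exact := S.exact_of_f_is_kernel (Limits.kernelIsKernel q)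
  have := hS.map_of_mono_of_preservesKernel (sectionsFunctor U) inferInstance inferInstance
  rw [ShortComplex.ab_exact_iff] at this
  exact this s hs

lemma shortExact_of_locally (S : ShortComplex X.Modules)
    (H : ∀ x : X, ∃ U : X.Opens, x ∈ U ∧ ∀ V ≤ U, Function.Injective (S.f.app V) ∧
      Function.Surjective (S.g.app V) ∧
      ∀ b : Γ(S.X₂, V), S.g.app V b = 0 → ∃ a, S.f.app V a = b) : S.ShortExact := by
  have h1 : Mono S.f := mono_of_locally_injective _ fun x => by
    obtain ⟨U, hx, hU⟩ := H x
    exact ⟨U, hx, fun V hV => (hU V hV).1⟩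
  have h2 : Epi S.g := epi_of_locally_surjective _ fun x => by
    obtain ⟨U, hx, hU⟩ := H x
    exact ⟨U, hx, fun V hV => (hU V hV).2.1⟩
  refine ⟨?_⟩
  -- Exactness in the middle: the morphism to the kernel is locally surjective on sections.
  rw [ShortComplex.exact_iff_epi_kernel_lift]
  refine epi_of_locally_surjective _ fun x => ?_
  obtain ⟨U, hx, hU⟩ := H x
  refine ⟨U, hx, fun V hV k => ?_⟩
  obtain ⟨a, ha⟩ := (hU V hV).2.2 _ (kernel_ι_app S.g k)
  refine ⟨a, kernel_ι_injective _ _ ?_⟩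
  rw [← ha, ← comp_app_apply, Limits.kernel.lift_ι]

/-- Two epimorphisms with the same kernel have isomorphic targets. -/
lemma exists_iso_of_same_kernel (r : M ⟶ N) (r' : M ⟶ K) [Epi r] [Epi r']
    (H : ∀ x : X, ∃ U : X.Opens, x ∈ U ∧ ∀ V ≤ U, ∀ s : Γ(M, V), r.app V s = 0 ↔ r'.app V s = 0) :
    ∃ e : N ≅ K, r ≫ e.hom = r' := by
  have key : ∀ (V : X.Opens) (s : Γ(M, V)), r.app V s = 0 ↔ r'.app V s = 0 := by
    have : ∀ {N K : X.Modules} (r : M ⟶ N) (r' : M ⟶ K) (H : ∀ x : X, ∃ U : X.Opens, x ∈ U ∧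
        ∀ V ≤ U, ∀ s : Γ(M, V), r.app V s = 0 → r'.app V s = 0) (V : X.Opens) (s : Γ(M, V)),
        r.app V s = 0 → r'.app V s = 0 := by
      intro N K r r' H V s hs
      refine section_ext fun x hx => ?_
      obtain ⟨U, hxU, hU⟩ := H x
      refine ⟨U ⊓ V, ⟨hxU, hx⟩, inf_le_right, ?_⟩
      rw [← resM_app, map_zero]
      apply hU _ inf_le_left
      rw [resM_app, hs, map_zero]
    refine fun V s => ⟨this r r' (fun x => ?_) V s, this r' r (fun x => ?_) V s⟩
    · obtain ⟨U, hx, hU⟩ := H x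
      exact ⟨U, hx, fun V hV s => (hU V hV s).1⟩
    · obtain ⟨U, hx, hU⟩ := H x
      exact ⟨U, hx, fun V hV s => (hU V hV s).2⟩
  have h1 : Limits.kernel.ι r ≫ r' = 0 := by
    ext V k
    exact (key V _).mp (kernel_ι_app r k)
  have h2 : Limits.kernel.ι r' ≫ r = 0 := by
    ext V k
    exact (key V _).mpr (kernel_ι_app r' k)
  refine ⟨⟨Abelian.epiDesc r r' h1, Abelian.epiDesc r' r h2, ?_, ?_⟩, Abelian.comp_epiDesc r r' h1⟩
  · rw [← cancel_epi r]; simp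
  · rw [← cancel_epi r']; simp

/-- Homomorphisms of sheaves of modules can be constructed locally from a relation `S` between the
sections of `M` and of `N` that determines them: on the members `U` of a cover that is closed under
passing to smaller open subsets, the relation has to be contained in the graph of a linear map, and
the sections of `M` that are related to some section of `N` have to generate `Γ(M, U)`. -/
lemma exists_hom_of_relation (B : Set X.Opens) (hB : ∀ x : X, ∃ U ∈ B, x ∈ U)
    (hB' : ∀ U ∈ B, ∀ V ≤ U, V ∈ B) (S : ∀ U : X.Opens, Γ(M, U) → Γ(N, U) → Prop)
    (hS : ∀ (U V : X.Opens) (h : V ≤ U) m n, S U m n → S V (resM M h m) (resM N h n))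
    (H : ∀ U ∈ B, ∃ φ : Γ(M, U) →ₗ[Γ(X, U)] Γ(N, U), (∀ m n, S U m n → φ m = n) ∧
      Submodule.span Γ(X, U) {m | ∃ n, S U m n} = ⊤) :
    ∃ f : M ⟶ N, ∀ (U : X.Opens) (m : Γ(M, U)) (n : Γ(N, U)), S U m n → f.app U m = n := by
  choose! φ hφ hspan using H
  have hcomp : ∀ (U V : X.Opens) (hU : U ∈ B) (hV : V ∈ B) (h : V ≤ U) (m : Γ(M, U)),
      φ V (resM M h m) = resM N h (φ U m) := by
    intro U V hU hV h m
    have hm : m ∈ Submodule.span Γ(X, U) {m | ∃ n, S U m n} := by rw [hspan U hU]; trivial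
    induction hm using Submodule.span_induction with
    | mem m hm =>
      obtain ⟨n, hn⟩ := hm
      rw [hφ U hU _ _ hn, hφ V hV _ _ (hS U V h _ _ hn)]
    | zero => simp
    | add a b _ _ ha hb => simp only [map_add, ha, hb]
    | smul r a _ ha => simp only [resM_smul, _root_.map_smul, ha]
  have hex : ∀ (U : X.Opens) (m : Γ(M, U)), ∃ n : Γ(N, U), ∀ (V : X.Opens) (_ : V ∈ B) (h : V ≤ U),
      resM N h n = φ V (resM M h m) := by
    intro U m
    obtain ⟨n, hn⟩ := section_glue (M := N) (U := U) (fun V : {V // V ∈ B ∧ V ≤ U} => V.1)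
      (fun V => V.2.2) (fun x hx => by
        obtain ⟨V, hV, hxV⟩ := hB x
        exact TopologicalSpace.Opens.mem_iSup.mpr
          ⟨⟨V ⊓ U, hB' V hV _ inf_le_left, inf_le_right⟩, hxV, hx⟩)
      (fun V => φ V.1 (resM M V.2.2 m)) (by
        intro V V' W h h'
        have hW := hB' V.1 V.2.1 W h
        rw [← hcomp _ _ V.2.1 hW, ← hcomp _ _ V'.2.1 hW, resM_resM, resM_resM])
    exact ⟨n, fun V hV h => hn ⟨V, hV, h⟩⟩
  have hun : ∀ (U : X.Opens) (n n' : Γ(N, U)), (∀ (V : X.Opens) (_ : V ∈ B) (h : V ≤ U),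
      resM N h n = resM N h n') → n = n' := by
    intro U n n' h
    refine section_ext fun x hx => ?_
    obtain ⟨V, hV, hxV⟩ := hB x
    exact ⟨V ⊓ U, ⟨hxV, hx⟩, inf_le_right, h _ (hB' V hV _ inf_le_left) _⟩
  choose Φ hΦ using hex
  obtain ⟨f, hf⟩ := exists_hom_of_linearMaps (M := M) (N := N)
    (fun U => ⟨⟨Φ U, fun a b => hun U _ _ fun V hV h => by
      simp only [map_add, hΦ _ _ V hV]⟩, fun r a => hun U _ _ fun V hV h => by
      simp only [resM_smul, hΦ _ _ V hV, _root_.map_smul, RingHom.id_apply]⟩) (by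
      intro U V h m
      refine hun V _ _ fun W hW h' => ?_
      change resM N h' (Φ V (resM M h m)) = resM N h' (resM N h (Φ U m))
      rw [hΦ V _ W hW, resM_resM, resM_resM, hΦ U _ W hW])
  refine ⟨f, fun U m n hmn => ?_⟩
  rw [hf]
  refine hun U _ _ fun V hV h => ?_
  change resM N h (Φ U m) = _
  rw [hΦ _ _ V hV]
  exact hφ V hV _ _ (hS U V h _ _ hmn)

end AlgebraicGeometry.Scheme.Modules

namespace AlgebraicGeometry.Scheme.Modules
universe u
variable {X Y Z T : Scheme.{u}} {M N K : X.Modules} {U V W : X.Opens} {ι κ : Type*}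

/-! ### Bases of kernels, direct images and sheaves on the spectrum of a field -/

section

variable [Fintype ι] [Fintype κ] {s : ι → Γ(M, U)}

lemma bijective_of_surjective_of_basis {R A : Type*} [CommRing R] [AddCommGroup A] [Module R A]
    (b : Module.Basis ι R A) (t : ι → A)
    (h : Function.Surjective (fun c : ι → R => ∑ i, c i • t i)) :
    Function.Bijective (fun c : ι → R => ∑ i, c i • t i) := by
  have key : (fun c : ι → R => ∑ i, c i • t i) =
      b.equivFun.symm ∘ (b.equivFun.toLinearMap ∘ₗ Fintype.linearCombination R t) := by
    ext c
    simp [Fintype.linearCombination_apply]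
  have h2 : Function.Surjective (b.equivFun.toLinearMap ∘ₗ Fintype.linearCombination R t) := by
    have := b.equivFun.surjective.comp h
    rw [key] at this
    convert this using 1
    ext c
    simp
  rw [key]
  exact b.equivFun.symm.bijective.comp
    ⟨OrzechProperty.injective_of_surjective_endomorphism _ h2, h2⟩

/-- Generators that are as many as the elements of a basis form a basis. -/
lemma IsBasisOn.of_generate (hs : IsBasisOn M U s) (t : ι → Γ(M, U))
    (h : ∀ i, ∃ c : ι → Γ(X, U), s i = ∑ j, c j • t j) : IsBasisOn M U t := by
  intro V hV
  choose c hc using h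
  refine bijective_of_surjective_of_basis (hs.basis hV) _ fun m => ?_
  obtain ⟨d, rfl⟩ := hs.exists_eq hV m
  refine ⟨fun j => ∑ i, d i * resF hV (c i j), ?_⟩
  simp only [hc, map_sum, resM_smul, Finset.smul_sum, Finset.sum_smul, mul_smul]
  exact Finset.sum_comm

/-- A homomorphism out of a sheaf of modules with a basis is given by the images of the basis. -/
lemma IsBasisOn.exists_hom [DecidableEq ι] {s : ι → Γ(M, ⊤)} (hs : IsBasisOn M ⊤ s)
    (n : ι → Γ(N, ⊤)) : ∃ φ : M ⟶ N, ∀ i, φ.app ⊤ (s i) = n i := by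
  choose a ha using hs.exists_coordinates
  choose b hb using fun i => exists_hom_of_section (n i)
  refine ⟨∑ i, a i ≫ b i, fun j => ?_⟩
  have hj : s j = ∑ i, (if i = j then 1 else 0 : Γ(X, ⊤)) • resM M le_top (s i) := by
    simp [ite_smul]
  rw [app_sum]
  conv_rhs => rw [show n j = ∑ i, (if i = j then 1 else 0 : Γ(X, ⊤)) • resM N le_top (n i) by
    simp [ite_smul]]
  refine Finset.sum_congr rfl fun i _ => ?_
  rw [comp_app_apply, ← hb i, hj]
  exact congrArg _ (ha i ⊤ fun l => if l = j then 1 else 0)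

lemma IsBasisOn.hom_ext {s : ι → Γ(M, ⊤)} (hs : IsBasisOn M ⊤ s) {φ ψ : M ⟶ N}
    (h : ∀ i, φ.app ⊤ (s i) = ψ.app ⊤ (s i)) : φ = ψ := by
  ext V m
  obtain ⟨c, rfl⟩ := hs.exists_eq le_top m
  change φ.app V _ = ψ.app V _
  rw [map_sum, map_sum]
  exact Finset.sum_congr rfl fun i _ => by
    rw [Hom.app_smul, Hom.app_smul, resM_app, resM_app, h]

/-- If sections `k i` of the kernel of `q` and sections `e j` together form a basis, and the
images of the `e j` form a basis, then the `k i` form a basis of the kernel. -/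
lemma isBasisOn_kernel (q : M ⟶ N) {k : ι → Γ(Limits.kernel q, U)} {e : κ → Γ(M, U)}
    (h : IsBasisOn M U (Sum.elim (fun i => (Limits.kernel.ι q).app U (k i)) e))
    (hq : IsBasisOn N U (fun j => q.app U (e j))) : IsBasisOn (Limits.kernel q) U k := by
  intro V hV
  have key : ∀ c : ι → Γ(X, V), (Limits.kernel.ι q).app V (∑ i, c i • resM _ hV (k i)) =
      ∑ i, Sum.elim c 0 i •
        resM _ hV (Sum.elim (fun i => (Limits.kernel.ι q).app U (k i)) e i) := by
    intro c
    rw [map_sum, Fintype.sum_sum_type]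
    simp [resM_app]
  constructor
  · intro c d hcd
    have := h.coeff_eq hV ((key c).symm.trans ((congrArg _ hcd).trans (key d)))
    ext i
    exact congrFun this (.inl i)
  · intro m
    obtain ⟨c, hc⟩ := h.exists_eq hV ((Limits.kernel.ι q).app V m)
    have h0 := kernel_ι_app q m
    rw [hc, map_sum, Fintype.sum_sum_type] at h0
    have h1 : ∀ i, q.app V (c (.inl i) • resM _ hV ((Limits.kernel.ι q).app U (k i))) = 0 := by
      intro i
      rw [Hom.app_smul, resM_app, kernel_ι_app, map_zero, smul_zero]
    have h2 : ∑ j, c (.inr j) • resM _ hV (q.app U (e j)) = ∑ j, (0 : κ → Γ(X, V)) j •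
        resM _ hV (q.app U (e j)) := by
      simpa [h1, resM_app] using h0
    have h3 := hq.coeff_eq hV h2
    refine ⟨fun i => c (.inl i), kernel_ι_injective _ _ ?_⟩
    change (Limits.kernel.ι q).app V (∑ i, c (.inl i) • resM _ hV (k i)) = _
    rw [hc, key]
    refine Finset.sum_congr rfl fun i _ => ?_
    rcases i with i | i
    · rfl
    · have := congrFun h3 i
      simp [show c (.inr i) = 0 from this]

end

/-- The elements `1` and `x` form a basis of the `A`-algebra `B`. -/
def _root_.AlgebraicGeometry.IsGenerator {A B : Type*} [CommRing A] [CommRing B] (f : A →+* B)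
    (x : B) : Prop :=
  Function.Bijective (fun c : Fin 2 → A => f (c 0) + f (c 1) * x)

/-- The functions `1` and `x` form a basis of the direct image of the structure sheaf over `U`. -/
def _root_.AlgebraicGeometry.IsGeneratorOn (p : Y ⟶ X) (U : X.Opens) (x : Γ(Y, p ⁻¹ᵁ U)) : Prop :=
  ∀ (V : X.Opens) (h : V ≤ U), IsGenerator (p.app V).hom (resF (p.preimage_mono h) x)

lemma _root_.AlgebraicGeometry.IsGeneratorOn.mono {p : Y ⟶ X} {x : Γ(Y, p ⁻¹ᵁ U)} (hx : IsGeneratorOn p U x) (h : V ≤ U) :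
    IsGeneratorOn p V (resF (p.preimage_mono h) x) := by
  intro W h'
  simpa using hx W (h'.trans h)

/-- If `1` and `x` form a basis of `p_* 𝒪` and `ν` is a basis of the line bundle `L`, then `ν` and
`x ν` form a basis of `p_* L`. -/
lemma isBasisOn_pushforward {p : Y ⟶ X} {x : Γ(Y, p ⁻¹ᵁ U)} (hx : IsGeneratorOn p U x)
    {L : Y.Modules} {ν : Γ(L, p ⁻¹ᵁ U)} (hν : IsBasisOn L (p ⁻¹ᵁ U) (fun _ : Unit => ν)) :
    IsBasisOn ((pushforward p).obj L) U (fun i : Fin 2 => (x ^ (i : ℕ) • ν : Γ(L, p ⁻¹ᵁ U))) := by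
  intro V h
  have h1 := (hν (p ⁻¹ᵁ V) (p.preimage_mono h)).comp
    ((Equiv.funUnique Unit Γ(Y, p ⁻¹ᵁ V)).symm.bijective.comp (hx V h))
  refine (congrArg Function.Bijective (funext fun c => ?_)).mpr h1
  rw [Fin.sum_univ_two]
  change p.app V (c 0) • resM L (p.preimage_mono h) (x ^ 0 • ν) +
    p.app V (c 1) • resM L (p.preimage_mono h) (x ^ 1 • ν) = _
  simp [add_smul, mul_smul]

section tilde

variable (k : Type u) [Field k] {E : Type u} [AddCommGroup E] [Module k E]

/-- The global section of `vectorSheaf k E` given by a vector. -/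
noncomputable def vecSec (v : E) : Γ(vectorSheaf k E, ⊤) :=
  (tilde.toOpen (R := CommRingCat.of k) (ModuleCat.of k E) ⊤).hom v

lemma vecSec_add (v w : E) : vecSec k (v + w) = vecSec k v + vecSec k w :=
  map_add (tilde.toOpen (R := CommRingCat.of k) (ModuleCat.of k E) ⊤).hom v w

lemma vecSec_smul (a : k) (v : E) :
    vecSec k (a • v) = (Scheme.ΓSpecIso (CommRingCat.of k)).inv a • vecSec k v :=
  _root_.map_smul (tilde.toOpen (R := CommRingCat.of k) (ModuleCat.of k E) ⊤).hom a v

lemma vecSec_bijective : Function.Bijective (vecSec k : E → _) :=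
  @ConcreteCategory.bijective_of_isIso _ _ _ _ _ _ _ _
    _ (tilde.isIso_toOpen_top (R := CommRingCat.of k) (M := ModuleCat.of k E))

/-- The spectrum of a field has only one point, so that it suffices to consider global sections. -/
lemma isBasisOn_vecSec {ι : Type*} [Fintype ι] (b : Module.Basis ι k E) :
    IsBasisOn (vectorSheaf k E) ⊤ (fun i => vecSec k (b i)) := by
  refine IsBasisOn.of_locally fun V _ x hx => ?_
  have hV : V = ⊤ := by
    ext y
    have : Subsingleton (Spec (CommRingCat.of k)) :=
      inferInstanceAs (Subsingleton (PrimeSpectrum k))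
    simpa [Subsingleton.elim y x] using hx
  subst hV
  refine ⟨⊤, hx, le_rfl, le_rfl, ?_⟩
  let e : k ≃+* Γ(Spec (CommRingCat.of k), ⊤) :=
    (Scheme.ΓSpecIso (CommRingCat.of k)).symm.commRingCatIsoToRingEquiv
  have key : (fun c : ι → Γ(Spec (CommRingCat.of k), ⊤) =>
      ∑ i, c i • resM (vectorSheaf k E) le_rfl (vecSec k (b i))) =
      vecSec k ∘ b.equivFun.symm ∘ (fun c i => e.symm (c i)) := by
    funext c
    rw [Function.comp_apply, Function.comp_apply, Module.Basis.equivFun_symm_apply]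
    rw [vecSec, map_sum]
    refine Finset.sum_congr rfl fun i _ => ?_
    rw [resM_self]
    refine Eq.trans ?_ (vecSec_smul k (e.symm (c i)) (b i)).symm
    exact congrArg (· • vecSec k (b i)) (e.apply_symm_apply (c i)).symm
  rw [key]
  refine (vecSec_bijective k).comp (b.equivFun.symm.bijective.comp ?_)
  exact (Equiv.piCongrRight fun _ => e.symm.toEquiv).bijective

end tilde

end AlgebraicGeometry.Scheme.Modules

namespace AlgebraicGeometry.Scheme.Modules
universe u
variable {X Y Z T : Scheme.{u}} {M N K L : X.Modules} {U V W : X.Opens} {ι κ : Type*}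
  [Fintype ι]

/-! ### Line bundles -/

lemma IsBasisOn.isIso [DecidableEq ι] {s : ι → Γ(M, ⊤)} (hs : IsBasisOn M ⊤ s) {n : ι → Γ(N, ⊤)}
    (hn : IsBasisOn N ⊤ n) (φ : M ⟶ N) (h : ∀ i, φ.app ⊤ (s i) = n i) : IsIso φ := by
  obtain ⟨ψ, hψ⟩ := hn.exists_hom s
  refine ⟨ψ, hs.hom_ext fun i => ?_, hn.hom_ext fun i => ?_⟩
  · rw [comp_app_apply, h, hψ, id_app_apply]
  · rw [comp_app_apply, hψ, h, id_app_apply]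

/-- A section of `L` over `U` whose multiples are all the sections of `L` over open subsets of
`U`, in a unique way. -/
abbrev IsGenOn (L : X.Modules) (U : X.Opens) (μ : Γ(L, U)) : Prop :=
  IsBasisOn L U (fun _ : Unit => μ)

namespace IsGenOn

variable {μ : Γ(L, U)}

lemma exists_eq_smul (hμ : IsGenOn L U μ) (h : V ≤ U) (s : Γ(L, V)) :
    ∃ c : Γ(X, V), s = c • resM L h μ := by
  obtain ⟨c, hc⟩ := IsBasisOn.exists_eq hμ h s
  exact ⟨c (), by simpa using hc⟩

lemma exists_eq_smul_self (hμ : IsGenOn L U μ) (s : Γ(L, U)) : ∃ c : Γ(X, U), s = c • μ := by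
  obtain ⟨c, hc⟩ := hμ.exists_eq_smul le_rfl s
  exact ⟨c, by simpa using hc⟩

lemma smul_injective (hμ : IsGenOn L U μ) (h : V ≤ U) {c d : Γ(X, V)}
    (e : c • resM L h μ = d • resM L h μ) : c = d :=
  congrFun (IsBasisOn.coeff_eq hμ h (c := fun _ => c) (d := fun _ => d) (by simpa using e)) ()

lemma smul_injective_self (hμ : IsGenOn L U μ) {c d : Γ(X, U)} (e : c • μ = d • μ) : c = d :=
  hμ.smul_injective le_rfl (by simpa using e)

lemma isUnit (hμ : IsGenOn L U μ) {c : Γ(X, U)} (h : IsGenOn L U (c • μ)) : IsUnit c := by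
  obtain ⟨d, hd⟩ := h.exists_eq_smul_self μ
  rw [smul_smul] at hd
  exact .of_mul_eq_one d ((mul_comm _ _).trans
    (hμ.smul_injective_self (hd.symm.trans (one_smul _ _).symm)))

lemma smul_of_isUnit (hμ : IsGenOn L U μ) {c : Γ(X, U)} (hc : IsUnit c) : IsGenOn L U (c • μ) :=
  IsBasisOn.unitsSMul hμ (fun _ => c) (fun _ => hc) (fun _ => rfl)

lemma pullSec (hμ : IsGenOn L U μ) (g : Y ⟶ X) :
    IsGenOn ((pullback g).obj L) (g ⁻¹ᵁ U) (Modules.pullSec g μ) := IsBasisOn.pullSec hμ g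

end IsGenOn

lemma resM_restrSec {s : Γ(L, U)} {W : U.toScheme.Opens} (h : W ≤ U.ι ⁻¹ᵁ U)
    (h' : U.ι ''ᵁ W ≤ U) :
    resM (L.restrict U.ι) h (restrSec U.ι s) = (show Γ(L, U.ι ''ᵁ W) from resM L h' s) := by
  have hV : U.ι ''ᵁ (U.ι ⁻¹ᵁ U) = U := by simp
  exact resM_resM hV.le (U.ι.image_mono h) s

lemma resM_restrict {V W : U.toScheme.Opens} (h : W ≤ V) (h' : U.ι ''ᵁ W ≤ U.ι ''ᵁ V)
    (μ : Γ(L, U.ι ''ᵁ V)) :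
    resM (L.restrict U.ι) h (show Γ(L.restrict U.ι, V) from μ) =
      (show Γ(L.restrict U.ι, W) from resM L h' μ) := rfl

lemma restrSec_resM (μ : Γ(L, U.ι ''ᵁ ⊤)) (h : U ≤ U.ι ''ᵁ ⊤) :
    restrSec U.ι (resM L h μ) =
      resM (L.restrict U.ι) le_top (show Γ(L.restrict U.ι, ⊤) from μ) := by
  have h' : U.ι ''ᵁ (U.ι ⁻¹ᵁ U) ≤ U := by simp
  rw [← resM_self le_rfl (restrSec U.ι (resM L h μ)), resM_restrSec le_rfl h',
    resM_restrict le_top (h'.trans h)]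
  exact resM_resM h h' μ

/-- A sheaf is a line bundle if and only if it is locally generated by one section that has no
relations. -/
lemma isLineBundle_iff : IsLineBundle L ↔
    ∀ x : X, ∃ U : X.Opens, x ∈ U ∧ ∃ μ : Γ(L, U), IsGenOn L U μ := by
  constructor
  · intro H x
    obtain ⟨U, hx, ⟨e⟩⟩ := H x
    have hU : U.ι ''ᵁ ⊤ = U := by simp
    have hU' : U.ι ⁻¹ᵁ U = ⊤ := by simp
    let μ' : Γ(L.restrict U.ι, ⊤) := e.inv.app ⊤ (unitSec ⊤ 1)
    have hμ' : IsBasisOn (L.restrict U.ι) ⊤ (fun _ : Unit => μ') :=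
      (isBasisOn_structureSheaf (X := U.toScheme) ⊤).of_iso e.inv
    refine ⟨U, hx, resM L hU.ge μ', isBasisOn_restrict_iff.mp ?_⟩
    rw [show restrSec U.ι (resM L hU.ge μ') = resM (L.restrict U.ι) le_top μ' from
      restrSec_resM μ' hU.ge]
    exact hμ'.mono (V := U.ι ⁻¹ᵁ U) le_top
  · intro H x
    obtain ⟨U, hx, μ, hμ⟩ := H x
    have hU' : U.ι ⁻¹ᵁ U = ⊤ := by simp
    have h1 := (isBasisOn_restrict_iff.mpr hμ).mono hU'.ge
    have h2 := isBasisOn_structureSheaf (X := U.toScheme) ⊤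
    obtain ⟨φ, hφ⟩ := h1.exists_hom (fun _ => unitSec ⊤ 1)
    have := h1.isIso h2 φ hφ
    exact ⟨U, hx, ⟨asIso φ⟩⟩

lemma IsLineBundle.pullback (hL : IsLineBundle L) (g : Y ⟶ X) :
    IsLineBundle ((pullback g).obj L) := by
  rw [isLineBundle_iff] at hL ⊢
  intro y
  obtain ⟨U, hx, μ, hμ⟩ := hL (g y)
  exact ⟨g ⁻¹ᵁ U, hx, _, hμ.pullSec g⟩

lemma isLineBundle_structureSheaf : IsLineBundle (structureSheaf X) :=
  isLineBundle_iff.mpr fun _ => ⟨⊤, trivial, _, isBasisOn_structureSheaf ⊤⟩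

end AlgebraicGeometry.Scheme.Modules

namespace AlgebraicGeometry

universe u

open Scheme.Modules

variable {k : Type u} [Field k] {E : Type u} [AddCommGroup E] [Module k E]
  {S T T' X : Scheme.{u}} {ι : Type*} [Fintype ι]

/-! ### Morphisms to projective spaces -/

/-- The constants among the functions on a `k`-scheme. -/
noncomputable def constFun (f : T ⟶ Spec (CommRingCat.of k)) (U : T.Opens) : k →+* Γ(T, U) :=
  ((resF le_top).comp (f.appTop).hom).comp (Scheme.ΓSpecIso (CommRingCat.of k)).inv.hom

lemma resF_constFun (f : T ⟶ Spec (CommRingCat.of k)) {U V : T.Opens} (h : V ≤ U) (a : k) :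
    resF h (constFun f U a) = constFun f V a := resF_resF le_top h _

lemma app_resF (h : T' ⟶ T) {U V : T.Opens} (i : V ≤ U) (r : Γ(T, U)) :
    h.app V (resF i r) = resF (h.preimage_mono i) (h.app U r) :=
  congr($(h.naturality (homOfLE i).op) r)

lemma app_constFun (h : T' ⟶ T) (f : T ⟶ Spec (CommRingCat.of k)) (U : T.Opens) (a : k) :
    h.app U (constFun f U a) = constFun (h ≫ f) (h ⁻¹ᵁ U) a :=
  app_resF h le_top _

section vectorSection

variable {f : T ⟶ Spec (CommRingCat.of k)} {L N : T.Modules}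
  (q : (Scheme.Modules.pullback f).obj (vectorSheaf k E) ⟶ L)

lemma vectorSection_eq (v : E) :
    vectorSection q v = q.app ⊤ (pullSec (U := ⊤) f (vecSec k v)) := rfl

lemma vectorSection_add (v w : E) :
    vectorSection q (v + w) = vectorSection q v + vectorSection q w := by
  rw [vectorSection_eq, vecSec_add, pullSec_add]
  exact map_add (q.app ⊤).hom _ _

lemma vectorSection_smul (a : k) (v : E) :
    vectorSection q (a • v) = constFun f ⊤ a • vectorSection q v := by
  rw [vectorSection_eq, vecSec_smul, pullSec_smul]
  refine (Hom.app_smul q _ _).trans ?_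
  rw [constFun, RingHom.comp_apply, RingHom.comp_apply, resF_self]
  rfl

lemma vectorSection_sum {κ : Type*} (s : Finset κ) (v : κ → E) :
    vectorSection q (∑ i ∈ s, v i) = ∑ i ∈ s, vectorSection q (v i) :=
  map_sum (AddMonoidHom.mk' (vectorSection q) (vectorSection_add q)) v s

lemma isBasisOn_pullSec_vecSec (f : T ⟶ Spec (CommRingCat.of k)) (b : Module.Basis ι k E) :
    IsBasisOn ((Scheme.Modules.pullback f).obj (vectorSheaf k E)) ⊤
      (fun i => pullSec (U := ⊤) f (vecSec k (b i))) :=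
  (isBasisOn_vecSec k b).pullSec f

lemma vectorSection_pullbackQuotient {P : Scheme.{u}} {π : P ⟶ Spec (CommRingCat.of k)}
    {L : P.Modules} (q : (Scheme.Modules.pullback π).obj (vectorSheaf k E) ⟶ L) (g : T ⟶ P)
    (v : E) : vectorSection (pullbackQuotient q g) v = pullSec (U := ⊤) g (vectorSection q v) := by
  have h := pullSec_comp (U := ⊤) g π (vecSec k v)
  replace h := (congrArg (((pullbackComp g π).inv.app (vectorSheaf k E)).app ⊤)
    (resM_self le_rfl _).symm).trans h
  refine (congrArg (((Scheme.Modules.pullback g).map q).app ⊤) h).trans ?_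
  exact pullback_map_pullSec (U := ⊤) g q _

end vectorSection

end AlgebraicGeometry

namespace AlgebraicGeometry.Scheme.Modules
universe u
variable {X Y : Scheme.{u}} {L : X.Modules} {U V : X.Opens}

/-! ### Non-vanishing loci -/

lemma _root_.AlgebraicGeometry.isUnit_resF_basicOpen (c : Γ(X, U)) (h : V ≤ X.basicOpen c)
    (h' : V ≤ U) : IsUnit (resF h' c) := by
  have := (RingedSpace.isUnit_res_basicOpen X.toLocallyRingedSpace.toRingedSpace c).map (resF h)
  convert this using 1
  exact (resF_resF (X.basicOpen_le c) h c).symm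

lemma _root_.AlgebraicGeometry.mem_basicOpen_of_isUnit (c : Γ(X, U)) (h' : V ≤ U)
    (h : IsUnit (resF h' c)) {x : X} (hx : x ∈ V) : x ∈ X.basicOpen c := by
  have h1 : X.basicOpen (resF h' c) = V ⊓ X.basicOpen c := X.basicOpen_res c (homOfLE h').op
  have h2 : X.basicOpen (resF h' c) = V := X.basicOpen_of_isUnit h
  have : x ∈ V ⊓ X.basicOpen c := by rw [← h1, h2]; exact hx
  exact this.2

/-- The open subset where a section of a line bundle does not vanish. -/
noncomputable def nonvan (s : Γ(L, ⊤)) : X.Opens :=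
  sSup {U | IsGenOn L U (resM L le_top s)}

lemma isGenOn_nonvan (s : Γ(L, ⊤)) : IsGenOn L (nonvan s) (resM L le_top s) := by
  refine IsBasisOn.of_cover fun x hx => ?_
  obtain ⟨U, hU, hxU⟩ := TopologicalSpace.Opens.mem_sSup.mp hx
  have hle : U ≤ nonvan s := le_sSup hU
  refine ⟨U, hxU, hle, ?_⟩
  simp only [resM_resM]
  exact hU

lemma le_nonvan_iff {s : Γ(L, ⊤)} : U ≤ nonvan s ↔ IsGenOn L U (resM L le_top s) := by
  refine ⟨fun h => ?_, fun h => le_sSup h⟩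
  have := IsBasisOn.mono (isGenOn_nonvan s) h
  simp only [resM_resM] at this
  exact this

lemma nonvan_iso {N : X.Modules} (s : Γ(L, ⊤)) (e : L ⟶ N) [IsIso e] :
    nonvan (e.app ⊤ s) = nonvan s := by
  have key : ∀ {L N : X.Modules} (s : Γ(L, ⊤)) (e : L ⟶ N) [IsIso e],
      nonvan s ≤ nonvan (e.app ⊤ s) := by
    intro L N s e _
    rw [le_nonvan_iff, ← resM_app]
    exact (isGenOn_nonvan s).of_iso e
  refine le_antisymm ((key (e.app ⊤ s) (inv e)).trans_eq ?_) (key s e)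
  rw [← comp_app_apply, IsIso.hom_inv_id, id_app_apply]

lemma mem_nonvan_iff {s : Γ(L, ⊤)} {μ : Γ(L, U)} (hμ : IsGenOn L U μ) {c : Γ(X, U)}
    (hc : resM L le_top s = c • μ) {x : X} (hx : x ∈ U) : x ∈ nonvan s ↔ x ∈ X.basicOpen c := by
  constructor
  · intro h
    have h1 : IsGenOn L (nonvan s ⊓ U) (resM L le_top s) := le_nonvan_iff.mp inf_le_left
    have h2 : IsGenOn L (nonvan s ⊓ U) (resM L inf_le_right μ) := IsBasisOn.mono hμ inf_le_right
    have h3 : resM L (le_top : nonvan s ⊓ U ≤ ⊤) s =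
        resF (inf_le_right : nonvan s ⊓ U ≤ U) c • resM L (inf_le_right : nonvan s ⊓ U ≤ U) μ := by
      rw [← resM_smul, ← hc, resM_resM]
    rw [h3] at h1
    exact mem_basicOpen_of_isUnit c inf_le_right (h2.isUnit h1) ⟨h, hx⟩
  · intro h
    have hle := X.basicOpen_le c
    have h3 : resM L (le_top : X.basicOpen c ≤ ⊤) s = resF hle c • resM L hle μ := by
      rw [← resM_smul, ← hc, resM_resM]
    have : IsGenOn L (X.basicOpen c) (resM L le_top s) := by
      rw [h3]
      exact IsGenOn.smul_of_isUnit (IsBasisOn.mono hμ hle) (isUnit_resF_basicOpen c le_rfl hle)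
    exact le_nonvan_iff.mpr this h

/-- The pullback of a global section. -/
noncomputable def pullTop (g : Y ⟶ X) (s : Γ(L, ⊤)) : Γ((pullback g).obj L, ⊤) :=
  pullSec (U := ⊤) g s

lemma resM_pullTop (g : Y ⟶ X) (s : Γ(L, ⊤)) (h : g ⁻¹ᵁ U ≤ ⊤) :
    resM _ h (pullTop g s) = pullSec g (resM L le_top s) :=
  (pullSec_resM g (le_top : U ≤ ⊤) s).symm

/-- Locally the section is a function times a generator, so that the assertion reduces to the one
for functions. -/
lemma nonvan_pullTop (hL : IsLineBundle L) (g : Y ⟶ X) (s : Γ(L, ⊤)) :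
    nonvan (pullTop g s) = g ⁻¹ᵁ nonvan s := by
  ext y
  obtain ⟨U, hx, μ, hμ⟩ := isLineBundle_iff.mp hL (g y)
  obtain ⟨c, hc⟩ := hμ.exists_eq_smul_self (resM L le_top s)
  have h1 := mem_nonvan_iff hμ hc hx
  have hc' : resM _ le_top (pullTop g s) = g.app U c • pullSec g μ := by
    rw [resM_pullTop, hc, pullSec_smul]
  have h2 := mem_nonvan_iff (hμ.pullSec g) hc' hx
  rw [← Scheme.preimage_basicOpen] at h2
  exact h2.trans h1.symm

end AlgebraicGeometry.Scheme.Modules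

namespace AlgebraicGeometry

universe u

open Scheme.Modules

variable {k : Type u} [Field k] {E : Type u} [AddCommGroup E] [Module k E]
  {P : ProjectiveBundle (vectorSheaf k E)} {T T' : Scheme.{u}} {ι : Type*}

/-! ### Homogeneous coordinates -/

namespace ProjectiveBundle

/-- The pullback along `g : T ⟶ ℙ(E)` of the section of `𝒪(1)` given by a vector. -/
noncomputable def vec (g : T ⟶ P.space) (v : E) : Γ((Scheme.Modules.pullback g).obj P.O1, ⊤) :=
  pullTop g (vectorSection P.quot v)

lemma vec_eq (g : T ⟶ P.space) (v : E) :
    vec g v = vectorSection (pullbackQuotient P.quot g) v :=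
  (vectorSection_pullbackQuotient P.quot g v).symm

lemma vec_comp (h : T' ⟶ T) (g : T ⟶ P.space) (v : E) :
    ((pullbackComp h g).hom.app P.O1).app ⊤ (pullTop h (vec g v)) = vec (h ≫ g) v :=
  (pullSec_comp' (U := ⊤) h g _).trans (resM_self le_rfl _)

lemma isLineBundle_pullback (g : T ⟶ P.space) :
    IsLineBundle ((Scheme.Modules.pullback g).obj P.O1) :=
  P.isProjectiveBundle.isLineBundle.pullback g

instance (g : T ⟶ P.space) : Epi (pullbackQuotient P.quot g) := by
  have := P.isProjectiveBundle.epi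
  unfold pullbackQuotient
  infer_instance

/-- Over `U`, the morphism `g : T ⟶ ℙ(E)` is given by the homogeneous coordinates `c` with respect
to the basis `b` of `E`. -/
def HasCoordsOn (g : T ⟶ P.space) (U : T.Opens) (b : Module.Basis ι k E) (c : ι → Γ(T, U)) : Prop :=
  ∃ μ : Γ((Scheme.Modules.pullback g).obj P.O1, U),
    IsGenOn _ U μ ∧ ∀ i, resM _ le_top (vec g (b i)) = c i • μ

lemma resM_vec [Fintype ι] {g : T ⟶ P.space} {U : T.Opens} {b : Module.Basis ι k E} {c : ι → Γ(T, U)}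
    {μ : Γ((Scheme.Modules.pullback g).obj P.O1, U)}
    (hμ : ∀ i, resM _ le_top (vec g (b i)) = c i • μ) (v : E) :
    resM _ le_top (vec g v) = (∑ i, constFun (g ≫ P.π) U (b.repr v i) * c i) • μ := by
  conv_lhs => rw [← b.sum_repr v, vec_eq, vectorSection_sum, map_sum]
  rw [Finset.sum_smul]
  refine Finset.sum_congr rfl fun i _ => ?_
  rw [vectorSection_smul, resM_smul, resF_constFun, ← vec_eq, hμ, smul_smul]

/-- Over the open subset where the section given by `b j` does not vanish, there are coordinates
whose `j`-th member is `1`. -/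
lemma exists_hasCoordsOn_nonvan (g : T ⟶ P.space) (b : Module.Basis ι k E) (j : ι) {U : T.Opens}
    (hU : U ≤ nonvan (vec g (b j))) : ∃ c : ι → Γ(T, U), c j = 1 ∧ HasCoordsOn g U b c := by
  have hμ := le_nonvan_iff.mp hU
  choose c hc using fun i => hμ.exists_eq_smul_self (resM _ le_top (vec g (b i)))
  exact ⟨c, hμ.smul_injective_self (by rw [one_smul, ← hc]), _, hμ, hc⟩

lemma nonvan_vec_comp (h : T' ⟶ T) (g : T ⟶ P.space) (v : E) :
    nonvan (vec (h ≫ g) v) = h ⁻¹ᵁ nonvan (vec g v) := by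
  rw [← nonvan_pullTop (isLineBundle_pullback g), ← vec_comp, nonvan_iso]

namespace HasCoordsOn

variable {g g' : T ⟶ P.space} {U V : T.Opens} {b : Module.Basis ι k E} {c c' : ι → Γ(T, U)}

lemma mono (H : HasCoordsOn g U b c) (h : V ≤ U) : HasCoordsOn g V b (fun i => resF h (c i)) := by
  obtain ⟨μ, h1, h2⟩ := H
  refine ⟨resM _ h μ, IsBasisOn.mono h1 h, fun i => ?_⟩
  rw [← resM_smul, ← h2, resM_resM]

lemma mem_nonvan_iff (H : HasCoordsOn g U b c) {x : T} (hx : x ∈ U) (i : ι) :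
    x ∈ nonvan (vec g (b i)) ↔ x ∈ T.basicOpen (c i) := by
  obtain ⟨μ, h1, h2⟩ := H
  exact Scheme.Modules.mem_nonvan_iff h1 (h2 i) hx

lemma le_nonvan (H : HasCoordsOn g U b c) {i : ι} (hi : IsUnit (c i)) :
    U ≤ nonvan (vec g (b i)) := by
  obtain ⟨μ, h1, h2⟩ := H
  rw [le_nonvan_iff, h2]
  exact h1.smul_of_isUnit hi

lemma smul (H : HasCoordsOn g U b c) (w : Γ(T, U)) (hw : IsUnit w) (h : ∀ i, c' i = w * c i) :
    HasCoordsOn g U b c' := by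
  obtain ⟨μ, h1, h2⟩ := H
  obtain ⟨w, rfl⟩ := hw
  refine ⟨(w⁻¹.val : Γ(T, U)) • μ, h1.smul_of_isUnit w⁻¹.isUnit, fun i => ?_⟩
  rw [h2, h, smul_smul]
  congr 1
  rw [mul_right_comm, Units.mul_inv, one_mul]

lemma exists_unit (H : HasCoordsOn g U b c) (H' : HasCoordsOn g U b c') :
    ∃ w : Γ(T, U), IsUnit w ∧ ∀ i, c' i = w * c i := by
  obtain ⟨μ, h1, h2⟩ := H
  obtain ⟨μ', h1', h2'⟩ := H'
  obtain ⟨w, rfl⟩ := h1'.exists_eq_smul_self μ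
  refine ⟨w, h1'.isUnit h1, fun i => h1'.smul_injective_self ?_⟩
  rw [← h2', h2, smul_smul, mul_comm]

lemma comp (H : HasCoordsOn g U b c) (h : T' ⟶ T) :
    HasCoordsOn (h ≫ g) (h ⁻¹ᵁ U) b (fun i => h.app U (c i)) := by
  obtain ⟨μ, h1, h2⟩ := H
  refine ⟨((pullbackComp h g).hom.app P.O1).app (h ⁻¹ᵁ U) (pullSec h μ),
    (h1.pullSec h).of_iso ((pullbackComp h g).hom.app P.O1), fun i => ?_⟩
  rw [← Hom.app_smul, ← pullSec_smul, ← h2, ← resM_pullTop (U := U) h _ le_top, ← vec_comp]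
  exact (resM_app ((pullbackComp h g).hom.app P.O1) le_top _).symm

/-- The homogeneous coordinates have no common zero. -/
lemma exists_mem_basicOpen [Fintype ι] (H : HasCoordsOn g U b c) {x : T} (hx : x ∈ U) :
    ∃ i, x ∈ T.basicOpen (c i) := by
  by_contra! hc
  -- If all coordinates vanish at `x`, the pullback of the tautological quotient to the residue
  -- field is both zero and an epimorphism onto a line bundle.
  let h := T.fromSpecResidueField x
  have hU : h ⁻¹ᵁ U = ⊤ := by
    ext y
    simpa [h, T.fromSpecResidueField_apply] using hx
  have h0 : ∀ i, h.app U (c i) = 0 := by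
    intro i
    rw [← basicOpen_eq_bot_iff, ← Scheme.preimage_basicOpen]
    ext y
    have : h y = x := T.fromSpecResidueField_apply x y
    change h y ∈ T.basicOpen (c i) ↔ False
    rw [this]
    exact iff_of_false (hc i) id
  obtain ⟨μ, h1, h2⟩ := (H.comp h).mono hU.ge
  have h3 : ∀ i, vec (h ≫ g) (b i) = 0 := by
    intro i
    rw [← resM_self le_rfl (vec (h ≫ g) (b i)), h2]
    beta_reduce
    rw [h0, map_zero, zero_smul]
  have h4 : pullbackQuotient P.quot (h ≫ g) = 0 := by
    refine (isBasisOn_pullSec_vecSec (h ≫ g ≫ P.π) b).hom_ext fun i => ?_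
    exact (vec_eq (h ≫ g) (b i)).symm.trans (h3 i)
  have h5 : 𝟙 ((Scheme.Modules.pullback (h ≫ g)).obj P.O1) = 0 := by
    rw [← cancel_epi (pullbackQuotient P.quot (h ≫ g)), h4, Limits.zero_comp, Limits.zero_comp]
  have h6 : μ = 0 := by
    rw [← id_app_apply μ, h5]
    rfl
  have h7 : (1 : Γ(Spec (T.residueField x), ⊤)) = 0 :=
    h1.smul_injective_self (by rw [h6, smul_zero, smul_zero])
  exact one_ne_zero h7

end HasCoordsOn

/-- Two morphisms with the same homogeneous coordinates are equal: the pullbacks of the tautological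
quotient have the same kernel, hence they are isomorphic quotients. -/
lemma hom_ext [Fintype ι] {g g' : T ⟶ P.space} (b : Module.Basis ι k E) (h : g ≫ P.π = g' ≫ P.π)
    (H : ∀ x : T, ∃ (U : T.Opens) (c : ι → Γ(T, U)), x ∈ U ∧ HasCoordsOn g U b c ∧
      HasCoordsOn g' U b c) : g = g' := by
  let r := (pullbackCongr h.symm).hom.app (vectorSheaf k E) ≫ pullbackQuotient P.quot g
  have hr : ∀ v, vectorSection r v = vec g v := by
    intro v
    rw [vec_eq]
    refine congrArg ((pullbackQuotient P.quot g).app ⊤) ?_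
    exact (pullSec_congr (U := ⊤) h.symm _).trans (resM_self le_rfl _)
  have : Epi r := inferInstance
  obtain ⟨e, he⟩ := exists_iso_of_same_kernel (pullbackQuotient P.quot g') r (by
    intro x
    obtain ⟨U, c, hx, ⟨μ, h1, h2⟩, μ', h1', h2'⟩ := H x
    -- The kernel of a quotient is given by the linear relations between the coordinates.
    have key : ∀ {L : T.Modules} (q : (Scheme.Modules.pullback (g' ≫ P.π)).obj (vectorSheaf k E) ⟶ L)
        (μ : Γ(L, U)) (h1 : IsGenOn L U μ)
        (h2 : ∀ i, resM L le_top (vectorSection q (b i)) = c i • μ) (V : T.Opens) (hV : V ≤ U)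
        (d : ι → Γ(T, V)), q.app V (∑ i, d i • resM _ le_top
          (pullSec (U := ⊤) (g' ≫ P.π) (vecSec k (b i)))) = 0 ↔ ∑ i, d i * resF hV (c i) = 0 := by
      intro L q μ h1 h2 V hV d
      have : q.app V (∑ i, d i • resM _ le_top
          (pullSec (U := ⊤) (g' ≫ P.π) (vecSec k (b i)))) =
          (∑ i, d i * resF hV (c i)) • resM L hV μ := by
        rw [map_sum, Finset.sum_smul]
        refine Finset.sum_congr rfl fun i _ => ?_
        rw [Hom.app_smul, mul_smul, ← resM_smul, ← h2, resM_resM]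
        exact congrArg _ (resM_app q le_top _)
      rw [this]
      refine ⟨fun e => h1.smul_injective hV (e.trans (zero_smul _ _).symm), fun e => ?_⟩
      rw [e, zero_smul]
    refine ⟨U, hx, fun V hV s => ?_⟩
    obtain ⟨d, rfl⟩ := (isBasisOn_pullSec_vecSec (g' ≫ P.π) b).exists_eq le_top s
    exact (key _ μ' h1' (by simpa only [← vec_eq] using h2') V hV d).trans
      (key r μ h1 (by simpa only [hr] using h2) V hV d).symm)
  obtain ⟨g₀, -, hu⟩ := P.isProjectiveBundle.existsUnique T (g' ≫ P.π)
    ((Scheme.Modules.pullback g).obj P.O1) r (isLineBundle_pullback g) this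
  rw [hu g ⟨h, Iso.refl _, by simp [r, pullbackCongr]⟩, hu g' ⟨rfl, e, by rw [he]; simp [pullbackCongr]⟩]

/-- Locally, a morphism to a projective space has homogeneous coordinates, one of which is `1`. -/
lemma exists_hasCoordsOn [Fintype ι] (g : T ⟶ P.space) (b : Module.Basis ι k E) (x : T) :
    ∃ (U : T.Opens) (c : ι → Γ(T, U)) (j : ι), x ∈ U ∧ c j = 1 ∧ HasCoordsOn g U b c := by
  obtain ⟨U, hx, μ, hμ⟩ := isLineBundle_iff.mp (isLineBundle_pullback g) x
  choose c hc using fun i => hμ.exists_eq_smul_self (resM _ le_top (vec g (b i)))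
  have H : HasCoordsOn g U b c := ⟨μ, hμ, hc⟩
  obtain ⟨j, hj⟩ := H.exists_mem_basicOpen hx
  have hle := T.basicOpen_le (c j)
  obtain ⟨w, hw⟩ := isUnit_resF_basicOpen (c j) le_rfl hle
  refine ⟨T.basicOpen (c j), fun i => w⁻¹.val * resF hle (c i), j, hj, ?_,
    (H.mono hle).smul w⁻¹.val w⁻¹.isUnit fun i => rfl⟩
  beta_reduce
  rw [← hw, Units.inv_mul]

/-- Functions of which one is a unit are the homogeneous coordinates of a morphism, because they
define a surjection onto the structure sheaf. -/
lemma exists_of_coords [Fintype ι] (f : T ⟶ Spec (CommRingCat.of k)) (b : Module.Basis ι k E)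
    (c : ι → Γ(T, ⊤)) (j : ι) (hc : IsUnit (c j)) :
    ∃ g : T ⟶ P.space, g ≫ P.π = f ∧ HasCoordsOn g ⊤ b c := by
  classical
  obtain ⟨r, hr⟩ := (isBasisOn_pullSec_vecSec f b).exists_hom (fun i => unitSec ⊤ (c i))
  have : Epi r := by
    refine epi_of_locally_surjective r fun x => ⟨⊤, trivial, fun V _ m => ?_⟩
    obtain ⟨w, hw⟩ := hc
    refine ⟨((unitSec V).symm m * resF le_top w⁻¹.val) •
      resM _ le_top (pullSec (U := ⊤) f (vecSec k (b j))), ?_⟩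
    rw [Hom.app_smul]
    refine (congrArg _ (resM_app r le_top _)).trans ?_
    rw [hr, resM_unitSec, ← _root_.map_smul, smul_eq_mul, ← hw, mul_assoc, ← map_mul,
      Units.inv_mul, map_one, mul_one, LinearEquiv.apply_symm_apply]
  obtain ⟨g, ⟨rfl, e, he⟩, -⟩ := P.isProjectiveBundle.existsUnique T f _ r
    isLineBundle_structureSheaf this
  refine ⟨g, rfl, e.inv.app ⊤ (unitSec ⊤ 1), (isBasisOn_structureSheaf ⊤).of_iso e.inv, fun i => ?_⟩
  rw [resM_self, ← Hom.app_smul, ← _root_.map_smul, smul_eq_mul, mul_one, ← hr, vec_eq]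
  have he' : pullbackQuotient P.quot g = r ≫ e.inv := by
    rw [← cancel_mono e.hom, he]
    simp [pullbackCongr]
  rw [he']
  rfl

end ProjectiveBundle

end AlgebraicGeometry

namespace AlgebraicGeometry
universe u
open Scheme.Modules

/-! ### Double covers generated by one function -/

namespace IsGenerator

section

variable {A B : Type*} [CommRing A] [CommRing B] {f : A →+* B} {x : B}

lemma exists_eq (h : IsGenerator f x) (y : B) : ∃ a b, y = f a + f b * x := by
  obtain ⟨c, hc⟩ := h.2 y
  exact ⟨c 0, c 1, hc.symm⟩

lemma ext (h : IsGenerator f x) {a b a' b' : A} (e : f a + f b * x = f a' + f b' * x) :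
    a = a' ∧ b = b' := by
  have := h.1 (a₁ := ![a, b]) (a₂ := ![a', b']) e
  exact ⟨congrFun this 0, congrFun this 1⟩

lemma exists_basis [Algebra A B] (h : IsGenerator (algebraMap A B) x) :
    ∃ b : Module.Basis (Fin 2) A B, b 0 = 1 ∧ b 1 = x := by
  have hb : Function.Bijective (Fintype.linearCombination A ![(1 : B), x]) := by
    refine (congrArg Function.Bijective (funext fun c => ?_)).mpr h
    simp [Fintype.linearCombination_apply, Algebra.smul_def]
  let e := LinearEquiv.ofBijective _ hb
  refine ⟨Module.Basis.ofEquivFun e.symm, ?_, ?_⟩ <;>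
  simp [e, Module.Basis.ofEquivFun, Fintype.linearCombination_apply, Pi.single_apply]

lemma of_basis [Algebra A B] (b : Module.Basis (Fin 2) A B) (h0 : b 0 = 1) (h1 : b 1 = x) :
    IsGenerator (algebraMap A B) x := by
  refine (congrArg Function.Bijective (funext fun c => ?_)).mpr b.equivFun.symm.bijective
  simp [Module.Basis.equivFun_symm_apply, h0, h1, Algebra.smul_def]

end

lemma of_isPushout {A B A' B' : CommRingCat.{u}} {f : A ⟶ B} {g : A ⟶ A'} {h : B ⟶ B'}
    {i : A' ⟶ B'} (H : IsPushout f g h i) {x : B} (hx : IsGenerator f.hom x) :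
    IsGenerator i.hom (h.hom x) := by
  algebraize [f.hom, g.hom, h.hom, i.hom, (f ≫ h).hom]
  have : IsScalarTower A B B' := .of_algebraMap_eq' rfl
  have : IsScalarTower A A' B' := .of_algebraMap_eq' congr(($H.w).hom)
  have hp : Algebra.IsPushout A A' B B' := CommRingCat.isPushout_iff_isPushout.mp H.flip
  obtain ⟨b, h0, h1⟩ := exists_basis (A := A) (B := B) hx
  refine of_basis (A := A') (B := B') (hp.out.basis b) ?_ ?_
  · rw [IsBaseChange.basis_apply, h0]
    exact map_one h.hom
  · rw [IsBaseChange.basis_apply, h1]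
    rfl

end IsGenerator

lemma app_eq_appLE' {X Y : Scheme.{u}} (f : X ⟶ Y) (U : Y.Opens) :
    f.app U = f.appLE U (f ⁻¹ᵁ U) le_rfl := (Scheme.Hom.appLE_eq_app f).symm

section

variable {T T' W W' : Scheme.{u}} {w : W' ⟶ W} {p' : W' ⟶ T'} {p : W ⟶ T} {g : T' ⟶ T}

lemma isPushout_appLE (H : IsPullback w p' p g) [IsAffineHom p] {V : T.Opens} {V' : T'.Opens}
    (hV : IsAffineOpen V) (hV' : IsAffineOpen V') (e : V' ≤ g ⁻¹ᵁ V)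
    (e' : p' ⁻¹ᵁ V' ≤ w ⁻¹ᵁ p ⁻¹ᵁ V) :
    IsPushout (p.app V) (g.appLE V V' e) (w.appLE (p ⁻¹ᵁ V) (p' ⁻¹ᵁ V') e') (p'.app V') := by
  have h : p' ⁻¹ᵁ V' = w ⁻¹ᵁ p ⁻¹ᵁ V ⊓ p' ⁻¹ᵁ V' := (inf_eq_right.mpr e').symm
  have h1 := Scheme.Hom.isPullback_resLE H e le_rfl h
  have : IsAffine V.toScheme := hV
  have : IsAffine V'.toScheme := hV'
  have : IsAffine (p ⁻¹ᵁ V).toScheme := hV.preimage p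
  have h2 := isPushout_appTop_of_isPullback h1
  refine h2.of_iso V.topIso (p ⁻¹ᵁ V).topIso V'.topIso (p' ⁻¹ᵁ V').topIso ?_ ?_ ?_ ?_
  all_goals
    rw [Scheme.Hom.appTop, Scheme.Hom.resLE_app_top]
    simp only [Category.assoc, Iso.inv_hom_id, Category.comp_id, app_eq_appLE']

lemma IsGeneratorOn.of_locally {U : T.Opens} {x : Γ(W, p ⁻¹ᵁ U)}
    (H : ∀ V : T.Opens, V ≤ U → ∀ y ∈ V, ∃ (V' : T.Opens) (_ : y ∈ V') (_ : V' ≤ V) (h : V' ≤ U),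
      IsGenerator (p.app V').hom (resF (p.preimage_mono h) x)) : IsGeneratorOn p U x := by
  have key : ∀ (V : T.Opens) (h : V ≤ U), IsGenerator (p.app V).hom (resF (p.preimage_mono h) x) ↔
      Function.Bijective (fun c : Fin 2 → Γ(T, V) => ∑ i, c i •
        resM ((pushforward p).obj (structureSheaf W)) h
          (unitSec (p ⁻¹ᵁ U) (x ^ (i : ℕ)))) := by
    intro V h
    refine iff_of_eq (congrArg Function.Bijective (funext fun c => ?_))
    rw [Fin.sum_univ_two]
    change _ = p.app V (c 0) * resF (p.preimage_mono h) (x ^ 0) +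
      p.app V (c 1) * resF (p.preimage_mono h) (x ^ 1)
    simp
  have h2 : IsBasisOn ((pushforward p).obj (structureSheaf W)) U
      (fun i : Fin 2 => (unitSec (p ⁻¹ᵁ U) (x ^ (i : ℕ)) :)) := by
    refine IsBasisOn.of_locally fun V hV y hy => ?_
    obtain ⟨V', h1, h2, h3, h4⟩ := H V hV y hy
    exact ⟨V', h1, h2, h3, (key V' h3).mp h4⟩
  exact fun V h => (key V h).mpr (h2 V h)

/-- For an affine morphism, generation can be checked on global sections over an affine open. -/
lemma isGeneratorOn_of_isAffineOpen [IsAffineHom p] {U : T.Opens} (hU : IsAffineOpen U)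
    {x : Γ(W, p ⁻¹ᵁ U)} (hx : IsGenerator (p.app U).hom x) : IsGeneratorOn p U x := by
  refine IsGeneratorOn.of_locally fun V hV y hy => ?_
  obtain ⟨_, ⟨V', hV', rfl⟩, hyV', hle⟩ := T.isBasis_affineOpens.exists_subset_of_mem_open hy V.2
  have h : V' ≤ U := le_trans hle hV
  refine ⟨V', hyV', hle, h, ?_⟩
  have H : IsPullback (𝟙 W) p p (𝟙 T) := IsPullback.of_horiz_isIso ⟨by simp⟩
  have h2 := hx.of_isPushout (isPushout_appLE H hU hV' h (p.preimage_mono h))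
  have h3 : (𝟙 W : W ⟶ W).appLE (p ⁻¹ᵁ U) (p ⁻¹ᵁ V') (p.preimage_mono h) x =
      resF (p.preimage_mono h) x := rfl
  rwa [← h3]

lemma preimage_le_of_comm (H : w ≫ p = p' ≫ g) (U : T.Opens) :
    p' ⁻¹ᵁ g ⁻¹ᵁ U ≤ w ⁻¹ᵁ p ⁻¹ᵁ U := by
  rw [← Scheme.Hom.comp_preimage, ← Scheme.Hom.comp_preimage, H]

lemma resF_appLE {X Y : Scheme.{u}} (f : X ⟶ Y) {U U' : Y.Opens} {V V' : X.Opens}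
    (e : V ≤ f ⁻¹ᵁ U) (h : V' ≤ V) (h' : U' ≤ U) (e' : V' ≤ f ⁻¹ᵁ U') (x : Γ(Y, U)) :
    resF h (f.appLE U V e x) = f.appLE U' V' e' (resF h' x) := by
  have h1 := congr($(f.appLE_map e (homOfLE h).op) x)
  have h2 := congr($(f.map_appLE e' (homOfLE h').op) x)
  exact h1.trans h2.symm

lemma IsGeneratorOn.of_isPullback (H : IsPullback w p' p g) [IsAffineHom p] {U : T.Opens}
    {x : Γ(W, p ⁻¹ᵁ U)} (hx : IsGeneratorOn p U x) :
    IsGeneratorOn p' (g ⁻¹ᵁ U) (w.appLE _ _ (preimage_le_of_comm H.w U) x) := by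
  refine IsGeneratorOn.of_locally fun V hV y hy => ?_
  obtain ⟨_, ⟨V₀, hV₀, rfl⟩, hyV₀, hle₀⟩ :=
    T.isBasis_affineOpens.exists_subset_of_mem_open (hV hy) U.2
  obtain ⟨_, ⟨V', hV', rfl⟩, hyV', hle⟩ := T'.isBasis_affineOpens.exists_subset_of_mem_open
    (show y ∈ V ⊓ g ⁻¹ᵁ V₀ from ⟨hy, hyV₀⟩) (V ⊓ g ⁻¹ᵁ V₀).2
  have hle1 : V' ≤ V := le_trans hle inf_le_left
  have hle2 : V' ≤ g ⁻¹ᵁ V₀ := le_trans hle inf_le_right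
  refine ⟨V', hyV', hle1, hle1.trans hV, ?_⟩
  have e' : p' ⁻¹ᵁ V' ≤ w ⁻¹ᵁ p ⁻¹ᵁ V₀ :=
    (p'.preimage_mono hle2).trans (preimage_le_of_comm H.w V₀)
  have h2 := (hx V₀ hle₀).of_isPushout (isPushout_appLE H hV₀ hV' hle2 e')
  rw [resF_appLE w _ _ (p.preimage_mono hle₀) e']
  exact h2

end

/-! ### Charts of families of pairs of points -/

variable {k : Type u} [Field k] {E : Type u} [AddCommGroup E] [Module k E]
  {P : ProjectiveBundle (vectorSheaf k E)}

open ProjectiveBundle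

/-- The restriction to `U` of the family of pairs of points given by `a : W ⟶ ℙ(E)` and
`p : W ⟶ T` is described by the functions `α, β, σ, τ` on `U`: it is given by the points with
coordinates `(1, x, α + β x)` where `x² = σ x + τ`, and `1` and `x` form a basis of its functions. -/
structure IsChartOn {T W : Scheme.{u}} (a : W ⟶ P.space) (p : W ⟶ T)
    (b : Module.Basis (Fin 3) k E) (U : T.Opens) (α β σ τ : Γ(T, U)) (x : Γ(W, p ⁻¹ᵁ U)) :
    Prop where
  coords : HasCoordsOn a (p ⁻¹ᵁ U) b ![1, x, p.app U α + p.app U β * x]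
  gen : IsGeneratorOn p U x
  sq : x * x = p.app U σ * x + p.app U τ

namespace IsChartOn

variable {T T' W W' : Scheme.{u}} {a : W ⟶ P.space} {p : W ⟶ T} {b : Module.Basis (Fin 3) k E}
  {U V : T.Opens} {α β σ τ α' β' σ' τ' : Γ(T, U)} {x x' : Γ(W, p ⁻¹ᵁ U)}

lemma mono (H : IsChartOn a p b U α β σ τ x) (h : V ≤ U) : IsChartOn a p b V (resF h α) (resF h β)
    (resF h σ) (resF h τ) (resF (p.preimage_mono h) x) where
  coords := by
    convert H.coords.mono (p.preimage_mono h) using 1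
    ext i
    fin_cases i
    · simp
    · simp
    · simp [app_resF]
  gen := H.gen.mono h
  sq := by
    rw [app_resF, app_resF, ← map_mul, ← map_mul, ← map_add, H.sq]

/-- In a given basis, a family has at most one chart, because `1` and `x` are linearly independent
over the functions on the base. -/
lemma unique (H : IsChartOn a p b U α β σ τ x) (H' : IsChartOn a p b U α' β' σ' τ' x') :
    α = α' ∧ β = β' ∧ σ = σ' ∧ τ = τ' ∧ x = x' := by
  obtain ⟨w, -, hw⟩ := H.coords.exists_unit H'.coords
  have h0 : (1 : Γ(W, p ⁻¹ᵁ U)) = w * 1 := hw 0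
  have h1 : x' = w * x := hw 1
  have h2 : p.app U α' + p.app U β' * x' = w * (p.app U α + p.app U β * x) := hw 2
  rw [mul_one] at h0
  subst h0
  rw [one_mul] at h1 h2
  subst h1
  have hg := H.gen U le_rfl
  rw [resF_self] at hg
  obtain ⟨h3, h4⟩ := hg.ext h2
  have h5 := H.sq.symm.trans H'.sq
  rw [add_comm, add_comm (p.app U σ' * x')] at h5
  obtain ⟨h6, h7⟩ := hg.ext h5
  exact ⟨h3.symm, h4.symm, h7, h6, rfl⟩

lemma of_isPullback {w : W' ⟶ W} {p' : W' ⟶ T'} {g : T' ⟶ T} [IsAffineHom p]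
    (H : IsChartOn a p b U α β σ τ x) (h : IsPullback w p' p g) :
    IsChartOn (w ≫ a) p' b (g ⁻¹ᵁ U) (g.app U α) (g.app U β) (g.app U σ) (g.app U τ)
      (w.appLE _ _ (preimage_le_of_comm h.w U) x) := by
  have key : ∀ r : Γ(T, U), p'.app (g ⁻¹ᵁ U) (g.app U r) =
      w.appLE _ _ (preimage_le_of_comm h.w U) (p.app U r) := by
    exact fun r => congr($(Scheme.Hom.congr_app h.w.symm U) r)
  refine ⟨?_, H.gen.of_isPullback h, ?_⟩
  · convert (H.coords.comp w).mono (preimage_le_of_comm h.w U) using 1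
    ext i
    fin_cases i
    · simp
    · rfl
    · change _ = w.appLE _ _ _ (p.app U α + p.app U β * x)
      rw [map_add, map_mul, ← key, ← key]
      rfl
  · rw [key, key, ← map_mul, ← map_mul, ← map_add, H.sq]

end IsChartOn

end AlgebraicGeometry

namespace AlgebraicGeometry
universe u
open Scheme.Modules ProjectiveBundle

variable {k : Type u} [Field k] {E : Type u} [AddCommGroup E] [Module k E]
  {P : ProjectiveBundle (vectorSheaf k E)}

/-! ### The universal family with a chart -/

lemma isIso_of_appTop {X Y : Scheme.{u}} [IsAffine X] [IsAffine Y] (f : X ⟶ Y)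
    (h : Function.Bijective f.appTop) : IsIso f := by
  have : IsIso f.appTop := (ConcreteCategory.isIso_iff_bijective _).mpr h
  have h2 := Scheme.isoSpec_hom_naturality f
  have h3 : f = X.isoSpec.hom ≫ Spec.map f.appTop ≫ Y.isoSpec.inv := by
    rw [← Category.assoc, h2]
    simp
  rw [h3]
  infer_instance

/-- The morphism to the spectrum of a ring given by a homomorphism to the ring of functions. -/
noncomputable def toSpec {T : Scheme.{u}} {R : Type u} [CommRing R] (φ : R →+* Γ(T, ⊤)) :
    T ⟶ Spec (CommRingCat.of R) :=
  T.toSpecΓ ≫ Spec.map (CommRingCat.ofHom φ)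

/-- The functions on the spectrum of a ring. -/
noncomputable def specFun {R : Type u} [CommRing R] : R ≃+* Γ(Spec (CommRingCat.of R), ⊤) :=
  (Scheme.ΓSpecIso (CommRingCat.of R)).symm.commRingCatIsoToRingEquiv

lemma toSpec_appTop {T : Scheme.{u}} {R : Type u} [CommRing R] (φ : R →+* Γ(T, ⊤)) (r : R) :
    (toSpec φ).appTop (specFun r) = φ r := by
  have h : (Scheme.ΓSpecIso (CommRingCat.of R)).inv ≫ (toSpec φ).appTop = CommRingCat.ofHom φ := by
    simp [toSpec]
  exact congr($h r)

lemma spec_hom_ext {T : Scheme.{u}} {R : Type u} [CommRing R] {f g : T ⟶ Spec (CommRingCat.of R)}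
    (h : ∀ r : R, f.appTop (specFun r) = g.appTop (specFun r)) : f = g := by
  refine ext_of_isAffine (CommRingCat.hom_ext (RingHom.ext fun x => ?_))
  obtain ⟨r, rfl⟩ := specFun.surjective x
  exact h r

lemma constFun_top {T : Scheme.{u}} (f : T ⟶ Spec (CommRingCat.of k)) (a : k) :
    constFun f ⊤ a = f.appTop (specFun a) := resF_self le_rfl _

namespace IsChartOn

variable {T T' W W' : Scheme.{u}} {a : W ⟶ P.space} {p : W ⟶ T} {a' : W' ⟶ P.space} {p' : W' ⟶ T'}
  {b : Module.Basis (Fin 3) k E} {α β σ τ : Γ(T, ⊤)} {x : Γ(W, p ⁻¹ᵁ ⊤)} {α' β' σ' τ' : Γ(T', ⊤)}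
  {x' : Γ(W', p' ⁻¹ᵁ ⊤)}

/-- A family with a chart on an affine scheme is the pullback of every other family whose chart is
given by functions that are pulled back to those of the given chart. -/
lemma isPullback [IsAffine T] [IsAffine T'] [IsAffineHom p] [IsAffineHom p']
    (H : IsChartOn a p b ⊤ α β σ τ x) (H' : IsChartOn a' p' b ⊤ α' β' σ' τ' x')
    {t : T ⟶ Spec (CommRingCat.of k)} {t' : T' ⟶ Spec (CommRingCat.of k)}
    (ha : a ≫ P.π = p ≫ t) (ha' : a' ≫ P.π = p' ≫ t') {g : T ⟶ T'} (hg : g ≫ t' = t)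
    (hα : g.appTop α' = α) (hβ : g.appTop β' = β)
    {w : W ⟶ W'} (hw : w ≫ p' = p ≫ g) (hx : w.appTop x' = x) :
    IsPullback w p p' g ∧ w ≫ a' = a := by
  constructor
  · let l : W ⟶ Limits.pullback p' g := Limits.pullback.lift w p hw
    have hQ : IsPullback (Limits.pullback.fst p' g) (Limits.pullback.snd p' g) p' g :=
      IsPullback.of_hasPullback _ _
    have h1 := H'.of_isPullback hQ
    have hA : IsAffine W := isAffine_of_isAffineHom p
    have hA' : IsAffine (Limits.pullback p' g) := isAffine_of_isAffineHom (Limits.pullback.snd p' g)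
    have h3 := H.gen ⊤ le_top
    rw [resF_self] at h3
    have e : resF (X := Limits.pullback p' g) (U := ⊤) (V := ⊤) le_rfl (resF (U := ⊤) (V := ⊤) le_rfl
        ((Limits.pullback.fst p' g).appTop x')) = (Limits.pullback.fst p' g).appTop x' := by
      rw [resF_self, resF_self]
    have h2 : IsGenerator (Limits.pullback.snd p' g).appTop.hom
        ((Limits.pullback.fst p' g).appTop x') :=
      (congrArg (IsGenerator _) e).mp (h1.gen ⊤ le_top)
    have h4 : ∀ c : Γ(T, ⊤), l.appTop ((Limits.pullback.snd p' g).appTop c) = p.appTop c := by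
      intro c
      have : l ≫ Limits.pullback.snd p' g = p := Limits.pullback.lift_snd _ _ _
      conv_rhs => rw [← this]
      rfl
    have h5 : l.appTop ((Limits.pullback.fst p' g).appTop x') = x := by
      have : l ≫ Limits.pullback.fst p' g = w := Limits.pullback.lift_fst _ _ _
      rw [← hx]
      conv_rhs => rw [← this]
      rfl
    have h6 : Function.Bijective (l.appTop ∘ fun c : Fin 2 → Γ(T, ⊤) =>
        (Limits.pullback.snd p' g).appTop (c 0) + (Limits.pullback.snd p' g).appTop (c 1) *
          (Limits.pullback.fst p' g).appTop x') := by
      refine (congrArg Function.Bijective (funext fun c => ?_)).mpr h3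
      change l.appTop (_ + _ * _) = _
      rw [map_add, map_mul, h4, h4, h5]
      rfl
    have h7 : Function.Bijective l.appTop := (Function.Bijective.of_comp_iff _ h2).mp h6
    have := isIso_of_appTop l h7
    exact hQ.of_iso (asIso l).symm (Iso.refl _) (Iso.refl _) (Iso.refl _) 
      (by simpa [l] using (Limits.pullback.lift_fst w p hw))
      (by simpa [l] using (Limits.pullback.lift_snd w p hw)) (by simp) (by simp)
  · refine hom_ext b ?_ fun y => ⟨⊤, _, trivial, ?_, H.coords⟩
    · rw [Category.assoc, ha', ha, ← Category.assoc, hw, Category.assoc, hg]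
    · have key : ∀ r : Γ(T', ⊤), w.appTop (p'.appTop r) = p.appTop (g.appTop r) := fun r =>
        congr($(congrArg Scheme.Hom.appTop hw) r)
      refine (congrArg (HasCoordsOn (w ≫ a') ⊤ b) (funext fun i => ?_)).mp (H'.coords.comp w)
      fin_cases i
      · exact map_one w.appTop.hom
      · exact hx
      · change w.appTop (p'.appTop α' + p'.appTop β' * (show Γ(W', ⊤) from x')) =
          p.appTop α + p.appTop β * (show Γ(W, ⊤) from x)
        rw [map_add, map_mul, key, key, hα, hβ, hx]

end IsChartOn

end AlgebraicGeometry

namespace AlgebraicGeometry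
universe u
open Scheme.Modules ProjectiveBundle

variable {k : Type u} [Field k] {E : Type u} [AddCommGroup E] [Module k E]
  {P : ProjectiveBundle (vectorSheaf k E)} {ι : Type}

/-! ### The standard affine charts of projective space -/

variable (P) in
/-- The open subset of `ℙ(E)` where the coordinate given by `v` does not vanish. -/
noncomputable def ProjectiveBundle.chart (v : E) : P.space.Opens :=
  nonvan (vectorSection P.quot v)

lemma preimage_chart {T : Scheme.{u}} (g : T ⟶ P.space) (v : E) :
    g ⁻¹ᵁ P.chart v = nonvan (vec g v) :=
  (nonvan_pullTop P.isProjectiveBundle.isLineBundle g _).symm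

lemma exists_coords_chart {T : Scheme.{u}} (g : T ⟶ P.space) (b : Module.Basis ι k E) (j : ι) :
    ∃ c : ι → Γ(T, g ⁻¹ᵁ P.chart (b j)), c j = 1 ∧ HasCoordsOn g (g ⁻¹ᵁ P.chart (b j)) b c :=
  exists_hasCoordsOn_nonvan g b j (preimage_chart g _).le

variable [Fintype ι]

lemma iSup_chart (b : Module.Basis ι k E) : ⨆ j, P.chart (b j) = ⊤ := by
  refine eq_top_iff.mpr fun y _ => ?_
  obtain ⟨U, c, j, hy, hj, H⟩ := exists_hasCoordsOn (𝟙 P.space) b y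
  have h1 := H.le_nonvan (i := j) (by rw [hj]; exact isUnit_one)
  rw [← preimage_chart] at h1
  exact TopologicalSpace.Opens.mem_iSup.mpr ⟨j, h1 hy⟩

/-- The affine chart is the spectrum of the polynomial ring in the coordinates other than the one
that does not vanish. -/
lemma isAffineOpen_chart (b : Module.Basis ι k E) (j : ι) : IsAffineOpen (P.chart (b j)) := by
  classical
  let D := P.chart (b j)
  let R := MvPolynomial {i : ι // i ≠ j} k
  let s : Spec (CommRingCat.of R) ⟶ Spec (CommRingCat.of k) :=
    Spec.map (CommRingCat.ofHom MvPolynomial.C)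
  have hs : ∀ r : k, s.appTop (specFun r) = specFun (MvPolynomial.C r : R) := by
    intro r
    exact congr($(Scheme.ΓSpecIso_inv_naturality (CommRingCat.ofHom
      (MvPolynomial.C : k →+* R))) r).symm
  let c : ι → Γ(Spec (CommRingCat.of R), ⊤) := fun i =>
    if h : i = j then 1 else specFun (MvPolynomial.X ⟨i, h⟩ : R)
  have hcj : c j = 1 := dif_pos rfl
  -- The morphism from affine space with the coordinates `c`, whose image lies in the chart.
  obtain ⟨φ, hφ, hc⟩ := P.exists_of_coords s b c j (by rw [hcj]; exact isUnit_one)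
  have htop : φ ⁻¹ᵁ D = ⊤ := by
    rw [preimage_chart, eq_top_iff]
    exact hc.le_nonvan (by rw [hcj]; exact isUnit_one)
  obtain ⟨d₀, hd₀, hd₀'⟩ := exists_coords_chart D.ι b j
  have hDtop : (⊤ : D.toScheme.Opens) ≤ D.ι ⁻¹ᵁ P.chart (b j) := by
    simp [D]
  have hd := hd₀'.mono hDtop
  set d : ι → Γ(D.toScheme, ⊤) := fun i => resF hDtop (d₀ i)
  have hdj : d j = 1 := by simp [d, hd₀]
  -- The coordinates on the chart define a morphism to affine space.
  let ev : R →+* Γ(D.toScheme, ⊤) :=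
    MvPolynomial.eval₂Hom (constFun (D.ι ≫ P.π) ⊤) (fun i => d i.1)
  have hevX : ∀ i, ev (MvPolynomial.X i) = d i.1 := fun i => MvPolynomial.eval₂Hom_X' _ _ i
  have hevC : ∀ r : k, ev (MvPolynomial.C r) = constFun (D.ι ≫ P.π) ⊤ r :=
    fun r => MvPolynomial.eval₂Hom_C _ _ r
  let ψ := toSpec ev
  have hψc : ∀ i, ψ.appTop (c i) = d i := by
    intro i
    by_cases h : i = j
    · subst h
      rw [hcj, hdj, map_one]
    · simp only [c, dif_neg h]
      exact (toSpec_appTop ev _).trans (hevX ⟨i, h⟩)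
  have hψs : ψ ≫ s = D.ι ≫ P.π := by
    refine spec_hom_ext fun r => ?_
    rw [← constFun_top (D.ι ≫ P.π) r]
    change ψ.appTop (s.appTop (specFun r)) = _
    rw [hs]
    exact (toSpec_appTop ev _).trans (hevC r)
  have hψφ : ψ ≫ φ = D.ι := by
    refine P.hom_ext b ?_ fun x => ⟨⊤, d, trivial, ?_, hd⟩
    · rw [Category.assoc, hφ, hψs]
    · have := hc.comp ψ
      exact (congrArg (HasCoordsOn (ψ ≫ φ) ⊤ b) (funext hψc)).mp this
  -- Both compositions of these morphisms preserve the coordinates, so they are identities.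
  let φ' : Spec (CommRingCat.of R) ⟶ D.toScheme := IsOpenImmersion.lift D.ι φ (by
    rw [Scheme.Opens.range_ι]
    rintro _ ⟨x, rfl⟩
    exact htop.ge (show x ∈ ⊤ from trivial))
  have hφ' : φ' ≫ D.ι = φ := IsOpenImmersion.lift_fac _ _ _
  have h1 : ψ ≫ φ' = 𝟙 _ := by
    rw [← cancel_mono D.ι, Category.assoc, hφ', hψφ, Category.id_comp]
  have h2 : φ' ≫ ψ = 𝟙 _ := by
    have hcc := hd.comp φ'
    rw [hφ'] at hcc
    obtain ⟨w, -, hw⟩ := hc.exists_unit hcc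
    have hw1 : w = 1 := by
      have := hw j
      rw [hcj, mul_one] at this
      rw [← this]
      change φ'.appTop (d j) = 1
      rw [hdj, map_one]
    have hcd : ∀ i, φ'.appTop (d i) = c i := by
      intro i
      have := hw i
      rw [hw1, one_mul] at this
      exact this
    let m1 : R →+* Γ(Spec (CommRingCat.of R), ⊤) := φ'.appTop.hom.comp ev
    let m2 : R →+* Γ(Spec (CommRingCat.of R), ⊤) := specFun.toRingHom
    have hm : m1 = m2 := by
      refine MvPolynomial.ringHom_ext (fun r => ?_) fun i => ?_
      · change φ'.appTop (ev (MvPolynomial.C r)) = specFun (MvPolynomial.C r : R)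
        rw [← hs, ← hφ, ← hφ']
        rw [hevC, constFun_top]
        rfl
      · change φ'.appTop (ev (MvPolynomial.X i)) = specFun (MvPolynomial.X i : R)
        rw [hevX, hcd]
        exact dif_neg i.2
    refine spec_hom_ext fun r => ?_
    change φ'.appTop (ψ.appTop (specFun r)) = specFun r
    rw [toSpec_appTop]
    exact congr($hm r)
  have : IsIso ψ := ⟨φ', h1, h2⟩
  exact IsAffine.of_isIso ψ

/-- A morphism to `ℙ(E) ×ₖ T` from an affine scheme is a closed immersion if the coordinates of its
first component generate the functions as a module over the functions on the affine scheme `T`. -/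
lemma isClosedImmersion_of_coords {T W : Scheme.{u}} [IsAffine T] [IsAffine W]
    {t : T ⟶ Spec (CommRingCat.of k)} (f : W ⟶ Limits.pullback P.π t)
    {b : Module.Basis ι k E} {c : ι → Γ(W, ⊤)}
    (H : HasCoordsOn (f ≫ Limits.pullback.fst P.π t) ⊤ b c)
    (h : ∀ r : Γ(W, ⊤), ∃ a : ι → Γ(T, ⊤),
      r = ∑ i, (f ≫ Limits.pullback.snd P.π t).appTop (a i) * c i) : IsClosedImmersion f := by
  refine IsZariskiLocalAtTarget.of_iSup_eq_top (P := @IsClosedImmersion)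
    (fun j => Limits.pullback.fst P.π t ⁻¹ᵁ P.chart (b j)) ?_ fun j => ?_
  · rw [← Scheme.Hom.preimage_iSup, iSup_chart, Scheme.Hom.preimage_top]
  set V := Limits.pullback.fst P.π t ⁻¹ᵁ P.chart (b j) with hV
  have : IsAffineHom t := isAffineHom_of_isAffine t
  have : IsAffineHom (Limits.pullback.fst P.π t) :=
    (isAffineHom_isStableUnderBaseChange.of_isPullback
      (IsPullback.of_hasPullback P.π t).flip this)
  have hVa : IsAffineOpen V := (isAffineOpen_chart b j).preimage _
  have : IsAffine V.toScheme := hVa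
  have hpre : f ⁻¹ᵁ V = W.basicOpen (c j) := by
    rw [hV, ← Scheme.Hom.comp_preimage, preimage_chart]
    ext x
    exact H.mem_nonvan_iff (x := x) trivial j
  have hWa : IsAffineOpen (f ⁻¹ᵁ V) := by
    rw [hpre]
    exact (isAffineOpen_top W).basicOpen _
  have : IsAffine (f ⁻¹ᵁ V).toScheme := hWa
  -- Over the chart where the coordinate `j` does not vanish, `W` is the locus where `c j` is
  -- invertible. There every function is a combination of the quotients `c i / c j`, which are
  -- pulled back from the chart.
  have hsurj : Function.Surjective (f.app V) := by
    obtain ⟨d, hdj, hd⟩ := exists_coords_chart (Limits.pullback.fst P.π t) b j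
    obtain ⟨w, -, hw⟩ := (hd.comp f).exists_unit (H.mono (le_top : f ⁻¹ᵁ V ≤ ⊤))
    have hwj : w = resF le_top (c j) := by
      rw [hw j]
      change _ = _ * f.app V (d j)
      rw [hdj, map_one, mul_one]
    have key : ∀ r : Γ(W, ⊤), ∃ y, resF le_top r = w * f.app V y := by
      intro r
      obtain ⟨a, ha⟩ := h r
      refine ⟨∑ i, resF le_top ((Limits.pullback.snd P.π t).appTop (a i)) * d i, ?_⟩
      rw [ha, map_sum, map_sum, Finset.mul_sum]
      refine Finset.sum_congr rfl fun i _ => ?_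
      rw [map_mul, map_mul, hw i, mul_left_comm]
      congr 2
      exact (app_resF f (le_top : V ≤ ⊤) ((Limits.pullback.snd P.π t).appTop (a i))).symm
    obtain ⟨y₀, hy₀⟩ := key 1
    rw [map_one] at hy₀
    have hunit : IsUnit w := IsUnit.of_mul_eq_one _ hy₀.symm
    have key' : ∀ r : Γ(W, ⊤), ∃ y, f.app V y = resF le_top r := by
      intro r
      obtain ⟨y, hy⟩ := key (c j * r)
      rw [map_mul, ← hwj] at hy
      exact ⟨y, (hunit.mul_left_cancel hy).symm⟩
    intro z
    have hloc := (isAffineOpen_top W).isLocalization_of_eq_basicOpen (c j)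
      (homOfLE (le_top : f ⁻¹ᵁ V ≤ ⊤)) hpre
    let := (W.presheaf.map (homOfLE (le_top : f ⁻¹ᵁ V ≤ ⊤)).op).hom.toAlgebra
    obtain ⟨n, r, hr⟩ := @IsLocalization.Away.surj _ _ _ _ _ (c j) hloc z
    obtain ⟨y, hy⟩ := key' r
    refine ⟨y * y₀ ^ n, ?_⟩
    rw [map_mul, map_pow, hy]
    change z * resF le_top (c j) ^ n = resF le_top r at hr
    rw [← hr, ← hwj, mul_assoc, ← mul_pow, ← hy₀, one_pow, mul_one]
  refine IsClosedImmersion.of_surjective_of_isAffine _ ?_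
  rw [morphismRestrict_appTop]
  refine Function.Surjective.comp (g := W.presheaf.map
    (eqToHom (image_morphismRestrict_preimage f V ⊤)).op) (f := f.app (V.ι ''ᵁ ⊤)) ?_ ?_
  · exact (ConcreteCategory.bijective_of_isIso
      (W.presheaf.map (eqToHom (image_morphismRestrict_preimage f V ⊤)).op)).2
  · rw [Scheme.Opens.ι_image_top]
    exact hsurj

end AlgebraicGeometry

namespace AlgebraicGeometry
universe u
open Scheme.Modules ProjectiveBundle

/-! ### The universal family of pairs of points with a chart -/

/-- Families of closed subschemes of constant length are stable under base change. -/
lemma IsLengthFamily.of_isPullback {S X T T' W W' : Scheme.{u}} {x : X ⟶ S} {n : ℕ} {t : T ⟶ S}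
    {a : W ⟶ X} {p : W ⟶ T} (H : IsLengthFamily x n t a p) {w : W' ⟶ W} {p' : W' ⟶ T'} {g : T' ⟶ T}
    (h : IsPullback w p' p g) : IsLengthFamily x n (g ≫ t) (w ≫ a) p' := by
  have := H.isFinite
  have := H.flat
  have hcomm : (w ≫ a) ≫ x = p' ≫ g ≫ t := by
    rw [Category.assoc, H.comm, ← Category.assoc, h.w, Category.assoc]
  refine ⟨hcomm, ?_, MorphismProperty.of_isPullback (P := @IsFinite) h H.isFinite,
    MorphismProperty.of_isPullback (P := @Flat) h H.flat,
    MorphismProperty.of_isPullback (P := @LocallyOfFinitePresentation) h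
      H.locallyOfFinitePresentation, fun y => ?_⟩
  · let m : Limits.pullback x (g ≫ t) ⟶ Limits.pullback x t :=
      Limits.pullback.lift (Limits.pullback.fst _ _) (Limits.pullback.snd _ _ ≫ g)
        (by rw [Limits.pullback.condition, Category.assoc])
    have h1 : IsPullback m (Limits.pullback.snd x (g ≫ t)) (Limits.pullback.snd x t) g := by
      refine IsPullback.of_right (h₁₂ := Limits.pullback.fst x t) (h₂₂ := t) (v₁₃ := x) ?_
        (Limits.pullback.lift_snd _ _ _) (IsPullback.of_hasPullback x t)
      rw [Limits.pullback.lift_fst]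
      exact IsPullback.of_hasPullback x (g ≫ t)
    have h2 : IsPullback w (Limits.pullback.lift (w ≫ a) p' hcomm)
        (Limits.pullback.lift a p H.comm) m := by
      refine IsPullback.of_bot (v₂₁ := Limits.pullback.snd x (g ≫ t))
        (v₂₂ := Limits.pullback.snd x t) (h₃₁ := g) ?_ ?_ h1
      · rw [Limits.pullback.lift_snd, Limits.pullback.lift_snd]
        exact h
      · apply Limits.pullback.hom_ext
        · rw [Category.assoc, Category.assoc, Limits.pullback.lift_fst, Limits.pullback.lift_fst,
            Limits.pullback.lift_fst]
        · rw [Category.assoc, Category.assoc, Limits.pullback.lift_snd, Limits.pullback.lift_snd,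
            Limits.pullback.lift_snd_assoc, h.w]
    exact MorphismProperty.of_isPullback (P := @IsClosedImmersion) h2 H.isClosedImmersion
  · rw [Scheme.Hom.finrank_of_isPullback _ _ _ _ h, H.finrank_eq]

section

variable {A : Type*} [CommRing A] (σ τ : A)

/-- The polynomial `X² - σ X - τ`. -/
noncomputable def quadratic : Polynomial A :=
  Polynomial.X ^ 2 - (Polynomial.C σ * Polynomial.X + Polynomial.C τ)

lemma monic_quadratic : (quadratic σ τ).Monic :=
  Polynomial.monic_X_pow_sub (Polynomial.degree_linear_le.trans_lt (by norm_num))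

lemma natDegree_quadratic [Nontrivial A] : (quadratic σ τ).natDegree = 2 := by
  unfold quadratic
  compute_degree!

lemma eval₂_quadratic {B : Type*} [CommRing B] (f : A →+* B) (x : B) :
    (quadratic σ τ).eval₂ f x = x * x - (f σ * x + f τ) := by
  simp [quadratic, Polynomial.eval₂_sub, sq]

lemma root_quadratic : AdjoinRoot.root (quadratic σ τ) * AdjoinRoot.root (quadratic σ τ) =
    algebraMap A _ σ * AdjoinRoot.root (quadratic σ τ) + algebraMap A _ τ := by
  have h1 := AdjoinRoot.eval₂_root (quadratic σ τ)
  rw [eval₂_quadratic] at h1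
  exact sub_eq_zero.mp h1

lemma exists_basis_quadratic [Nontrivial A] :
    ∃ β : Module.Basis (Fin 2) A (AdjoinRoot (quadratic σ τ)),
      β 0 = 1 ∧ β 1 = AdjoinRoot.root (quadratic σ τ) := by
  refine ⟨(AdjoinRoot.powerBasis' (monic_quadratic σ τ)).basis.reindex
    (finCongr (natDegree_quadratic σ τ)), ?_, ?_⟩ <;>
    rw [Module.Basis.reindex_apply, PowerBasis.basis_eq_pow]
  · exact pow_zero _
  · exact pow_one _

lemma IsGenerator.of_ringEquiv {A' B B' : Type*} [CommRing A'] [CommRing B] [CommRing B']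
    {f : A →+* B} {f' : A' →+* B'} {x : B} (h : IsGenerator f x) (e : A ≃+* A') (e' : B ≃+* B')
    (H : ∀ r, f' (e r) = e' (f r)) : IsGenerator f' (e' x) := by
  have h1 := e'.bijective.comp (h.comp (Equiv.arrowCongr (Equiv.refl (Fin 2)) e.toEquiv).symm.bijective)
  refine (congrArg Function.Bijective (funext fun c => ?_)).mpr h1
  have h2 : ∀ i, f' (c i) = e' (f (e.symm (c i))) := fun i => by rw [← H, e.apply_symm_apply]
  change _ = e' (f (e.symm (c 0)) + f (e.symm (c 1)) * x)
  rw [h2, h2, map_add, map_mul]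

end

variable {k : Type u} [Field k] {E : Type u} [AddCommGroup E] [Module k E]

/-- The family of the pairs of points `(1, x, α + β x)` with `x² = σ x + τ` over the affine space
with coordinates `α, β, σ, τ`. -/
lemma exists_universal_chart (P : ProjectiveBundle (vectorSheaf k E))
    (b : Module.Basis (Fin 3) k E) :
    ∃ (T W : Scheme.{u}) (t : T ⟶ Spec (CommRingCat.of k)) (a : W ⟶ P.space) (p : W ⟶ T)
      (c : Fin 4 → Γ(T, ⊤)) (x : Γ(W, p ⁻¹ᵁ ⊤)), IsAffine T ∧ IsAffineHom p ∧
      IsLengthFamily P.π 2 t a p ∧ IsChartOn a p b ⊤ (c 0) (c 1) (c 2) (c 3) x ∧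
      ∀ (T' : Scheme.{u}) (t' : T' ⟶ Spec (CommRingCat.of k)) (c' : Fin 4 → Γ(T', ⊤)),
        ∃ h : T' ⟶ T, h ≫ t = t' ∧ (∀ i, h.appTop (c i) = c' i) ∧
          ∀ (W' : Scheme.{u}) (p' : W' ⟶ T') (x' : Γ(W', ⊤)),
            x' * x' = p'.appTop (c' 2) * x' + p'.appTop (c' 3) →
            ∃ w : W' ⟶ W, w ≫ p = p' ≫ h ∧ w.appTop x = x' := by
  -- The family is the spectrum of `B = A[x] / (x² - σ x - τ)`, where `A = k[α, β, σ, τ]`.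
  let A := MvPolynomial (Fin 4) k
  let f : Polynomial A := quadratic (MvPolynomial.X 2) (MvPolynomial.X 3)
  let B := AdjoinRoot f
  obtain ⟨β, hβ0, hβ1⟩ := exists_basis_quadratic (A := A) (MvPolynomial.X 2) (MvPolynomial.X 3)
  have hgen : IsGenerator (algebraMap A B) (AdjoinRoot.root f) := IsGenerator.of_basis β hβ0 hβ1
  have : Module.Free A B := Module.Free.of_basis β
  have : Module.Finite A B := Module.Finite.of_basis β
  have hrank : Module.finrank A B = 2 := by
    rw [Module.finrank_eq_card_basis β]
    rfl
  let T := Spec (CommRingCat.of A)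
  let W := Spec (CommRingCat.of B)
  let p : W ⟶ T := Spec.map (CommRingCat.ofHom (algebraMap A B))
  let t : T ⟶ Spec (CommRingCat.of k) := Spec.map (CommRingCat.ofHom MvPolynomial.C)
  have hp : ∀ r : A, p.appTop (specFun r) = specFun (algebraMap A B r) := by
    intro r
    exact congr($(Scheme.ΓSpecIso_inv_naturality (CommRingCat.ofHom (algebraMap A B))) r).symm
  have ht : ∀ r : k, t.appTop (specFun r) = specFun (MvPolynomial.C r : A) := by
    intro r
    exact congr($(Scheme.ΓSpecIso_inv_naturality (CommRingCat.ofHom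
      (MvPolynomial.C : k →+* A))) r).symm
  let c : Fin 4 → Γ(T, ⊤) := fun i => specFun (MvPolynomial.X i : A)
  let x : Γ(W, ⊤) := specFun (AdjoinRoot.root f)
  obtain ⟨a, ha, hc⟩ := P.exists_of_coords (p ≫ t) b
    ![1, x, p.appTop (c 0) + p.appTop (c 1) * x] 0 isUnit_one
  have hgen' : IsGenerator p.appTop.hom x := hgen.of_ringEquiv specFun specFun hp
  have hcl : IsClosedImmersion (Limits.pullback.lift a p ha) := by
    -- The coordinates `1` and `x` generate `B` as a module over `A`.
    refine isClosedImmersion_of_coords (b := b) (c := ![1, x, p.appTop (c 0) + p.appTop (c 1) * x])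
      _ ?_ fun r => ?_
    · rw [Limits.pullback.lift_fst]
      exact hc
    · obtain ⟨d, e, hr⟩ := hgen'.exists_eq r
      refine ⟨![d, e, 0], ?_⟩
      rw [Limits.pullback.lift_snd, hr]
      simp [Fin.sum_univ_three]
  refine ⟨T, W, t, a, p, c, x, inferInstance, inferInstance, ⟨ha, hcl, ?_, ?_, ?_, fun y => ?_⟩,
    ⟨hc, isGeneratorOn_of_isAffineOpen (isAffineOpen_top T) hgen', ?_⟩, ?_⟩
  · rw [IsFinite.SpecMap_iff]
    exact RingHom.finite_algebraMap.mpr inferInstance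
  · rw [Flat.SpecMap_iff]
    exact RingHom.flat_algebraMap_iff.mpr inferInstance
  · rw [LocallyOfFinitePresentation.SpecMap_iff]
    exact RingHom.finitePresentation_algebraMap.mpr inferInstance
  · refine (Scheme.Hom.finrank_SpecMap_algebraMap A B y).trans ?_
    rw [Module.rankAtStalk_eq_finrank_of_free, hrank]
    rfl
  · have h1 : x * x = p.appTop (c 2) * x + p.appTop (c 3) := by
      rw [hp, hp, ← map_mul, ← map_mul, ← map_add]
      exact congrArg _ (root_quadratic _ _)
    exact h1
  · intro T' t' c'
    let ev : A →+* Γ(T', ⊤) := MvPolynomial.eval₂Hom (constFun t' ⊤) c'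
    have hevX : ∀ i, ev (MvPolynomial.X i) = c' i := fun i => MvPolynomial.eval₂Hom_X' _ _ i
    have hevC : ∀ r : k, ev (MvPolynomial.C r) = constFun t' ⊤ r :=
      fun r => MvPolynomial.eval₂Hom_C _ _ r
    refine ⟨toSpec ev, spec_hom_ext fun r => ?_, fun i => ?_, fun W' p' x' hx' => ?_⟩
    · rw [← constFun_top t' r]
      change (toSpec ev).appTop (t.appTop (specFun r)) = _
      rw [ht]
      exact (toSpec_appTop ev _).trans (hevC r)
    · exact (toSpec_appTop ev _).trans (hevX i)
    · let m : B →+* Γ(W', ⊤) := AdjoinRoot.lift (p'.appTop.hom.comp ev) x' (by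
        rw [eval₂_quadratic, sub_eq_zero, hx', RingHom.comp_apply, RingHom.comp_apply, hevX, hevX])
      refine ⟨toSpec m, spec_hom_ext fun r => ?_, ?_⟩
      · change (toSpec m).appTop (p.appTop (specFun r)) =
          p'.appTop ((toSpec ev).appTop (specFun r))
        rw [hp, toSpec_appTop, toSpec_appTop]
        exact AdjoinRoot.lift_of _
      · exact (toSpec_appTop m _).trans (AdjoinRoot.lift_root _)

end AlgebraicGeometry

namespace AlgebraicGeometry
universe u
open Scheme.Modules ProjectiveBundle

namespace HilbertScheme

variable {k : Type u} [Field k] {E : Type u} [AddCommGroup E] [Module k E]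
  {P : ProjectiveBundle (vectorSheaf k E)} (H : HilbertScheme P.π 2) {T T' : Scheme.{u}}
  {b : Module.Basis (Fin 3) k E} {g g' : T ⟶ H.space} {c : Fin 4 → Γ(T, ⊤)}

instance : IsFinite H.p₂ := H.isLengthFamily.isFinite

/-- The family of pairs of points over `T` that is classified by `g` has a chart on the whole of
`T`, given by the functions `c`. -/
def HasChart (g : T ⟶ H.space) (b : Module.Basis (Fin 3) k E) (c : Fin 4 → Γ(T, ⊤)) : Prop :=
  ∃ (W : Scheme.{u}) (w : W ⟶ H.family) (p : W ⟶ T) (x : Γ(W, p ⁻¹ᵁ ⊤)),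
    IsPullback w p H.p₂ g ∧ IsChartOn (w ≫ H.p₁) p b ⊤ (c 0) (c 1) (c 2) (c 3) x

variable {H}

lemma HasChart.comp (h : H.HasChart g b c) (f : T' ⟶ T) :
    H.HasChart (f ≫ g) b (fun i => f.appTop (c i)) := by
  obtain ⟨W, w, p, x, hp, hx⟩ := h
  have : IsAffineHom p := isAffineHom_isStableUnderBaseChange.of_isPullback hp inferInstance
  have h1 := (IsPullback.of_hasPullback p f)
  have h2 := hx.of_isPullback h1
  rw [← Category.assoc] at h2
  exact ⟨_, Limits.pullback.fst p f ≫ w, Limits.pullback.snd p f, _, h1.paste_horiz hp, h2⟩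

/-- For any four functions there is a morphism to the Hilbert scheme whose family has a chart with
these functions. -/
lemma exists_hasChart (t : T ⟶ Spec (CommRingCat.of k)) (b : Module.Basis (Fin 3) k E)
    (c : Fin 4 → Γ(T, ⊤)) : ∃ g : T ⟶ H.space, g ≫ H.π = t ∧ H.HasChart g b c := by
  obtain ⟨T₀, W₀, t₀, a₀, p₀, c₀, x₀, -, -, hlen, hchart, huniv⟩ := exists_universal_chart P b
  obtain ⟨χ, ⟨hχ, w, hw, hpb⟩, -⟩ := H.existsUnique _ _ _ _ _ hlen
  obtain ⟨h, ht, hc, -⟩ := huniv T t c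
  have h1 : H.HasChart χ b c₀ := ⟨W₀, w, p₀, x₀, hpb, by rw [hw]; exact hchart⟩
  have h2 := h1.comp h
  simp only [hc] at h2
  exact ⟨h ≫ χ, by rw [Category.assoc, hχ, ht], h2⟩

/-- A morphism to the Hilbert scheme whose family has a chart is determined by the functions of the
chart, since the family is the pullback of the universal family with a chart. -/
lemma HasChart.hom_ext (h : H.HasChart g b c) (h' : H.HasChart g' b c) (e : g ≫ H.π = g' ≫ H.π) :
    g = g' := by
  wlog hT : IsAffine T generalizing T g g' c
  · refine Scheme.hom_ext_of_forall _ _ fun x => ?_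
    obtain ⟨_, ⟨U, hU, rfl⟩, hxU, -⟩ := T.isBasis_affineOpens.exists_subset_of_mem_open
      (show x ∈ (⊤ : T.Opens) from trivial) (⊤ : T.Opens).2
    refine ⟨U, hxU, this (h.comp (Scheme.Opens.ι U)) (h'.comp (Scheme.Opens.ι U)) ?_ hU⟩
    rw [Category.assoc, Category.assoc, e]
  · obtain ⟨T₀, W₀, t₀, a₀, p₀, c₀, x₀, hT₀, hp₀, hlen, hchart, huniv⟩ := exists_universal_chart P b
    obtain ⟨χ, ⟨hχ, w₁, hw₁, hpb₁⟩, -⟩ := H.existsUnique _ _ _ _ _ hlen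
    obtain ⟨f, ht, hc, hf⟩ := huniv T (g ≫ H.π) c
    have key : ∀ g₁ : T ⟶ H.space, g₁ ≫ H.π = g ≫ H.π → H.HasChart g₁ b c → g₁ = f ≫ χ := by
      rintro g₁ e₁ ⟨W, w, p, x, hp, hx⟩
      have : IsAffineHom p := isAffineHom_isStableUnderBaseChange.of_isPullback hp inferInstance
      have hfam := H.isLengthFamily.of_isPullback hp
      -- On the affine base the function `x` defines a morphism from the family to the universal
      -- family with a chart, and the resulting square is a pullback square.
      obtain ⟨w₂, hw₂, hx₂⟩ := hf W p x hx.sq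
      obtain ⟨hpb₂, hw₃⟩ := hx.isPullback hchart (t := g ≫ H.π) (t' := t₀) (g := f)
        (by rw [← e₁]; exact hfam.comm) hlen.comm ht (hc 0) (hc 1) hw₂ hx₂
      obtain ⟨_, -, hun⟩ := H.existsUnique _ _ _ _ _ hfam
      rw [hun g₁ ⟨rfl, w, rfl, hp⟩]
      refine (hun (f ≫ χ) ⟨?_, w₂ ≫ w₁, ?_, hpb₂.paste_horiz hpb₁⟩).symm
      · rw [Category.assoc, hχ, ht, e₁]
      · rw [Category.assoc, hw₁, hw₃]
    rw [key g rfl h, key g' e.symm h']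

lemma hasChart_of_isChartOn {U : H.space.Opens} {α β σ τ : Γ(H.space, U)}
    {x : Γ(H.family, H.p₂ ⁻¹ᵁ U)} (h : IsChartOn H.p₁ H.p₂ b U α β σ τ x) (f : T ⟶ H.space)
    (hf : ⊤ ≤ f ⁻¹ᵁ U) : H.HasChart f b (fun i => resF hf (f.app U (![α, β, σ, τ] i))) := by
  have h1 := (IsPullback.of_hasPullback H.p₂ f)
  have h2 := (h.of_isPullback h1).mono hf
  exact ⟨_, Limits.pullback.fst H.p₂ f, Limits.pullback.snd H.p₂ f, _, h1, h2⟩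

/-- The functions of a chart are determined by the family, so that a chart on `H` determines the
functions of the charts of all families. -/
lemma HasChart.eq_of_isChartOn (hg : H.HasChart g b c) {U : H.space.Opens}
    {α β σ τ : Γ(H.space, U)} {x : Γ(H.family, H.p₂ ⁻¹ᵁ U)}
    (h : IsChartOn H.p₁ H.p₂ b U α β σ τ x) (i : Fin 4) :
    g.app U (![α, β, σ, τ] i) = resF le_top (c i) := by
  obtain ⟨W, w, p, y, hp, hy⟩ := hg
  have h1 := h.of_isPullback hp
  obtain ⟨h0, h1, h2, h3, -⟩ := h1.unique (hy.mono (le_top : g ⁻¹ᵁ U ≤ ⊤))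
  fin_cases i
  exacts [h0, h1, h2, h3]

end HilbertScheme

end AlgebraicGeometry

namespace AlgebraicGeometry
universe u
open Scheme.Modules ProjectiveBundle

/-! ### Generators of algebras of rank two -/

section

variable {R B : Type*} [CommRing R] [CommRing B] [Algebra R B]

/-- An algebra that is a quotient of the field `κ` has dimension at most one over `κ`. -/
lemma finrank_le_one_of_surjective {κ : Type*} [Field κ] {C : Type*} [CommRing C] [Algebra κ C]
    (h : Function.Surjective (algebraMap κ C)) : Module.finrank κ C ≤ 1 :=
  finrank_le_one 1 fun w => by
    obtain ⟨r, rfl⟩ := h w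
    exact ⟨r, (Algebra.algebraMap_eq_smul_one r).symm⟩

/-- By Nakayama's lemma, an element of a finite flat algebra of rank two that is not a scalar in
the fibre at a prime ideal generates the algebra in a neighbourhood of that ideal. -/
lemma exists_localized_bijective [Module.Finite R B] [Module.Flat R B] [Module.FinitePresentation R B]
    (q : Ideal R) [q.IsPrime] (hrank : Module.finrank q.ResidueField (q.ResidueField ⊗[R] B) = 2)
    (y : B) (hy : ∀ r : q.ResidueField,
      algebraMap q.ResidueField (q.ResidueField ⊗[R] B) r ≠ 1 ⊗ₜ y) :
    ∃ g : R, g ∉ q ∧ Function.Bijective (LocalizedModule.map (Submonoid.powers g)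
      (Fintype.linearCombination R ![(1 : B), y])) := by
  let Rq := Localization.AtPrime q
  let κ := q.ResidueField
  let e : κ ⊗[Rq] (Rq ⊗[R] B) ≃ₗ[κ] κ ⊗[R] B := AlgebraTensorModule.cancelBaseChange R Rq κ κ B
  let v : Fin 2 → Rq ⊗[R] B := fun i => 1 ⊗ₜ (![(1 : B), y] i)
  have hev : ∀ i, e ((TensorProduct.mk Rq κ (Rq ⊗[R] B) 1 ∘ v) i) = 1 ⊗ₜ (![(1 : B), y] i) := by
    intro i
    simp [e, v]
  -- In the fibre, `1` and `y` are linearly independent and hence form a basis. This basis lifts to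
  -- the localization at `q`, and from there to a neighbourhood.
  have hli : LinearIndependent κ (TensorProduct.mk Rq κ (Rq ⊗[R] B) 1 ∘ v) := by
    refine LinearIndependent.of_comp e.toLinearMap (Fintype.linearIndependent_iff.mpr fun c hc => ?_)
    have hc' : algebraMap κ (κ ⊗[R] B) (c 0) + c 1 • (1 ⊗ₜ y) = 0 := by
      rw [Algebra.algebraMap_eq_smul_one, ← hc, Fin.sum_univ_two]
      exact congrArg₂ (· + ·) (congrArg _ (hev 0).symm) (congrArg _ (hev 1).symm)
    have h1 : c 1 = 0 := by
      by_contra hne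
      refine hy (-(c 1)⁻¹ * c 0) ?_
      have := congrArg ((c 1)⁻¹ • ·) hc'
      simp only [smul_add, smul_zero, smul_smul, inv_mul_cancel₀ hne, one_smul] at this
      rw [neg_mul, map_neg, map_mul, ← Algebra.smul_def]
      exact (eq_neg_of_add_eq_zero_right this).symm
    have h0 : c 0 = 0 := by
      rw [h1, zero_smul, add_zero] at hc'
      have : Nontrivial (κ ⊗[R] B) := Module.nontrivial_of_finrank_pos (R := κ) (by rw [hrank]; norm_num)
      exact (map_eq_zero_iff _ (algebraMap κ (κ ⊗[R] B)).injective).mp hc'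
    intro i
    fin_cases i
    exacts [h0, h1]
  have hsp : Submodule.span κ (Set.range (TensorProduct.mk Rq κ (Rq ⊗[R] B) 1 ∘ v)) = ⊤ := by
    refine hli.span_eq_top_of_card_eq_finrank ?_
    rw [e.finrank_eq, hrank]
    rfl
  obtain ⟨b, hb⟩ := Module.exists_basis_of_basis_baseChange v hli hsp
    (Module.Flat.rTensor_preserves_injective_linearMap _ Subtype.val_injective)
  let fM : (Fin 2 → R) →ₗ[R] (Fin 2 → Rq) :=
    .pi fun i => Algebra.linearMap R Rq ∘ₗ LinearMap.proj i
  let fN : B →ₗ[R] Rq ⊗[R] B := TensorProduct.mk R Rq B 1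
  have : IsLocalizedModule q.primeCompl fN := (isLocalizedModule_iff_isBaseChange q.primeCompl Rq fN).mpr
    (TensorProduct.isBaseChange R B Rq)
  have : IsLocalizedModule q.primeCompl fM := inferInstance
  refine Module.FinitePresentation.exists_notMem_bijective _ q fM fN ?_
  have h1 : IsLocalizedModule.map q.primeCompl fM fN (Fintype.linearCombination R ![(1 : B), y]) =
      (b.equivFun.symm : (Fin 2 → Rq) →ₗ[Rq] Rq ⊗[R] B).restrictScalars R := by
    refine IsLocalizedModule.linearMap_ext q.primeCompl fM fN ?_
    rw [IsLocalizedModule.map_comp]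
    ext i
    simp [fM, fN, hb, v, Fintype.linearCombination_apply, Pi.single_apply, Module.Basis.equivFun_symm_apply]
  rw [h1]
  exact b.equivFun.symm.bijective

/-- Surjectivity and injectivity of a localized linear map in terms of elements. -/
lemma bijective_localizedModule_map_iff {M N : Type*} [AddCommGroup M] [Module R M] [AddCommGroup N] [Module R N]
    {S : Submonoid R} {φ : M →ₗ[R] N} (h : Function.Bijective (LocalizedModule.map S φ)) :
    (∀ z : N, ∃ (s : S) (m : M), s • z = φ m) ∧ ∀ m : M, φ m = 0 → ∃ s : S, s • m = 0 := by
  constructor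
  · intro z
    obtain ⟨x, hx⟩ := h.2 (LocalizedModule.mk z 1)
    induction x using LocalizedModule.induction_on with
    | h m s =>
      rw [LocalizedModule.map_mk, LocalizedModule.mk_eq] at hx
      obtain ⟨u, hu⟩ := hx
      refine ⟨u * s, u • m, ?_⟩
      rw [one_smul] at hu
      rw [mul_smul, ← hu]
      exact (map_smul φ (u : R) m).symm
  · intro m hm
    have h1 : LocalizedModule.mk m (1 : S) = 0 := by
      refine h.1 ?_
      rw [LocalizedModule.map_mk, hm, LocalizedModule.zero_mk, map_zero]
    rw [← LocalizedModule.zero_mk (1 : S), LocalizedModule.mk_eq] at h1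
    obtain ⟨u, hu⟩ := h1
    exact ⟨u, by simpa using hu⟩

end

variable {T W : Scheme.{u}} {p : W ⟶ T}

/-- If `1` and `y` generate all functions up to powers of `g` and the relations between them are
annihilated by powers of `g`, then they form a basis over the locus where `g` is invertible. -/
lemma isGenerator_basicOpen [IsAffineHom p] {U : T.Opens} (hU : IsAffineOpen U) {y : Γ(W, p ⁻¹ᵁ U)}
    {g : Γ(T, U)}
    (h1 : ∀ z : Γ(W, p ⁻¹ᵁ U), ∃ (n : ℕ) (a b : Γ(T, U)),
      p.app U g ^ n * z = p.app U a + p.app U b * y)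
    (h2 : ∀ a b : Γ(T, U), p.app U a + p.app U b * y = 0 → ∃ n : ℕ, g ^ n * a = 0 ∧ g ^ n * b = 0) :
    IsGenerator (p.app (T.basicOpen g)).hom
      (resF (p.preimage_mono (T.basicOpen_le g)) y) := by
  let V := T.basicOpen g
  have hVU : V ≤ U := T.basicOpen_le g
  have hpV : p ⁻¹ᵁ V = W.basicOpen (p.app U g) := Scheme.preimage_basicOpen p g
  have hloc := hU.isLocalization_of_eq_basicOpen g (homOfLE hVU) rfl
  have hloc' := (hU.preimage p).isLocalization_of_eq_basicOpen (p.app U g)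
    (homOfLE (p.preimage_mono hVU)) hpV
  let := (T.presheaf.map (homOfLE hVU).op).hom.toAlgebra
  let := (W.presheaf.map (homOfLE (p.preimage_mono hVU)).op).hom.toAlgebra
  have hg : IsUnit (resF hVU g) := isUnit_resF_basicOpen g le_rfl hVU
  have hG : IsUnit (resF (p.preimage_mono hVU) (p.app U g)) :=
    isUnit_resF_basicOpen (p.app U g) hpV.le (p.preimage_mono hVU)
  have hres : ∀ r : Γ(T, U), p.app V (resF hVU r) = resF (p.preimage_mono hVU) (p.app U r) :=
    fun r => app_resF p hVU r
  constructor
  -- A relation over the basic open subset becomes a relation over `U` after clearing denominators.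
  · have key : ∀ c : Fin 2 → Γ(T, V), p.app V (c 0) + p.app V (c 1) * resF (p.preimage_mono hVU) y = 0 →
        c = 0 := by
      intro c hc
      obtain ⟨n, a, ha⟩ := @IsLocalization.Away.surj _ _ _ _ _ g hloc (c 0)
      obtain ⟨m, b, hb⟩ := @IsLocalization.Away.surj _ _ _ _ _ g hloc (c 1)
      change c 0 * resF hVU g ^ n = resF hVU a at ha
      change c 1 * resF hVU g ^ m = resF hVU b at hb
      have h3 : resF (p.preimage_mono hVU) (p.app U (g ^ m * a) + p.app U (g ^ n * b) * y) =
          resF (p.preimage_mono hVU) 0 := by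
        rw [map_add, map_mul _ (p.app U (g ^ n * b)), ← hres, ← hres, map_mul (resF hVU),
          map_mul (resF hVU), ← ha, ← hb]
        simp only [map_mul, map_pow, map_zero]
        linear_combination (p.app V (resF hVU g)) ^ n * (p.app V (resF hVU g)) ^ m * hc
      obtain ⟨l, hl⟩ := @IsLocalization.Away.exists_of_eq _ _ _ _ _ (p.app U g) hloc' _ _ h3
      rw [mul_zero, mul_add, ← mul_assoc, ← map_pow, ← map_mul, ← map_mul] at hl
      obtain ⟨j, hj0, hj1⟩ := h2 _ _ hl
      have hu := hg.pow (j + l + m + n)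
      funext i
      fin_cases i
      · refine hu.mul_left_cancel ?_
        have := congrArg (resF hVU) hj0
        simp only [map_mul, map_pow, map_zero, ← ha] at this
        change _ * c 0 = _ * 0
        rw [mul_zero, ← this]
        ring
      · refine hu.mul_left_cancel ?_
        have := congrArg (resF hVU) hj1
        simp only [map_mul, map_pow, map_zero, ← hb] at this
        change _ * c 1 = _ * 0
        rw [mul_zero, ← this]
        ring
    intro c c' e
    have := key (c - c') (by
      change p.app V (c 0 - c' 0) + p.app V (c 1 - c' 1) * _ = 0
      rw [map_sub, map_sub]
      have e' : p.app V (c 0) + p.app V (c 1) * resF (p.preimage_mono hVU) y =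
        p.app V (c' 0) + p.app V (c' 1) * resF (p.preimage_mono hVU) y := e
      linear_combination e')
    exact sub_eq_zero.mp this
  · intro z
    obtain ⟨n, r, hr⟩ := @IsLocalization.Away.surj _ _ _ _ _ (p.app U g) hloc' z
    change z * resF (p.preimage_mono hVU) (p.app U g) ^ n = resF (p.preimage_mono hVU) r at hr
    obtain ⟨m, a, b, hab⟩ := h1 r
    obtain ⟨u, hu⟩ := hg
    refine ⟨![u⁻¹.val ^ (n + m) * resF hVU a, u⁻¹.val ^ (n + m) * resF hVU b], ?_⟩
    refine (hG.pow (n + m)).mul_left_cancel ?_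
    have hab' := congrArg (resF (p.preimage_mono hVU)) hab
    simp only [map_add, map_mul, map_pow, ← hr, ← hres, ← hu] at hab' ⊢
    have hui : p.app V u.val ^ (n + m) * p.app V u⁻¹.val ^ (n + m) = 1 := by
      rw [← mul_pow, ← map_mul, Units.mul_inv, map_one, one_pow]
    change p.app V u.val ^ (n + m) * (p.app V (u⁻¹.val ^ (n + m) * resF hVU a) +
      p.app V (u⁻¹.val ^ (n + m) * resF hVU b) * resF (p.preimage_mono hVU) y) = _
    simp only [map_mul, map_pow]
    rw [pow_add _ n m, mul_comm z] at *
    linear_combination (p.app V (resF hVU a) +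
      p.app V (resF hVU b) * resF (p.preimage_mono hVU) y) * hui - hab'

end AlgebraicGeometry

namespace AlgebraicGeometry
universe u
open Scheme.Modules ProjectiveBundle

/-! ### Existence of charts -/

lemma isPullback_fromSpec {T W : Scheme.{u}} (p : W ⟶ T) [IsAffineHom p] {U : T.Opens}
    (hU : IsAffineOpen U) :
    IsPullback (hU.preimage p).fromSpec (Spec.map (p.app U)) p hU.fromSpec := by
  have h0 : Spec.map (p.app U) ≫ hU.fromSpec = (hU.preimage p).fromSpec ≫ p := by
    rw [app_eq_appLE']
    exact IsAffineOpen.SpecMap_appLE_fromSpec p hU (hU.preimage p) le_rfl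
  have h1 := isPullback_morphismRestrict p U
  have h2 : IsPullback (hU.preimage p).isoSpec.inv (Spec.map (p.app U)) (p ∣_ U) hU.isoSpec.inv := by
    refine IsPullback.of_horiz_isIso ⟨?_⟩
    rw [← cancel_mono U.ι, Category.assoc, Category.assoc, morphismRestrict_ι]
    exact h0.symm
  exact h2.paste_horiz h1.flip

lemma resF_app_specMap_fromSpec {W : Scheme.{u}} {V : W.Opens} (hV : IsAffineOpen V) {C : CommRingCat.{u}}
    (φ : Γ(W, V) ⟶ C) (h : ⊤ ≤ (Spec.map φ ≫ hV.fromSpec) ⁻¹ᵁ V) (z : Γ(W, V)) :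
    resF h ((Spec.map φ ≫ hV.fromSpec).app V z) = specFun (φ z) := by
  have h0 : ⊤ ≤ hV.fromSpec ⁻¹ᵁ V := hV.fromSpec_preimage_self.ge
  have h1 : resF h0 (hV.fromSpec.app V z) = (Scheme.ΓSpecIso Γ(W, V)).inv z := by
    rw [hV.fromSpec_app_self]
    change resF h0 (resF _ ((Scheme.ΓSpecIso Γ(W, V)).inv z)) = _
    rw [resF_resF]
    exact resF_self _ _
  have h2 := app_resF (Spec.map φ) h0 (hV.fromSpec.app V z)
  rw [h1] at h2
  exact h2.symm.trans congr($(Scheme.ΓSpecIso_inv_naturality φ) z).symm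

lemma exists_isAffineOpen_preimage_le {T W : Scheme.{u}} (p : W ⟶ T) [IsFinite p] (D : W.Opens) (t : T)
    (h : ∀ w, p w = t → w ∈ D) : ∃ U : T.Opens, IsAffineOpen U ∧ t ∈ U ∧ p ⁻¹ᵁ U ≤ D := by
  have hc : IsClosed (p '' (D : Set W)ᶜ) := p.isClosedMap _ D.2.isClosed_compl
  let D' : T.Opens := ⟨(p '' (D : Set W)ᶜ)ᶜ, hc.isOpen_compl⟩
  have ht : t ∈ D' := by
    rintro ⟨w, hw, rfl⟩
    exact hw (h w rfl)
  obtain ⟨_, ⟨U, hU, rfl⟩, htU, hle⟩ := T.isBasis_affineOpens.exists_subset_of_mem_open ht D'.2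
  refine ⟨U, hU, htU, fun w hw => ?_⟩
  by_contra hwD
  exact hle hw ⟨w, hwD, rfl⟩

variable {k : Type u} [Field k] {E : Type u} [AddCommGroup E] [Module k E]
  {P : ProjectiveBundle (vectorSheaf k E)}

variable {T W : Scheme.{u}} {t : T ⟶ Spec (CommRingCat.of k)} {a : W ⟶ P.space} {p : W ⟶ T}

/-- If all coordinates of a family of closed subschemes are constant on the fibre at a prime ideal
of an affine open subset, then that fibre consists of at most one reduced point. -/
lemma surjective_of_const {n : ℕ} (H : IsLengthFamily P.π n t a p) {U : T.Opens} (hU : IsAffineOpen U)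
    {ι : Type} [Fintype ι] (b : Module.Basis ι k E) (c : ι → Γ(W, p ⁻¹ᵁ U)) (hc : HasCoordsOn a (p ⁻¹ᵁ U) b c)
    {κ : Type u} [CommRing κ] [Algebra Γ(T, U) κ] [Algebra Γ(T, U) Γ(W, p ⁻¹ᵁ U)]
    (halg : algebraMap Γ(T, U) Γ(W, p ⁻¹ᵁ U) = (p.app U).hom)
    (hconst : ∀ i, ∃ r : κ, algebraMap κ (κ ⊗[Γ(T, U)] Γ(W, p ⁻¹ᵁ U)) r = 1 ⊗ₜ c i) :
    Function.Surjective (algebraMap κ (κ ⊗[Γ(T, U)] Γ(W, p ⁻¹ᵁ U))) := by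
  have := H.isFinite
  have := H.isClosedImmersion
  let A := Γ(T, U)
  let B := Γ(W, p ⁻¹ᵁ U)
  have hfin : (p.app U).hom.Finite := IsFinite.finite_app p U hU
  have : Module.Finite A B := by
    rw [← halg] at hfin
    exact RingHom.finite_algebraMap.mp hfin
  let f : CommRingCat.of κ ⟶ CommRingCat.of (κ ⊗[A] B) := CommRingCat.ofHom (algebraMap _ _)
  let j : CommRingCat.of B ⟶ CommRingCat.of (κ ⊗[A] B) :=
    CommRingCat.ofHom (Algebra.TensorProduct.includeRight : B →ₐ[A] κ ⊗[A] B).toRingHom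
  let i : CommRingCat.of A ⟶ CommRingCat.of κ := CommRingCat.ofHom (algebraMap _ _)
  have hij : p.app U ≫ j = i ≫ f := by
    refine CommRingCat.hom_ext (RingHom.ext fun r => ?_)
    have h1 := (Algebra.TensorProduct.includeRight : B →ₐ[A] κ ⊗[A] B).commutes r
    rw [halg, IsScalarTower.algebraMap_apply A κ (κ ⊗[A] B)] at h1
    exact h1
  choose r hr using hconst
  -- Two morphisms to the fibre that agree after composition with the projection to the spectrum of
  -- `κ` have the same constant coordinates. So they agree as morphisms to the projective space over
  -- the base, into which the family embeds.
  have : Epi f := by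
    constructor
    intro C g h e
    have e' : Spec.map (j ≫ g) = Spec.map (j ≫ h) := by
      rw [← cancel_mono (hU.preimage p).fromSpec, ← cancel_mono (Limits.pullback.lift a p H.comm)]
      have hp : ∀ g : CommRingCat.of (κ ⊗[A] B) ⟶ C,
          Spec.map (j ≫ g) ≫ (hU.preimage p).fromSpec ≫ p = Spec.map (i ≫ f ≫ g) ≫ hU.fromSpec := by
        intro g
        rw [(isPullback_fromSpec p hU).w, ← Category.assoc, ← Spec.map_comp, ← Category.assoc, hij,
          Category.assoc]
      have ha : ∀ g : CommRingCat.of (κ ⊗[A] B) ⟶ C,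
          HasCoordsOn ((Spec.map (j ≫ g) ≫ (hU.preimage p).fromSpec) ≫ a) ⊤ b
            (fun i => specFun ((f ≫ g).hom (r i))) := by
        intro g
        have hle : ⊤ ≤ (Spec.map (j ≫ g) ≫ (hU.preimage p).fromSpec) ⁻¹ᵁ p ⁻¹ᵁ U := by
          rw [Scheme.Hom.comp_preimage, IsAffineOpen.fromSpec_preimage_self]
          exact le_top
        refine (congrArg (HasCoordsOn _ ⊤ b) (funext fun l => ?_)).mp
          ((hc.comp (Spec.map (j ≫ g) ≫ (hU.preimage p).fromSpec)).mono hle)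
        rw [resF_app_specMap_fromSpec]
        exact congrArg (fun z => specFun (g z)) (hr l).symm
      have hpe : (Spec.map (j ≫ g) ≫ (hU.preimage p).fromSpec) ≫ p =
          (Spec.map (j ≫ h) ≫ (hU.preimage p).fromSpec) ≫ p := by
        rw [Category.assoc, Category.assoc, hp, hp, e]
      have hae : (Spec.map (j ≫ g) ≫ (hU.preimage p).fromSpec) ≫ a =
          (Spec.map (j ≫ h) ≫ (hU.preimage p).fromSpec) ≫ a := by
        refine P.hom_ext b ?_ fun x => ⟨⊤, _, trivial, ha g, ?_⟩
        · rw [Category.assoc _ a, Category.assoc _ a, H.comm, ← Category.assoc, hpe, Category.assoc]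
        · rw [e]
          exact ha h
      apply Limits.pullback.hom_ext
      · rw [Category.assoc _ _ (Limits.pullback.fst _ _), Category.assoc _ _ (Limits.pullback.fst _ _),
          Limits.pullback.lift_fst]
        exact hae
      · rw [Category.assoc _ _ (Limits.pullback.snd _ _), Category.assoc _ _ (Limits.pullback.snd _ _),
          Limits.pullback.lift_snd]
        exact hpe
    have e2 := Spec.map_injective e'
    refine CommRingCat.hom_ext (RingHom.ext fun (x : κ ⊗[A] B) => ?_)
    change g x = h x
    induction x using TensorProduct.induction_on with
    | zero => simp
    | add x y hx hy => rw [map_add, map_add, hx, hy]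
    | tmul s z =>
      have hsz : s ⊗ₜ[A] z = f s * j z := by
        change _ = (s ⊗ₜ 1) * (1 ⊗ₜ z)
        simp
      rw [hsz, map_mul, map_mul]
      congr 1
      · exact congr($e s)
      · exact congr($e2 z)
  exact RingHom.surjective_of_epi_of_finite f (RingHom.finite_algebraMap.mpr inferInstance)

/-- With respect to a local generator of the pullback of `𝒪(1)`, the sections given by vectors are
given by functions which depend linearly on the vector. -/
lemma exists_coordMap (a : W ⟶ P.space) {U : W.Opens} {μ : Γ((Scheme.Modules.pullback a).obj P.O1, U)}
    (hμ : IsGenOn _ U μ) : ∃ L : E →+ Γ(W, U), (∀ v, resM _ le_top (vec a v) = L v • μ) ∧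
      ∀ (r : k) v, L (r • v) = constFun (a ≫ P.π) U r * L v := by
  choose L hL using fun v => hμ.exists_eq_smul_self (resM _ le_top (vec a v))
  refine ⟨AddMonoidHom.mk' L fun v w => hμ.smul_injective_self ?_, hL, fun r v =>
    hμ.smul_injective_self ?_⟩
  · rw [← hL, vec_eq, vectorSection_add, map_add, add_smul, ← vec_eq, ← vec_eq, hL, hL]
  · change L (r • v) • μ = _
    rw [← hL, vec_eq, vectorSection_smul, resM_smul, resF_constFun, ← vec_eq, hL, smul_smul]
    rfl

/-- A generator is not a function on a nonempty base, since it is linearly independent of `1`. -/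
lemma IsGeneratorOn.ne_app {U : T.Opens} {x : Γ(W, p ⁻¹ᵁ U)} (hx : IsGeneratorOn p U x) [Nonempty U]
    (r : Γ(T, U)) : x ≠ p.app U r := by
  intro e
  have h := hx U le_rfl
  rw [resF_self] at h
  have h1 := h.ext (a := r) (b := 0) (a' := 0) (b' := 1) (by
    rw [map_zero, map_one, zero_mul, add_zero, one_mul, zero_add]
    exact e.symm)
  exact zero_ne_one h1.2

/-- An element of the algebra of a family that is a scalar in the fibre at a point does not generate
the algebra of any family that is pulled back along a morphism whose image contains that point. -/
lemma not_isGeneratorOn_of_const [IsAffineHom p] {U : T.Opens} (hU : IsAffineOpen U)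
    [Algebra Γ(T, U) Γ(W, p ⁻¹ᵁ U)] (halg : algebraMap Γ(T, U) Γ(W, p ⁻¹ᵁ U) = (p.app U).hom)
    (q : PrimeSpectrum Γ(T, U)) {z : Γ(W, p ⁻¹ᵁ U)} {r : q.asIdeal.ResidueField}
    (hr : algebraMap _ (q.asIdeal.ResidueField ⊗[Γ(T, U)] Γ(W, p ⁻¹ᵁ U)) r = 1 ⊗ₜ z)
    {T' W' : Scheme.{u}} {w : W' ⟶ W} {p' : W' ⟶ T'} {m : T' ⟶ T} (hpb : IsPullback w p' p m)
    (y' : T') (hy' : m y' = hU.fromSpec q) {V : T'.Opens} (hyV : y' ∈ V) (hV : V ≤ m ⁻¹ᵁ U) :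
    ¬ IsGeneratorOn p' V (resF (p'.preimage_mono hV)
      (w.appLE _ _ (preimage_le_of_comm hpb.w U) z)) := by
  intro hgen
  have : IsAffineHom p' := isAffineHom_isStableUnderBaseChange.of_isPullback hpb inferInstance
  -- Base change to the residue field of `y'`, which is an extension of the residue field at `q`.
  -- There the pullback of `z` is still a scalar, so that it does not generate.
  let h := T'.fromSpecResidueField y'
  have hpb' := IsPullback.of_hasPullback p' h
  have hgen' := hgen.of_isPullback hpb'
  set p'' := Limits.pullback.snd p' h
  set w' := Limits.pullback.fst p' h
  let m' := h ≫ m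
  have hm' : ∀ s, m' s = hU.fromSpec q := by
    intro s
    rw [← hy']
    exact congrArg m (T'.fromSpecResidueField_apply y' s)
  let O : (Spec (T'.residueField y')).Opens := m' ⁻¹ᵁ U
  have hyU : hU.fromSpec q ∈ U := by
    have : q ∈ hU.fromSpec ⁻¹ᵁ U := by rw [hU.fromSpec_preimage_self]; trivial
    exact this
  have hO : ∀ s, s ∈ O := fun s => by
    change m' s ∈ U
    rw [hm']
    exact hyU
  let θ : Γ(T, U) →+* Γ(Spec (T'.residueField y'), O) := (m'.app U).hom
  have hmem : ∀ s : Γ(T, U), s ∉ q.asIdeal ↔ hU.fromSpec q ∈ T.basicOpen s := by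
    intro s
    have : q ∈ hU.fromSpec ⁻¹ᵁ T.basicOpen s ↔ s ∉ q.asIdeal := by
      rw [hU.fromSpec_preimage_basicOpen]
      rfl
    exact this.symm
  have h1 : q.asIdeal ≤ RingHom.ker θ := by
    intro s hs
    rw [RingHom.mem_ker]
    change m'.app U s = 0
    rw [← basicOpen_eq_bot_iff, ← Scheme.preimage_basicOpen]
    ext x
    change m' x ∈ T.basicOpen s ↔ False
    rw [hm', ← hmem]
    exact iff_of_false (fun h => h hs) id
  have h2 : q.asIdeal.primeCompl ≤ (IsUnit.submonoid _).comap θ := by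
    intro s hs
    have := isUnit_resF_basicOpen (m'.app U s) (V := O) (fun x _ => by
      rw [← Scheme.preimage_basicOpen]
      change m' x ∈ T.basicOpen s
      rw [hm']
      exact (hmem s).mp hs) le_rfl
    rw [resF_self] at this
    exact this
  let ϑ := Ideal.ResidueField.lift q.asIdeal θ h1 h2
  let R := Γ(Limits.pullback p' h, p'' ⁻¹ᵁ O)
  let := ((p''.app O).hom.comp θ).toAlgebra
  let f₁ : q.asIdeal.ResidueField →ₐ[Γ(T, U)] R :=
    { toRingHom := (p''.app O).hom.comp ϑ
      commutes' := fun s => congrArg (p''.app O).hom (Ideal.ResidueField.lift_algebraMap _ _ h1 h2 s) }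
  have hpb2 := hpb'.paste_horiz hpb
  let f₂ : Γ(W, p ⁻¹ᵁ U) →ₐ[Γ(T, U)] R :=
    { toRingHom := ((w' ≫ w).appLE _ _ (preimage_le_of_comm hpb2.w U)).hom
      commutes' := fun s => by
        rw [halg]
        change ((w' ≫ w).appLE _ _ _) (p.app U s) = p''.app O (m'.app U s)
        exact (congr($(Scheme.Hom.congr_app hpb2.w.symm U) s)).symm }
  have h3 := congrArg (Algebra.TensorProduct.productMap f₁ f₂) hr
  rw [Algebra.TensorProduct.algebraMap_apply, Algebra.TensorProduct.productMap_apply_tmul,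
    Algebra.TensorProduct.productMap_apply_tmul, map_one, map_one, one_mul, mul_one] at h3
  have h5 : p''.app O (ϑ r) = (w' ≫ w).appLE _ _ (preimage_le_of_comm hpb2.w U) z := h3
  have hOV : O ≤ h ⁻¹ᵁ V := fun s _ => by
    change h s ∈ V
    rw [show h s = y' from T'.fromSpecResidueField_apply y' s]
    exact hyV
  have h6 : resF (p''.preimage_mono hOV) (w'.appLE _ _ (preimage_le_of_comm hpb'.w V)
      (resF (p'.preimage_mono hV) (w.appLE _ _ (preimage_le_of_comm hpb.w U) z))) =
        p''.app O (ϑ r) := by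
    rw [← resF_appLE w' (preimage_le_of_comm hpb'.w (m ⁻¹ᵁ U)) (p''.preimage_mono (h.preimage_mono hV))
      (p'.preimage_mono hV) (preimage_le_of_comm hpb'.w V), resF_resF, h5]
    refine (resF_self le_rfl _).trans ?_
    exact congr($(Scheme.Hom.appLE_comp_appLE w' w _ _ _ _ _) z)
  have : Nonempty O := ⟨⟨_, hO (default : Spec (T'.residueField y'))⟩⟩
  exact (hgen'.mono hOV).ne_app _ h6

lemma exists_isGenOn_comp {a : W ⟶ P.space} {U : W.Opens}
    {μ : Γ((Scheme.Modules.pullback a).obj P.O1, U)} (hμ : IsGenOn _ U μ) {L : E → Γ(W, U)}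
    (hL : ∀ v, resM _ le_top (vec a v) = L v • μ) {W' : Scheme.{u}} (w : W' ⟶ W) :
    ∃ μ' : Γ((Scheme.Modules.pullback (w ≫ a)).obj P.O1, w ⁻¹ᵁ U), IsGenOn _ _ μ' ∧
      ∀ v, resM _ (le_top : w ⁻¹ᵁ U ≤ ⊤) (vec (w ≫ a) v) = w.app U (L v) • μ' := by
  refine ⟨((pullbackComp w a).hom.app P.O1).app (w ⁻¹ᵁ U) (pullSec w μ),
    (hμ.pullSec w).of_iso ((pullbackComp w a).hom.app P.O1), fun v => ?_⟩
  rw [← Hom.app_smul, ← pullSec_smul, ← hL, ← resM_pullTop (U := U) w _ le_top, ← vec_comp]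
  exact (resM_app ((pullbackComp w a).hom.app P.O1) le_top _).symm

/-- The functions `α, β, σ, τ` of a chart are the coefficients of the last coordinate and of `x²`
with respect to the basis `1, x`. -/
lemma IsGeneratorOn.exists_isChartOn {a : W ⟶ P.space} {p : W ⟶ T} {b : Module.Basis (Fin 3) k E}
    {U : T.Opens} {x : Γ(W, p ⁻¹ᵁ U)} (hgen : IsGeneratorOn p U x)
    (hle : p ⁻¹ᵁ U ≤ nonvan (vec a (b 0)))
    (hx : resM _ (le_top : p ⁻¹ᵁ U ≤ ⊤) (vec a (b 1)) =
      x • resM _ (le_top : p ⁻¹ᵁ U ≤ ⊤) (vec a (b 0))) :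
    ∃ α β σ τ : Γ(T, U), IsChartOn a p b U α β σ τ x := by
  obtain ⟨c, hc0, μ, hμ, hc⟩ := exists_hasCoordsOn_nonvan a b 0 hle
  have hc1 : c 1 = x := by
    refine hμ.smul_injective_self ?_
    change c 1 • μ = x • μ
    rw [← hc, hx, hc, hc0, one_smul]
  have hgU := hgen U le_rfl
  rw [resF_self] at hgU
  obtain ⟨α, β, hαβ⟩ := hgU.exists_eq (c 2)
  obtain ⟨τ, σ, hτσ⟩ := hgU.exists_eq (x * x)
  refine ⟨α, β, σ, τ, ⟨?_, hgen, by rw [hτσ, add_comm]⟩⟩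
  refine (congrArg (HasCoordsOn a (p ⁻¹ᵁ U) b) (funext fun i => ?_)).mp ⟨μ, hμ, hc⟩
  fin_cases i
  exacts [hc0, hc1, hαβ]

/-- Suppose that the coordinate given by `b j` does not vanish on the fibre over `y`. Then for every
vector `v` outside of a proper subspace, the quotient `x` of the coordinate given by `v` by that
given by `b j` generates the functions of the family near `y`. -/
lemma exists_subspace_generator (H : IsLengthFamily P.π 2 t a p) {ι : Type} [Fintype ι]
    (b : Module.Basis ι k E) (j : ι) (y : T) (hy : ∀ w, p w = y → w ∈ nonvan (vec a (b j))) :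
    ∃ S : Submodule k E, S ≠ ⊤ ∧ b j ∈ S ∧
      (∀ v ∈ S, ∀ {T' W' : Scheme.{u}} {w : W' ⟶ W} {p' : W' ⟶ T'} {m : T' ⟶ T}, IsPullback w p' p m →
        ∀ (y' : T') (V : T'.Opens) (x : Γ(W', p' ⁻¹ᵁ V)), y' ∈ V → m y' = y → IsGeneratorOn p' V x →
        resM _ (le_top : p' ⁻¹ᵁ V ≤ ⊤) (vec (w ≫ a) v) ≠
          x • resM _ (le_top : p' ⁻¹ᵁ V ≤ ⊤) (vec (w ≫ a) (b j))) ∧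
      ∀ v ∉ S, ∃ (U : T.Opens) (x : Γ(W, p ⁻¹ᵁ U)), y ∈ U ∧
      p ⁻¹ᵁ U ≤ nonvan (vec a (b j)) ∧ IsGeneratorOn p U x ∧
      resM _ (le_top : p ⁻¹ᵁ U ≤ ⊤) (vec a v) = x • resM _ (le_top : p ⁻¹ᵁ U ≤ ⊤) (vec a (b j)) := by
  have := H.isFinite
  have := H.flat
  have := H.locallyOfFinitePresentation
  obtain ⟨U, hU, hyU, hle⟩ := exists_isAffineOpen_preimage_le p _ y hy
  obtain ⟨c, hcj, μ, hμ, hc⟩ := exists_hasCoordsOn_nonvan a b j hle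
  have hvj : resM _ le_top (vec a (b j)) = μ := by rw [hc, hcj, one_smul]
  obtain ⟨L, hL, hLsmul'⟩ := exists_coordMap a hμ
  have hLb : ∀ i, L (b i) = c i := fun i => hμ.smul_injective_self (by rw [← hL, hc])
  have hLsmul : ∀ (r : k) v, L (r • v) = p.app U (constFun t U r) * L v := by
    intro r v
    rw [hLsmul', app_constFun, ← H.comm]
  let A := Γ(T, U)
  let B := Γ(W, p ⁻¹ᵁ U)
  algebraize [(p.app U).hom]
  have halg : algebraMap A B = (p.app U).hom := rfl
  have hfin : Module.Finite A B := IsFinite.finite_app p U hU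
  have hflat : Module.Flat A B := by
    have := Flat.flat_appLE p hU (hU.preimage p) le_rfl
    rw [← app_eq_appLE'] at this
    exact this
  have hfp : Algebra.FinitePresentation A B := by
    have := p.finitePresentation_appLE hU (hU.preimage p) le_rfl
    rw [← app_eq_appLE'] at this
    exact this
  have hfp' : Module.FinitePresentation A B :=
    Module.FinitePresentation.of_finite_of_finitePresentation A B
  let q := hU.primeIdealOf ⟨y, hyU⟩
  have hq : hU.fromSpec q = y := hU.fromSpec_primeIdealOf _
  have hrank : Module.finrank q.asIdeal.ResidueField (q.asIdeal.ResidueField ⊗[A] B) = 2 := by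
    have h1 := q.asIdeal.finrank_fiber_eq_rankAtStalk (M := B)
    refine h1.trans ?_
    rw [← Scheme.Hom.finrank_SpecMap_algebraMap A B q, ← H.finrank_eq y, ← hq]
    exact Scheme.Hom.finrank_of_isPullback _ _ _ _ (isPullback_fromSpec p hU) q
  let κ := q.asIdeal.ResidueField
  -- `S` consists of the vectors whose coordinate is a scalar in the fibre over `y`. It is proper,
  -- because otherwise the fibre would have length at most one.
  let S : Submodule k E :=
    { carrier := {v | ∃ r : κ, algebraMap κ (κ ⊗[A] B) r = 1 ⊗ₜ L v}
      add_mem' := by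
        rintro v w ⟨r, hr⟩ ⟨s, hs⟩
        exact ⟨r + s, by rw [map_add, hr, hs, map_add L, tmul_add]⟩
      zero_mem' := by
        refine ⟨0, ?_⟩
        rw [map_zero, map_zero, tmul_zero]
      smul_mem' := by
        rintro r v ⟨s, hs⟩
        refine ⟨algebraMap A κ (constFun t U r) * s, ?_⟩
        rw [map_mul, hs, hLsmul, ← IsScalarTower.algebraMap_apply, ← Algebra.smul_def]
        change _ = 1 ⊗ₜ ((algebraMap A B (constFun t U r)) * L v)
        rw [← Algebra.smul_def, tmul_smul] }
  refine ⟨S, ?_, ?_, ?_, ?_⟩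
  · intro htop
    have h1 := surjective_of_const H hU b c ⟨μ, hμ, hc⟩ (κ := κ) halg fun i => by
      have : b i ∈ S := htop ▸ Submodule.mem_top
      rw [← hLb i]
      exact this
    have h2 := finrank_le_one_of_surjective h1
    rw [hrank] at h2
    norm_num at h2
  · refine ⟨1, ?_⟩
    rw [map_one, hLb, hcj]
    rfl
  · rintro v ⟨r, hr⟩ T' W' w p' m hpb y' V x hyV hmy hx e
    have hyV' : y' ∈ V ⊓ m ⁻¹ᵁ U := ⟨hyV, by change m y' ∈ U; rw [hmy]; exact hyU⟩
    have hVle : V ⊓ m ⁻¹ᵁ U ≤ V := inf_le_left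
    have hUle : V ⊓ m ⁻¹ᵁ U ≤ m ⁻¹ᵁ U := inf_le_right
    refine not_isGeneratorOn_of_const hU halg q hr hpb y' (by rw [hmy, hq]) hyV' hUle ?_
    have H1 : HasCoordsOn a (p ⁻¹ᵁ U) b (fun i => L (b i)) := ⟨μ, hμ, fun i => hL _⟩
    obtain ⟨μ', hμ', h1⟩ := exists_isGenOn_comp hμ hL w
    have hle : p' ⁻¹ᵁ (V ⊓ m ⁻¹ᵁ U) ≤ w ⁻¹ᵁ p ⁻¹ᵁ U :=
      (p'.preimage_mono hUle).trans (preimage_le_of_comm hpb.w U)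
    have h2 := congrArg (resM _ (p'.preimage_mono hVle)) e
    rw [resM_smul, resM_resM, resM_resM, ← resM_resM (le_top : w ⁻¹ᵁ p ⁻¹ᵁ U ≤ ⊤) hle, h1,
      ← resM_resM (le_top : w ⁻¹ᵁ p ⁻¹ᵁ U ≤ ⊤) hle, h1, hLb, hcj, map_one, one_smul, resM_smul] at h2
    have h3 := hμ'.smul_injective hle h2
    have h4 := hx.mono hVle
    rw [← h3] at h4
    rw [Scheme.Hom.appLE]
    change IsGeneratorOn p' (V ⊓ m ⁻¹ᵁ U) (resF _ (resF _ _))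
    rw [resF_resF]
    exact h4
  · intro v hv
    obtain ⟨g, hgq, hg⟩ := exists_localized_bijective q.asIdeal hrank (L v) fun r hr => hv ⟨r, hr⟩
    obtain ⟨h1, h2⟩ := bijective_localizedModule_map_iff hg
    have hgU := T.basicOpen_le g
    have hlin : ∀ m : Fin 2 → A, Fintype.linearCombination A ![(1 : B), L v] m =
        p.app U (m 0) + p.app U (m 1) * L v := by
      intro m
      rw [Fintype.linearCombination_apply, Fin.sum_univ_two]
      simp [Algebra.smul_def, halg]
    have hgen := isGenerator_basicOpen hU (y := L v) (g := g) (fun z => by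
      obtain ⟨⟨_, n, rfl⟩, m, hm⟩ := h1 z
      rw [hlin] at hm
      refine ⟨n, m 0, m 1, ?_⟩
      rw [← hm, ← map_pow]
      exact (Algebra.smul_def (A := B) (g ^ n) z).symm) fun r s hrs => by
        obtain ⟨⟨_, n, rfl⟩, hn⟩ := h2 ![r, s] (by rw [hlin]; exact hrs)
        exact ⟨n, congrFun hn 0, congrFun hn 1⟩
    refine ⟨T.basicOpen g, _, ?_, (p.preimage_mono hgU).trans hle,
      isGeneratorOn_of_isAffineOpen (hU.basicOpen g) hgen, ?_⟩
    · rw [← hq]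
      have : q ∈ hU.fromSpec ⁻¹ᵁ T.basicOpen g := by
        rw [hU.fromSpec_preimage_basicOpen]
        exact hgq
      exact this
    · have h3 := congrArg (resM _ (p.preimage_mono hgU)) (hL v)
      rw [resM_resM, resM_smul, ← hvj, resM_resM] at h3
      exact h3

/-- The coordinates given by general vectors do not vanish at a given point. -/
lemma exists_subspace_nonvan [Module.Finite k E] (a : W ⟶ P.space) (w : W) :
    ∃ S : Submodule k E, S ≠ ⊤ ∧ ∀ v ∉ S, w ∈ nonvan (vec a v) := by
  let b := Module.finBasis k E
  obtain ⟨U, hw, μ, hμ⟩ := isLineBundle_iff.mp (isLineBundle_pullback a) w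
  obtain ⟨L, hL, hLsmul⟩ := exists_coordMap a hμ
  have H : HasCoordsOn a U b (fun i => L (b i)) := ⟨μ, hμ, fun i => hL _⟩
  obtain ⟨i, hi⟩ := H.exists_mem_basicOpen hw
  refine ⟨{ carrier := {v | W.evaluation U w hw (L v) = 0}
            add_mem' := fun {v v'} hv hv' => by
              change W.evaluation U w hw (L (v + v')) = 0
              rw [map_add, map_add, hv, hv', add_zero]
            zero_mem' := by
              change W.evaluation U w hw (L 0) = 0
              rw [map_zero, map_zero]
            smul_mem' := fun r v hv => by
              change W.evaluation U w hw (L (r • v)) = 0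
              rw [hLsmul, map_mul, hv, mul_zero] }, fun htop => ?_, fun v hv => ?_⟩
  · have h1 : W.evaluation U w hw (L (b i)) = 0 := by
      have : b i ∈ (⊤ : Submodule k E) := trivial
      rw [← htop] at this
      exact this
    exact (W.evaluation_ne_zero_iff_mem_basicOpen w hw _).mpr hi h1
  · exact (Scheme.Modules.mem_nonvan_iff hμ (hL v) hw).mpr
      ((W.evaluation_ne_zero_iff_mem_basicOpen w hw _).mp hv)

lemma exists_basis_of_pair (hE : Module.finrank k E = 3) {v₀ v₁ : E} (h : LinearIndependent k ![v₀, v₁]) :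
    ∃ b : Module.Basis (Fin 3) k E, b 0 = v₀ ∧ b 1 = v₁ := by
  have : Module.Finite k E := Module.finite_of_finrank_pos (by rw [hE]; norm_num)
  obtain ⟨v₂, hv₂⟩ : ∃ v₂, v₂ ∉ Submodule.span k (Set.range ![v₀, v₁]) := by
    by_contra! hall
    have h1 := finrank_range_le_card (R := k) ![v₀, v₁]
    have h2 : Submodule.span k (Set.range ![v₀, v₁]) = ⊤ := eq_top_iff.mpr fun v _ => hall v
    rw [Set.finrank, h2, finrank_top, hE] at h1
    norm_num at h1
  have hli : LinearIndependent k (Fin.snoc (α := fun _ => E) ![v₀, v₁] v₂) :=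
    linearIndependent_finSnoc.mpr ⟨h, hv₂⟩
  refine ⟨basisOfLinearIndependentOfCardEqFinrank hli (by rw [hE]; rfl), ?_, ?_⟩ <;>
    rw [coe_basisOfLinearIndependentOfCardEqFinrank] <;> rfl

/-- At any two points of the base of a family of pairs of points in the projective plane, a general
basis gives charts. -/
lemma IsLengthFamily.exists_isChartOn [Infinite k] (hE : Module.finrank k E = 3)
    (H : IsLengthFamily P.π 2 t a p) (y₁ y₂ : T) : ∃ b : Module.Basis (Fin 3) k E,
      ∀ y, y = y₁ ∨ y = y₂ → ∃ (U : T.Opens) (α β σ τ : Γ(T, U)) (x : Γ(W, p ⁻¹ᵁ U)),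
        y ∈ U ∧ IsChartOn a p b U α β σ τ x := by
  have := H.isFinite
  have : Module.Finite k E := Module.finite_of_finrank_pos (by rw [hE]; norm_num)
  have : Nontrivial E := Module.nontrivial_of_finrank_pos (R := k) (by rw [hE]; norm_num)
  have hfin : ∀ y, (p ⁻¹' {y}).Finite := fun y => p.finite_preimage_singleton y
  choose S hS hSv using fun w : W => exists_subspace_nonvan a w
  have : Finite ↥(p ⁻¹' {y₁} ∪ p ⁻¹' {y₂}) := ((hfin y₁).union (hfin y₂)).to_subtype
  -- The coordinate given by `v₀` shall not vanish at any of the finitely many points of the two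
  -- fibres. This excludes finitely many proper subspaces, whose union is not the whole space since
  -- the field is infinite. The zero subspace is excluded as well, as the fibres may be empty a
  -- priori.
  obtain ⟨v₀, hv₀⟩ : ∃ v₀, v₀ ∉ ⋃ i : Option ↥(p ⁻¹' {y₁} ∪ p ⁻¹' {y₂}),
      ((i.elim ⊥ fun w => S w.1 : Submodule k E) : Set E) := by
    by_contra! hall
    obtain ⟨i, hi⟩ := Subspace.exists_eq_top_of_iUnion_eq_univ (Set.eq_univ_of_forall hall)
    cases i with
    | none => exact bot_ne_top hi
    | some w => exact hS w.1 hi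
  rw [Set.mem_iUnion, not_exists] at hv₀
  have hne : v₀ ≠ 0 := fun h => hv₀ none (by simp [h])
  have hnv : ∀ y, y = y₁ ∨ y = y₂ → ∀ w, p w = y → w ∈ nonvan (vec a v₀) := by
    intro y hy w hw
    refine hSv w v₀ (hv₀ (some ⟨w, ?_⟩))
    rcases hy with rfl | rfl
    exacts [Or.inl hw, Or.inr hw]
  have hpair : ∀ S : Submodule k E, v₀ ∈ S → ∀ v ∉ S, LinearIndependent k ![v₀, v] :=
    fun S h0 v hv => (LinearIndependent.pair_iff' hne).mpr fun r hr =>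
      hv (hr ▸ S.smul_mem r h0)
  obtain ⟨b₀, hb₀⟩ : ∃ b₀ : Module.Basis (Fin 3) k E, b₀ 0 = v₀ := by
    have h1 : k ∙ v₀ ≠ ⊤ := by
      intro h1
      have h2 := finrank_span_singleton (K := k) hne
      rw [h1, finrank_top, hE] at h2
      norm_num at h2
    obtain ⟨v, hv⟩ : ∃ v, v ∉ k ∙ v₀ := by
      by_contra! hall
      exact h1 (eq_top_iff.mpr fun v _ => hall v)
    obtain ⟨b₀, h0, -⟩ := exists_basis_of_pair hE (hpair _ (Submodule.mem_span_singleton_self v₀) v hv)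
    exact ⟨b₀, h0⟩
  obtain ⟨S₁, hS₁, hm₁, -, hx₁⟩ := exists_subspace_generator H b₀ 0 y₁ (by rw [hb₀]; exact hnv _ (.inl rfl))
  obtain ⟨S₂, hS₂, hm₂, -, hx₂⟩ := exists_subspace_generator H b₀ 0 y₂ (by rw [hb₀]; exact hnv _ (.inr rfl))
  rw [hb₀] at hm₁ hm₂ hx₁ hx₂
  -- The quotient of the coordinate given by `v₁` by the one given by `v₀` shall generate the
  -- functions of the family near `y₁` and near `y₂`.
  obtain ⟨v₁, hv₁⟩ : ∃ v₁, v₁ ∉ ⋃ i : Bool, ((if i then S₁ else S₂ : Submodule k E) : Set E) := by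
    by_contra! hall
    obtain ⟨i, hi⟩ := Subspace.exists_eq_top_of_iUnion_eq_univ (Set.eq_univ_of_forall hall)
    cases i
    exacts [hS₂ hi, hS₁ hi]
  rw [Set.mem_iUnion, not_exists] at hv₁
  have h1 : v₁ ∉ S₁ := hv₁ true
  have h2 : v₁ ∉ S₂ := hv₁ false
  obtain ⟨b, hb0, hb1⟩ := exists_basis_of_pair hE (hpair S₁ hm₁ v₁ h1)
  refine ⟨b, fun y hy => ?_⟩
  obtain ⟨U, x, hyU, hle, hgen, hx⟩ : ∃ (U : T.Opens) (x : Γ(W, p ⁻¹ᵁ U)), y ∈ U ∧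
      p ⁻¹ᵁ U ≤ nonvan (vec a (b 0)) ∧ IsGeneratorOn p U x ∧
      resM _ (le_top : p ⁻¹ᵁ U ≤ ⊤) (vec a (b 1)) =
        x • resM _ (le_top : p ⁻¹ᵁ U ≤ ⊤) (vec a (b 0)) := by
    rw [hb0, hb1]
    rcases hy with rfl | rfl
    exacts [hx₁ v₁ h1, hx₂ v₁ h2]
  obtain ⟨α, β, σ, τ, h⟩ := hgen.exists_isChartOn hle hx
  exact ⟨U, α, β, σ, τ, x, hyU, h⟩

end AlgebraicGeometry

namespace AlgebraicGeometry
universe u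
open Scheme.Modules ProjectiveBundle

/-! ### Gluing of morphisms and descent of charts -/

/-- Gluing of morphisms that are characterized by a local property. -/
lemma exists_hom_of_local {X Y : Scheme.{u}} (Q : ∀ U : X.Opens, (U.toScheme ⟶ Y) → Prop)
    (mono : ∀ U V (h : V ≤ U) f, Q U f → Q V (X.homOfLE h ≫ f))
    (unique : ∀ U f f', Q U f → Q U f' → f = f')
    (exist : ∀ x, ∃ U : X.Opens, x ∈ U ∧ ∃ f, Q U f) :
    ∃ f : X ⟶ Y, ∀ x, ∃ U : X.Opens, x ∈ U ∧ Q U (U.ι ≫ f) := by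
  choose U hU f hf using exist
  have hcov : TopologicalSpace.IsOpenCover U := by
    rw [TopologicalSpace.IsOpenCover, eq_top_iff]
    exact fun x _ => TopologicalSpace.Opens.mem_iSup.mpr ⟨x, hU x⟩
  let 𝒰 := X.openCoverOfIsOpenCover U hcov
  have key : ∀ i j, Limits.pullback.fst (U i).ι (U j).ι ≫ f i =
      Limits.pullback.snd (U i).ι (U j).ι ≫ f j := by
    intro i j
    let l : Limits.pullback (U i).ι (U j).ι ⟶ (U i ⊓ U j : X.Opens) :=
      IsOpenImmersion.lift (U i ⊓ U j : X.Opens).ι (Limits.pullback.fst (U i).ι (U j).ι ≫ (U i).ι) (by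
        rintro _ ⟨z, rfl⟩
        rw [Scheme.Opens.range_ι]
        refine ⟨(Limits.pullback.fst (U i).ι (U j).ι z).2, ?_⟩
        rw [Limits.pullback.condition]
        exact (Limits.pullback.snd (U i).ι (U j).ι z).2)
    have hl : l ≫ (U i ⊓ U j : X.Opens).ι = Limits.pullback.fst (U i).ι (U j).ι ≫ (U i).ι :=
      IsOpenImmersion.lift_fac _ _ _
    have h1 : Limits.pullback.fst (U i).ι (U j).ι = l ≫ X.homOfLE inf_le_left := by
      rw [← cancel_mono (U i).ι, Category.assoc, Scheme.homOfLE_ι, hl]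
    have h2 : Limits.pullback.snd (U i).ι (U j).ι = l ≫ X.homOfLE inf_le_right := by
      rw [← cancel_mono (U j).ι, Category.assoc, Scheme.homOfLE_ι, hl, Limits.pullback.condition]
    rw [h1, h2, Category.assoc, Category.assoc,
      unique _ _ _ (mono _ _ inf_le_left _ (hf i)) (mono _ _ inf_le_right _ (hf j))]
  refine ⟨𝒰.glueMorphisms f key, fun x => ⟨U x, hU x, ?_⟩⟩
  have h : (U x).ι ≫ 𝒰.glueMorphisms f key = f x := 𝒰.ι_glueMorphisms f key x
  rw [h]
  exact hf x

namespace HilbertScheme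

variable {k : Type u} [Field k] {E : Type u} [AddCommGroup E] [Module k E]
  {P : ProjectiveBundle (vectorSheaf k E)} {H : HilbertScheme P.π 2} {T : Scheme.{u}}
  {b : Module.Basis (Fin 3) k E} {g : T ⟶ H.space} {c : Fin 4 → Γ(T, ⊤)}

/-- Charts descend along base change, because the conditions on the basis that make a chart possible
near a point only depend on the fibre over this point. -/
lemma HasChart.exists_isChartOn (hg : H.HasChart g b c) (y : T) :
    ∃ (U : H.space.Opens) (α β σ τ : Γ(H.space, U)) (x : Γ(H.family, H.p₂ ⁻¹ᵁ U)),
      g y ∈ U ∧ IsChartOn H.p₁ H.p₂ b U α β σ τ x := by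
  obtain ⟨W, w, p, x, hp, hx⟩ := hg
  have hnv : ∀ z, H.p₂ z = g y → z ∈ nonvan (vec H.p₁ (b 0)) := by
    intro z hz
    obtain ⟨z', h1, -⟩ := Scheme.Pullback.exists_preimage_pullback z y hz
    have h2 := hx.coords.le_nonvan (i := 0) (by exact isUnit_one)
    have h3 : hp.isoPullback.inv z' ∈ nonvan (vec (w ≫ H.p₁) (b 0)) := h2 trivial
    rw [nonvan_vec_comp] at h3
    have h4 : w (hp.isoPullback.inv z') = z := by
      rw [← h1, ← Scheme.Hom.comp_apply, hp.isoPullback_inv_fst]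
    rw [← h4]
    exact h3
  obtain ⟨S, -, -, hS, hS'⟩ := exists_subspace_generator H.isLengthFamily b 0 (g y) hnv
  -- Vectors in `S` do not give a generator of any family obtained by base change, but `b 1` does.
  have h1 : b 1 ∉ S := by
    intro hmem
    refine hS (b 1) hmem hp y ⊤ x trivial rfl hx.gen ?_
    obtain ⟨μ, hμ, hc⟩ := hx.coords
    have e0 : resM _ le_top (vec (w ≫ H.p₁) (b 0)) = (1 : Γ(W, p ⁻¹ᵁ ⊤)) • μ := hc 0
    have e1 : resM _ le_top (vec (w ≫ H.p₁) (b 1)) = x • μ := hc 1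
    rw [e1, e0, one_smul]
  obtain ⟨U, x', hy, hle, hgen, hx'⟩ := hS' _ h1
  obtain ⟨α, β, σ, τ, h⟩ := hgen.exists_isChartOn hle hx'
  exact ⟨U, α, β, σ, τ, x', hy, h⟩

end HilbertScheme

end AlgebraicGeometry

namespace AlgebraicGeometry
universe u
open Scheme.Modules ProjectiveBundle

/-! ### Incidence of points and lines -/

lemma Scheme.Modules.IsGenOn.tensorSection {X : Scheme.{u}} {M N : X.Modules} {U : X.Opens} {μ : Γ(M, U)}
    {ν : Γ(N, U)} (hμ : IsGenOn M U μ) (hν : IsGenOn N U ν) :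
    IsGenOn (tensor M N) U (Scheme.Modules.tensorSection μ ν) := by
  exact (isBasisOn_tensor hμ hν).congr (Equiv.punitProd.{0, 0} Unit).symm fun _ => rfl

variable {k : Type u} [Field k] {E : Type u} [AddCommGroup E] [Module k E]
  {P : ProjectiveBundle (vectorSheaf k E)} {P' : ProjectiveBundle (vectorSheaf k (Module.Dual k E))}
  {T T' W : Scheme.{u}}

/-- The points of `ℙ(E)` given by `a` lie on the hyperplanes given by `f`. -/
def Incident (a : W ⟶ P.space) (f : W ⟶ P'.space) : Prop :=
  ∀ (ι : Type) [Fintype ι] [DecidableEq ι] (b : Module.Basis ι k E),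
    ∑ i, tensorSection (vec a (b i)) (vec f (b.coord i)) = 0

/-- The equation of the incidence variety in terms of coordinates. It does not depend on the basis. -/
lemma exists_incidence {n : ℕ} {a : W ⟶ P.space} {f : W ⟶ P'.space} (e : a ≫ P.π = f ≫ P'.π)
    {b : Module.Basis (Fin n) k E} {U : W.Opens} {c d : Fin n → Γ(W, U)} (hc : HasCoordsOn a U b c)
    (hd : HasCoordsOn f U b.dualBasis d) :
    ∃ ρ, IsGenOn (tensor ((Scheme.Modules.pullback a).obj P.O1) ((Scheme.Modules.pullback f).obj P'.O1)) U ρ ∧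
      ∀ (ι : Type) [Fintype ι] [DecidableEq ι] (b' : Module.Basis ι k E),
        resM _ le_top (∑ i, tensorSection (vec a (b' i)) (vec f (b'.coord i))) =
          (∑ i, c i * d i) • ρ := by
  obtain ⟨μ, hμ, hc⟩ := hc
  obtain ⟨ν, hν, hd⟩ := hd
  refine ⟨tensorSection μ ν, hμ.tensorSection hν, fun ι _ _ b' => ?_⟩
  -- The sum over the basis `b'` is the image of the canonical element of the tensor product of the
  -- space with its dual.
  have key : ∑ j, (∑ i, constFun (a ≫ P.π) U (b.repr (b' j) i) * c i) *
      (∑ i, constFun (f ≫ P'.π) U (b.dualBasis.repr (b'.coord j) i) * d i) = ∑ i, c i * d i := by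
    have h1 : ∀ i i', ∑ j, constFun (a ≫ P.π) U (b.repr (b' j) i) * constFun (f ≫ P'.π) U (b.dualBasis.repr (b'.coord j) i') =
        if i = i' then 1 else 0 := by
      intro i i'
      rw [← e]
      have h2 : ∑ j, b.repr (b' j) i * b.dualBasis.repr (b'.coord j) i' = if i = i' then 1 else 0 := by
        have h3 := congrArg (fun v => b.repr v i) (b'.sum_repr (b i'))
        simp only [map_sum, _root_.map_smul, Finsupp.finsetSum_apply, Finsupp.smul_apply, smul_eq_mul,
          Module.Basis.repr_self, Finsupp.single_apply] at h3
        rw [← ite_congr (propext (eq_comm (a := i') (b := i))) (fun _ => rfl) (fun _ => rfl), ← h3]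
        refine Finset.sum_congr rfl fun j _ => ?_
        rw [Module.Basis.dualBasis_repr, mul_comm]
        rfl
      simp only [← map_mul, ← map_sum, h2]
      split_ifs <;> simp
    calc _ = ∑ j, ∑ i, ∑ i', (constFun (a ≫ P.π) U (b.repr (b' j) i) *
          constFun (f ≫ P'.π) U (b.dualBasis.repr (b'.coord j) i')) * (c i * d i') := by
          refine Finset.sum_congr rfl fun j _ => ?_
          rw [Finset.sum_mul_sum]
          refine Finset.sum_congr rfl fun i _ => Finset.sum_congr rfl fun i' _ => ?_
          ring
      _ = ∑ i, ∑ i', (if i = i' then 1 else 0) * (c i * d i') := by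
          rw [Finset.sum_comm]
          refine Finset.sum_congr rfl fun i _ => ?_
          rw [Finset.sum_comm]
          refine Finset.sum_congr rfl fun i' _ => ?_
          rw [← Finset.sum_mul, h1]
      _ = _ := by simp
  rw [← key, map_sum, Finset.sum_smul]
  refine Finset.sum_congr rfl fun j _ => ?_
  rw [tensorSection_res, resM_vec hc, resM_vec hd, tensorSection_smul_left, tensorSection_smul_right,
    smul_smul]

/-- Incidence in terms of coordinates. -/
lemma Incident.sum_eq_zero {n : ℕ} {a : W ⟶ P.space} {f : W ⟶ P'.space} (h : Incident a f)
    (e : a ≫ P.π = f ≫ P'.π)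
    {b : Module.Basis (Fin n) k E} {U : W.Opens} {c d : Fin n → Γ(W, U)} (hc : HasCoordsOn a U b c)
    (hd : HasCoordsOn f U b.dualBasis d) : ∑ i, c i * d i = 0 := by
  obtain ⟨ρ, hρ, H⟩ := exists_incidence e hc hd
  refine hρ.smul_injective_self ?_
  rw [← H _ b, h _ b, map_zero, zero_smul]

/-- Incidence can be checked locally, in terms of coordinates with respect to varying bases. -/
lemma incident_of_locally {a : W ⟶ P.space} {f : W ⟶ P'.space}
    (e : a ≫ P.π = f ≫ P'.π) (H : ∀ w : W, ∃ U : W.Opens, w ∈ U ∧ ∃ (n : ℕ) (b : Module.Basis (Fin n) k E)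
      (c d : Fin n → Γ(W, U)), HasCoordsOn a U b c ∧ HasCoordsOn f U b.dualBasis d ∧
        ∑ i, c i * d i = 0) : Incident a f := by
  intro ι _ _ b'
  refine section_ext fun w _ => ?_
  obtain ⟨U, hw, n, b, c, d, hc, hd, h0⟩ := H w
  obtain ⟨ρ, -, H⟩ := exists_incidence e hc hd
  refine ⟨U, hw, le_top, ?_⟩
  rw [H _ b', h0, zero_smul, map_zero]

lemma Incident.comp [Module.Finite k E] {a : W ⟶ P.space} {f : W ⟶ P'.space} (h : Incident a f)
    (e : a ≫ P.π = f ≫ P'.π) {W' : Scheme.{u}} (w : W' ⟶ W) : Incident (w ≫ a) (w ≫ f) := by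
  refine incident_of_locally (by simp only [Category.assoc, e]) fun y => ?_
  let b := Module.finBasis k E
  obtain ⟨U, c, -, hU, -, hc⟩ := exists_hasCoordsOn a b (w y)
  obtain ⟨U', d, -, hU', -, hd⟩ := exists_hasCoordsOn f b.dualBasis (w y)
  have h1 := (hc.mono (inf_le_left : U ⊓ U' ≤ U)).comp w
  have h2 := (hd.mono (inf_le_right : U ⊓ U' ≤ U')).comp w
  refine ⟨w ⁻¹ᵁ (U ⊓ U'), ⟨hU, hU'⟩, _, b, _, _, h1, h2, ?_⟩
  have h3 := congrArg (w.app (U ⊓ U')) (h.sum_eq_zero e (hc.mono inf_le_left) (hd.mono inf_le_right))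
  rw [map_zero, map_sum] at h3
  rw [← h3]
  exact Finset.sum_congr rfl fun i _ => (map_mul _ _ _).symm

/-- A chart determines the coordinates of the lines through the pairs of points. -/
lemma IsChartOn.hasCoordsOn_of_incident {a : W ⟶ P.space} {p : W ⟶ T} {b : Module.Basis (Fin 3) k E}
    {U : T.Opens} {α β σ τ : Γ(T, U)} {x : Γ(W, p ⁻¹ᵁ U)} (hx : IsChartOn a p b U α β σ τ x)
    {f : T ⟶ P'.space} (h : Incident a (p ≫ f)) (e : a ≫ P.π = p ≫ f ≫ P'.π) :
    HasCoordsOn f U b.dualBasis ![-α, -β, 1] := by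
  -- The incidence relation for `(1, x, α + β x)` and the line `(d₀, d₁, d₂)` reads `(d₀ + d₂ α) +
  -- (d₁ + d₂ β) x = 0`, and `1, x` are linearly independent.
  have key : ∀ (O : T.Opens) (hO : O ≤ U) (d : Fin 3 → Γ(T, O)), HasCoordsOn f O b.dualBasis d →
      d 0 = - (d 2 * resF hO α) ∧ d 1 = -(d 2 * resF hO β) := by
    intro O hO d hd
    have h1 := h.sum_eq_zero (by rw [e, Category.assoc]) (hx.mono hO).coords (hd.comp p)
    rw [Fin.sum_univ_three] at h1
    change 1 * p.app O (d 0) + resF _ x * p.app O (d 1) + (p.app O (resF hO α) + p.app O (resF hO β) *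
      resF _ x) * p.app O (d 2) = 0 at h1
    have h2 := hx.gen O hO
    have h3 : p.app O (d 0 + d 2 * resF hO α) + p.app O (d 1 + d 2 * resF hO β) * resF (p.preimage_mono hO) x =
      p.app O 0 + p.app O 0 * resF (p.preimage_mono hO) x := by
      rw [map_zero, zero_mul, zero_add, ← h1]
      simp only [map_add, map_mul]
      ring
    obtain ⟨h4, h5⟩ := h2.ext h3
    exact ⟨eq_neg_of_add_eq_zero_left h4, eq_neg_of_add_eq_zero_left h5⟩
  -- Since the coordinates `d₀` and `d₁` are multiples of `d₂`, the coordinate `d₂` has no zeros.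
  have hU : U ≤ nonvan (vec f (b.dualBasis 2)) := by
    intro y hy
    obtain ⟨O, d, -, hyO, -, hd⟩ := exists_hasCoordsOn f b.dualBasis y
    have hd' := hd.mono (inf_le_left : O ⊓ U ≤ O)
    have hy' : y ∈ O ⊓ U := ⟨hyO, hy⟩
    obtain ⟨h1, h2⟩ := key _ inf_le_right _ hd'
    rw [hd'.mem_nonvan_iff hy']
    obtain ⟨i, hi⟩ := hd'.exists_mem_basicOpen hy'
    fin_cases i
    · change y ∈ T.basicOpen (resF _ (d 0)) at hi
      rw [h1, ← mul_neg, Scheme.basicOpen_mul] at hi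
      exact hi.1
    · change y ∈ T.basicOpen (resF _ (d 1)) at hi
      rw [h2, ← mul_neg, Scheme.basicOpen_mul] at hi
      exact hi.1
    · exact hi
  obtain ⟨d, hd2, hd⟩ := exists_hasCoordsOn_nonvan f b.dualBasis 2 hU
  obtain ⟨h0, h1⟩ := key U le_rfl d hd
  rw [hd2, one_mul, resF_self] at h0 h1
  refine (congrArg (HasCoordsOn f U _) (funext fun i => ?_)).mp hd
  fin_cases i
  exacts [h0, h1, hd2]

/-- The points `(1, x, α + β x)` lie on the line with coordinates `(-α, -β, 1)`. -/
lemma IsChartOn.incidence {a : W ⟶ P.space} {p : W ⟶ T} {b : Module.Basis (Fin 3) k E}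
    {U : T.Opens} {α β σ τ : Γ(T, U)} {x : Γ(W, p ⁻¹ᵁ U)} (hx : IsChartOn a p b U α β σ τ x)
    {f : T ⟶ P'.space} (hf : HasCoordsOn f U b.dualBasis ![-α, -β, 1]) :
    ∃ c d : Fin 3 → Γ(W, p ⁻¹ᵁ U), HasCoordsOn a (p ⁻¹ᵁ U) b c ∧
      HasCoordsOn (p ≫ f) (p ⁻¹ᵁ U) b.dualBasis d ∧ ∑ i, c i * d i = 0 := by
  refine ⟨_, _, hx.coords, hf.comp p, ?_⟩
  rw [Fin.sum_univ_three]
  change 1 * p.app U (-α) + x * p.app U (-β) + (p.app U α + p.app U β * x) * p.app U 1 = 0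
  rw [map_neg, map_neg, map_one]
  ring

/-- Coordinates can be checked on an open subscheme. -/
lemma HasCoordsOn.of_ι {ι : Type*} [Fintype ι] {g : T ⟶ P.space} {b : Module.Basis ι k E} {U V : T.Opens}
    (h : V ≤ U) {c : ι → Γ(T, V)} {j : ι} (hj : c j = 1)
    (H : HasCoordsOn (U.ι ≫ g) (U.ι ⁻¹ᵁ V) b (fun i => U.ι.app V (c i))) : HasCoordsOn g V b c := by
  have hV : V ≤ nonvan (vec g (b j)) := by
    intro y hy
    have h1 := H.le_nonvan (i := j) (by rw [hj, map_one]; exact isUnit_one)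
    have h2 := h1 (show (⟨y, h hy⟩ : U.toScheme) ∈ U.ι ⁻¹ᵁ V from hy)
    rw [nonvan_vec_comp] at h2
    exact h2
  obtain ⟨d, hdj, hd⟩ := exists_hasCoordsOn_nonvan g b j hV
  obtain ⟨w, -, hw⟩ := H.exists_unit (hd.comp U.ι)
  have hw1 := hw j
  rw [hdj, hj, map_one, mul_one] at hw1
  subst hw1
  have hiso : IsIso (U.ι.app V) := U.ι.isIso_app _ (by simpa using h)
  convert hd
  ext i
  refine (ConcreteCategory.bijective_of_isIso (U.ι.app V)).1 ?_
  rw [← one_mul (U.ι.app V (c i))]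
  exact (hw i).symm

end AlgebraicGeometry

namespace AlgebraicGeometry
universe u
open Scheme.Modules ProjectiveBundle

variable {k : Type u} [Field k] {E : Type u} [AddCommGroup E] [Module k E]
  {P : ProjectiveBundle (vectorSheaf k E)} {P' : ProjectiveBundle (vectorSheaf k (Module.Dual k E))}

/-- A version of `ProjectiveBundle.hom_ext` where the basis may vary. -/
lemma ProjectiveBundle.hom_ext_of_locally {ι : Type*} [Fintype ι] {T : Scheme.{u}} {g g' : T ⟶ P.space}
    (h : g ≫ P.π = g' ≫ P.π)
    (H : ∀ x : T, ∃ (U : T.Opens) (b : Module.Basis ι k E) (c : ι → Γ(T, U)), x ∈ U ∧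
      HasCoordsOn g U b c ∧ HasCoordsOn g' U b c) : g = g' := by
  refine Scheme.hom_ext_of_forall _ _ fun x => ?_
  obtain ⟨U, b, c, hx, h1, h2⟩ := H x
  refine ⟨U, hx, hom_ext b (by simp only [Category.assoc, h]) fun y => ?_⟩
  exact ⟨_, _, y.2, h1.comp U.ι, h2.comp U.ι⟩

/-- On a chart, the morphism to the dual plane is determined by the incidence relation. -/
lemma HilbertScheme.IsSpanMap.hasCoordsOn {H : HilbertScheme P.π 2} {ψ : H.space ⟶ P'.space}
    (h : H.IsSpanMap ψ) (hψ : ψ ≫ P'.π = H.π) {b : Module.Basis (Fin 3) k E} {U : H.space.Opens}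
    {α β σ τ : Γ(H.space, U)} {x : Γ(H.family, H.p₂ ⁻¹ᵁ U)} (hx : IsChartOn H.p₁ H.p₂ b U α β σ τ x) :
    HasCoordsOn ψ U b.dualBasis ![-α, -β, 1] := by
  refine hx.hasCoordsOn_of_incident (fun ι _ _ b => ?_) (by rw [hψ, H.isLengthFamily.comm])
  simpa only [vec_eq] using h ι b

/-- The morphism that sends a pair of points of the projective plane to the line that it spans. -/
theorem HilbertScheme.exists_isSpanMap [Infinite k] (hE : Module.finrank k E = 3)
    (P' : ProjectiveBundle (vectorSheaf k (Module.Dual k E))) (H : HilbertScheme P.π 2) :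
    ∃ ψ : H.space ⟶ P'.space, ψ ≫ P'.π = H.π ∧ H.IsSpanMap ψ := by
  have : Module.Finite k E := Module.finite_of_finrank_pos (by rw [hE]; norm_num)
  have hcomm := H.isLengthFamily.comm
  have hpb : ∀ U : H.space.Opens, IsPullback (H.p₂ ⁻¹ᵁ U).ι (H.p₂ ∣_ U) H.p₂ U.ι := fun U =>
    (isPullback_morphismRestrict H.p₂ U).flip
  have hcomm' : ∀ (U : H.space.Opens) (f : U.toScheme ⟶ P'.space), f ≫ P'.π = U.ι ≫ H.π →
      ((H.p₂ ⁻¹ᵁ U).ι ≫ H.p₁) ≫ P.π = H.p₂ ∣_ U ≫ f ≫ P'.π := by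
    intro U f h
    rw [h, Category.assoc, hcomm, ← (hpb U).w_assoc]
  have hchart : ∀ (U : H.space.Opens) (y : U.toScheme), ∃ (b : Module.Basis (Fin 3) k E)
      (V : U.toScheme.Opens), ∃ α β σ τ x,
      y ∈ V ∧ IsChartOn ((H.p₂ ⁻¹ᵁ U).ι ≫ H.p₁) (H.p₂ ∣_ U) b V α β σ τ x := by
    intro U y
    obtain ⟨b, hb⟩ := H.isLengthFamily.exists_isChartOn hE (U.ι y) (U.ι y)
    obtain ⟨V, α, β, σ, τ, x, hyV, hx⟩ := hb _ (.inl rfl)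
    exact ⟨b, _, _, _, _, _, _, hyV, hx.of_isPullback (hpb U)⟩
  -- The morphisms on open subsets that satisfy the incidence relation are unique and exist locally
  -- by the description on charts.
  obtain ⟨ψ, hψ⟩ := exists_hom_of_local (X := H.space) (Y := P'.space)
    (fun U f => f ≫ P'.π = U.ι ≫ H.π ∧
      Incident (P := P) (P' := P') ((H.p₂ ⁻¹ᵁ U).ι ≫ H.p₁) (H.p₂ ∣_ U ≫ f)) (by
    rintro U V h f ⟨h1, h2⟩
    refine ⟨by rw [Category.assoc, h1, Scheme.homOfLE_ι_assoc], ?_⟩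
    have h3 := h2.comp (by rw [hcomm' U f h1, Category.assoc])
      (H.family.homOfLE (H.p₂.preimage_mono h))
    have e : H.family.homOfLE (H.p₂.preimage_mono h) ≫ H.p₂ ∣_ U = H.p₂ ∣_ V ≫ H.space.homOfLE h := by
      rw [← cancel_mono U.ι]
      simp
    rw [Scheme.homOfLE_ι_assoc, reassoc_of% e] at h3
    exact h3) (by
    rintro U f f' ⟨h1, h2⟩ ⟨h1', h2'⟩
    refine hom_ext_of_locally (ι := Fin 3) (by rw [h1, h1']) fun y => ?_
    obtain ⟨b, V, α, β, σ, τ, x, hy, hx⟩ := hchart U y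
    exact ⟨V, b.dualBasis, ![-α, -β, 1], hy, hx.hasCoordsOn_of_incident h2 (hcomm' U f h1),
      hx.hasCoordsOn_of_incident h2' (hcomm' U f' h1')⟩) (by
    intro y
    obtain ⟨b, hb⟩ := H.isLengthFamily.exists_isChartOn hE y y
    obtain ⟨U, α, β, σ, τ, x, hyU, hx⟩ := hb _ (.inl rfl)
    have hx' := (hx.of_isPullback (hpb U)).mono (show ⊤ ≤ U.ι ⁻¹ᵁ U by simp)
    obtain ⟨f, hf, hfc⟩ := exists_of_coords (P := P') (U.ι ≫ H.π) b.dualBasis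
      (![-(resF _ (U.ι.app U α)), -(resF _ (U.ι.app U β)), 1]) 2 isUnit_one
    refine ⟨U, hyU, f, hf, incident_of_locally (by rw [hcomm' U f hf, Category.assoc]) fun w => ?_⟩
    obtain ⟨c, d, hc, hd, h0⟩ := hx'.incidence hfc
    exact ⟨(H.p₂ ∣_ U) ⁻¹ᵁ ⊤, trivial, 3, b, c, d, hc, hd, h0⟩)
  have hπ : ψ ≫ P'.π = H.π := by
    refine Scheme.hom_ext_of_forall _ _ fun y => ?_
    obtain ⟨U, hy, h1, -⟩ := hψ y
    exact ⟨U, hy, by rw [← h1, Category.assoc]⟩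
  refine ⟨ψ, hπ, ?_⟩
  suffices h : Incident (P := P) (P' := P') H.p₁ (H.p₂ ≫ ψ) by
    intro ι _ _ b
    simpa only [vec_eq] using h ι b
  refine incident_of_locally (by rw [Category.assoc, hπ, hcomm]) fun w => ?_
  obtain ⟨b, hb⟩ := H.isLengthFamily.exists_isChartOn hE (H.p₂ w) (H.p₂ w)
  obtain ⟨V, α, β, σ, τ, x, hyV, hx⟩ := hb _ (.inl rfl)
  obtain ⟨U, hyU, h1, h2⟩ := hψ (H.p₂ w)
  have hx' := hx.mono (inf_le_left : V ⊓ U ≤ V)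
  have h3 := (hx'.of_isPullback (hpb U)).hasCoordsOn_of_incident h2 (hcomm' U _ h1)
  have h4 : HasCoordsOn ψ (V ⊓ U) b.dualBasis
      ![-(resF inf_le_left α), -(resF inf_le_left β), 1] := by
    refine HasCoordsOn.of_ι inf_le_right (j := 2) rfl ?_
    refine (congrArg (HasCoordsOn _ _ _) (funext fun i => ?_)).mp h3
    fin_cases i
    exacts [(map_neg _ _).symm, (map_neg _ _).symm, (map_one _).symm]
  obtain ⟨c, d, hc, hd, h0⟩ := hx'.incidence h4
  exact ⟨H.p₂ ⁻¹ᵁ (V ⊓ U), ⟨hyV, hyU⟩, 3, b, c, d, hc, hd, h0⟩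

end AlgebraicGeometry

namespace AlgebraicGeometry
universe u
open Scheme.Modules ProjectiveBundle

variable {k : Type u} [Field k] {E : Type u} [AddCommGroup E] [Module k E]

/-! ### The kernel bundle on the dual projective plane -/

/-- Evaluation of linear forms at a vector, over an arbitrary base. -/
lemma exists_evHom {T : Scheme.{u}} [Module.Finite k E] (f : T ⟶ Spec (CommRingCat.of k)) (v : E) :
    ∃ φ : (Scheme.Modules.pullback f).obj (vectorSheaf k (Module.Dual k E)) ⟶ structureSheaf T,
      ∀ l : Module.Dual k E, vectorSection φ l = unitSec ⊤ (constFun f ⊤ (l v)) := by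
  let B := Module.finBasis k (Module.Dual k E)
  obtain ⟨φ, hφ⟩ := (isBasisOn_pullSec_vecSec f B).exists_hom
    fun i => unitSec ⊤ (constFun f ⊤ (B i v))
  refine ⟨φ, fun l => ?_⟩
  have h1 : ∀ i, vectorSection φ (B i) = unitSec ⊤ (constFun f ⊤ (B i v)) := hφ
  conv_lhs => rw [← B.sum_repr l, vectorSection_sum]
  have h2 : l v = ∑ i, B.repr l i * B i v := by
    conv_lhs => rw [← B.sum_repr l]
    rw [LinearMap.sum_apply]
    rfl
  rw [h2, map_sum, map_sum]
  refine Finset.sum_congr rfl fun i _ => ?_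
  rw [vectorSection_smul, h1, ← _root_.map_smul, smul_eq_mul, map_mul (constFun f ⊤)]

namespace ProjectiveBundle

variable (P' : ProjectiveBundle (vectorSheaf k (Module.Dual k E)))

/-- The homomorphism `E^∨ ⊗ 𝒪 ⟶ 𝒪` given by evaluation at a vector. -/
noncomputable def evHom [Module.Finite k E] (v : E) :
    (Scheme.Modules.pullback P'.π).obj (vectorSheaf k (Module.Dual k E)) ⟶ structureSheaf P'.space :=
  (exists_evHom P'.π v).choose

/-- The inclusion of the kernel bundle. -/
noncomputable def kerι :
    P'.kernelBundle ⟶ (Scheme.Modules.pullback P'.π).obj (vectorSheaf k (Module.Dual k E)) :=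
  Limits.kernel.ι P'.quot

/-- The linear form on the sections of the kernel bundle given by evaluation at a vector. -/
noncomputable def ev [Module.Finite k E] (v : E) (W : P'.space.Opens) :
    Γ(P'.kernelBundle, W) →ₗ[Γ(P'.space, W)] Γ(P'.space, W) :=
  (unitSec W).symm.toLinearMap ∘ₗ
    { toFun := fun m => (P'.evHom v).app W (P'.kerι.app W m)
      map_add' := fun m n => by rw [map_add, map_add]
      map_smul' := fun r m => by rw [Hom.app_smul, Hom.app_smul]; rfl }

lemma unitSec_ev [Module.Finite k E] (v : E) {W : P'.space.Opens} (m : Γ(P'.kernelBundle, W)) :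
    unitSec W (P'.ev v W m) = (P'.evHom v).app W (P'.kerι.app W m) :=
  LinearEquiv.apply_symm_apply _ _

lemma ev_resM [Module.Finite k E] (v : E) {V W : P'.space.Opens} (h : W ≤ V) (m : Γ(P'.kernelBundle, V)) :
    P'.ev v W (resM _ h m) = resF h (P'.ev v V m) := by
  refine (unitSec W).injective ?_
  rw [unitSec_ev, ← resM_unitSec, unitSec_ev, ← resM_app, ← resM_app]

/-- Evaluation at a vector, as a section of the dual of the kernel bundle. -/
noncomputable def evSec [Module.Finite k E] (v : E) : dualSections P'.kernelBundle ⊤ :=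
  ⟨fun W => P'.ev v W.1, fun _ _ h m => P'.ev_resM v h m⟩

/-- The section of `E^∨ ⊗ 𝒪` given by a linear form. -/
noncomputable def formSec (l : Module.Dual k E) :
    Γ((Scheme.Modules.pullback P'.π).obj (vectorSheaf k (Module.Dual k E)), ⊤) :=
  vectorSection (𝟙 _) l

lemma quot_formSec (l : Module.Dual k E) :
    P'.quot.app ⊤ (P'.formSec l) = vectorSection P'.quot l := rfl

variable {P'}

lemma evHom_formSec [Module.Finite k E] (v : E) (l : Module.Dual k E) :
    (P'.evHom v).app ⊤ (P'.formSec l) = unitSec ⊤ (constFun P'.π ⊤ (l v)) :=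
  (exists_evHom P'.π v).choose_spec l

lemma ev_eq [Module.Finite k E] (v : E) {W : P'.space.Opens} {κ : Γ(P'.kernelBundle, W)} {ι : Type} [Fintype ι]
    {c : ι → Γ(P'.space, W)} {l : ι → Module.Dual k E}
    (h : P'.kerι.app W κ = ∑ i, c i • resM _ le_top (P'.formSec (l i))) :
    P'.ev v W κ = ∑ i, c i * constFun P'.π W (l i v) := by
  refine (unitSec W).injective ?_
  rw [unitSec_ev, h, map_sum, map_sum]
  refine Finset.sum_congr rfl fun i _ => ?_
  rw [Hom.app_smul, resM_app, evHom_formSec, resM_unitSec, resF_constFun, ← _root_.map_smul, smul_eq_mul]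

variable (P') in
lemma exists_chartFun (b : Module.Basis (Fin 3) k E) :
    ∃ d : Fin 3 → Γ(P'.space, P'.chart (b.coord 2)), ∀ i,
      resM _ (le_top : P'.chart (b.coord 2) ≤ ⊤) (vectorSection P'.quot (b.coord i)) =
        d i • resM _ (le_top : P'.chart (b.coord 2) ≤ ⊤) (vectorSection P'.quot (b.coord 2)) := by
  choose d hd using fun i => (isGenOn_nonvan (vectorSection P'.quot (b.coord 2))).exists_eq_smul_self
    (resM _ le_top (vectorSection P'.quot (b.coord i)))
  exact ⟨d, hd⟩

variable (P') in
/-- The coordinates on the affine chart of the dual plane where the last coordinate is nonzero,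
normalized by this coordinate. -/
noncomputable def chartFun (b : Module.Basis (Fin 3) k E) : Fin 3 → Γ(P'.space, P'.chart (b.coord 2)) :=
  (exists_chartFun P' b).choose

lemma vectorSection_chartFun (b : Module.Basis (Fin 3) k E) (i : Fin 3) :
    resM _ (le_top : P'.chart (b.coord 2) ≤ ⊤) (vectorSection P'.quot (b.coord i)) =
      P'.chartFun b i • resM _ (le_top : P'.chart (b.coord 2) ≤ ⊤) (vectorSection P'.quot (b.coord 2)) :=
  (exists_chartFun P' b).choose_spec i

lemma exists_kerSec (b : Module.Basis (Fin 3) k E) (i : Fin 2) :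
    ∃ κ : Γ(P'.kernelBundle, P'.chart (b.coord 2)), P'.kerι.app _ κ =
      ∑ j : Fin 2, (![1, -P'.chartFun b i.castSucc] j : Γ(P'.space, P'.chart (b.coord 2))) •
        resM _ le_top (P'.formSec (![b.coord i.castSucc, b.coord 2] j)) := by
  refine exists_kernel_section P'.quot _ ?_
  rw [map_sum, Fin.sum_univ_two, Hom.app_smul, Hom.app_smul, resM_app, resM_app, quot_formSec, quot_formSec]
  change (1 : Γ(P'.space, P'.chart (b.coord 2))) • resM _ le_top (vectorSection P'.quot (b.coord i.castSucc)) +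
    (-P'.chartFun b i.castSucc) • resM _ le_top (vectorSection P'.quot (b.coord 2)) = 0
  rw [vectorSection_chartFun b i.castSucc, one_smul, neg_smul, add_neg_cancel]

/-- The sections `e₀ - c₀ e₂` and `e₁ - c₁ e₂` of the kernel bundle on an affine chart of the
dual plane with coordinates `(c₀, c₁, 1)`, where `e₀, e₁, e₂` is the dual basis of `b`. -/
noncomputable def kerSec (b : Module.Basis (Fin 3) k E) (i : Fin 2) :
    Γ(P'.kernelBundle, P'.chart (b.coord 2)) :=
  (exists_kerSec b i).choose

lemma ev_kerSec [Module.Finite k E] (b : Module.Basis (Fin 3) k E) (i : Fin 2) (v : E) :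
    P'.ev v _ (kerSec b i) = constFun P'.π _ (b.coord i.castSucc v) -
      P'.chartFun b i.castSucc * constFun P'.π _ (b.coord 2 v) := by
  refine (ev_eq v (exists_kerSec b i).choose_spec).trans ?_
  rw [Fin.sum_univ_two]
  change 1 * _ + (-_) * _ = _
  rw [one_mul, neg_mul, ← sub_eq_add_neg]
  rfl

lemma isBasisOn_kerSec (b : Module.Basis (Fin 3) k E) :
    IsBasisOn P'.kernelBundle (P'.chart (b.coord 2)) (kerSec b) := by
  let D := P'.chart (b.coord 2)
  have h0 : IsBasisOn ((Scheme.Modules.pullback P'.π).obj (vectorSheaf k (Module.Dual k E))) D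
      (fun i => resM _ le_top (P'.formSec (b.coord i))) := by
    have h1 := (isBasisOn_pullSec_vecSec P'.π b.dualBasis).mono (show D ≤ P'.π ⁻¹ᵁ ⊤ from le_top)
    rw [Module.Basis.coe_dualBasis] at h1
    exact h1
  have hι : ∀ i, P'.kerι.app D (kerSec b i) =
      resM _ le_top (P'.formSec (b.coord i.castSucc)) -
        P'.chartFun b i.castSucc • resM _ le_top (P'.formSec (b.coord 2)) := by
    intro i
    refine (exists_kerSec b i).choose_spec.trans ?_
    rw [Fin.sum_univ_two]
    change (1 : Γ(P'.space, D)) • _ + (-_ : Γ(P'.space, D)) • _ = _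
    rw [one_smul, neg_smul, ← sub_eq_add_neg]
    rfl
  -- Together with `e₂`, which maps to a generator of the tautological quotient, the two sections
  -- form a basis of `E^∨ ⊗ 𝒪`.
  refine isBasisOn_kernel (κ := Fin 1) P'.quot (e := fun _ => resM _ le_top (P'.formSec (b.coord 2))) ?_ ?_
  · refine (h0.congr (finSumFinEquiv (m := 2) (n := 1)) fun _ => rfl).of_generate _ ?_
    rintro (i | i)
    · refine ⟨Sum.elim (Pi.single i 1) (fun _ => P'.chartFun b i.castSucc), ?_⟩
      rw [Fintype.sum_sum_type]
      simp only [Sum.elim_inl, Sum.elim_inr, Finset.univ_unique, Finset.sum_singleton, Pi.single_apply,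
        ite_smul, one_smul, zero_smul, Finset.sum_ite_eq', Finset.mem_univ, if_true]
      exact (sub_eq_iff_eq_add.mp (hι i).symm)
    · refine ⟨Sum.elim 0 1, ?_⟩
      rw [Fintype.sum_sum_type]
      simp only [Sum.elim_inl, Sum.elim_inr, Finset.univ_unique, Finset.sum_singleton, Pi.zero_apply, Pi.one_apply,
        zero_smul, Finset.sum_const_zero, zero_add, one_smul]
      have : i = 0 := Subsingleton.elim _ _
      subst this
      rfl
  · have h2 := isGenOn_nonvan (vectorSection P'.quot (b.coord 2))
    refine (h2.congr (Equiv.equivPUnit (Fin 1)) fun i => ?_)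
    rw [resM_app, quot_formSec]
    rfl

end ProjectiveBundle

end AlgebraicGeometry

namespace AlgebraicGeometry
universe u
open Scheme.Modules ProjectiveBundle

variable {k : Type u} [Field k] {E : Type u} [AddCommGroup E] [Module k E]
  {P' : ProjectiveBundle (vectorSheaf k (Module.Dual k E))} {T : Scheme.{u}} {f : T ⟶ P'.space}
  {b : Module.Basis (Fin 3) k E} {U V : T.Opens} {α β : Γ(T, U)}

/-! ### Symmetric powers of the pullback of the kernel bundle -/

/-- The expansion of a linear form with respect to a dual basis. -/
lemma Scheme.Modules.IsBasisOn.dualSec_eq_sum {X : Scheme.{u}} {M : X.Modules} {U : X.Opens} {ι : Type*} [Fintype ι]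
    [DecidableEq ι] {s : ι → Γ(M, U)} (hs : IsBasisOn M U s) (z : ι → dualSections M U)
    (hz : ∀ i j, (z i).1 ⟨U, le_rfl⟩ (s j) = if i = j then 1 else 0) (y : dualSections M U) :
    dualSec y = ∑ i, y.1 ⟨U, le_rfl⟩ (s i) • dualSec (z i) := by
  have h : y = ∑ i, y.1 ⟨U, le_rfl⟩ (s i) • z i := by
    refine hs.dualSections_ext le_rfl fun j => ?_
    rw [dualSections_sum_apply, resM_self]
    have h1 : ∀ i, (y.1 ⟨U, le_rfl⟩ (s i) • z i).1 ⟨U, le_rfl⟩ (s j) =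
        if i = j then y.1 ⟨U, le_rfl⟩ (s i) else 0 := fun i => by
      rw [dualSections_smul_apply, resF_self, hz]
      split_ifs
      exacts [mul_one _, mul_zero _]
    rw [Finset.sum_congr rfl fun i _ => h1 i]
    simp
  conv_lhs => rw [h, dualSec_sum]
  exact Finset.sum_congr rfl fun i _ => dualSec_smul _ _

namespace ProjectiveBundle.HasCoordsOn

lemma le_chart (h : HasCoordsOn f U b.dualBasis ![-α, -β, 1]) : U ≤ f ⁻¹ᵁ P'.chart (b.coord 2) := by
  rw [preimage_chart]
  have := h.le_nonvan (i := 2) isUnit_one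
  rwa [Module.Basis.coe_dualBasis] at this

/-- The pullbacks of the coordinates on the affine chart of the dual plane are the coordinates of
the morphism. -/
lemma app_chartFun (h : HasCoordsOn f U b.dualBasis ![-α, -β, 1]) (i : Fin 3) :
    resF h.le_chart (f.app _ (P'.chartFun b i)) = ![-α, -β, 1] i := by
  generalize h.le_chart = h1
  obtain ⟨μ, hμ, hc⟩ := h
  rw [Module.Basis.coe_dualBasis] at hc
  refine hμ.smul_injective_self ?_
  rw [← hc]
  have h2 : resM _ (le_top : U ≤ ⊤) (vec f (b.coord 2)) = μ := (hc 2).trans (one_smul _ _)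
  rw [← h2]
  have h3 := congrArg (pullSec f) (vectorSection_chartFun b i (P' := P'))
  rw [pullSec_smul, pullSec_resM, pullSec_resM] at h3
  have h4 := congrArg (resM _ h1) h3
  rw [resM_smul, resM_resM, resM_resM] at h4
  exact h4.symm

end ProjectiveBundle.HasCoordsOn

/-- The value on a vector of the pullback of the linear form `y₀ + y₁ X` on the line, for the
line with coordinates `(-α, -β, 1)`, whose points are `(y₀, y₁, α y₀ + β y₁)`. -/
noncomputable def lineForm {R : Type*} [CommRing R] (γ : k →+* R) (b : Module.Basis (Fin 3) k E) (α β : R)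
    (v : E) : Polynomial R :=
  Polynomial.C (γ (b.coord 0 v) + α * γ (b.coord 2 v)) +
    Polynomial.C (γ (b.coord 1 v) + β * γ (b.coord 2 v)) * Polynomial.X

/-- The vectors whose product is the monomial of degree `j` in the second variable. -/
noncomputable def monVec (b : Module.Basis (Fin 3) k E) {d : ℕ} (j : Fin (d + 1)) (i : Fin d) : E :=
  if (i : ℕ) < j then b 1 else b 0

section

variable [Module.Finite k E]

/-- The section of `f^* Sym^d K^∨` given by a product of `d` vectors, where vectors are considered as
linear forms on the kernel bundle `K`. -/
noncomputable def prodSec (f : T ⟶ P'.space) {d : ℕ} (v : Fin d → E) :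
    Γ((Scheme.Modules.pullback f).obj (P'.kernelBundle.dual.sym d), ⊤) :=
  pullSec (U := ⊤) f (symSec fun i => dualSec (P'.evSec (v i)))

lemma ev_kerSec_basis (b : Module.Basis (Fin 3) k E) (i j : Fin 2) :
    P'.ev (b i.castSucc) _ (kerSec b j) = if i = j then 1 else 0 := by
  rw [ev_kerSec]
  fin_cases i <;> fin_cases j <;> simp

lemma dualRes_evSec_kerSec (b : Module.Basis (Fin 3) k E) (v : E) (j : Fin 2) :
    (dualRes (le_top : P'.chart (b.coord 2) ≤ ⊤) (P'.evSec v)).1 ⟨_, le_rfl⟩ (kerSec b j) =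
      P'.ev v _ (kerSec b j) := rfl

/-- The vectors `b 0` and `b 1`, as linear forms on the kernel bundle, form the basis dual to
`kerSec b`. -/
lemma isBasisOn_dual_kernelBundle (b : Module.Basis (Fin 3) k E) :
    IsBasisOn P'.kernelBundle.dual (P'.chart (b.coord 2))
      (fun i : Fin 2 => resM _ le_top (dualSec (P'.evSec (b i.castSucc)))) := by
  simp only [resM_dualSec]
  refine isBasisOn_dual (isBasisOn_kerSec b) _ fun i j => ?_
  rw [dualRes_evSec_kerSec, ev_kerSec_basis]
  congr

lemma resM_dualSec_evSec (b : Module.Basis (Fin 3) k E) (v : E) :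
    resM _ (le_top : P'.chart (b.coord 2) ≤ ⊤) (dualSec (P'.evSec v)) =
      P'.ev v _ (kerSec b 0) • resM _ le_top (dualSec (P'.evSec (b 0))) +
      P'.ev v _ (kerSec b 1) • resM _ le_top (dualSec (P'.evSec (b 1))) := by
  have h1 := (isBasisOn_kerSec b).dualSec_eq_sum
    (fun i : Fin 2 => dualRes le_top (P'.evSec (b i.castSucc))) (fun i j => ev_kerSec_basis b i j)
    (dualRes le_top (P'.evSec v))
  rw [Fin.sum_univ_two, ← resM_dualSec, ← resM_dualSec, ← resM_dualSec] at h1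
  exact h1

lemma symMon_evSec {d : ℕ} (b : Module.Basis (Fin 3) k E) (j : Fin (d + 1)) :
    symMon (fun i : Fin 2 => resM _ (le_top : P'.chart (b.coord 2) ≤ ⊤)
      (dualSec (P'.evSec (b i.castSucc)))) j =
        resM _ le_top (symSec fun i => dualSec (P'.evSec (monVec b j i))) := by
  rw [resM_symSec, symMon]
  congr 1
  ext i
  unfold monVec
  split_ifs <;> rfl

lemma resM_pullSec_symMon (h : U ≤ f ⁻¹ᵁ P'.chart (b.coord 2)) {d : ℕ} (j : Fin (d + 1)) :
    resM _ h (pullSec f (symMon (fun i : Fin 2 => resM _ (le_top : P'.chart (b.coord 2) ≤ ⊤)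
      (dualSec (P'.evSec (b i.castSucc)))) j)) =
        resM _ (le_top : U ≤ ⊤) (prodSec f (monVec b j)) := by
  rw [symMon_evSec, pullSec_resM, resM_resM]
  rfl

/-- The products of the vectors `b 0` and `b 1` form a basis of `f^* Sym^d K^∨`. -/
lemma isBasisOn_prodSec (h : HasCoordsOn f U b.dualBasis ![-α, -β, 1]) (d : ℕ) :
    IsBasisOn ((Scheme.Modules.pullback f).obj (P'.kernelBundle.dual.sym d)) U
      (fun j : Fin (d + 1) => resM _ le_top (prodSec f (monVec b j))) := by
  have h1 := ((isBasisOn_sym (isBasisOn_dual_kernelBundle b (P' := P')) d).pullSec f).mono h.le_chart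
  exact h1.congr (Equiv.refl _) fun j => (resM_pullSec_symMon h.le_chart j).symm

/-- The expansion of a product of vectors into monomials: a vector is a linear form on the line, and
the coefficients are those of the product of the corresponding polynomials. -/
lemma resM_prodSec (h : HasCoordsOn f U b.dualBasis ![-α, -β, 1]) {d : ℕ} (v : Fin d → E) :
    resM _ (le_top : U ≤ ⊤) (prodSec f v) = ∑ j : Fin (d + 1),
      (∏ i, lineForm (constFun (f ≫ P'.π) U) b α β (v i)).coeff j • resM _ le_top (prodSec f (monVec b j)) := by
  have h1 := symSec_eq_sum (isBasisOn_dual_kernelBundle b (P' := P')) (k := d)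
    (fun i => P'.ev (v i) _ (kerSec b 0)) (fun i => P'.ev (v i) _ (kerSec b 1))
    (fun i => resM _ le_top (dualSec (P'.evSec (v i)))) (fun i => resM_dualSec_evSec b (v i))
  rw [← resM_symSec] at h1
  have h2 := congrArg (fun s => resM _ h.le_chart (pullSec f s)) h1
  beta_reduce at h2
  rw [pullSec_resM, resM_resM, pullSec_sum, map_sum] at h2
  refine h2.trans (Finset.sum_congr rfl fun j _ => ?_)
  rw [pullSec_smul, resM_smul]
  congr 1
  · let φ := (resF h.le_chart).comp (f.app (P'.chart (b.coord 2))).hom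
    change φ _ = _
    rw [← Polynomial.coeff_map, Polynomial.map_prod]
    congr 1
    refine Finset.prod_congr rfl fun i _ => ?_
    have hc : ∀ a, φ (constFun P'.π _ a) = constFun (f ≫ P'.π) U a := fun a => by
      change resF _ (f.app _ _) = _
      rw [app_constFun, resF_constFun]
    have hd : ∀ i, φ (P'.chartFun b i) = ![-α, -β, 1] i := h.app_chartFun
    have he : ∀ (l : Fin 2) (v : E), φ (P'.ev v _ (kerSec b l)) =
        constFun (f ≫ P'.π) U (b.coord l.castSucc v) -
          ![-α, -β, 1] l.castSucc * constFun (f ≫ P'.π) U (b.coord 2 v) := by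
      intro l v
      rw [ev_kerSec, map_sub, map_mul, hc, hc, hd]
    rw [Polynomial.map_add, Polynomial.map_mul, Polynomial.map_C, Polynomial.map_C, Polynomial.map_X,
      he, he, lineForm]
    simp
  · exact resM_pullSec_symMon h.le_chart j

end

end AlgebraicGeometry

namespace AlgebraicGeometry
universe u
open Scheme.Modules ProjectiveBundle

variable {k : Type u} [Field k] {E : Type u} [AddCommGroup E] [Module k E]
  {P' : ProjectiveBundle (vectorSheaf k (Module.Dual k E))} {T : Scheme.{u}} {f : T ⟶ P'.space}
  {b : Module.Basis (Fin 3) k E} {U V : T.Opens} {α β : Γ(T, U)} {O : P'.space.Opens}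

/-! ### The symmetric square of the pullback of the kernel bundle -/

/-- The section of `f^* Sym² K` given by the product of two sections of `K`. -/
noncomputable def pairSec (f : T ⟶ P'.space) (κ κ' : Γ(P'.kernelBundle, O)) :
    Γ((Scheme.Modules.pullback f).obj (P'.kernelBundle.sym 2), f ⁻¹ᵁ O) :=
  pullSec f (symSec ![κ, κ'])

/-- The basis of `f^* Sym² K` given by the monomials in the two sections `kerSec b`. -/
noncomputable def pairMon (f : T ⟶ P'.space) (b : Module.Basis (Fin 3) k E) (j : Fin 3) :
    Γ((Scheme.Modules.pullback f).obj (P'.kernelBundle.sym 2), f ⁻¹ᵁ P'.chart (b.coord 2)) :=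
  pullSec f (symMon (k := 2) (kerSec b) j)

lemma isBasisOn_pairMon (f : T ⟶ P'.space) (b : Module.Basis (Fin 3) k E) :
    IsBasisOn ((Scheme.Modules.pullback f).obj (P'.kernelBundle.sym 2)) (f ⁻¹ᵁ P'.chart (b.coord 2))
      (pairMon f b) :=
  (isBasisOn_sym (isBasisOn_kerSec b) 2).pullSec f

lemma pairMon_eq (f : T ⟶ P'.space) (b : Module.Basis (Fin 3) k E) (j : Fin 3) :
    pairMon f b j = pairSec f (kerSec b (![0, 1, 1] j)) (kerSec b (![0, 0, 1] j)) := by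
  unfold pairMon pairSec symMon
  congr 2
  ext i
  fin_cases j <;> fin_cases i <;> rfl

/-- The function on `V` given by evaluating the pullback of a section of the kernel bundle at a
vector. -/
noncomputable def evAt [Module.Finite k E] (f : T ⟶ P'.space) (h : V ≤ f ⁻¹ᵁ O) (v : E)
    (κ : Γ(P'.kernelBundle, O)) : Γ(T, V) :=
  resF h (f.app O (P'.ev v O κ))

/-- The expansion of a section of the kernel bundle. The coefficients are the values at `b 0` and `b
1`. -/
lemma resM_kernelBundle [Module.Finite k E] (b : Module.Basis (Fin 3) k E) (h : O ≤ P'.chart (b.coord 2))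
    (κ : Γ(P'.kernelBundle, O)) : κ = P'.ev (b 0) O κ • resM _ h (kerSec b 0) +
      P'.ev (b 1) O κ • resM _ h (kerSec b 1) := by
  obtain ⟨c, rfl⟩ := (isBasisOn_kerSec b).exists_eq h κ
  have key : ∀ i : Fin 2, P'.ev (b i.castSucc) O (∑ j, c j • resM _ h (kerSec b j)) = c i := by
    intro i
    rw [map_sum]
    have : ∀ j, P'.ev (b i.castSucc) O (c j • resM _ h (kerSec b j)) = if i = j then c j else 0 := by
      intro j
      rw [_root_.map_smul, ev_resM, ev_kerSec_basis]
      split_ifs <;> simp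
    rw [Finset.sum_congr rfl fun j _ => this j]
    simp
  have h0 := key 0
  have h1 := key 1
  rw [show b (Fin.castSucc (0 : Fin 2)) = b 0 from rfl] at h0
  rw [show b (Fin.castSucc (1 : Fin 2)) = b 1 from rfl] at h1
  rw [h0, h1, Fin.sum_univ_two]

lemma coeff_mul_linear {R : Type*} [CommRing R] (A B A' B' : R) :
    ((Polynomial.C A + Polynomial.C B * Polynomial.X) * (Polynomial.C A' + Polynomial.C B' * Polynomial.X)).coeff 0 =
        A * A' ∧
    ((Polynomial.C A + Polynomial.C B * Polynomial.X) * (Polynomial.C A' + Polynomial.C B' * Polynomial.X)).coeff 1 =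
        A * B' + B * A' ∧
    ((Polynomial.C A + Polynomial.C B * Polynomial.X) * (Polynomial.C A' + Polynomial.C B' * Polynomial.X)).coeff 2 =
        B * B' := by
  have : (Polynomial.C A + Polynomial.C B * Polynomial.X) * (Polynomial.C A' + Polynomial.C B' * Polynomial.X) =
      Polynomial.C (A * A') + Polynomial.C (A * B' + B * A') * Polynomial.X +
        Polynomial.C (B * B') * Polynomial.X ^ 2 := by
    simp only [map_add, map_mul]
    ring
  rw [this]
  simp only [Polynomial.coeff_add, Polynomial.coeff_C_mul, Polynomial.coeff_C, Polynomial.coeff_X,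
    Polynomial.coeff_X_pow]
  norm_num

/-- The expansion of a product of two sections of the kernel bundle. -/
lemma resM_pairSec [Module.Finite k E] (h : V ≤ f ⁻¹ᵁ P'.chart (b.coord 2)) (hO : V ≤ f ⁻¹ᵁ O)
    (κ κ' : Γ(P'.kernelBundle, O)) :
    resM _ hO (pairSec f κ κ') =
      (evAt f hO (b 0) κ * evAt f hO (b 0) κ') • resM _ h (pairMon f b 0) +
      (evAt f hO (b 0) κ * evAt f hO (b 1) κ' + evAt f hO (b 1) κ * evAt f hO (b 0) κ') •
        resM _ h (pairMon f b 1) +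
      (evAt f hO (b 1) κ * evAt f hO (b 1) κ') • resM _ h (pairMon f b 2) := by
  let D := O ⊓ P'.chart (b.coord 2)
  have hV : V ≤ f ⁻¹ᵁ D := fun x hx => ⟨hO hx, h hx⟩
  have h1 := symSec_eq_sum ((isBasisOn_kerSec b).mono (inf_le_right : D ≤ _)) (k := 2)
    (fun i => P'.ev (b 0) _ (resM _ inf_le_left (![κ, κ'] i)))
    (fun i => P'.ev (b 1) _ (resM _ inf_le_left (![κ, κ'] i)))
    (fun i => resM _ (inf_le_left : D ≤ O) (![κ, κ'] i))
    (fun i => resM_kernelBundle b inf_le_right _)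
  rw [← resM_symSec] at h1
  simp only [← resM_symMon] at h1
  have h2 := congrArg (fun s => resM _ hV (pullSec f s)) h1
  beta_reduce at h2
  rw [pullSec_resM, resM_resM, pullSec_sum, map_sum, Fin.sum_univ_three] at h2
  simp only [pullSec_smul, resM_smul, pullSec_resM, resM_resM, Fin.prod_univ_two] at h2
  refine h2.trans ?_
  have he : ∀ (v : E) (κ : Γ(P'.kernelBundle, O)), resF hV (f.app D (P'.ev v _ (resM _ inf_le_left κ))) =
      evAt f hO v κ := by
    intro v κ
    rw [ev_resM, app_resF, resF_resF]
    rfl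
  let φ := (resF hV).comp (f.app D).hom
  have he' : ∀ (v : E) (κ : Γ(P'.kernelBundle, O)), φ (P'.ev v _ (resM _ inf_le_left κ)) =
      evAt f hO v κ := he
  obtain ⟨c0, c1, c2⟩ := coeff_mul_linear (P'.ev (b 0) D (resM _ inf_le_left κ))
    (P'.ev (b 1) D (resM _ inf_le_left κ)) (P'.ev (b 0) D (resM _ inf_le_left κ'))
    (P'.ev (b 1) D (resM _ inf_le_left κ'))
  refine congrArg₂ (· + ·) (congrArg₂ (· + ·) (congrArg (· • _) ((congrArg φ c0).trans ?_))
    (congrArg (· • _) ((congrArg φ c1).trans ?_))) (congrArg (· • _) ((congrArg φ c2).trans ?_))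
  · rw [map_mul, he', he']
  · rw [map_add, map_mul, map_mul, he', he', he', he']
  · rw [map_mul, he', he']

end AlgebraicGeometry

namespace AlgebraicGeometry
universe u
open Scheme.Modules ProjectiveBundle

variable {k : Type u} [Field k] {E : Type u} [AddCommGroup E] [Module k E]
  {P : ProjectiveBundle (vectorSheaf k E)}

/-! ### Sections of the powers of the tautological line bundle -/

variable (P) in
/-- The section of `𝒪(d)` given by the product of `d` vectors. -/
noncomputable def powSec : {d : ℕ} → (Fin d → E) → Γ(P.O d, ⊤)
  | 0, _ => unitSec ⊤ 1
  | _ + 1, v => tensorSection (powSec fun i => v i.castSucc) (vectorSection P.quot (v (Fin.last _)))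

lemma isGenOn_powSec (v : E) (d : ℕ) :
    IsGenOn (P.O d) (P.chart v) (resM _ le_top (powSec P fun _ : Fin d => v)) := by
  induction d with
  | zero => exact (isBasisOn_structureSheaf _).mono le_top
  | succ d ih =>
    have h := ih.tensorSection (isGenOn_nonvan (vectorSection P.quot v))
    have e : resM _ (le_top : P.chart v ≤ ⊤) (powSec P fun _ : Fin (d + 1) => v) =
        tensorSection (resM _ le_top (powSec P fun _ : Fin d => v))
          (resM _ le_top (vectorSection P.quot v)) := tensorSection_res _ _ _
    rw [e]
    exact h

/-- A product of vectors as a multiple of the power of a vector `v₀`. -/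
lemma resM_powSec {U : P.space.Opens} {μ : Γ(P.O1, U)} {v₀ : E}
    (h₀ : resM _ le_top (vectorSection P.quot v₀) = μ) {d : ℕ} (v : Fin d → E) (c : Fin d → Γ(P.space, U))
    (hc : ∀ i, resM _ le_top (vectorSection P.quot (v i)) = c i • μ) :
    resM _ (le_top : U ≤ ⊤) (powSec P v) = (∏ i, c i) • resM _ le_top (powSec P fun _ : Fin d => v₀) := by
  induction d with
  | zero =>
    rw [Finset.univ_eq_empty, Finset.prod_empty, one_smul]
    rfl
  | succ d ih =>
    have h1 := ih (fun i => v i.castSucc) (fun i => c i.castSucc) (fun i => hc _)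
    have h2 : resM _ (le_top : U ≤ ⊤) (powSec P v) =
        tensorSection (resM _ le_top (powSec P fun i => v i.castSucc))
          (resM _ le_top (vectorSection P.quot (v (Fin.last _)))) := tensorSection_res _ _ _
    have h3 : resM _ (le_top : U ≤ ⊤) (powSec P fun _ : Fin (d + 1) => v₀) =
        tensorSection (resM _ le_top (powSec P fun _ : Fin d => v₀))
          (resM _ le_top (vectorSection P.quot v₀)) := tensorSection_res _ _ _
    rw [h2, h3, h1, hc, h₀, tensorSection_smul_left, tensorSection_smul_right, smul_smul,
      Fin.prod_univ_castSucc]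
    rfl

/-- The polynomial of a vector, evaluated at `x`, is its coordinate at the point `(1, x, α + β x)`.
-/
lemma lineForm_eval₂ {R B : Type*} [CommRing R] [CommRing B] (φ : R →+* B) (γ : k →+* R)
    (b : Module.Basis (Fin 3) k E) (α β : R) (x : B) (v : E) :
    (lineForm γ b α β v).eval₂ φ x = φ (γ (b.coord 0 v)) * 1 + φ (γ (b.coord 1 v)) * x +
      φ (γ (b.coord 2 v)) * (φ α + φ β * x) := by
  simp only [lineForm, Polynomial.eval₂_add, Polynomial.eval₂_mul, Polynomial.eval₂_C, Polynomial.eval₂_X,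
    map_add, map_mul]
  ring

lemma natDegree_lineForm_le {R : Type*} [CommRing R] (γ : k →+* R)
    (b : Module.Basis (Fin 3) k E) (α β : R) (v : E) : (lineForm γ b α β v).natDegree ≤ 1 := by
  unfold lineForm
  compute_degree

lemma natDegree_prod_lineForm_le {R : Type*} [CommRing R] (γ : k →+* R)
    (b : Module.Basis (Fin 3) k E) (α β : R) {d : ℕ} (v : Fin d → E) :
    (∏ i, lineForm γ b α β (v i)).natDegree ≤ d := by
  refine (Polynomial.natDegree_prod_le _ _).trans ?_
  refine (Finset.sum_le_sum fun i _ => natDegree_lineForm_le γ b α β (v i)).trans ?_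
  simp

variable {T W : Scheme.{u}} {a : W ⟶ P.space} {p : W ⟶ T} {b : Module.Basis (Fin 3) k E}
    {U : T.Opens} {α β σ τ : Γ(T, U)} {x : Γ(W, p ⁻¹ᵁ U)}

lemma IsChartOn.le_chart (h : IsChartOn a p b U α β σ τ x) : p ⁻¹ᵁ U ≤ a ⁻¹ᵁ P.chart (b 0) := by
  rw [preimage_chart]
  exact h.coords.le_nonvan (i := 0) isUnit_one

lemma IsChartOn.isGenOn_powSec (h : IsChartOn a p b U α β σ τ x) (d : ℕ) :
    IsGenOn ((Scheme.Modules.pullback a).obj (P.O d)) (p ⁻¹ᵁ U)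
      (resM _ le_top (pullSec (U := ⊤) a (powSec P fun _ : Fin d => b 0))) := by
  have h1 := ((AlgebraicGeometry.isGenOn_powSec (P := P) (b 0) d).pullSec a).mono h.le_chart
  simp only [pullSec_resM, resM_resM] at h1
  exact h1

/-- The value of a product of vectors on a pair of points `(1, x, α + β x)`, relative to the
generator given by the power of `b 0`, is the value at `x` of the corresponding polynomial. -/
lemma IsChartOn.resM_powSec (h : IsChartOn a p b U α β σ τ x) {t : T ⟶ Spec (CommRingCat.of k)}
    (ht : a ≫ P.π = p ≫ t) {d : ℕ} (v : Fin d → E) :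
    resM _ (le_top : p ⁻¹ᵁ U ≤ ⊤) (pullSec (U := ⊤) a (powSec P v)) =
      (∏ i, lineForm (constFun t U) b α β (v i)).eval₂ (p.app U).hom x •
        resM _ (le_top : p ⁻¹ᵁ U ≤ ⊤) (pullSec (U := ⊤) a (powSec P fun _ : Fin d => b 0)) := by
  have hD := h.le_chart
  obtain ⟨μ, hμ, hc⟩ := h.coords
  have hc₀ : ∀ i, ∃ c : Γ(P.space, P.chart (b 0)),
      resM _ (le_top : P.chart (b 0) ≤ ⊤) (vectorSection P.quot (v i)) =
        c • resM _ (le_top : P.chart (b 0) ≤ ⊤) (vectorSection P.quot (b 0)) :=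
    fun i => (isGenOn_nonvan (vectorSection P.quot (b 0))).exists_eq_smul_self _
  choose c hc' using hc₀
  have h1 := AlgebraicGeometry.resM_powSec rfl v c hc'
  have h2 := congrArg (fun s => resM _ hD (pullSec a s)) h1
  beta_reduce at h2
  rw [pullSec_resM, resM_resM, pullSec_smul, resM_smul, pullSec_resM, resM_resM, map_prod, map_prod] at h2
  refine h2.trans ?_
  rw [Polynomial.eval₂_finsetProd]
  congr 1
  refine Finset.prod_congr rfl fun i _ => hμ.smul_injective_self ?_
  have h3 := congrArg (fun s => resM _ hD (pullSec a s)) (hc' i)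
  beta_reduce at h3
  rw [pullSec_resM, resM_resM, pullSec_smul, resM_smul, pullSec_resM, resM_resM] at h3
  have h0 : resM _ (le_top : p ⁻¹ᵁ U ≤ ⊤) (vec a (b 0)) = μ := (hc 0).trans (one_smul _ _)
  have h4 : resM _ (le_top : p ⁻¹ᵁ U ≤ ⊤) (vec a (v i)) = resF hD (a.app _ (c i)) • μ := by
    rw [← h0]
    exact h3
  rw [← h4, resM_vec hc, lineForm_eval₂, Fin.sum_univ_three, ht]
  have h5 : ∀ r, (p.app U).hom (constFun t U r) = constFun (p ≫ t) (p ⁻¹ᵁ U) r := fun r => app_constFun _ _ _ _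
  rw [h5, h5, h5]
  rfl

end AlgebraicGeometry

namespace AlgebraicGeometry
universe u
open Scheme.Modules ProjectiveBundle

section

variable {X : Scheme.{u}} {M : X.Modules} {U : X.Opens} {ι : Type*} [Fintype ι] {s : ι → Γ(M, U)}

lemma Scheme.Modules.IsBasisOn.exists_linearMap (hs : IsBasisOn M U s) {A : Type*} [AddCommGroup A] [Module Γ(X, U) A]
    (n : ι → A) : ∃ φ : Γ(M, U) →ₗ[Γ(X, U)] A, ∀ c : ι → Γ(X, U), φ (∑ i, c i • s i) = ∑ i, c i • n i := by
  refine ⟨(hs.basis le_rfl).constr ℤ n, fun c => ?_⟩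
  rw [map_sum]
  refine Finset.sum_congr rfl fun i _ => ?_
  rw [_root_.map_smul]
  congr 1
  have h : hs.basis le_rfl i = s i := by simp
  rw [← h]
  exact (hs.basis le_rfl).constr_basis ℤ n i

lemma Scheme.Modules.IsBasisOn.span_eq_top (hs : IsBasisOn M U s) {S : Set Γ(M, U)} (h : ∀ i, s i ∈ S) :
    Submodule.span Γ(X, U) S = ⊤ := by
  refine eq_top_iff.mpr fun m _ => ?_
  obtain ⟨c, rfl⟩ := hs.exists_eq_self m
  exact Submodule.sum_mem _ fun i _ => Submodule.smul_mem _ _ (Submodule.subset_span (h i))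

end

/-- The element with the coefficients of a polynomial as coordinates. -/
noncomputable def polySum {R A : Type*} [CommRing R] [AddCommGroup A] [Module R A] {n : ℕ} (e : Fin n → A) :
    Polynomial R →ₗ[R] A where
  toFun p := ∑ j : Fin n, p.coeff (j : ℕ) • e j
  map_add' p q := by simp [add_smul, Finset.sum_add_distrib]
  map_smul' r p := by simp [mul_smul, Finset.smul_sum]

lemma polySum_apply {R A : Type*} [CommRing R] [AddCommGroup A] [Module R A] {n : ℕ} (e : Fin n → A)
    (p : Polynomial R) : polySum e p = ∑ j : Fin n, p.coeff (j : ℕ) • e j := rfl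

/-- A tuple of coefficients is that of a polynomial of bounded degree. -/
lemma exists_coeff_eq {R : Type*} [CommRing R] {d : ℕ} (c : Fin (d + 1) → R) :
    ∃ p : Polynomial R, p.natDegree ≤ d ∧ ∀ j : Fin (d + 1), p.coeff j = c j := by
  refine ⟨∑ j : Fin (d + 1), Polynomial.monomial j (c j), ?_, fun j => ?_⟩
  · exact Polynomial.natDegree_sum_le_of_forall_le _ _ fun j _ =>
      (Polynomial.natDegree_monomial_le _).trans (Nat.lt_succ_iff.mp j.2)
  · rw [Polynomial.finsetSum_coeff, Finset.sum_eq_single j]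
    · rw [Polynomial.coeff_monomial, if_pos rfl]
    · intro i _ hi
      rw [Polynomial.coeff_monomial, if_neg (fun h => hi (Fin.ext h))]
    · simp

namespace HilbertScheme

variable {k : Type u} [Field k] {E : Type u} [AddCommGroup E] [Module k E]
  {P : ProjectiveBundle (vectorSheaf k E)} {P' : ProjectiveBundle (vectorSheaf k (Module.Dual k E))}
  (H : HilbertScheme P.π 2)

/-! ### The evaluation homomorphism to the tautological sheaf -/

/-- The section of the tautological sheaf of `𝒪(d)` given by the product of `d` vectors. -/
noncomputable def tautSec {d : ℕ} (v : Fin d → E) : Γ(H.tautological (P.O d), ⊤) :=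
  pullSec (U := ⊤) H.p₁ (powSec P v)

/-- The section of the tautological sheaf of `𝒪(d)` given by the product of a function on the family
with the `d`-th power of a vector. -/
noncomputable def mulSec (v : E) (d : ℕ) (U : H.space.Opens) :
    Γ(H.family, H.p₂ ⁻¹ᵁ U) →+ Γ(H.tautological (P.O d), U) :=
  (LinearMap.toSpanSingleton Γ(H.family, H.p₂ ⁻¹ᵁ U)
    Γ((Scheme.Modules.pullback H.p₁).obj (P.O d), H.p₂ ⁻¹ᵁ U)
    (resM _ le_top (pullSec (U := ⊤) H.p₁ (powSec P fun _ : Fin d => v)))).toAddMonoidHom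

variable {H} {b : Module.Basis (Fin 3) k E} {U : H.space.Opens} {α β σ τ : Γ(H.space, U)}
    {x : Γ(H.family, H.p₂ ⁻¹ᵁ U)}

lemma mulSec_app_mul (v : E) (d : ℕ) (c : Γ(H.space, U)) (r : Γ(H.family, H.p₂ ⁻¹ᵁ U)) :
    H.mulSec v d U (H.p₂.app U c * r) = c • H.mulSec v d U r :=
  mul_smul (H.p₂.app U c) r (resM ((Scheme.Modules.pullback H.p₁).obj (P.O d)) (le_top : H.p₂ ⁻¹ᵁ U ≤ ⊤)
    (pullSec (U := ⊤) H.p₁ (powSec P fun _ : Fin d => v)))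

/-- On a chart, the tautological sheaf is the direct image of the structure sheaf of the family. -/
lemma bijective_mulSec (h : IsChartOn H.p₁ H.p₂ b U α β σ τ x) (d : ℕ) :
    Function.Bijective (H.mulSec (b 0) d U) :=
  ⟨fun _ _ e => (h.isGenOn_powSec d).smul_injective_self e, fun s => by
    obtain ⟨c, hc⟩ := (h.isGenOn_powSec d).exists_eq_smul_self s
    exact ⟨c, hc.symm⟩⟩

lemma resM_tautSec (h : IsChartOn H.p₁ H.p₂ b U α β σ τ x) {d : ℕ} (v : Fin d → E) :
    resM _ (le_top : U ≤ ⊤) (H.tautSec v) = H.mulSec (b 0) d U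
      ((∏ i, lineForm (constFun H.π U) b α β (v i)).eval₂ (H.p₂.app U).hom x) :=
  h.resM_powSec H.isLengthFamily.comm v

lemma sum_smul_mulSec (d : ℕ) {p : Polynomial Γ(H.space, U)} (hp : p.natDegree ≤ d) :
    ∑ j : Fin (d + 1), p.coeff j • H.mulSec (b 0) d U (x ^ (j : ℕ)) =
      H.mulSec (b 0) d U (p.eval₂ (H.p₂.app U).hom x) := by
  rw [Polynomial.eval₂_eq_sum_range' _ (Nat.lt_succ_of_le hp), ← Fin.sum_univ_eq_sum_range
    (fun j => (H.p₂.app U).hom (p.coeff j) * x ^ j), map_sum]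
  exact Finset.sum_congr rfl fun j _ => (mulSec_app_mul _ _ _ _).symm

variable [Module.Finite k E] {ψ : H.space ⟶ P'.space}

/-- The homomorphism that restricts the forms of degree `d` on the line through a pair of points to
the pair of points. -/
lemma exists_restriction [Infinite k] (hE : Module.finrank k E = 3) (hπ : ψ ≫ P'.π = H.π)
    (hψ : H.IsSpanMap ψ) (d : ℕ) :
    ∃ g : (Scheme.Modules.pullback ψ).obj (P'.kernelBundle.dual.sym d) ⟶ H.tautological (P.O d),
      ∀ v : Fin d → E, g.app ⊤ (prodSec ψ v) = H.tautSec v := by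
  -- The homomorphism is determined by its values on products of vectors, which do not depend on a
  -- chart. So it suffices to construct it on charts.
  obtain ⟨g, hg⟩ := exists_hom_of_relation
    (M := (Scheme.Modules.pullback ψ).obj (P'.kernelBundle.dual.sym d)) (N := H.tautological (P.O d))
    {U | ∃ b α β σ τ x, IsChartOn H.p₁ H.p₂ b U α β σ τ x} (fun y => by
      obtain ⟨b, hb⟩ := H.isLengthFamily.exists_isChartOn hE y y
      obtain ⟨U, α, β, σ, τ, x, hy, hx⟩ := hb y (.inl rfl)
      exact ⟨U, ⟨b, α, β, σ, τ, x, hx⟩, hy⟩) (by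
      rintro U ⟨b, α, β, σ, τ, x, hx⟩ V hV
      exact ⟨b, _, _, _, _, _, hx.mono hV⟩)
    (fun U m n => ∃ v : Fin d → E, m = resM _ le_top (prodSec ψ v) ∧ n = resM _ le_top (H.tautSec v)) (by
      rintro U V hV m n ⟨v, rfl, rfl⟩
      exact ⟨v, resM_resM _ _ _, resM_resM _ _ _⟩) (by
      rintro U ⟨b, α, β, σ, τ, x, hx⟩
      have hc := hψ.hasCoordsOn hπ hx
      obtain ⟨φ, hφ⟩ := (isBasisOn_prodSec hc d).exists_linearMap
        fun j : Fin (d + 1) => H.mulSec (b 0) d U (x ^ (j : ℕ))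
      have key : ∀ v : Fin d → E, φ (resM _ le_top (prodSec ψ v)) = resM _ le_top (H.tautSec v) := by
        intro v
        rw [resM_prodSec hc, hφ, resM_tautSec hx, hπ, sum_smul_mulSec d (natDegree_prod_lineForm_le _ _ _ _ _)]
      refine ⟨φ, ?_, (isBasisOn_prodSec hc d).span_eq_top fun j => ⟨_, monVec b j, rfl, rfl⟩⟩
      rintro _ _ ⟨v, rfl, rfl⟩
      exact key v)
  exact ⟨g, fun v => hg ⊤ _ _ ⟨v, (resM_self _ _).symm, (resM_self _ _).symm⟩⟩

/-- The restriction homomorphism on a chart. -/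
lemma restriction_polySum {d : ℕ}
    {g : (Scheme.Modules.pullback ψ).obj (P'.kernelBundle.dual.sym d) ⟶ H.tautological (P.O d)}
    (hg : ∀ v : Fin d → E, g.app ⊤ (prodSec ψ v) = H.tautSec v)
    (h : IsChartOn H.p₁ H.p₂ b U α β σ τ x) {p : Polynomial Γ(H.space, U)} (hp : p.natDegree ≤ d) :
    g.app U (polySum (fun j : Fin (d + 1) => resM _ le_top (prodSec ψ (monVec b j))) p) =
      H.mulSec (b 0) d U (p.eval₂ (H.p₂.app U).hom x) := by
  rw [← sum_smul_mulSec d hp, polySum_apply, map_sum]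
  refine Finset.sum_congr rfl fun j _ => ?_
  rw [Hom.app_smul, resM_app, hg, resM_tautSec h]
  congr 2
  have h1 : ∀ i : Fin d, lineForm (constFun H.π U) b α β (monVec b j i) =
      if (i : ℕ) < j then Polynomial.X else 1 := by
    intro i
    unfold monVec
    split_ifs <;> simp [lineForm]
  rw [Finset.prod_congr rfl fun i _ => h1 i, Finset.prod_ite, Finset.prod_const, Finset.prod_const_one, mul_one,
    Polynomial.eval₂_pow, Polynomial.eval₂_X]
  congr 1
  rw [Fin.card_filter_val_lt]
  exact min_eq_right (Nat.lt_succ_iff.mp j.2)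

end HilbertScheme

end AlgebraicGeometry

namespace AlgebraicGeometry
universe u
open Scheme.Modules ProjectiveBundle

section

variable {R A : Type*} [CommRing R] [AddCommGroup A] [Module R A]

lemma polySum_X_pow {n : ℕ} (e : Fin n → A) (j : Fin n) :
    polySum e (Polynomial.X ^ (j : ℕ) : Polynomial R) = e j := by
  rw [polySum_apply, Finset.sum_eq_single j]
  · simp
  · intro i _ hi
    rw [Polynomial.coeff_X_pow, if_neg (fun e => hi (Fin.ext e)), zero_smul]
  · simp

/-- The coordinates of `X² - σ X - τ` are `(-τ, -σ, 1)`. -/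
lemma polySum_quadratic (e : Fin 3 → A) (σ τ : R) :
    polySum e (quadratic σ τ) = e 2 - σ • e 1 - τ • e 0 := by
  have h : quadratic σ τ = Polynomial.X ^ ((2 : Fin 3) : ℕ) - (σ • Polynomial.X ^ ((1 : Fin 3) : ℕ) +
      τ • Polynomial.X ^ ((0 : Fin 3) : ℕ)) := by
    simp [quadratic, Polynomial.smul_eq_C_mul]
  rw [h, map_sub, map_add, _root_.map_smul, _root_.map_smul, polySum_X_pow, polySum_X_pow, polySum_X_pow,
    sub_sub]

lemma natDegree_quadratic_le (σ τ : R) : (quadratic σ τ).natDegree ≤ 2 := by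
  unfold quadratic
  compute_degree

variable {X : Scheme.{u}} {M : X.Modules} {U : X.Opens} {d : ℕ} {s : Fin (d + 1) → Γ(M, U)}

lemma Scheme.Modules.IsBasisOn.polySum_injective (hs : IsBasisOn M U s) {p q : Polynomial Γ(X, U)}
    (hp : p.natDegree ≤ d) (hq : q.natDegree ≤ d) (h : polySum s p = polySum s q) : p = q := by
  have h1 := hs.coeff_eq_self (c := fun j => p.coeff j) (d := fun j => q.coeff j) h
  ext j
  by_cases hj : j < d + 1
  · exact congrFun h1 ⟨j, hj⟩
  · rw [Polynomial.coeff_eq_zero_of_natDegree_lt (by omega),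
      Polynomial.coeff_eq_zero_of_natDegree_lt (by omega)]

/-- With respect to a basis indexed by degrees, sections are polynomials of bounded degree. -/
lemma Scheme.Modules.IsBasisOn.exists_eq_polySum (hs : IsBasisOn M U s) (m : Γ(M, U)) :
    ∃ p : Polynomial Γ(X, U), p.natDegree ≤ d ∧ m = polySum s p := by
  obtain ⟨c, rfl⟩ := hs.exists_eq_self m
  obtain ⟨p, hp, hc⟩ := exists_coeff_eq c
  exact ⟨p, hp, Finset.sum_congr rfl fun j _ => by rw [hc]⟩

end

variable {k : Type u} [Field k] {E : Type u} [AddCommGroup E] [Module k E]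
  {P : ProjectiveBundle (vectorSheaf k E)} {P' : ProjectiveBundle (vectorSheaf k (Module.Dual k E))}

/-- The basis of `f^* Sym^d K^∨` on `U` that consists of the monomials in the vectors `b 0` and `b 1`. -/
noncomputable abbrev monSec [Module.Finite k E] {T : Scheme.{u}} (f : T ⟶ P'.space) (b : Module.Basis (Fin 3) k E)
    (U : T.Opens) (d : ℕ) (j : Fin (d + 1)) :
    Γ((Scheme.Modules.pullback f).obj (P'.kernelBundle.dual.sym d), U) :=
  resM _ le_top (prodSec f (monVec b j))

namespace HilbertScheme

variable {H : HilbertScheme P.π 2} {b : Module.Basis (Fin 3) k E} {U : H.space.Opens}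
  {α β σ τ : Γ(H.space, U)} {x : Γ(H.family, H.p₂ ⁻¹ᵁ U)} [Module.Finite k E] {ψ : H.space ⟶ P'.space}

/-! ### The kernel of the restriction of quadratic forms -/

/-- On a chart, the quadratic forms on the line that vanish on the pair of points are the multiples of the
form `X² - σ X - τ`. -/
lemma exists_kernel_generator (hπ : ψ ≫ P'.π = H.π) (hψ : H.IsSpanMap ψ)
    {g : (Scheme.Modules.pullback ψ).obj (P'.kernelBundle.dual.sym 2) ⟶ H.tautological (P.O 2)}
    (hg : ∀ v : Fin 2 → E, g.app ⊤ (prodSec ψ v) = H.tautSec v)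
    (h : IsChartOn H.p₁ H.p₂ b U α β σ τ x) :
    ∃ m : Γ(Limits.kernel g, U), IsGenOn (Limits.kernel g) U m ∧
      (Limits.kernel.ι g).app U m = polySum (monSec ψ b U 2) (quadratic σ τ) := by
  have hc := hψ.hasCoordsOn hπ h
  obtain ⟨m, hm⟩ := exists_kernel_section g (polySum (monSec ψ b U 2) (quadratic σ τ)) (by
    have h1 : x * x - ((H.p₂.app U).hom σ * x + (H.p₂.app U).hom τ) = 0 := sub_eq_zero.mpr h.sq
    rw [restriction_polySum hg h (natDegree_quadratic_le σ τ), eval₂_quadratic, h1, map_zero])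
  -- The form `X² - σ X - τ` together with the monomials `1` and `X` is a basis of the quadratic
  -- forms, and `1` and `X` map to a basis of the tautological sheaf.
  refine ⟨m, ?_, hm⟩
  have h0 := isBasisOn_prodSec hc 2
  have hq : ∀ j : Fin 2, g.app U (monSec ψ b U 2 j.castSucc) = H.mulSec (b 0) 2 U (x ^ (j : ℕ)) := by
    intro j
    have := restriction_polySum hg h (p := Polynomial.X ^ (j : ℕ)) (by
      refine (Polynomial.natDegree_X_pow_le _).trans ?_
      omega)
    rw [Polynomial.eval₂_pow, Polynomial.eval₂_X] at this
    rw [← this]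
    exact congrArg _ (polySum_X_pow _ j.castSucc).symm
  refine (isBasisOn_kernel (ι := Fin 1) (κ := Fin 2) g (k := fun _ => m)
    (e := fun j => monSec ψ b U 2 j.castSucc) ?_ ?_).congr (Equiv.equivPUnit (Fin 1)).symm fun _ => rfl
  · refine (h0.congr (finSumFinEquiv (m := 1) (n := 2)) fun _ => rfl).of_generate _ ?_
    have key : ∀ (c : Fin 1 ⊕ Fin 2 → Γ(H.space, U)), ∑ j, c j • Sum.elim (fun _ : Fin 1 => (Limits.kernel.ι g).app U m)
        (fun j => monSec ψ b U 2 j.castSucc) j = c (.inl 0) • (monSec ψ b U 2 2 - σ • monSec ψ b U 2 1 - τ • monSec ψ b U 2 0) +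
          (c (.inr 0) • monSec ψ b U 2 0 + c (.inr 1) • monSec ψ b U 2 1) := by
      intro c
      rw [Fintype.sum_sum_type, Fin.sum_univ_two, Fin.sum_univ_one, ← polySum_quadratic, ← hm]
      rfl
    have h3 : ∀ i : Fin 3, ∃ c : Fin 1 ⊕ Fin 2 → Γ(H.space, U), monSec ψ b U 2 i =
        ∑ j, c j • Sum.elim (fun _ : Fin 1 => (Limits.kernel.ι g).app U m)
        (fun j => monSec ψ b U 2 j.castSucc) j := by
      intro i
      simp only [key]
      fin_cases i
      · exact ⟨Sum.elim 0 ![1, 0], by simp⟩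
      · exact ⟨Sum.elim 0 ![0, 1], by simp⟩
      · exact ⟨Sum.elim 1 ![τ, σ], by simp; abel⟩
    exact fun i => h3 _
  · simp only [hq]
    exact isBasisOn_pushforward h.gen (h.isGenOn_powSec 2)

end HilbertScheme

end AlgebraicGeometry

namespace AlgebraicGeometry
universe u
open Scheme.Modules ProjectiveBundle

variable {k : Type u} [Field k] {E : Type u} [AddCommGroup E] [Module k E]
  {P : ProjectiveBundle (vectorSheaf k E)} {P' : ProjectiveBundle (vectorSheaf k (Module.Dual k E))}

section

variable {T : Scheme.{u}} {f : T ⟶ P'.space} {b : Module.Basis (Fin 3) k E} {U V : T.Opens} {α β : Γ(T, U)}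

/-- The coefficients of the polynomial of a vector are its values on the basis sections of the
kernel bundle. -/
lemma lineForm_eq (h : HasCoordsOn f U b.dualBasis ![-α, -β, 1]) [Module.Finite k E] (v : E) :
    lineForm (constFun (f ≫ P'.π) U) b α β v = Polynomial.C (evAt f h.le_chart v (kerSec b 0)) +
      Polynomial.C (evAt f h.le_chart v (kerSec b 1)) * Polynomial.X := by
  have key : ∀ i : Fin 2, evAt f h.le_chart v (kerSec b i) =
      constFun (f ≫ P'.π) U (b.coord i.castSucc v) -
          ![-α, -β, 1] i.castSucc * constFun (f ≫ P'.π) U (b.coord 2 v) := by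
    intro i
    rw [evAt, ev_kerSec, map_sub, map_mul, map_sub, map_mul, h.app_chartFun, app_constFun, app_constFun,
      resF_constFun, resF_constFun]
  rw [key, key, lineForm]
  simp

lemma resM_polySum {d : ℕ} (h : V ≤ U) [Module.Finite k E] (p : Polynomial Γ(T, U)) :
    resM _ h (polySum (monSec f b U d) p) = polySum (monSec f b V d) (p.map (resF h)) := by
  rw [polySum_apply, polySum_apply, map_sum]
  refine Finset.sum_congr rfl fun j _ => ?_
  rw [resM_smul, Polynomial.coeff_map, resM_resM]

end

lemma quadratic_map {R S : Type*} [CommRing R] [CommRing S] (φ : R →+* S) (σ τ : R) :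
    (quadratic σ τ).map φ = quadratic (φ σ) (φ τ) := by
  simp [quadratic]

namespace HilbertScheme

variable {H : HilbertScheme P.π 2} {b : Module.Basis (Fin 3) k E} {U V : H.space.Opens}
  {α β σ τ : Γ(H.space, U)} {x : Γ(H.family, H.p₂ ⁻¹ᵁ U)} [Module.Finite k E] {ψ : H.space ⟶ P'.space}
  {g : (Scheme.Modules.pullback ψ).obj (P'.kernelBundle.dual.sym 2) ⟶ H.tautological (P.O 2)}

variable (g) in
/-- The section `m` generates the kernel of the restriction of quadratic forms, and it is the form
`X² - σ X - τ`. -/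
structure IsKernelGenerator (b : Module.Basis (Fin 3) k E) (U : H.space.Opens) (σ τ : Γ(H.space, U))
    (m : Γ(Limits.kernel g, U)) : Prop where
  isGenOn : IsGenOn (Limits.kernel g) U m
  eq : (Limits.kernel.ι g).app U m = polySum (monSec ψ b U 2) (quadratic σ τ)

lemma IsKernelGenerator.mono {m : Γ(Limits.kernel g, U)} (hm : IsKernelGenerator g b U σ τ m) (h : V ≤ U) :
    IsKernelGenerator g b V (resF h σ) (resF h τ) (resM _ h m) where
  isGenOn := IsBasisOn.mono hm.isGenOn h
  eq := by rw [resM_app, hm.eq, resM_polySum, quadratic_map]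

/-- If a combination of products of vectors is `c` times the generator of the kernel, then the
corresponding polynomial is `c` times `X² - σ X - τ`. -/
lemma IsKernelGenerator.sum_eq {m : Γ(Limits.kernel g, U)} (hm : IsKernelGenerator g b U σ τ m)
    (hc : HasCoordsOn ψ U b.dualBasis ![-α, -β, 1]) (c : Γ(H.space, U)) {n : ℕ} (r : Fin n → Γ(H.space, U))
    (w : Fin n → Fin 2 → E)
    (h : (Limits.kernel.ι g).app U (c • m) = ∑ i, r i • resM _ le_top (prodSec ψ (w i))) :
    ∑ i, Polynomial.C (r i) * ∏ l, lineForm (constFun (ψ ≫ P'.π) U) b α β (w i l) =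
      Polynomial.C c * quadratic σ τ := by
  refine (isBasisOn_prodSec hc 2).polySum_injective ?_ ?_ ?_
  · exact Polynomial.natDegree_sum_le_of_forall_le _ _ fun i _ =>
      (Polynomial.natDegree_C_mul_le _ _).trans (natDegree_prod_lineForm_le _ _ _ _ _)
  · exact (Polynomial.natDegree_C_mul_le _ _).trans (natDegree_quadratic_le σ τ)
  · rw [← Polynomial.smul_eq_C_mul, _root_.map_smul]
    refine Eq.trans ?_ ((congrArg (c • ·) hm.eq).symm.trans ((Hom.app_smul _ _ _).symm.trans h)).symm
    rw [map_sum]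
    refine Finset.sum_congr rfl fun i _ => ?_
    rw [← Polynomial.smul_eq_C_mul, _root_.map_smul, resM_prodSec hc, polySum_apply]

/-- The polarization of the evaluation of quadratic forms at a product of two sections of the kernel
bundle. -/
noncomputable def polar (ψ : H.space ⟶ P'.space) {O : P'.space.Opens} (h : U ≤ ψ ⁻¹ᵁ O)
    (κ κ' : Γ(P'.kernelBundle, O)) (w : Fin 2 → E) : Γ(H.space, U) :=
  evAt ψ h (w 0) κ * evAt ψ h (w 1) κ' + evAt ψ h (w 1) κ * evAt ψ h (w 0) κ'

/-- The values of the polarizations on the form `X² - σ X - τ`. -/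
lemma IsKernelGenerator.sum_polar {m : Γ(Limits.kernel g, U)} (hm : IsKernelGenerator g b U σ τ m)
    (hc : HasCoordsOn ψ U b.dualBasis ![-α, -β, 1]) (c : Γ(H.space, U)) {n : ℕ} (r : Fin n → Γ(H.space, U))
    (w : Fin n → Fin 2 → E)
    (h : (Limits.kernel.ι g).app U (c • m) = ∑ i, r i • resM _ le_top (prodSec ψ (w i))) (j : Fin 3) :
    ∑ i, r i * polar ψ hc.le_chart (kerSec b (![0, 1, 1] j)) (kerSec b (![0, 0, 1] j)) (w i) =
      c * ![-2 * τ, -σ, 2] j := by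
  have key := hm.sum_eq hc c r w h
  simp only [Fin.prod_univ_two, lineForm_eq hc] at key
  have h2 : ∀ d : ℕ, ∑ i, r i * ((Polynomial.C (evAt ψ hc.le_chart (w i 0) (kerSec b 0)) +
      Polynomial.C (evAt ψ hc.le_chart (w i 0) (kerSec b 1)) * Polynomial.X) *
      (Polynomial.C (evAt ψ hc.le_chart (w i 1) (kerSec b 0)) +
      Polynomial.C (evAt ψ hc.le_chart (w i 1) (kerSec b 1)) * Polynomial.X)).coeff d =
        c * (quadratic σ τ).coeff d := by
    intro d
    have := congrArg (fun p => Polynomial.coeff p d) key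
    simpa only [Polynomial.finsetSum_coeff, Polynomial.coeff_C_mul] using this
  have hq0 : (quadratic σ τ).coeff 0 = -τ := by simp [quadratic]
  have hq1 : (quadratic σ τ).coeff 1 = -σ := by simp [quadratic, Polynomial.coeff_X_pow, Polynomial.coeff_C]
  have hq2 : (quadratic σ τ).coeff 2 = 1 := by simp [quadratic]
  have c0 := h2 0
  have c1 := h2 1
  have c2 := h2 2
  simp only [(coeff_mul_linear _ _ _ _).1, hq0] at c0
  simp only [(coeff_mul_linear _ _ _ _).2.1, hq1] at c1
  simp only [(coeff_mul_linear _ _ _ _).2.2, hq2] at c2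
  fin_cases j
  · change ∑ i, r i * (_ * _ + _ * _) = c * (-2 * τ)
    rw [show c * (-2 * τ) = 2 * (c * -τ) by ring, ← c0, Finset.mul_sum]
    refine Finset.sum_congr rfl fun i _ => ?_
    change r i * (evAt ψ hc.le_chart (w i 0) (kerSec b 0) * evAt ψ hc.le_chart (w i 1) (kerSec b 0) +
      evAt ψ hc.le_chart (w i 1) (kerSec b 0) * evAt ψ hc.le_chart (w i 0) (kerSec b 0)) = _
    ring
  · change ∑ i, r i * (_ * _ + _ * _) = c * (-σ)
    rw [← c1]
    refine Finset.sum_congr rfl fun i _ => ?_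
    change r i * (evAt ψ hc.le_chart (w i 0) (kerSec b 1) * evAt ψ hc.le_chart (w i 1) (kerSec b 0) +
      evAt ψ hc.le_chart (w i 1) (kerSec b 1) * evAt ψ hc.le_chart (w i 0) (kerSec b 0)) = _
    ring
  · change ∑ i, r i * (_ * _ + _ * _) = c * 2
    rw [show c * 2 = 2 * (c * 1) by ring, ← c2, Finset.mul_sum]
    refine Finset.sum_congr rfl fun i _ => ?_
    change r i * (evAt ψ hc.le_chart (w i 0) (kerSec b 1) * evAt ψ hc.le_chart (w i 1) (kerSec b 1) +
      evAt ψ hc.le_chart (w i 1) (kerSec b 1) * evAt ψ hc.le_chart (w i 0) (kerSec b 1)) = _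
    ring

end HilbertScheme

end AlgebraicGeometry

namespace AlgebraicGeometry
universe u
open Scheme.Modules ProjectiveBundle

namespace HilbertScheme

variable {k : Type u} [Field k] {E : Type u} [AddCommGroup E] [Module k E]
  {P : ProjectiveBundle (vectorSheaf k E)} {P' : ProjectiveBundle (vectorSheaf k (Module.Dual k E))}
  {H : HilbertScheme P.π 2} [Module.Finite k E] {ψ : H.space ⟶ P'.space}
  {g : (Scheme.Modules.pullback ψ).obj (P'.kernelBundle.dual.sym 2) ⟶ H.tautological (P.O 2)}

/-! ### The tautological quotient on the Hilbert scheme -/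

/-- The linear form on the kernel that is dual to the generator. -/
lemma IsKernelGenerator.exists_dualSections {b : Module.Basis (Fin 3) k E} {U : H.space.Opens}
    {σ τ : Γ(H.space, U)} {m : Γ(Limits.kernel g, U)} (hm : IsKernelGenerator g b U σ τ m) :
    ∃ y : dualSections (Limits.kernel g) U, ∀ (V : H.space.Opens) (h : V ≤ U) (c : Γ(H.space, V)),
      y.1 ⟨V, h⟩ (c • resM _ h m) = c := by
  obtain ⟨y, hy⟩ := IsBasisOn.exists_dualSections hm.isGenOn ()
  exact ⟨y, fun V h c => by simpa using hy V h fun _ => c⟩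

lemma IsKernelGenerator.dualSec_eq {b : Module.Basis (Fin 3) k E} {U : H.space.Opens}
    {σ τ : Γ(H.space, U)} {m : Γ(Limits.kernel g, U)} (hm : IsKernelGenerator g b U σ τ m)
    {y₀ : dualSections (Limits.kernel g) U} (hy₀ : y₀.1 ⟨U, le_rfl⟩ m = 1) (y : dualSections (Limits.kernel g) U) :
    dualSec y = y.1 ⟨U, le_rfl⟩ m • dualSec y₀ := by
  have := IsBasisOn.dualSec_eq_sum hm.isGenOn (fun _ => y₀) (fun _ _ => by rw [hy₀, if_pos rfl]) y
  simpa using this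

/-- The section `n` of the dual of the kernel of the restriction of quadratic forms is given by the
polarizations with respect to the two factors of a product `s` of sections of the kernel bundle. -/
def IsPolarization (g : (Scheme.Modules.pullback ψ).obj (P'.kernelBundle.dual.sym 2) ⟶ H.tautological (P.O 2))
    (U : H.space.Opens) (s : Γ((Scheme.Modules.pullback ψ).obj (P'.kernelBundle.sym 2), U))
    (n : Γ((Limits.kernel g).dual, U)) : Prop :=
  ∃ (O : P'.space.Opens) (hO : U ≤ ψ ⁻¹ᵁ O) (κ κ' : Γ(P'.kernelBundle, O)) (y : dualSections (Limits.kernel g) U),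
    s = resM _ hO (pairSec ψ κ κ') ∧ n = dualSec y ∧
    ∀ (V : H.space.Opens) (h : V ≤ U) (z : Γ(Limits.kernel g, V)) (l : ℕ) (r : Fin l → Γ(H.space, V))
      (w : Fin l → Fin 2 → E), (Limits.kernel.ι g).app V z = ∑ i, r i • resM _ le_top (prodSec ψ (w i)) →
        y.1 ⟨V, h⟩ z = ∑ i, r i * polar ψ (h.trans hO) κ κ' (w i)

/-- The polarizations with respect to the three monomials are `-2 τ`, `-σ` and `2` times the linear
form dual to the generator. -/
lemma IsKernelGenerator.isPolarization (hπ : ψ ≫ P'.π = H.π) (hψ : H.IsSpanMap ψ)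
    {b : Module.Basis (Fin 3) k E} {U : H.space.Opens} {α β σ τ : Γ(H.space, U)}
    {x : Γ(H.family, H.p₂ ⁻¹ᵁ U)} (hx : IsChartOn H.p₁ H.p₂ b U α β σ τ x) {m : Γ(Limits.kernel g, U)}
    (hm : IsKernelGenerator g b U σ τ m) (hU : U ≤ ψ ⁻¹ᵁ P'.chart (b.coord 2)) {y : dualSections (Limits.kernel g) U}
    (hy : ∀ (V : H.space.Opens) (h : V ≤ U) (c : Γ(H.space, V)), y.1 ⟨V, h⟩ (c • resM _ h m) = c) (j : Fin 3) :
    IsPolarization g U (resM _ hU (pairMon ψ b j)) ((![-2 * τ, -σ, 2] j : Γ(H.space, U)) • dualSec y) := by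
  refine ⟨_, hU, kerSec b (![0, 1, 1] j), kerSec b (![0, 0, 1] j), (![-2 * τ, -σ, 2] j : Γ(H.space, U)) • y,
    by rw [pairMon_eq], (dualSec_smul _ _).symm, fun V h z l r w hz => ?_⟩
  have hmV := hm.mono h
  obtain ⟨c, rfl⟩ := hmV.isGenOn.exists_eq_smul_self z
  have hcV := hψ.hasCoordsOn hπ (hx.mono h)
  refine Eq.trans ?_ (hmV.sum_polar hcV c r w hz j).symm
  refine (dualSections_smul_apply _ y h _).trans ?_
  rw [hy, mul_comm]
  refine congrArg (c * ·) ?_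
  fin_cases j
  · change resF h (-2 * τ) = -2 * resF h τ
    rw [map_mul, map_neg, map_ofNat]
  · exact map_neg _ _
  · exact map_ofNat _ _

/-- A linear map with the prescribed values on the monomials sends every product of two sections of
the kernel bundle to its polarization. -/
lemma IsKernelGenerator.map_eq_of_isPolarization {b : Module.Basis (Fin 3) k E} {U : H.space.Opens}
    {σ τ : Γ(H.space, U)} {m : Γ(Limits.kernel g, U)}
    (hm : IsKernelGenerator g b U σ τ m) (hU : U ≤ ψ ⁻¹ᵁ P'.chart (b.coord 2)) {y : dualSections (Limits.kernel g) U}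
    (hy : y.1 ⟨U, le_rfl⟩ m = 1)
    (φ : Γ((Scheme.Modules.pullback ψ).obj (P'.kernelBundle.sym 2), U) →ₗ[Γ(H.space, U)]
      Γ((Limits.kernel g).dual, U))
    (hφ : ∀ j, φ (resM _ hU (pairMon ψ b j)) = (![-2 * τ, -σ, 2] j : Γ(H.space, U)) • dualSec y)
    {s n} (h : IsPolarization g U s n) : φ s = n := by
  obtain ⟨O, hO, κ, κ', y', rfl, rfl, h⟩ := h
  rw [hm.dualSec_eq hy, resM_pairSec hU hO, map_add, map_add, _root_.map_smul, _root_.map_smul, _root_.map_smul,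
    hφ, hφ, hφ, smul_smul, smul_smul, smul_smul, ← add_smul, ← add_smul]
  refine congrArg (· • dualSec y) ?_
  rw [h U le_rfl m 3 ![1, -σ, -τ] ![monVec b 2, monVec b 1, monVec b 0] (by
    rw [hm.eq, polySum_quadratic, Fin.sum_univ_three]
    change _ = (1 : Γ(H.space, U)) • monSec ψ b U 2 2 + (-σ) • monSec ψ b U 2 1 + (-τ) • monSec ψ b U 2 0
    rw [one_smul, neg_smul, neg_smul, ← sub_eq_add_neg, ← sub_eq_add_neg]), Fin.sum_univ_three]
  change _ * (-2 * τ) + _ * (-σ) + _ * 2 = 1 * (evAt ψ hO (b 1) κ * evAt ψ hO (b 1) κ' + evAt ψ hO (b 1) κ * evAt ψ hO (b 1) κ') +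
    (-σ) * (evAt ψ hO (b 1) κ * evAt ψ hO (b 0) κ' + evAt ψ hO (b 0) κ * evAt ψ hO (b 1) κ') +
    (-τ) * (evAt ψ hO (b 0) κ * evAt ψ hO (b 0) κ' + evAt ψ hO (b 0) κ * evAt ψ hO (b 0) κ')
  ring

/-- The quotient of `ψ^* Sym² K` that pairs products of sections of `K` with the quadratic forms
that vanish on the pairs of points. On a chart, it is the polarization of `X² - σ X - τ`. -/
lemma exists_quotient [Infinite k] (hE : Module.finrank k E = 3) (hπ : ψ ≫ P'.π = H.π)
    (hψ : H.IsSpanMap ψ) (hg : ∀ v : Fin 2 → E, g.app ⊤ (prodSec ψ v) = H.tautSec v) :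
    ∃ q : (Scheme.Modules.pullback ψ).obj (P'.kernelBundle.sym 2) ⟶ (Limits.kernel g).dual,
      ∀ (b : Module.Basis (Fin 3) k E) (U : H.space.Opens) (α β σ τ : Γ(H.space, U))
        (x : Γ(H.family, H.p₂ ⁻¹ᵁ U)), IsChartOn H.p₁ H.p₂ b U α β σ τ x →
        ∀ hU : U ≤ ψ ⁻¹ᵁ P'.chart (b.coord 2), ∃ ν, IsGenOn (Limits.kernel g).dual U ν ∧
          ∀ j, q.app U (resM _ hU (pairMon ψ b j)) = (![-2 * τ, -σ, 2] j : Γ(H.space, U)) • ν := by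
  have main : ∀ (b : Module.Basis (Fin 3) k E) (U : H.space.Opens) (α β σ τ : Γ(H.space, U))
      (x : Γ(H.family, H.p₂ ⁻¹ᵁ U)), IsChartOn H.p₁ H.p₂ b U α β σ τ x →
      ∃ (m : Γ(Limits.kernel g, U)) (y : dualSections (Limits.kernel g) U), IsKernelGenerator g b U σ τ m ∧
        (∀ (V : H.space.Opens) (h : V ≤ U) (c : Γ(H.space, V)), y.1 ⟨V, h⟩ (c • resM _ h m) = c) ∧
        y.1 ⟨U, le_rfl⟩ m = 1 ∧ IsGenOn (Limits.kernel g).dual U (dualSec y) := by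
    intro b U α β σ τ x hx
    obtain ⟨m, hm, hm'⟩ := exists_kernel_generator hπ hψ hg hx
    have hm : IsKernelGenerator g b U σ τ m := ⟨hm, hm'⟩
    obtain ⟨y, hy⟩ := hm.exists_dualSections
    have hy1 : y.1 ⟨U, le_rfl⟩ m = 1 := by
      have := hy U le_rfl 1
      rwa [one_smul, resM_self] at this
    exact ⟨m, y, hm, hy, hy1, isBasisOn_dual hm.isGenOn (fun _ => y) (fun _ _ => by rw [hy1, if_pos rfl])⟩
  -- The relation `IsPolarization g` does not refer to a chart, so the local homomorphisms glue.
  obtain ⟨q, hq⟩ := exists_hom_of_relation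
    (M := (Scheme.Modules.pullback ψ).obj (P'.kernelBundle.sym 2)) (N := (Limits.kernel g).dual)
    {U | ∃ b α β σ τ x, IsChartOn H.p₁ H.p₂ b U α β σ τ x} (fun y => by
      obtain ⟨b, hb⟩ := H.isLengthFamily.exists_isChartOn hE y y
      obtain ⟨U, α, β, σ, τ, x, hy, hx⟩ := hb y (.inl rfl)
      exact ⟨U, ⟨b, α, β, σ, τ, x, hx⟩, hy⟩) (by
      rintro U ⟨b, α, β, σ, τ, x, hx⟩ V hV
      exact ⟨b, _, _, _, _, _, hx.mono hV⟩)
    (IsPolarization g) (by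
      rintro U V hV _ _ ⟨O, hO, κ, κ', y, rfl, rfl, h⟩
      exact ⟨O, hV.trans hO, κ, κ', dualRes hV y, resM_resM _ _ _, resM_dualSec _ _,
        fun W hW z l r w hz => h W (hW.trans hV) z l r w hz⟩) (by
      rintro U ⟨b, α, β, σ, τ, x, hx⟩
      have hU := (hψ.hasCoordsOn hπ hx).le_chart
      obtain ⟨m, y, hm, hy, hy1, -⟩ := main b U α β σ τ x hx
      have hB := (isBasisOn_pairMon ψ b).mono hU
      obtain ⟨φ, hφ⟩ := hB.exists_linearMap fun j : Fin 3 => (![-2 * τ, -σ, 2] j : Γ(H.space, U)) • dualSec y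
      refine ⟨φ, fun s n => hm.map_eq_of_isPolarization hU hy1 φ fun j => ?_,
        hB.span_eq_top fun j => ⟨_, hm.isPolarization hπ hψ hx hU hy j⟩⟩
      have := hφ (Pi.single j 1)
      simpa only [Pi.single_apply, ite_smul, one_smul, zero_smul, Finset.sum_ite_eq', Finset.mem_univ, if_true] using this)
  refine ⟨q, fun b U α β σ τ x hx hU => ?_⟩
  obtain ⟨m, y, hm, hy, -, hν⟩ := main b U α β σ τ x hx
  exact ⟨dualSec y, hν, fun j => hq U _ _ (hm.isPolarization hπ hψ hx hU hy j)⟩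

end HilbertScheme

end AlgebraicGeometry

namespace AlgebraicGeometry
universe u
open Scheme.Modules ProjectiveBundle

namespace HilbertScheme

variable {k : Type u} [Field k] {E : Type u} [AddCommGroup E] [Module k E]
  {P : ProjectiveBundle (vectorSheaf k E)} {P' : ProjectiveBundle (vectorSheaf k (Module.Dual k E))}
  {H : HilbertScheme P.π 2} [Module.Finite k E] {ψ : H.space ⟶ P'.space}
  {g : (Scheme.Modules.pullback ψ).obj (P'.kernelBundle.dual.sym 2) ⟶ H.tautological (P.O 2)}

/-! ### The resolution of the tautological sheaves -/

/-- The section `y` of the bidual of the kernel of the restriction of quadratic forms is evaluation at the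
section `z` of this kernel. -/
def IsEvaluationAt {U : H.space.Opens} (z : Γ(Limits.kernel g, U)) (y : dualSections (Limits.kernel g).dual U) : Prop :=
  ∀ (V : H.space.Opens) (h : V ≤ U) (y' : dualSections (Limits.kernel g) V),
    y.1 ⟨V, h⟩ (dualSec y') = y'.1 ⟨V, le_rfl⟩ (resM _ h z)

/-- The section `n` is the product of a form of degree `d` with a quadratic form that vanishes on the pairs
of points, and `m` is the corresponding section of the tensor product. -/
def IsProduct (g : (Scheme.Modules.pullback ψ).obj (P'.kernelBundle.dual.sym 2) ⟶ H.tautological (P.O 2))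
    (d : ℕ) (U : H.space.Opens)
    (m : Γ(((Scheme.Modules.pullback ψ).obj (P'.kernelBundle.dual.sym d)).tensor (Limits.kernel g).dual.dual, U))
    (n : Γ((Scheme.Modules.pullback ψ).obj (P'.kernelBundle.dual.sym (d + 2)), U)) : Prop :=
  ∃ (v : Fin d → E) (z : Γ(Limits.kernel g, U)) (y : dualSections (Limits.kernel g).dual U)
    (l : ℕ) (r : Fin l → Γ(H.space, U)) (w : Fin l → Fin 2 → E),
    (Limits.kernel.ι g).app U z = ∑ i, r i • resM _ le_top (prodSec ψ (w i)) ∧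
    IsEvaluationAt z y ∧ m = tensorSection (resM _ le_top (prodSec ψ v)) (dualSec y) ∧
    n = ∑ i, r i • resM _ le_top (prodSec ψ (Fin.append v (w i)))

lemma IsProduct.restrict {d : ℕ} {U V : H.space.Opens} (h : V ≤ U) {m n} (H' : IsProduct g d U m n) :
    IsProduct g d V (resM _ h m) (resM _ h n) := by
  obtain ⟨v, z, y, l, r, w, h1, h2, rfl, rfl⟩ := H'
  refine ⟨v, resM _ h z, dualRes h y, l, fun i => resF h (r i), w, ?_, fun W hW y' => ?_, ?_, ?_⟩
  · rw [resM_app, h1, map_sum]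
    exact Finset.sum_congr rfl fun i _ => by rw [resM_smul, resM_resM]
  · rw [dualRes_apply, resM_resM]
    exact h2 W (hW.trans h) y'
  · rw [tensorSection_res, resM_resM, resM_dualSec]
  · rw [map_sum]
    exact Finset.sum_congr rfl fun i _ => by rw [resM_smul, resM_resM]

section

variable {b : Module.Basis (Fin 3) k E} {U : H.space.Opens} {α β σ τ : Γ(H.space, U)}
  {x : Γ(H.family, H.p₂ ⁻¹ᵁ U)} {m : Γ(Limits.kernel g, U)}

/-- The basis of the tensor product with the bidual of the kernel on a chart. -/
noncomputable def tensorMon (ψ : H.space ⟶ P'.space) (b : Module.Basis (Fin 3) k E) (d : ℕ)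
    (ω : dualSections (Limits.kernel g).dual U) (j : Fin (d + 1)) :
    Γ(((Scheme.Modules.pullback ψ).obj (P'.kernelBundle.dual.sym d)).tensor (Limits.kernel g).dual.dual, U) :=
  tensorSection (monSec ψ b U d j) (dualSec ω)

lemma isBasisOn_tensorMon (hc : HasCoordsOn ψ U b.dualBasis ![-α, -β, 1]) (d : ℕ)
    {ω : dualSections (Limits.kernel g).dual U} (hω : IsGenOn (Limits.kernel g).dual.dual U (dualSec ω)) :
    IsBasisOn _ U (tensorMon ψ b d ω) :=
  (isBasisOn_tensor (isBasisOn_prodSec hc d) hω).congr (Equiv.prodPUnit (Fin (d + 1))).symm fun _ => rfl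

/-- On a chart, there is a unique evaluation at the generator `X² - σ X - τ`, and it generates. -/
lemma IsKernelGenerator.exists_evaluation (hm : IsKernelGenerator g b U σ τ m) :
    ∃ ω : dualSections (Limits.kernel g).dual U, IsEvaluationAt m ω ∧
      IsGenOn (Limits.kernel g).dual.dual U (dualSec ω) ∧
      ∀ (c : Γ(H.space, U)) y, IsEvaluationAt (c • m) y → dualSec y = c • dualSec ω := by
  obtain ⟨y₀, hy₀⟩ := hm.exists_dualSections
  have hy1 : y₀.1 ⟨U, le_rfl⟩ m = 1 := by
    have := hy₀ U le_rfl 1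
    rwa [one_smul, resM_self] at this
  have hν : IsGenOn (Limits.kernel g).dual U (dualSec y₀) :=
    isBasisOn_dual hm.isGenOn (fun _ => y₀) (fun _ _ => by rw [hy1, if_pos rfl])
  obtain ⟨ω, hω⟩ := IsBasisOn.exists_dualSections hν ()
  have hω' : ∀ (V : H.space.Opens) (h : V ≤ U) (c : Γ(H.space, V)), ω.1 ⟨V, h⟩ (c • resM _ h (dualSec y₀)) = c :=
    fun V h c => by simpa using hω V h fun _ => c
  have hω1 : ω.1 ⟨U, le_rfl⟩ (dualSec y₀) = 1 := by
    have := hω' U le_rfl 1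
    rwa [one_smul, resM_self] at this
  refine ⟨ω, fun V h y' => ?_, isBasisOn_dual hν (fun _ => ω) (fun _ _ => by rw [hω1, if_pos rfl]), fun c y hy => ?_⟩
  · have h1 : (dualRes h y₀).1 ⟨V, le_rfl⟩ (resM _ h m) = 1 := by
      have := hy₀ V h 1
      rwa [one_smul] at this
    rw [(hm.mono h).dualSec_eq h1 y', ← resM_dualSec]
    exact hω' V h _
  · have h1 := IsBasisOn.dualSec_eq_sum hν (fun _ => ω) (fun _ _ => by rw [hω1, if_pos rfl]) y
    rw [Finset.univ_unique, Finset.sum_singleton] at h1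
    rw [h1]
    refine congrArg (· • dualSec ω) ?_
    refine (hy U le_rfl y₀).trans ?_
    rw [resM_self]
    have := hy₀ U le_rfl c
    rwa [resM_self] at this

lemma IsKernelGenerator.isProduct (hm : IsKernelGenerator g b U σ τ m) {d : ℕ} {ω : dualSections (Limits.kernel g).dual U}
    (hω : IsEvaluationAt m ω) (j : Fin (d + 1)) :
    ∃ n, IsProduct g d U (tensorMon ψ b d ω j) n := by
  refine ⟨_, monVec b j, m, ω, 3, fun j => (quadratic σ τ).coeff j, monVec b, ?_, hω, rfl, rfl⟩
  rw [hm.eq, polySum_apply]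

/-- A linear map that is multiplication by `X² - σ X - τ` on polynomials sends every tensor product
to the corresponding product of forms. -/
lemma IsKernelGenerator.map_eq_of_isProduct (hm : IsKernelGenerator g b U σ τ m)
    (hc : HasCoordsOn ψ U b.dualBasis ![-α, -β, 1]) {d : ℕ} {ω : dualSections (Limits.kernel g).dual U}
    (hω : ∀ (c : Γ(H.space, U)) y, IsEvaluationAt (c • m) y → dualSec y = c • dualSec ω)
    (φ : Γ(((Scheme.Modules.pullback ψ).obj (P'.kernelBundle.dual.sym d)).tensor (Limits.kernel g).dual.dual, U) →ₗ[Γ(H.space, U)]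
      Γ((Scheme.Modules.pullback ψ).obj (P'.kernelBundle.dual.sym (d + 2)), U))
    (hφ : ∀ p : Polynomial Γ(H.space, U), p.natDegree ≤ d → φ (polySum (tensorMon ψ b d ω) p) =
      polySum (monSec ψ b U (d + 2)) (p * quadratic σ τ)) {s n} (h : IsProduct g d U s n) : φ s = n := by
  obtain ⟨v, z, y, l, r, w, h1, h2, rfl, rfl⟩ := h
  obtain ⟨c, rfl⟩ := hm.isGenOn.exists_eq_smul_self z
  have h3 : tensorSection (resM _ (le_top : U ≤ ⊤) (prodSec ψ v)) (dualSec y) =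
      polySum (tensorMon ψ b d ω) (c • ∏ i, lineForm (constFun (ψ ≫ P'.π) U) b α β (v i)) := by
    rw [hω c y h2, tensorSection_smul_right, resM_prodSec hc, _root_.map_smul, polySum_apply]
    congr 1
    refine (LinearMap.map_sum₂ (tensorBilin _ _ U) _ _ (dualSec ω)).trans ?_
    exact Finset.sum_congr rfl fun j _ => tensorSection_smul_left _ _ _
  -- If `z` is `c` times the generator, then its product with a form `p` is `p * (c * (X² - σ X -
  -- τ))`, which is expanded into products of vectors.
  rw [h3, hφ _ ((Polynomial.natDegree_smul_le _ _).trans (natDegree_prod_lineForm_le _ _ _ _ _)),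
    Polynomial.smul_eq_C_mul, mul_comm (Polynomial.C c), mul_assoc, ← hm.sum_eq hc c r w h1, Finset.mul_sum, map_sum]
  refine Finset.sum_congr rfl fun i _ => ?_
  rw [resM_prodSec hc, ← polySum_apply, ← _root_.map_smul, Polynomial.smul_eq_C_mul, mul_left_comm, Fin.prod_univ_add]
  simp only [Fin.append_left, Fin.append_right]

end

/-- The homomorphism that multiplies forms of degree `d` with quadratic forms that vanish on the pairs of
points. -/
lemma exists_multiplication [Infinite k] (hE : Module.finrank k E = 3) (hπ : ψ ≫ P'.π = H.π)
    (hψ : H.IsSpanMap ψ) (hg : ∀ v : Fin 2 → E, g.app ⊤ (prodSec ψ v) = H.tautSec v) (d : ℕ) :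
    ∃ f : ((Scheme.Modules.pullback ψ).obj (P'.kernelBundle.dual.sym d)).tensor (Limits.kernel g).dual.dual ⟶
        (Scheme.Modules.pullback ψ).obj (P'.kernelBundle.dual.sym (d + 2)),
      ∀ (b : Module.Basis (Fin 3) k E) (U : H.space.Opens) (α β σ τ : Γ(H.space, U))
        (x : Γ(H.family, H.p₂ ⁻¹ᵁ U)), IsChartOn H.p₁ H.p₂ b U α β σ τ x →
        ∃ ω : dualSections (Limits.kernel g).dual U, IsBasisOn _ U (tensorMon ψ b d ω) ∧
          ∀ p : Polynomial Γ(H.space, U), p.natDegree ≤ d → f.app U (polySum (tensorMon ψ b d ω) p) =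
            polySum (monSec ψ b U (d + 2)) (p * quadratic σ τ) := by
  have main : ∀ (b : Module.Basis (Fin 3) k E) (U : H.space.Opens) (α β σ τ : Γ(H.space, U))
      (x : Γ(H.family, H.p₂ ⁻¹ᵁ U)), IsChartOn H.p₁ H.p₂ b U α β σ τ x →
      ∃ (ω : dualSections (Limits.kernel g).dual U)
        (φ : Γ(((Scheme.Modules.pullback ψ).obj (P'.kernelBundle.dual.sym d)).tensor (Limits.kernel g).dual.dual, U)
          →ₗ[Γ(H.space, U)] Γ((Scheme.Modules.pullback ψ).obj (P'.kernelBundle.dual.sym (d + 2)), U)),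
        IsBasisOn _ U (tensorMon ψ b d ω) ∧ (∀ s n, IsProduct g d U s n → φ s = n) ∧
        (∀ j, ∃ n, IsProduct g d U (tensorMon ψ b d ω j) n) ∧
        ∀ p : Polynomial Γ(H.space, U), p.natDegree ≤ d → φ (polySum (tensorMon ψ b d ω) p) =
          polySum (monSec ψ b U (d + 2)) (p * quadratic σ τ) := by
    intro b U α β σ τ x hx
    obtain ⟨m, hm, hm'⟩ := exists_kernel_generator hπ hψ hg hx
    have hm : IsKernelGenerator g b U σ τ m := ⟨hm, hm'⟩
    have hc := hψ.hasCoordsOn hπ hx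
    obtain ⟨ω, hω, hω', hω''⟩ := hm.exists_evaluation
    have hB := isBasisOn_tensorMon hc d hω'
    obtain ⟨φ, hφ⟩ := hB.exists_linearMap fun j : Fin (d + 1) =>
      polySum (monSec ψ b U (d + 2)) (Polynomial.X ^ (j : ℕ) * quadratic σ τ)
    have hφ' : ∀ p : Polynomial Γ(H.space, U), p.natDegree ≤ d → φ (polySum (tensorMon ψ b d ω) p) =
          polySum (monSec ψ b U (d + 2)) (p * quadratic σ τ) := by
      intro p hp
      rw [polySum_apply, hφ]
      conv_rhs => rw [p.as_sum_range_C_mul_X_pow' (Nat.lt_succ_of_le hp), ← Fin.sum_univ_eq_sum_range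
        (fun j => Polynomial.C (p.coeff j) * Polynomial.X ^ j), Finset.sum_mul, map_sum]
      exact Finset.sum_congr rfl fun j _ => by
        rw [mul_assoc, ← Polynomial.smul_eq_C_mul, _root_.map_smul]
    exact ⟨ω, φ, hB, fun s n => hm.map_eq_of_isProduct hc hω'' φ hφ', hm.isProduct hω, hφ'⟩
  -- The relation `IsProduct g d` does not refer to a chart, so the local homomorphisms glue.
  obtain ⟨f, hf⟩ := exists_hom_of_relation
    (M := ((Scheme.Modules.pullback ψ).obj (P'.kernelBundle.dual.sym d)).tensor (Limits.kernel g).dual.dual)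
    (N := (Scheme.Modules.pullback ψ).obj (P'.kernelBundle.dual.sym (d + 2)))
    {U | ∃ b α β σ τ x, IsChartOn H.p₁ H.p₂ b U α β σ τ x} (fun y => by
      obtain ⟨b, hb⟩ := H.isLengthFamily.exists_isChartOn hE y y
      obtain ⟨U, α, β, σ, τ, x, hy, hx⟩ := hb y (.inl rfl)
      exact ⟨U, ⟨b, α, β, σ, τ, x, hx⟩, hy⟩) (by
      rintro U ⟨b, α, β, σ, τ, x, hx⟩ V hV
      exact ⟨b, _, _, _, _, _, hx.mono hV⟩)
    (IsProduct g d) (fun U V hV m n h => h.restrict hV) (by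
      rintro U ⟨b, α, β, σ, τ, x, hx⟩
      obtain ⟨ω, φ, hB, h1, h2, -⟩ := main b U α β σ τ x hx
      exact ⟨φ, h1, hB.span_eq_top h2⟩)
  refine ⟨f, fun b U α β σ τ x hx => ?_⟩
  obtain ⟨ω, φ, hB, h1, h2, h3⟩ := main b U α β σ τ x hx
  refine ⟨ω, hB, fun p hp => ?_⟩
  rw [← h3 p hp, polySum_apply, map_sum, map_sum]
  refine Finset.sum_congr rfl fun j _ => ?_
  obtain ⟨n, hn⟩ := h2 j
  rw [Hom.app_smul, _root_.map_smul, hf U _ _ hn, h1 _ _ hn]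

end HilbertScheme

end AlgebraicGeometry

namespace AlgebraicGeometry
universe u
open Scheme.Modules ProjectiveBundle

/-! ### Exactness of the resolution -/

/-- A polynomial that vanishes at `x` is divisible by `X² - σ X - τ`, since its remainder is a
combination of `1` and `x`. -/
lemma quadratic_dvd_of_eval₂_eq_zero {A B : Type*} [CommRing A] [CommRing B] {f : A →+* B} {x : B}
    (h : IsGenerator f x) {σ τ : A} (hx : x * x = f σ * x + f τ) {p : Polynomial A}
    (hp : p.eval₂ f x = 0) : quadratic σ τ ∣ p := by
  nontriviality A
  have hq := monic_quadratic σ τ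
  rw [← Polynomial.modByMonic_eq_zero_iff_dvd hq]
  have hdeg : (p %ₘ quadratic σ τ).natDegree ≤ 1 := by
    have := Polynomial.natDegree_modByMonic_lt p hq (fun e => by
      have := natDegree_quadratic σ τ
      rw [e] at this
      simp at this)
    rw [natDegree_quadratic] at this
    omega
  have h1 : (p %ₘ quadratic σ τ).eval₂ f x = 0 := by
    have h2 := congrArg (Polynomial.eval₂ f x) (Polynomial.modByMonic_add_div p (quadratic σ τ))
    rw [Polynomial.eval₂_add, Polynomial.eval₂_mul, eval₂_quadratic, hx, sub_self, zero_mul, add_zero] at h2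
    rw [h2, hp]
  obtain ⟨a, c, e⟩ := Polynomial.exists_eq_X_add_C_of_natDegree_le_one hdeg
  rw [e] at h1 ⊢
  have h3 : f c + f a * x = f 0 + f 0 * x := by
    simp at h1
    rw [add_comm, h1]
    simp
  obtain ⟨rfl, rfl⟩ := h.ext h3
  simp

namespace HilbertScheme

variable {k : Type u} [Field k] {E : Type u} [AddCommGroup E] [Module k E]
  {P : ProjectiveBundle (vectorSheaf k E)} {P' : ProjectiveBundle (vectorSheaf k (Module.Dual k E))}
  {H : HilbertScheme P.π 2} [Module.Finite k E] {ψ : H.space ⟶ P'.space}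

/-- The exactness is division with remainder by the monic polynomials `X² - σ X - τ`. -/
theorem exists_shortExact [Infinite k] (hE : Module.finrank k E = 3) (hπ : ψ ≫ P'.π = H.π)
    (hψ : H.IsSpanMap ψ)
    {g : (Scheme.Modules.pullback ψ).obj (P'.kernelBundle.dual.sym 2) ⟶ H.tautological (P.O 2)}
    (hg : ∀ v : Fin 2 → E, g.app ⊤ (prodSec ψ v) = H.tautSec v) (d : ℕ) :
    ∃ (f : ((Scheme.Modules.pullback ψ).obj (P'.kernelBundle.dual.sym d)).tensor (Limits.kernel g).dual.dual ⟶
        (Scheme.Modules.pullback ψ).obj (P'.kernelBundle.dual.sym (d + 2)))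
      (g' : (Scheme.Modules.pullback ψ).obj (P'.kernelBundle.dual.sym (d + 2)) ⟶ H.tautological (P.O (d + 2)))
      (w : f ≫ g' = 0), (ShortComplex.mk f g' w).ShortExact := by
  obtain ⟨f, hf⟩ := exists_multiplication hE hπ hψ hg d
  obtain ⟨g', hg'⟩ := exists_restriction hE hπ hψ (d + 2)
  have hcov : ∀ y : H.space, ∃ U : H.space.Opens, y ∈ U ∧ ∃ b α β σ τ x, IsChartOn H.p₁ H.p₂ b U α β σ τ x := by
    intro y
    obtain ⟨b, hb⟩ := H.isLengthFamily.exists_isChartOn hE y y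
    obtain ⟨U, α, β, σ, τ, x, hy, hx⟩ := hb y (.inl rfl)
    exact ⟨U, hy, b, α, β, σ, τ, x, hx⟩
  have hdeg : ∀ (U : H.space.Opens) (σ τ : Γ(H.space, U)) (p : Polynomial Γ(H.space, U)), p.natDegree ≤ d →
      (p * quadratic σ τ).natDegree ≤ d + 2 := fun U σ τ p hp =>
    Polynomial.natDegree_mul_le.trans (add_le_add hp (natDegree_quadratic_le σ τ))
  have w : f ≫ g' = 0 := by
    ext V n
    refine section_ext fun y hy => ?_
    obtain ⟨U, hyU, b, α, β, σ, τ, x, hx⟩ := hcov y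
    have hx := hx.mono (inf_le_left : U ⊓ V ≤ U)
    obtain ⟨ω, hω, hω'⟩ := hf _ _ _ _ _ _ _ hx
    refine ⟨U ⊓ V, ⟨hyU, hy⟩, inf_le_right, ?_⟩
    rw [← resM_app]
    obtain ⟨p, hp, e⟩ := hω.exists_eq_polySum (resM _ inf_le_right n)
    rw [e, comp_app_apply, hω' p hp, restriction_polySum hg' hx (hdeg _ _ _ _ hp), Polynomial.eval₂_mul,
      eval₂_quadratic, hx.sq, sub_self, mul_zero, map_zero]
    exact (map_zero _).symm
  refine ⟨f, g', w, shortExact_of_locally _ fun y => ?_⟩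
  obtain ⟨U, hyU, b, α, β, σ, τ, x, hx⟩ := hcov y
  refine ⟨U, hyU, fun V hV => ?_⟩
  have hx := hx.mono hV
  obtain ⟨ω, hω, hω'⟩ := hf _ _ _ _ _ _ _ hx
  have hgen := hx.gen V le_rfl
  rw [resF_self] at hgen
  have hB := isBasisOn_prodSec (hψ.hasCoordsOn hπ hx) (d + 2)
  refine ⟨?_, fun s => ?_, fun s hs => ?_⟩
  -- Multiplication by a monic polynomial is injective.
  · refine (injective_iff_map_eq_zero _).mpr fun s hs => ?_
    obtain ⟨p, hp, rfl⟩ := hω.exists_eq_polySum s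
    have h1 := hs
    change f.app V _ = 0 at h1
    rw [hω' p hp] at h1
    have h2 := hB.polySum_injective (q := 0) (hdeg _ _ _ _ hp) (by simp) (h1.trans (map_zero _).symm)
    rw [mul_comm, (monic_quadratic _ _).mul_right_eq_zero_iff] at h2
    rw [h2, map_zero]
  -- Every function on the family is the value at `x` of a polynomial of degree at most one.
  · obtain ⟨r, rfl⟩ := (bijective_mulSec hx (d + 2)).2 s
    obtain ⟨r0, r1, rfl⟩ := hgen.exists_eq r
    have hp : (Polynomial.C r0 + Polynomial.C r1 * Polynomial.X).natDegree ≤ d + 2 := by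
      compute_degree!
    refine ⟨polySum (monSec ψ b V (d + 2)) (Polynomial.C r0 + Polynomial.C r1 * Polynomial.X), ?_⟩
    refine (restriction_polySum hg' hx hp).trans ?_
    simp
  -- A form that vanishes on the pairs of points is a multiple of `X² - σ X - τ`, and the quotient
  -- has the right degree because this polynomial is monic.
  · obtain ⟨p, hp, rfl⟩ := hB.exists_eq_polySum s
    have h1 : g'.app V (polySum (monSec ψ b V (d + 2)) p) = 0 := hs
    have h2 : p.eval₂ (H.p₂.app V).hom _ = 0 := (bijective_mulSec hx (d + 2)).1
      ((restriction_polySum hg' hx hp).symm.trans (h1.trans (map_zero _).symm))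
    obtain ⟨q, rfl⟩ := quadratic_dvd_of_eval₂_eq_zero hgen hx.sq h2
    refine ⟨polySum (tensorMon ψ b d ω) q, ?_⟩
    rw [mul_comm]
    refine hω' q ?_
    by_cases hq : q = 0
    · simp [hq]
    · have := Polynomial.Nontrivial.of_polynomial_ne hq
      rw [(monic_quadratic _ _).natDegree_mul' hq, natDegree_quadratic] at hp
      omega

end HilbertScheme

end AlgebraicGeometry

namespace AlgebraicGeometry
universe u
open Scheme.Modules ProjectiveBundle

variable {k : Type u} [Field k] {E : Type u} [AddCommGroup E] [Module k E]
  {P' : ProjectiveBundle (vectorSheaf k (Module.Dual k E))} {T T' : Scheme.{u}} {f f' : T ⟶ P'.space}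
  {b : Module.Basis (Fin 3) k E} {U V : T.Opens} {M M' : T.Modules}
  {r : (Scheme.Modules.pullback f).obj (P'.kernelBundle.sym 2) ⟶ M}
  {r' : (Scheme.Modules.pullback f').obj (P'.kernelBundle.sym 2) ⟶ M'}

/-! ### Quadrics on the lines of a family -/

lemma isUnit_two (h2 : (2 : k) ≠ 0) (t : T ⟶ Spec (CommRingCat.of k)) (V : T.Opens) : IsUnit (2 : Γ(T, V)) := by
  have := (IsUnit.mk0 _ h2).map (constFun t V)
  rwa [map_ofNat] at this

lemma map_line_coords {R R' : Type*} [CommRing R] [CommRing R'] (φ : R →+* R') (c : Fin 4 → R) (i : Fin 3) :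
    φ ((![-c 0, -c 1, 1] : Fin 3 → R) i) = (![-φ (c 0), -φ (c 1), 1] : Fin 3 → R') i := by
  fin_cases i
  exacts [map_neg _ _, map_neg _ _, map_one _]

lemma map_polar_coords {R R' : Type*} [CommRing R] [CommRing R'] (φ : R →+* R') (c : Fin 4 → R) (j : Fin 3) :
    φ ((![-2 * c 3, -c 2, 2] : Fin 3 → R) j) = (![-2 * φ (c 3), -φ (c 2), 2] : Fin 3 → R') j := by
  fin_cases j
  · change φ (-2 * c 3) = -2 * φ (c 3)
    rw [map_mul, map_neg, map_ofNat]
  · exact map_neg _ _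
  · exact map_ofNat _ _

/-- On `V`, the family of lines given by `f` has the coordinates `(-α, -β, 1)`, and the quotient `r` of
`f^* Sym² K` is the polarization of the quadratic form `X² - σ X - τ` on these lines, where
`c = (α, β, σ, τ)`. -/
structure IsQuadric (f : T ⟶ P'.space) (r : (Scheme.Modules.pullback f).obj (P'.kernelBundle.sym 2) ⟶ M)
    (b : Module.Basis (Fin 3) k E) (V : T.Opens) (c : Fin 4 → Γ(T, V)) : Prop where
  coords : HasCoordsOn f V b.dualBasis ![-c 0, -c 1, 1]
  exists_gen : ∃ ν, IsGenOn M V ν ∧ ∀ (h : V ≤ f ⁻¹ᵁ P'.chart (b.coord 2)) (j : Fin 3),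
    r.app V (resM _ h (pairMon f b j)) = (![-2 * c 3, -c 2, 2] j : Γ(T, V)) • ν

lemma app_pullbackQuotient_pullSec {S X T : Scheme.{u}} {E : S.Modules} {π : X ⟶ S} {L : X.Modules}
    (q : (Scheme.Modules.pullback π).obj E ⟶ L) (g : T ⟶ X) {O : S.Opens} (s : Γ(E, O)) :
    (pullbackQuotient q g).app (g ⁻¹ᵁ π ⁻¹ᵁ O) (resM _ (show g ⁻¹ᵁ π ⁻¹ᵁ O ≤ (g ≫ π) ⁻¹ᵁ O from le_rfl)
      (pullSec (g ≫ π) s)) = pullSec g (q.app _ (pullSec π s)) := by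
  have h := pullSec_comp g π s
  exact (congrArg (((Scheme.Modules.pullback g).map q).app _) h).trans (pullback_map_pullSec g q _)

lemma app_pullbackQuotient_pairMon (r : (Scheme.Modules.pullback f).obj (P'.kernelBundle.sym 2) ⟶ M) (g : T' ⟶ T)
    (b : Module.Basis (Fin 3) k E) (h : V ≤ f ⁻¹ᵁ P'.chart (b.coord 2))
    (h' : g ⁻¹ᵁ V ≤ (g ≫ f) ⁻¹ᵁ P'.chart (b.coord 2)) (j : Fin 3) :
    (pullbackQuotient r g).app (g ⁻¹ᵁ V) (resM _ h' (pairMon (g ≫ f) b j)) =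
      pullSec g (r.app V (resM _ h (pairMon f b j))) := by
  have h1 := app_pullbackQuotient_pullSec r g (symMon (k := 2) (kerSec b (P' := P')) j)
  have h2 := congrArg (resM _ (g.preimage_mono h)) h1
  rw [← resM_app, resM_resM, ← pullSec_resM, ← resM_app] at h2
  exact h2

namespace IsQuadric

variable {c c' : Fin 4 → Γ(T, V)}

lemma mono (H : IsQuadric f r b V c) (h : U ≤ V) : IsQuadric f r b U fun i => resF h (c i) where
  coords := by
    exact (congrArg (HasCoordsOn f U b.dualBasis) (funext (map_line_coords (resF h) c))).mp (H.coords.mono h)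
  exists_gen := by
    obtain ⟨ν, hν, hr⟩ := H.exists_gen
    refine ⟨_, IsBasisOn.mono hν h, fun h' j => ?_⟩
    have h1 := congrArg (resM M h) (hr H.coords.le_chart j)
    rw [← resM_app, resM_resM, resM_smul] at h1
    exact h1.trans (congrArg (· • resM M h ν) (map_polar_coords _ c j))

lemma comp (H : IsQuadric f r b V c) (g : T' ⟶ T) :
    IsQuadric (g ≫ f) (pullbackQuotient r g) b (g ⁻¹ᵁ V) fun i => g.app V (c i) where
  coords := by
    exact (congrArg (HasCoordsOn _ _ b.dualBasis) (funext (map_line_coords (g.app V).hom c))).mp (H.coords.comp g)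
  exists_gen := by
    obtain ⟨ν, hν, hr⟩ := H.exists_gen
    refine ⟨_, hν.pullSec g, fun h' j => ?_⟩
    rw [app_pullbackQuotient_pairMon r g b H.coords.le_chart, hr H.coords.le_chart j, pullSec_smul]
    exact congrArg (· • pullSec g ν) (map_polar_coords (g.app V).hom c j)

/-- A quotient determines the line and the quadratic form. The coefficient `2` of the polarization
is a unit, so that the generator of the target is determined. -/
lemma unique (h2 : (2 : k) ≠ 0) (H : IsQuadric f r b V c) (H' : IsQuadric f r b V c') : c = c' := by
  obtain ⟨w, -, hw⟩ := H.coords.exists_unit H'.coords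
  have hw2 : (1 : Γ(T, V)) = w * 1 := hw 2
  rw [mul_one] at hw2
  subst hw2
  obtain ⟨ν, hν, hr⟩ := H.exists_gen
  obtain ⟨ν', hν', hr'⟩ := H'.exists_gen
  have key : ∀ j, (![-2 * c 3, -c 2, 2] j : Γ(T, V)) • ν = (![-2 * c' 3, -c' 2, 2] j : Γ(T, V)) • ν' := fun j =>
    (hr H.coords.le_chart j).symm.trans (hr' H.coords.le_chart j)
  have hu := isUnit_two h2 (f ≫ P'.π) V
  have e : ν = ν' := hu.smul_left_cancel.mp (key 2)
  subst e
  have e0 : -c' 0 = 1 * -c 0 := hw 0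
  have e1 : -c' 1 = 1 * -c 1 := hw 1
  have e2 : -c 2 = -c' 2 := hν.smul_injective_self (key 1)
  have e3 : -2 * c 3 = -2 * c' 3 := hν.smul_injective_self (key 0)
  rw [one_mul, neg_inj] at e0 e1
  rw [neg_mul, neg_mul, neg_inj, hu.mul_right_inj] at e3
  ext i
  fin_cases i
  exacts [e0.symm, e1.symm, neg_inj.mp e2, e3]

lemma of_iso (H : IsQuadric f' r' b V c) (h : f' = f) (e : M' ≅ M)
    (he : r' ≫ e.hom = (pullbackCongr h).hom.app _ ≫ r) : IsQuadric f r b V c := by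
  subst h
  have he : r' ≫ e.hom = r := by simpa [pullbackCongr] using he
  obtain ⟨ν, hν, hr⟩ := H.exists_gen
  refine ⟨H.coords, _, hν.of_iso e.hom, fun h j => ?_⟩
  rw [← Hom.app_smul, ← hr h, ← he, comp_app_apply]

/-- The kernel of the quotient of `f^* Sym² K` given by a quadric. -/
lemma app_eq_zero_iff (H : IsQuadric f r b V c) (a : Fin 3 → Γ(T, V)) :
    r.app V (∑ j, a j • resM _ H.coords.le_chart (pairMon f b j)) = 0 ↔
      ∑ j, a j * (![-2 * c 3, -c 2, 2] j : Γ(T, V)) = 0 := by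
  obtain ⟨ν, hν, hr⟩ := H.exists_gen
  have : r.app V (∑ j, a j • resM _ H.coords.le_chart (pairMon f b j)) =
      (∑ j, a j * (![-2 * c 3, -c 2, 2] j : Γ(T, V))) • ν := by
    rw [map_sum, Finset.sum_smul]
    exact Finset.sum_congr rfl fun j _ => by rw [Hom.app_smul, hr, smul_smul]
  rw [this]
  exact ⟨fun h => hν.smul_injective_self (h.trans (zero_smul _ _).symm), fun h => by rw [h, zero_smul]⟩

/-- Quotients that are given locally by the same quadrics are isomorphic. -/
lemma exists_iso [Epi r] [Epi r'] (h : f' ≫ P'.π = f ≫ P'.π)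
    (H : ∀ y : T, ∃ (V : T.Opens) (b : Module.Basis (Fin 3) k E) (c : Fin 4 → Γ(T, V)), y ∈ V ∧
      IsQuadric f' r' b V c ∧ IsQuadric f r b V c) :
    ∃ (h : f' = f) (e : M' ≅ M), r' ≫ e.hom = (pullbackCongr h).hom.app _ ≫ r := by
  have h : f' = f := hom_ext_of_locally h fun y => by
    obtain ⟨V, b, c, hy, h1, h2⟩ := H y
    exact ⟨V, b.dualBasis, _, hy, h1.coords, h2.coords⟩
  subst h
  refine ⟨rfl, ?_⟩
  obtain ⟨e, he⟩ := exists_iso_of_same_kernel r' r fun y => by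
    obtain ⟨V, b, c, hy, h1, h2⟩ := H y
    refine ⟨V, hy, fun W hW s => ?_⟩
    obtain ⟨a, rfl⟩ := (isBasisOn_pairMon f' b).exists_eq (hW.trans h1.coords.le_chart) s
    exact ((h1.mono hW).app_eq_zero_iff a).trans ((h2.mono hW).app_eq_zero_iff a).symm
  exact ⟨e, by simp [he, pullbackCongr]⟩

/-- Quadrics can be found on an open subscheme. -/
lemma of_ι {V W : T.Opens} {c : Fin 4 → Γ(T, V)} (hV : V ≤ W) {μ : Γ(M, V)} (hμ : IsGenOn M V μ)
    (H : IsQuadric (W.ι ≫ f) (pullbackQuotient r W.ι) b (W.ι ⁻¹ᵁ V) fun i => W.ι.app V (c i)) :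
    IsQuadric f r b V c := by
  have hiso : IsIso (W.ι.app V) := W.ι.isIso_app _ (by simpa using hV)
  have hbij := ConcreteCategory.bijective_of_isIso (W.ι.app V)
  have hc : HasCoordsOn f V b.dualBasis ![-c 0, -c 1, 1] := by
    refine HasCoordsOn.of_ι hV (j := 2) rfl ?_
    exact (congrArg (HasCoordsOn _ _ _) (funext fun i => (map_line_coords (W.ι.app V).hom c i).symm)).mp H.coords
  refine ⟨hc, ?_⟩
  obtain ⟨ν, hν, hr⟩ := H.exists_gen
  choose a ha using fun j => hμ.exists_eq_smul_self (r.app V (resM _ hc.le_chart (pairMon f b j)))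
  have hμ' := hμ.pullSec W.ι
  obtain ⟨w, rfl⟩ := hμ'.exists_eq_smul_self ν
  obtain ⟨w, rfl⟩ := hbij.2 w
  have hw : IsUnit w := (isUnit_map_iff (W.ι.app V).hom w).mp (hμ'.isUnit hν)
  refine ⟨w • μ, hμ.smul_of_isUnit hw, fun h j => ?_⟩
  rw [ha, smul_smul]
  refine congrArg (· • μ) (hbij.1 (hμ'.smul_injective_self ?_))
  have h1 := hr H.coords.le_chart j
  rw [app_pullbackQuotient_pairMon r W.ι b hc.le_chart, ha, pullSec_smul, smul_smul] at h1
  refine h1.trans (congrArg (· • pullSec W.ι μ) ?_)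
  refine Eq.trans ?_ (map_mul (W.ι.app V).hom _ _).symm
  exact congrArg (· * (W.ι.app V).hom w) (map_polar_coords (W.ι.app V).hom c j).symm

end IsQuadric

end AlgebraicGeometry

namespace AlgebraicGeometry
universe u
open Scheme.Modules ProjectiveBundle

/-- An epimorphism onto a line bundle does not vanish at any point. -/
lemma Scheme.Modules.exists_mem_basicOpen_of_epi {X : Scheme.{u}} {M N : X.Modules} (r : N ⟶ M) [Epi r] {V : X.Opens}
    {ι : Type*} [Fintype ι] {s : ι → Γ(N, V)} (hs : IsBasisOn N V s) {μ : Γ(M, V)} (hμ : IsGenOn M V μ)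
    {a : ι → Γ(X, V)} (ha : ∀ i, r.app V (s i) = a i • μ) {y : X} (hy : y ∈ V) : ∃ i, y ∈ X.basicOpen (a i) := by
  by_contra! hc
  let h := X.fromSpecResidueField y
  have hV : ⊤ ≤ h ⁻¹ᵁ V := by
    intro z _
    simpa [h, X.fromSpecResidueField_apply] using hy
  have h0 : ∀ i, h.app V (a i) = 0 := by
    intro i
    rw [← basicOpen_eq_bot_iff, ← Scheme.preimage_basicOpen]
    ext z
    have : h z = y := X.fromSpecResidueField_apply y z
    change h z ∈ X.basicOpen (a i) ↔ False
    rw [this]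
    exact iff_of_false (hc i) id
  have h4 : (Scheme.Modules.pullback h).map r = 0 := by
    refine ((hs.pullSec h).mono hV).hom_ext fun i => ?_
    rw [resM_app, pullback_map_pullSec, ha, pullSec_smul, h0, zero_smul, map_zero]
    rfl
  have h5 : 𝟙 ((Scheme.Modules.pullback h).obj M) = 0 := by
    rw [← cancel_epi ((Scheme.Modules.pullback h).map r), h4, Limits.zero_comp, Limits.zero_comp]
  have hμ' : IsGenOn _ ⊤ (resM _ hV (pullSec h μ)) := IsBasisOn.mono (hμ.pullSec h) hV
  have h6 : resM _ hV (pullSec h μ) = 0 := by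
    rw [← id_app_apply (resM _ hV (pullSec h μ)), h5]
    rfl
  have h7 : (1 : Γ(Spec (X.residueField y), ⊤)) = 0 :=
    hμ'.smul_injective_self (by rw [h6, smul_zero, smul_zero])
  exact one_ne_zero h7

section

variable {k : Type*} [Field k] {E : Type*} [AddCommGroup E] [Module k E] (b : Module.Basis (Fin 3) k E)

lemma exists_basis_coord_eq (j : Fin 3) : ∃ b' : Module.Basis (Fin 3) k E, b'.coord 2 = b.coord j := by
  refine ⟨b.reindex (Equiv.swap j 2), LinearMap.ext fun v => ?_⟩
  rw [Module.Basis.coord_apply, Module.Basis.coord_apply, Module.Basis.repr_reindex_apply, Equiv.symm_swap,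
    Equiv.swap_apply_right]

lemma exists_basis_swap : ∃ b' : Module.Basis (Fin 3) k E, b'.coord 2 = b.coord 2 ∧ b'.coord 1 = b.coord 0 := by
  refine ⟨b.reindex (Equiv.swap 0 1), LinearMap.ext fun v => ?_, LinearMap.ext fun v => ?_⟩ <;>
  rw [Module.Basis.coord_apply, Module.Basis.coord_apply, Module.Basis.repr_reindex_apply] <;> rfl

/-- The change of basis that replaces the second coordinate by the sum of the first two. -/
lemma exists_basis_add : ∃ b' : Module.Basis (Fin 3) k E, b'.coord 2 = b.coord 2 ∧
    b'.coord 1 = b.coord 0 + b.coord 1 := by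
  let e : (Fin 3 → k) ≃ₗ[k] (Fin 3 → k) :=
    { toFun := fun x => ![x 0, x 0 + x 1, x 2]
      invFun := fun x => ![x 0, x 1 - x 0, x 2]
      map_add' := fun x y => by ext i; fin_cases i <;> simp; ring
      map_smul' := fun a x => by ext i; fin_cases i <;> simp; ring
      left_inv := fun x => by ext i; fin_cases i <;> simp
      right_inv := fun x => by ext i; fin_cases i <;> simp }
  refine ⟨Module.Basis.ofEquivFun (b.equivFun.trans e), LinearMap.ext fun v => ?_, LinearMap.ext fun v => ?_⟩ <;>
  simp [e]

end

variable {k : Type u} [Field k] {E : Type u} [AddCommGroup E] [Module k E]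
  {P' : ProjectiveBundle (vectorSheaf k (Module.Dual k E))} {T : Scheme.{u}} {f : T ⟶ P'.space}
  {b b' : Module.Basis (Fin 3) k E} {V : T.Opens} {M : T.Modules}
  {r : (Scheme.Modules.pullback f).obj (P'.kernelBundle.sym 2) ⟶ M} {μ : Γ(M, V)} {a : Fin 3 → Γ(T, V)}

/-- A quotient of `f^* Sym² K` is given by a quadric where the square of one of the basis sections generates. -/
lemma exists_isQuadric_of_isUnit (h2 : (2 : k) ≠ 0) (hV : V ≤ nonvan (vec f (b.coord 2))) (hμ : IsGenOn M V μ)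
    (h : V ≤ f ⁻¹ᵁ P'.chart (b.coord 2)) (ha : IsUnit (a 2))
    (hr : ∀ j, r.app V (resM _ h (pairMon f b j)) = a j • μ) : ∃ c, IsQuadric f r b V c := by
  obtain ⟨d, hd, hc⟩ := exists_hasCoordsOn_nonvan f b.dualBasis 2 (U := V) (by
    rwa [Module.Basis.coe_dualBasis])
  obtain ⟨t, ht⟩ := isUnit_two h2 (f ≫ P'.π) V
  obtain ⟨u, hu⟩ := ha
  -- The generator `ν` is determined by `a 2 • μ = 2 • ν`.
  have htu : (2 : Γ(T, V)) * t⁻¹.val = 1 := by rw [← ht, Units.mul_inv]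
  have huu : a 2 * u⁻¹.val = 1 := by rw [← hu, Units.mul_inv]
  refine ⟨![-d 0, -d 1, -2 * a 1 * u⁻¹.val, -(a 0 * u⁻¹.val)], ?_, (a 2 * t⁻¹.val) • μ,
    hμ.smul_of_isUnit ?_, fun h' j => (hr j).trans ?_⟩
  · refine (congrArg (HasCoordsOn f V b.dualBasis) (funext fun i => ?_)).mp hc
    fin_cases i
    exacts [(neg_neg _).symm, (neg_neg _).symm, hd]
  · rw [← hu]
    exact (u * t⁻¹).isUnit
  · rw [smul_smul]
    refine congrArg (· • μ) ?_
    fin_cases j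
    · change a 0 = -2 * -(a 0 * u⁻¹.val) * (a 2 * t⁻¹.val)
      linear_combination (-a 0) * htu - (a 0 * 2 * t⁻¹.val) * huu
    · change a 1 = -(-2 * a 1 * u⁻¹.val) * (a 2 * t⁻¹.val)
      linear_combination (-a 1) * htu - (a 1 * 2 * t⁻¹.val) * huu
    · change a 2 = 2 * (a 2 * t⁻¹.val)
      linear_combination (-a 2) * htu

/-- The value of a quotient of `f^* Sym² K` on the square of a basis section for another basis. -/
lemma app_pairMon_of_coord_eq [Module.Finite k E] (h : V ≤ f ⁻¹ᵁ P'.chart (b.coord 2)) (h' : V ≤ f ⁻¹ᵁ P'.chart (b'.coord 2))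
    (hr : ∀ j, r.app V (resM _ h (pairMon f b j)) = a j • μ) (e : b'.coord 2 = b.coord 2) {s t : k}
    (hs : b'.coord 1 (b 0) = s) (ht : b'.coord 1 (b 1) = t) :
    r.app V (resM _ h' (pairMon f b' 2)) = (constFun (f ≫ P'.π) V s * constFun (f ≫ P'.π) V s * a 0 +
      (constFun (f ≫ P'.π) V s * constFun (f ≫ P'.π) V t + constFun (f ≫ P'.π) V t * constFun (f ≫ P'.π) V s) * a 1 +
      constFun (f ≫ P'.π) V t * constFun (f ≫ P'.π) V t * a 2) • μ := by
  have key : ∀ i : Fin 2, evAt f h' (b i.castSucc) (kerSec b' 1) =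
      constFun (f ≫ P'.π) V (b'.coord 1 (b i.castSucc)) := by
    intro i
    have h0 : b'.coord 2 (b i.castSucc) = 0 := by
      rw [e]
      fin_cases i <;> simp
    unfold evAt
    rw [ev_kerSec, h0, map_zero, mul_zero, sub_zero, app_constFun, resF_constFun]
    rfl
  have k0 := key 0
  have k1 := key 1
  rw [show b (Fin.castSucc (0 : Fin 2)) = b 0 from rfl, hs] at k0
  rw [show b (Fin.castSucc (1 : Fin 2)) = b 1 from rfl, ht] at k1
  rw [pairMon_eq]
  refine (congrArg (r.app V) (resM_pairSec h h' (kerSec b' 1) (kerSec b' 1))).trans ?_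
  rw [k0, k1, map_add, map_add, Hom.app_smul, Hom.app_smul, Hom.app_smul, hr, hr, hr, smul_smul, smul_smul, smul_smul,
    ← add_smul, ← add_smul]

/-- Every quotient of `f^* Sym² K` that is a line bundle is locally given by a quadric. If the polarization of a
quadratic form in two variables does not vanish, then the form does not vanish at one of `(1, 0)`, `(0, 1)` and
`(1, 1)`, and a basis can be chosen accordingly. -/
lemma exists_isQuadric [Module.Finite k E] (h2 : (2 : k) ≠ 0) (hE : Module.finrank k E = 3) [Epi r] (hM : IsLineBundle M) (y : T) :
    ∃ (V : T.Opens) (b : Module.Basis (Fin 3) k E) (c : Fin 4 → Γ(T, V)), y ∈ V ∧ IsQuadric f r b V c := by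
  obtain ⟨b, hb⟩ : ∃ b : Module.Basis (Fin 3) k E, y ∈ nonvan (vec f (b.coord 2)) := by
    let b := Module.finBasisOfFinrankEq k E hE
    obtain ⟨U, c, j, hy, hj, hc⟩ := exists_hasCoordsOn f b.dualBasis y
    obtain ⟨b', hb'⟩ := exists_basis_coord_eq b j
    have h := hc.le_nonvan (i := j) (by rw [hj]; exact isUnit_one) hy
    rw [Module.Basis.coe_dualBasis, ← hb'] at h
    exact ⟨b', h⟩
  obtain ⟨V, hy, hN, μ, hμ⟩ : ∃ V : T.Opens, y ∈ V ∧ V ≤ nonvan (vec f (b.coord 2)) ∧ ∃ μ : Γ(M, V), IsGenOn M V μ := by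
    obtain ⟨U, hyU, μ, hμ⟩ := isLineBundle_iff.mp hM y
    exact ⟨U ⊓ nonvan (vec f (b.coord 2)), ⟨hyU, hb⟩, inf_le_right, _, IsBasisOn.mono hμ inf_le_left⟩
  have hchart := hN
  rw [← preimage_chart] at hchart
  choose a ha using fun j => IsGenOn.exists_eq_smul_self hμ (r.app V (resM _ hchart (pairMon f b j)))
  -- It suffices to find a basis with the same last coordinate for which the square of the second section generates.
  have key : ∀ (b' : Module.Basis (Fin 3) k E) (u : Γ(T, V)), b'.coord 2 = b.coord 2 → y ∈ T.basicOpen u →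
      (∀ h' : V ≤ f ⁻¹ᵁ P'.chart (b'.coord 2), r.app V (resM _ h' (pairMon f b' 2)) = u • μ) →
      ∃ (V : T.Opens) (b : Module.Basis (Fin 3) k E) (c : Fin 4 → Γ(T, V)), y ∈ V ∧ IsQuadric f r b V c := by
    intro b' u e hu hr
    have hle := T.basicOpen_le u
    have hN' : V ≤ nonvan (vec f (b'.coord 2)) := by rwa [e]
    have hchart' := hN'
    rw [← preimage_chart] at hchart'
    have hμ' : IsGenOn M (T.basicOpen u) (resM _ hle μ) := IsBasisOn.mono hμ hle
    choose a' ha' using fun j => hμ'.exists_eq_smul_self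
      (r.app (T.basicOpen u) (resM _ (hle.trans hchart') (pairMon f b' j)))
    have h2' : a' 2 = resF hle u := hμ'.smul_injective_self (by
      rw [← ha', ← resM_smul, ← hr hchart', ← resM_app, resM_resM])
    obtain ⟨c, hc⟩ := exists_isQuadric_of_isUnit h2 (hle.trans hN') hμ' (hle.trans hchart')
      (by rw [h2']; exact isUnit_resF_basicOpen u le_rfl hle) ha'
    exact ⟨_, b', c, hu, hc⟩
  by_contra hno
  obtain ⟨b₁, e₁, e₁'⟩ := exists_basis_swap b
  obtain ⟨b₂, e₂, e₂'⟩ := exists_basis_add b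
  have n0 : y ∉ T.basicOpen (a 0) := fun h => hno (key b₁ _ e₁ h fun h' => by
    have := app_pairMon_of_coord_eq hchart h' ha e₁ (s := 1) (t := 0) (by simp [e₁']) (by simp [e₁'])
    simpa using this)
  have n2 : y ∉ T.basicOpen (a 2) := fun h => hno (key b _ rfl h fun h' => ha 2)
  have n1 : y ∉ T.basicOpen (a 0 + (1 + 1) * a 1 + a 2) := fun h => hno (key b₂ _ e₂ h fun h' => by
    have := app_pairMon_of_coord_eq hchart h' ha e₂ (s := 1) (t := 1) (by simp [e₂']) (by simp [e₂'])
    simpa using this)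
  obtain ⟨j, hj⟩ := exists_mem_basicOpen_of_epi r ((isBasisOn_pairMon f b).mono hchart) hμ ha hy
  rw [T.mem_basicOpen _ _ hy, ← mem_nonunits_iff, ← IsLocalRing.mem_maximalIdeal] at n0 n1 n2
  have n3 : T.presheaf.germ V y hy (2 * a 1) ∈ IsLocalRing.maximalIdeal (T.presheaf.stalk y) := by
    have := Ideal.sub_mem _ (Ideal.sub_mem _ n1 n0) n2
    rw [← map_sub, ← map_sub] at this
    convert this using 2
    ring
  rw [IsLocalRing.mem_maximalIdeal, mem_nonunits_iff, map_mul] at n3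
  have hu := (isUnit_two h2 (f ≫ P'.π) V).map (T.presheaf.germ V y hy).hom
  have n4 : y ∉ T.basicOpen (a 1) := fun h => n3 (hu.mul ((T.mem_basicOpen _ _ hy).mp h))
  rw [IsLocalRing.mem_maximalIdeal, mem_nonunits_iff, ← T.mem_basicOpen _ _ hy] at n0 n2
  fin_cases j
  exacts [n0 hj, n4 hj, n2 hj]

end AlgebraicGeometry

namespace AlgebraicGeometry
universe u
open Scheme.Modules ProjectiveBundle

/-! ### The Hilbert scheme as a projective bundle over the dual plane -/

section

variable {T : Scheme.{u}} {V W : T.Opens}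

/-- Functions on an open subset, as global functions on the open subscheme. -/
noncomputable def onOpen (V : T.Opens) : Γ(T, V) →+* Γ(V.toScheme, ⊤) := (V.ι.appLE V ⊤ (by simp)).hom

lemma resF_app_ι (c : Γ(T, V)) : resF (by simp : ⊤ ≤ V.ι ⁻¹ᵁ V) (V.ι.app V c) = onOpen V c := rfl

lemma onOpen_injective (V : T.Opens) : Function.Injective (onOpen V) := by
  have h1 : IsIso (V.ι.app V) := V.ι.isIso_app _ (by simp)
  intro c c' h
  refine (ConcreteCategory.bijective_of_isIso (V.ι.app V)).1 ?_
  have h2 := congrArg (resF (le_top : V.ι ⁻¹ᵁ V ≤ ⊤)) h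
  rwa [← resF_app_ι, ← resF_app_ι, resF_resF, resF_resF, resF_self, resF_self] at h2

lemma appLE_appLE {X Y Z : Scheme.{u}} (f : X ⟶ Y) (g : Y ⟶ Z) {h : X ⟶ Z} (e : f ≫ g = h) {U : X.Opens} {V : Y.Opens}
    {W : Z.Opens} (e₁ : V ≤ g ⁻¹ᵁ W) (e₂ : U ≤ f ⁻¹ᵁ V) (e₃ : U ≤ h ⁻¹ᵁ W) (a : Γ(Z, W)) :
    f.appLE V U e₂ (g.appLE W V e₁ a) = h.appLE W U e₃ a := by
  subst e
  exact congr($(Scheme.Hom.appLE_comp_appLE f g W V U e₁ e₂) a)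

lemma appLE_resF {X Y : Scheme.{u}} (f : X ⟶ Y) {U : X.Opens} {V V' : Y.Opens} (h : V' ≤ V) (e : U ≤ f ⁻¹ᵁ V')
    (e' : U ≤ f ⁻¹ᵁ V) (a : Γ(Y, V)) : f.appLE V' U e (resF h a) = f.appLE V U e' a :=
  congr($(Scheme.Hom.map_appLE f e (homOfLE h).op) a)

lemma appTop_homOfLE_onOpen (h : W ≤ V) (c : Γ(T, V)) :
    (T.homOfLE h).appTop (onOpen V c) = onOpen W (resF h c) := by
  have hW : ⊤ ≤ W.ι ⁻¹ᵁ W := by simp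
  have h1 : (T.homOfLE h).appTop (onOpen V c) = (T.homOfLE h).appLE ⊤ ⊤ le_rfl (onOpen V c) :=
    congr($(app_eq_appLE' (T.homOfLE h) ⊤) (onOpen V c))
  rw [h1]
  exact (appLE_appLE (T.homOfLE h) V.ι (T.homOfLE_ι h) _ _ (hW.trans (W.ι.preimage_mono h)) c).trans
    (appLE_resF W.ι h _ _ c).symm

lemma resF_app_homOfLE {X : Scheme.{u}} (h : W ≤ V) (g : V.toScheme ⟶ X) {O : X.Opens} (hO : V.ι ⁻¹ᵁ W ≤ g ⁻¹ᵁ O)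
    (hf : ⊤ ≤ (T.homOfLE h ≫ g) ⁻¹ᵁ O) (a : Γ(X, O)) {c : Γ(T, W)} (hc : V.ι.app W c = resF hO (g.app O a)) :
    resF hf ((T.homOfLE h ≫ g).app O a) = onOpen W c := by
  have e : ⊤ ≤ (T.homOfLE h) ⁻¹ᵁ V.ι ⁻¹ᵁ W := by
    rw [← Scheme.Hom.comp_preimage, T.homOfLE_ι]
    simp
  have h1 : V.ι.appLE W _ le_rfl c = g.appLE O _ hO a := by
    rw [Scheme.Hom.appLE_eq_app]
    exact hc
  refine (appLE_appLE (T.homOfLE h) g rfl hO e hf a).symm.trans ?_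
  rw [← h1]
  exact appLE_appLE (T.homOfLE h) V.ι (T.homOfLE_ι h) le_rfl e (by simp) c

lemma resF_app_ι_comp {X : Scheme.{u}} (g : T ⟶ X) {O : X.Opens} (hO : W ≤ g ⁻¹ᵁ O)
    (hf : ⊤ ≤ (W.ι ≫ g) ⁻¹ᵁ O) (a : Γ(X, O)) :
    resF hf ((W.ι ≫ g).app O a) = onOpen W (resF hO (g.app O a)) :=
  (appLE_appLE W.ι g rfl hO (by simp) hf a).symm

end

variable {k : Type u} [Field k] {E : Type u} [AddCommGroup E] [Module k E]
  {P : ProjectiveBundle (vectorSheaf k E)} {P' : ProjectiveBundle (vectorSheaf k (Module.Dual k E))}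

namespace HilbertScheme

variable {H : HilbertScheme P.π 2} {ψ : H.space ⟶ P'.space} {O1 : H.space.Modules}
  {q : (Scheme.Modules.pullback ψ).obj (P'.kernelBundle.sym 2) ⟶ O1} {T : Scheme.{u}}

/-- The quotient `q` of `ψ^* Sym² K` is given on every chart by the quadratic form of this chart. -/
def IsQuadricQuotient (H : HilbertScheme P.π 2) {ψ : H.space ⟶ P'.space} {O1 : H.space.Modules}
    (q : (Scheme.Modules.pullback ψ).obj (P'.kernelBundle.sym 2) ⟶ O1) : Prop :=
  ∀ (b : Module.Basis (Fin 3) k E) (O : H.space.Opens) (α β σ τ : Γ(H.space, O))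
    (x : Γ(H.family, H.p₂ ⁻¹ᵁ O)), IsChartOn H.p₁ H.p₂ b O α β σ τ x → IsQuadric ψ q b O ![α, β, σ, τ]

lemma hasChart_ι_comp {b : Module.Basis (Fin 3) k E} {O : H.space.Opens} {α β σ τ : Γ(H.space, O)}
    {x : Γ(H.family, H.p₂ ⁻¹ᵁ O)} (hx : IsChartOn H.p₁ H.p₂ b O α β σ τ x) (g : T ⟶ H.space) {W : T.Opens}
    (hW : W ≤ g ⁻¹ᵁ O) :
    H.HasChart (W.ι ≫ g) b fun i => onOpen W (resF hW (g.app O (![α, β, σ, τ] i))) := by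
  have hf : ⊤ ≤ (W.ι ≫ g) ⁻¹ᵁ O := by
    have : ⊤ ≤ W.ι ⁻¹ᵁ W := by simp
    exact this.trans (W.ι.preimage_mono hW)
  exact (congrArg (H.HasChart _ b) (funext fun i => resF_app_ι_comp g hW hf _)).mp
    (hasChart_of_isChartOn hx (W.ι ≫ g) hf)

lemma HasChart.restrict {b : Module.Basis (Fin 3) k E} {V W : T.Opens} {g : V.toScheme ⟶ H.space}
    {c : Fin 4 → Γ(T, V)} (h : H.HasChart g b fun i => onOpen V (c i)) (hW : W ≤ V) :
    H.HasChart (T.homOfLE hW ≫ g) b fun i => onOpen W (resF hW (c i)) :=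
  (congrArg (H.HasChart _ b) (funext fun i => appTop_homOfLE_onOpen hW (c i))).mp (h.comp (T.homOfLE hW))

/-- If the family of a morphism has a chart, then the pullback of `q` is locally the quadric with
the same functions. -/
lemma IsQuadricQuotient.exists_isQuadric (hq : H.IsQuadricQuotient q) {g : T ⟶ H.space} {b : Module.Basis (Fin 3) k E}
    {V : T.Opens} {c : Fin 4 → Γ(T, V)} (h : H.HasChart (V.ι ≫ g) b fun i => onOpen V (c i)) {y : T} (hy : y ∈ V) :
    ∃ (W : T.Opens) (hW : W ≤ V), y ∈ W ∧ IsQuadric (g ≫ ψ) (pullbackQuotient q g) b W fun i => resF hW (c i) := by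
  obtain ⟨y, rfl⟩ : ∃ z : V.toScheme, V.ι z = y := ⟨⟨y, hy⟩, rfl⟩
  obtain ⟨O, α, β, σ, τ, x, hyO, hx⟩ := h.exists_isChartOn y
  rw [Scheme.Hom.comp_apply] at hyO
  have hle : V ⊓ g ⁻¹ᵁ O ≤ V := inf_le_left
  have hle' : V ⊓ g ⁻¹ᵁ O ≤ g ⁻¹ᵁ O := inf_le_right
  refine ⟨V ⊓ g ⁻¹ᵁ O, hle, ⟨hy, hyO⟩, ?_⟩
  refine (congrArg (IsQuadric _ _ b _) (funext fun i => onOpen_injective _ ?_)).mp (((hq _ _ _ _ _ _ _ hx).comp g).mono hle')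
  have hf : ⊤ ≤ ((V ⊓ g ⁻¹ᵁ O).ι ≫ g) ⁻¹ᵁ O := by
    have : ⊤ ≤ (V ⊓ g ⁻¹ᵁ O).ι ⁻¹ᵁ (V ⊓ g ⁻¹ᵁ O) := by simp
    exact this.trans ((V ⊓ g ⁻¹ᵁ O).ι.preimage_mono hle')
  have h1 := h.restrict hle
  rw [Scheme.homOfLE_ι_assoc] at h1
  have h2 := congrArg (resF hf) (h1.eq_of_isChartOn hx i)
  rw [resF_app_ι_comp g hle' hf, resF_resF] at h2
  exact h2.trans (resF_self _ _)

/-- The morphism `g` classifies the restriction to `U` of the quotient `r`: whenever a basis is suitable for the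
pair of points over some point of `U`, the chart of the family and the quadric given by `r` have the same
coordinates near this point. -/
structure IsClassifying (H : HilbertScheme P.π 2) {f : T ⟶ P'.space} {M : T.Modules}
    (r : (Scheme.Modules.pullback f).obj (P'.kernelBundle.sym 2) ⟶ M) (U : T.Opens) (g : U.toScheme ⟶ H.space) : Prop where
  comp_π : g ≫ H.π = U.ι ≫ f ≫ P'.π
  exists_isQuadric : ∀ (y : U.toScheme) (b : Module.Basis (Fin 3) k E) (O : H.space.Opens) (α β σ τ : Γ(H.space, O))
    (x : Γ(H.family, H.p₂ ⁻¹ᵁ O)), IsChartOn H.p₁ H.p₂ b O α β σ τ x → g y ∈ O →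
    ∃ (V : T.Opens) (h : V ≤ U) (c : Fin 4 → Γ(T, V)), U.ι y ∈ V ∧ IsQuadric f r b V c ∧
      H.HasChart (T.homOfLE h ≫ g) b fun i => onOpen V (c i)

namespace IsClassifying

variable {f : T ⟶ P'.space} {M : T.Modules} {r : (Scheme.Modules.pullback f).obj (P'.kernelBundle.sym 2) ⟶ M}
  {U V : T.Opens} {g g' : U.toScheme ⟶ H.space}

lemma mono (hg : H.IsClassifying r U g) (h : V ≤ U) : H.IsClassifying r V (T.homOfLE h ≫ g) where
  comp_π := by rw [Category.assoc, hg.comp_π, Scheme.homOfLE_ι_assoc]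
  exists_isQuadric y b O α β σ τ x hx hy := by
    obtain ⟨W, hW, c, hyW, hQ, hc⟩ := hg.exists_isQuadric (T.homOfLE h y) b O α β σ τ x hx (by simpa using hy)
    rw [← Scheme.Hom.comp_apply, T.homOfLE_ι] at hyW
    refine ⟨V ⊓ W, inf_le_left, fun i => resF inf_le_right (c i), ⟨y.2, hyW⟩, hQ.mono inf_le_right, ?_⟩
    have h1 := hc.restrict (inf_le_right : V ⊓ W ≤ W)
    rw [Scheme.homOfLE_homOfLE_assoc] at h1 ⊢
    exact h1

/-- Near a point, a basis that gives charts at the images of the point under both morphisms can be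
chosen. There the functions of both charts are those of the quadric given by `r`. -/
lemma unique [Infinite k] (h2 : (2 : k) ≠ 0) (hE : Module.finrank k E = 3) (hg : H.IsClassifying r U g)
    (hg' : H.IsClassifying r U g') : g = g' := by
  refine Scheme.hom_ext_of_forall _ _ fun y => ?_
  -- A basis that is suitable for both pairs of points.
  obtain ⟨b, hb⟩ := H.isLengthFamily.exists_isChartOn hE (g y) (g' y)
  obtain ⟨O, α, β, σ, τ, x, hy, hx⟩ := hb _ (.inl rfl)
  obtain ⟨O', α', β', σ', τ', x', hy', hx'⟩ := hb _ (.inr rfl)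
  obtain ⟨V, hV, c, hyV, hQ, hc⟩ := hg.exists_isQuadric y b O α β σ τ x hx hy
  obtain ⟨V', hV', c', hyV', hQ', hc'⟩ := hg'.exists_isQuadric y b O' α' β' σ' τ' x' hx' hy'
  have e := (hQ.mono (inf_le_left : V ⊓ V' ≤ V)).unique h2 (hQ'.mono inf_le_right)
  have h3 := hc.restrict (inf_le_left : V ⊓ V' ≤ V)
  have h3' := hc'.restrict (inf_le_right : V ⊓ V' ≤ V')
  rw [Scheme.homOfLE_homOfLE_assoc] at h3 h3'
  have h4 : T.homOfLE (inf_le_left.trans hV : V ⊓ V' ≤ U) ≫ g = T.homOfLE (inf_le_left.trans hV : V ⊓ V' ≤ U) ≫ g' := by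
    refine h3.hom_ext ((congrArg (H.HasChart _ b) (funext fun i => ?_)).mp h3') ?_
    · exact congrArg (onOpen _) (congrFun e i).symm
    · rw [Category.assoc, Category.assoc, hg.comp_π, hg'.comp_π]
  refine ⟨U.ι ⁻¹ᵁ (V ⊓ V'), ⟨hyV, hyV'⟩, ?_⟩
  let l : (U.ι ⁻¹ᵁ (V ⊓ V')).toScheme ⟶ (V ⊓ V').toScheme := U.ι ∣_ (V ⊓ V')
  have hl : l ≫ T.homOfLE (inf_le_left.trans hV : V ⊓ V' ≤ U) = (U.ι ⁻¹ᵁ (V ⊓ V')).ι := by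
    rw [← cancel_mono U.ι, Category.assoc, Scheme.homOfLE_ι]
    exact morphismRestrict_ι U.ι (V ⊓ V')
  rw [← hl, Category.assoc, Category.assoc, h4]

end IsClassifying

end HilbertScheme

end AlgebraicGeometry

namespace AlgebraicGeometry
universe u
open Scheme.Modules ProjectiveBundle

/-! ### Classification of quotients by morphisms to the Hilbert scheme -/

instance {S X T : Scheme.{u}} {E : S.Modules} {π : X ⟶ S} {L : X.Modules}
    (q : (Scheme.Modules.pullback π).obj E ⟶ L) [Epi q] (g : T ⟶ X) : Epi (pullbackQuotient q g) := by
  unfold pullbackQuotient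
  infer_instance

variable {k : Type u} [Field k] {E : Type u} [AddCommGroup E] [Module k E]
  {P : ProjectiveBundle (vectorSheaf k E)} {P' : ProjectiveBundle (vectorSheaf k (Module.Dual k E))}

namespace HilbertScheme

variable {H : HilbertScheme P.π 2} {ψ : H.space ⟶ P'.space} {O1 : H.space.Modules}
  {q : (Scheme.Modules.pullback ψ).obj (P'.kernelBundle.sym 2) ⟶ O1} {T : Scheme.{u}}
  {f : T ⟶ P'.space} {M : T.Modules} {r : (Scheme.Modules.pullback f).obj (P'.kernelBundle.sym 2) ⟶ M}

/-- Locally, `r` is a quadric, and the morphism whose family has a chart with the same functions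
classifies `r`. -/
lemma IsQuadricQuotient.exists_isClassifying [Module.Finite k E] [Epi q] (hq : H.IsQuadricQuotient q)
    (hπ : ψ ≫ P'.π = H.π) (h2 : (2 : k) ≠ 0) (hE : Module.finrank k E = 3) [Epi r] (hM : IsLineBundle M) (y : T) :
    ∃ U : T.Opens, y ∈ U ∧ ∃ g, H.IsClassifying r U g := by
  obtain ⟨U, b, c, hy, hc⟩ := AlgebraicGeometry.exists_isQuadric (r := r) h2 hE hM y
  obtain ⟨g, hg, hgc⟩ := H.exists_hasChart (U.ι ≫ f ≫ P'.π) b fun i => onOpen U (c i)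
  refine ⟨U, hy, g, hg, fun z b' O α β σ τ x hx hz => ?_⟩
  -- The pullback of `q` and the restriction of `r` are given by the same quadric.
  obtain ⟨e₀, e, he⟩ := IsQuadric.exists_iso (r' := pullbackQuotient q g) (r := pullbackQuotient r U.ι)
    (by rw [Category.assoc, hπ, hg, Category.assoc]) fun z => by
      have hgc' : H.HasChart ((⊤ : U.toScheme.Opens).ι ≫ g) b fun i => onOpen ⊤ (onOpen U (c i)) :=
        (congrArg (H.HasChart _ b) (funext fun i => (resF_self _ _).symm)).mp (hgc.comp (⊤ : U.toScheme.Opens).ι)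
      obtain ⟨W, hW, hzW, hQ⟩ := hq.exists_isQuadric hgc' (y := z) trivial
      refine ⟨W, b, _, hzW, hQ, ?_⟩
      have hW' : W ≤ U.ι ⁻¹ᵁ U := by
        intro w _
        exact w.2
      refine (congrArg (IsQuadric _ _ b W) (funext fun i => ?_)).mp ((hc.comp U.ι).mono hW')
      rw [← resF_app_ι, resF_resF]
  have hQ := ((hq _ _ _ _ _ _ _ hx).comp g).of_iso e₀ e he
  -- In another basis that is suitable for a pair of points, the pullback of `q` is the quadric of
  -- the chart, and hence so is `r`.
  obtain ⟨U', hzU', μ, hμ⟩ := isLineBundle_iff.mp hM (U.ι z)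
  let V := U.ι ''ᵁ (g ⁻¹ᵁ O) ⊓ U'
  have hV : V ≤ U := inf_le_left.trans (U.ι_image_le _)
  have hVO : U.ι ⁻¹ᵁ V ≤ g ⁻¹ᵁ O := by
    refine (U.ι.preimage_mono (inf_le_left : V ≤ U.ι ''ᵁ (g ⁻¹ᵁ O))).trans ?_
    rw [Scheme.Hom.preimage_image_eq]
  have hiso : IsIso (U.ι.app V) := U.ι.isIso_app _ (by simpa using hV)
  choose d hd using fun i => (ConcreteCategory.bijective_of_isIso (U.ι.app V)).2
    (resF hVO (g.app O (![α, β, σ, τ] i)))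
  refine ⟨V, hV, d, ⟨⟨z, hz, rfl⟩, hzU'⟩, ?_, ?_⟩
  · refine IsQuadric.of_ι hV (IsBasisOn.mono hμ inf_le_right) ?_
    exact (congrArg (IsQuadric _ _ b' _) (funext fun i => (hd i).symm)).mp (hQ.mono hVO)
  · have hf : ⊤ ≤ (T.homOfLE hV ≫ g) ⁻¹ᵁ O := by
      have : ⊤ ≤ (T.homOfLE hV) ⁻¹ᵁ U.ι ⁻¹ᵁ V := by
        rw [← Scheme.Hom.comp_preimage, T.homOfLE_ι]
        simp
      exact this.trans ((T.homOfLE hV).preimage_mono hVO)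
    exact (congrArg (H.HasChart _ b') (funext fun i => resF_app_homOfLE hV g hVO hf _ (hd i))).mp
      (hasChart_of_isChartOn hx _ hf)

/-- A morphism that pulls back `q` to `r` classifies `r`. -/
lemma IsQuadricQuotient.isClassifying (hq : H.IsQuadricQuotient q) (hπ : ψ ≫ P'.π = H.π) {g : T ⟶ H.space}
    (h : g ≫ ψ = f) (e : (Scheme.Modules.pullback g).obj O1 ≅ M)
    (he : pullbackQuotient q g ≫ e.hom = (pullbackCongr h).hom.app _ ≫ r) (U : T.Opens) :
    H.IsClassifying r U (U.ι ≫ g) := by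
  refine ⟨by rw [Category.assoc, ← hπ, ← h, Category.assoc], fun y b O α β σ τ x hx hy => ?_⟩
  rw [Scheme.Hom.comp_apply] at hy
  have hQ := ((hq _ _ _ _ _ _ _ hx).comp g).of_iso h e he
  refine ⟨U ⊓ g ⁻¹ᵁ O, inf_le_left, fun i => resF inf_le_right (g.app O (![α, β, σ, τ] i)), ⟨y.2, hy⟩,
    hQ.mono inf_le_right, ?_⟩
  rw [Scheme.homOfLE_ι_assoc]
  exact hasChart_ι_comp hx g inf_le_right

/-- A morphism that classifies `r` locally pulls back `q` to `r`. -/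
lemma IsQuadricQuotient.exists_iso [Infinite k] [Epi q] (hq : H.IsQuadricQuotient q) (hπ : ψ ≫ P'.π = H.π)
    (hE : Module.finrank k E = 3) [Epi r] {g : T ⟶ H.space}
    (hg : ∀ y : T, ∃ U : T.Opens, y ∈ U ∧ H.IsClassifying r U (U.ι ≫ g)) :
    ∃ (h : g ≫ ψ = f) (e : (Scheme.Modules.pullback g).obj O1 ≅ M),
      pullbackQuotient q g ≫ e.hom = (pullbackCongr h).hom.app _ ≫ r := by
  refine IsQuadric.exists_iso ?_ fun y => ?_
  · rw [Category.assoc, hπ]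
    refine Scheme.hom_ext_of_forall _ _ fun y => ?_
    obtain ⟨U, hy, h⟩ := hg y
    exact ⟨U, hy, by rw [← h.comp_π, Category.assoc]⟩
  · obtain ⟨U, hy, h⟩ := hg y
    obtain ⟨b, hb⟩ := H.isLengthFamily.exists_isChartOn hE (g y) (g y)
    obtain ⟨O, α, β, σ, τ, x, hyO, hx⟩ := hb _ (.inl rfl)
    obtain ⟨V, hV, c, hyV, hQ, hc⟩ := h.exists_isQuadric ⟨y, hy⟩ b O α β σ τ x hx hyO
    rw [Scheme.homOfLE_ι_assoc] at hc
    obtain ⟨W, hW, hyW, hQ'⟩ := hq.exists_isQuadric hc hyV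
    exact ⟨W, b, _, hyW, hQ', hQ.mono hW⟩

/-- The Hilbert scheme of pairs of points of the plane is the projective bundle of `Sym² K`, since a family of
lines together with a family of quadrics on these lines is the same as a family of pairs of points. -/
theorem IsQuadricQuotient.isProjectiveBundle [Infinite k] [Module.Finite k E] (hq : H.IsQuadricQuotient q)
    (hπ : ψ ≫ P'.π = H.π) (h2 : (2 : k) ≠ 0) (hE : Module.finrank k E = 3) :
    IsProjectiveBundle (P'.kernelBundle.sym 2) ψ q := by
  have hcov : ∀ y : H.space, ∃ (U : H.space.Opens) (b : Module.Basis (Fin 3) k E) (c : Fin 4 → Γ(H.space, U)),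
      y ∈ U ∧ IsQuadric ψ q b U c := by
    intro y
    obtain ⟨b, hb⟩ := H.isLengthFamily.exists_isChartOn hE y y
    obtain ⟨U, α, β, σ, τ, x, hy, hx⟩ := hb y (.inl rfl)
    exact ⟨U, b, _, hy, hq _ _ _ _ _ _ _ hx⟩
  have hepi : Epi q := by
    refine epi_of_locally_surjective q fun y => ?_
    obtain ⟨U, b, c, hy, hQ⟩ := hcov y
    refine ⟨U, hy, fun V hV s => ?_⟩
    have hQ := hQ.mono hV
    obtain ⟨ν, hν, hr⟩ := hQ.exists_gen
    obtain ⟨t, rfl⟩ := hν.exists_eq_smul_self s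
    obtain ⟨w, hw⟩ := isUnit_two h2 (ψ ≫ P'.π) V
    refine ⟨(t * w⁻¹.val) • resM _ hQ.coords.le_chart (pairMon ψ b 2), ?_⟩
    have h3 : (2 : Γ(H.space, V)) * w⁻¹.val = 1 := by rw [← hw, Units.mul_inv]
    refine (Hom.app_smul q _ _).trans ((congrArg _ (hr hQ.coords.le_chart 2)).trans ?_)
    rw [smul_smul]
    refine congrArg (· • ν) ?_
    change t * w⁻¹.val * 2 = t
    linear_combination t * h3
  refine ⟨isLineBundle_iff.mpr fun y => ?_, hepi, fun T f M r hM hr => ?_⟩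
  · obtain ⟨U, b, c, hy, hQ⟩ := hcov y
    obtain ⟨ν, hν, -⟩ := hQ.exists_gen
    exact ⟨U, hy, ν, hν⟩
  · obtain ⟨g, hg⟩ := exists_hom_of_local (H.IsClassifying r) (fun U V h g hg => hg.mono h)
      (fun U g g' hg hg' => hg.unique h2 hE hg') (hq.exists_isClassifying hπ h2 hE hM)
    refine ⟨g, hq.exists_iso hπ hE hg, ?_⟩
    rintro g' ⟨h, e, he⟩
    refine Scheme.hom_ext_of_forall _ _ fun y => ?_
    obtain ⟨U, hy, hU⟩ := hg y
    exact ⟨U, hy, (hq.isClassifying hπ h e he U).unique h2 hE hU⟩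

end HilbertScheme

end AlgebraicGeometry

theorem mainTheorem7 (V : Type) [AddCommGroup V] [Module ℂ V] (hV : Module.finrank ℂ V = 3)
    (P : ProjectiveBundle (vectorSheaf ℂ V))
    (P' : ProjectiveBundle (vectorSheaf ℂ (Module.Dual ℂ V)))
    (H : HilbertScheme P.π 2) :
    ∃ ψ : H.space ⟶ P'.space, ψ ≫ P'.π = H.π ∧ H.IsSpanMap ψ ∧
      ∃ (O1 : H.space.Modules)
        (q : (Scheme.Modules.pullback ψ).obj (P'.kernelBundle.sym 2) ⟶ O1),
        IsProjectiveBundle (P'.kernelBundle.sym 2) ψ q ∧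
        ∀ k : ℕ, 2 ≤ k →
          ∃ (f : ((Scheme.Modules.pullback ψ).obj (P'.kernelBundle.dual.sym (k - 2))).tensor
                O1.dual ⟶
              (Scheme.Modules.pullback ψ).obj (P'.kernelBundle.dual.sym k))
            (g : (Scheme.Modules.pullback ψ).obj (P'.kernelBundle.dual.sym k) ⟶
              H.tautological (P.O k))
            (w : f ≫ g = 0),
            (ShortComplex.mk f g w).ShortExact := by
  have : Module.Finite ℂ V := Module.finite_of_finrank_pos (by rw [hV]; norm_num)
  obtain ⟨ψ, hπ, hψ⟩ := HilbertScheme.exists_isSpanMap hV P' H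
  obtain ⟨g, hg⟩ := HilbertScheme.exists_restriction hV hπ hψ 2
  obtain ⟨q, hq⟩ := HilbertScheme.exists_quotient hV hπ hψ hg
  -- `𝒪(1)` is the dual of the kernel of the restriction of quadratic forms to the pairs of points.
  refine ⟨ψ, hπ, hψ, (Limits.kernel g).dual, q, HilbertScheme.IsQuadricQuotient.isProjectiveBundle
    (fun b O α β σ τ x hx => ?_) hπ two_ne_zero hV, fun k hk => ?_⟩
  -- On every chart, `q` is the polarization of the quadratic form of the chart.
  · have hc := hψ.hasCoordsOn hπ hx
    obtain ⟨ν, hν, hr⟩ := hq b O α β σ τ x hx hc.le_chart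
    exact ⟨hc, ν, hν, fun _ j => hr j⟩
  · obtain ⟨d, rfl⟩ := Nat.exists_eq_add_of_le' hk
    exact HilbertScheme.exists_shortExact hV hπ hψ hg d
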